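/- **Lemma (Weyl law for compactly supported symbols).** Fix $0\le\mu<\frac12$. *Symbols.* $S^m_\mu(\mathbb R^{2d})$ is the set of families $(a_\hbar)_{\hbar>0}$ of smooth functions with $|\partial_x^\alpha\partial_\xi^\beta a_\hbar|\le C_{\alpha\beta}\,\hbar^{-\mu(|\alpha|+|\beta|)}\langle\xi\rangle^{m-|\beta|}$ for $0<\hbar\le1$, and $S^{-\infty}_\mu=\bigcap_{m\in\mathbb R}S^m_\mu$. The classes on $T^*S^1$ (with $S^1=\mathbb R/\mathbb Z$) and on $T^*S^1\times S^2$ are defined in the same way, derivatives along $S^2$ costing $\hbar^{-\mu}$ each. *Quantizations.* $\mathrm{Op}^w_\hbar(f)\varphi(x)=(2\pi\hbar)^{-d}\int\!\!\int e^{\frac i\hbar\langle\xi,x-y\rangle}f\big(\tfrac{x+y}2,\xi\big)\varphi(y)\,d\xi\,dy$, on $\mathbb R^d$, and on $S^1$ (with $d=1$) by applying this formula to periodic functions. For $j\in\frac12\mathbb N$, $j>0$, let $\mathcal D_j$ be the irreducible unitary representation of $SU(2)$ of dimension $2j+1$. For $\mathbf n\in S^2$ let $|\mathbf n\rangle=\hat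 g_j|0\rangle\in\mathcal D_j$ be the coherent state, where $|0\rangle$ is the normalised vector with $J_3|0\rangle=-j|0\rangle$ and $g\in SU(2)$ rotates the south pole to $\mathbf n$. On $L^2(S^1)\otimes\mathcal D_j$ put $$\mathrm{Op}_j(f)=\frac{\dim\mathcal D_j}{4\pi}\int_{S^2}\mathrm{Op}^w_{1/j}\big(f(\cdot,\cdot,\mathbf n)\big)\otimes|\mathbf n\rangle\langle\mathbf n|\,d\mathbf n .$$ *Notation.* For a self-adjoint operator $A$, $N_\varepsilon(A)$ is the number of eigenvalues of $A$ in $\mathbb R\setminus(-\varepsilon,\varepsilon)$, counted with multiplicity. A family $a$ *does not concentrate at the level* $\varepsilon$ if for every $\eta>0$ there is $\delta>0$ such that $\mathrm{Vol}\{\varepsilon-\delta\le|a|\le\varepsilon+\delta\}\le\eta\,\mathrm{Vol}\{|a|>0\}$ for all sufficiently small values of the semiclassical parameter; for a symbol independent of the parameter this just means $\mathrm{Vol}\{|a|=\varepsilon\}=0$. **(i)** Let $a\in S^{-\infty}_\mu$, on $\mathbb R^{2d}$ or on $T^*S^1$ (then $d=1$), be real, each $a_\hbar$ being compactly supported. For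 every $\hbar>0$, $\mathrm{Op}^w_\hbar(a_\hbar)$ extends to a bounded operator on $L^2$ which is self-adjoint and trace class, and $N_\varepsilon(\mathrm{Op}^w_\hbar(a_\hbar))<\infty$ for all $\varepsilon>0$. For every $\varepsilon>0$ and $0<\delta<\varepsilon$, as $\hbar\to0$, $$\mathrm{Vol}\{|a|>\varepsilon+\delta\}-\mathrm{Vol}\{|a|>0\}\,o(1)\ \le\ (2\pi\hbar)^d N_\varepsilon\big(\mathrm{Op}^w_\hbar(a)\big)\ \le\ \mathrm{Vol}\{|a|>\varepsilon-\delta\}+\mathrm{Vol}\{|a|>0\}\,o(1),$$ and if $a$ does not concentrate at the level $\varepsilon$, then $$N_\varepsilon\big(\mathrm{Op}^w_\hbar(a)\big)=\frac1{(2\pi\hbar)^d}\Big(\mathrm{Vol}\{|a|>\varepsilon\}+\mathrm{Vol}\{|a|>0\}\,o(1)\Big).$$ **(ii)** Let $a\in S^{-\infty}_\mu(T^*S^1\times S^2)$ be real, each $a_\hbar$ being compactly supported, and let $\hbar=1/j$. The same holds for $\mathrm{Op}_j(a_{1/j})$, for all $j\in\frac12\mathbb N$, $j>0$, as $j\to\infty$,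 with $(2\pi\hbar)^{-d}$ replaced by $\frac{\dim(\mathcal D_j)\,j}{8\pi^2}$ and volumes taken with respect to $dx\,d\xi\,d\mathbf n$. In particular, if $(a_{1/j})_j$ does not concentrate at the level $\varepsilon$, then $$N_\varepsilon\big(\mathrm{Op}_j(a)\big)=\frac{\dim(\mathcal D_j)\,j}{8\pi^2}\Big(\mathrm{Vol}\{|a|>\varepsilon\}+\mathrm{Vol}\{|a|>0\}\,o(1)\Big).$$ -/

import Mathlib

open MeasureTheory Filter Topology
open scoped ContDiff SchwartzMap

noncomputable section

/-! ### Weyl quantization -/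

section Weyl

variable {E : Type*} [NormedAddCommGroup E] [InnerProductSpace ℝ E] [MeasureSpace E]
  {V : Type*} [NormedAddCommGroup V] [NormedSpace ℂ V]

/-- The Schwartz kernel of the Weyl quantization of `f`:
`(2πħ)^{-d} ∫ e^{i⟨ξ, x - y⟩/ħ} f((x+y)/2, ξ) dξ`, where `d = dim E`. -/
def weylKernel (ħ : ℝ) (f : E × E → ℝ) (x y : E) : ℂ :=
  ((((2 * Real.pi * ħ) ^ Module.finrank ℝ E)⁻¹ : ℝ) : ℂ) *
    ∫ ξ : E, Complex.exp (Complex.I * ((inner ℝ ξ (x - y) / ħ : ℝ) : ℂ)) *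
      (f ((1 / 2 : ℝ) • (x + y), ξ) : ℂ)

/-- The action of the Weyl quantization of `f` on a (vector valued) function `φ`:
`(2πħ)^{-d} ∫ (∫ e^{i⟨ξ, x - y⟩/ħ} f((x+y)/2, ξ) dξ) φ(y) dy`. For the symbols and functions
used below (symbols with compact support in `ξ`) both integrals converge absolutely. -/
def weylApply (ħ : ℝ) (f : E × E → ℝ) (φ : E → V) (x : E) : V :=
  ∫ y : E, weylKernel ħ f x y • φ y

end Weyl

/-- The bounded operator `T` on `L²(ℝ^d)` is the (unique) continuous extension of the Weyl
quantization of `f`, originally defined on Schwartz functions. -/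
def IsWeylQuantization {d : ℕ} (ħ : ℝ)
    (f : EuclideanSpace ℝ (Fin d) × EuclideanSpace ℝ (Fin d) → ℝ)
    (T : Lp ℂ 2 (volume : Measure (EuclideanSpace ℝ (Fin d))) →L[ℂ]
      Lp ℂ 2 (volume : Measure (EuclideanSpace ℝ (Fin d)))) : Prop :=
  ∀ φ : 𝓢(EuclideanSpace ℝ (Fin d), ℂ),
    T (φ.toLp 2 volume) =ᵐ[volume] weylApply ħ f φ

/-- The lift to `ℝ × ℝ` of a function on the cylinder `T*S¹ = (ℝ/ℤ) × ℝ`. -/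
def cylinderLift (f : UnitAddCircle × ℝ → ℝ) (z : ℝ × ℝ) : ℝ :=
  f ((z.1 : UnitAddCircle), z.2)

/-- The bounded operator `T` on `L²(S¹)`, `S¹ = ℝ/ℤ`, is the (unique) continuous extension of the
Weyl quantization on the circle of the function `f` on `T*S¹`: on smooth functions on the circle,
seen as smooth `1`-periodic functions on `ℝ`, it is given by the Weyl formula on `ℝ` applied to
the periodic lift of `f`. -/
def IsCircleWeylQuantization (ħ : ℝ) (f : UnitAddCircle × ℝ → ℝ)
    (T : Lp ℂ 2 (volume : Measure UnitAddCircle) →L[ℂ]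
      Lp ℂ 2 (volume : Measure UnitAddCircle)) : Prop :=
  ∀ φ : UnitAddCircle → ℂ, ContDiff ℝ ∞ (fun y : ℝ => φ (y : UnitAddCircle)) →
    ∀ u : Lp ℂ 2 (volume : Measure UnitAddCircle), u =ᵐ[volume] φ →
      ∀ᵐ x : ℝ, T u (x : UnitAddCircle) =
        weylApply ħ (cylinderLift f) (fun y : ℝ => φ (y : UnitAddCircle)) x

/-! ### Symbol classes -/

/-- The symbol class `S^m_μ` on `E × E`: families `(a_ħ)_{ħ > 0}` of smooth functions with
`|∂_x^α ∂_ξ^β a_ħ| ≤ C_{αβ} ħ^{-μ(|α|+|β|)} ⟨ξ⟩^{m-|β|}` for `0 < ħ ≤ 1`, where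
`⟨ξ⟩ = (1 + |ξ|²)^{1/2}`. Here `p = |α|`, `q = |β|`, and the mixed partial derivatives are
expressed through directional derivatives along vectors `(u, 0)` and `(0, w)`. -/
def IsSymbol {E : Type*} [NormedAddCommGroup E] [NormedSpace ℝ E] (μ m : ℝ)
    (a : ℝ → E × E → ℝ) : Prop :=
  (∀ ħ : ℝ, 0 < ħ → ContDiff ℝ ∞ (a ħ)) ∧
  ∀ p q : ℕ, ∃ C : ℝ, ∀ ħ : ℝ, 0 < ħ → ħ ≤ 1 → ∀ (x ξ : E) (u : Fin p → E) (w : Fin q → E),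
    |iteratedFDeriv ℝ (p + q) (a ħ) (x, ξ)
        (Fin.append (fun i => (u i, (0 : E))) (fun i => ((0 : E), w i)))| ≤
      C * ħ ^ (-μ * ((p : ℝ) + q)) * Real.sqrt (1 + ‖ξ‖ ^ 2) ^ (m - q) *
        ((∏ i, ‖u i‖) * ∏ i, ‖w i‖)

/-- Euclidean three-space. -/
abbrev E3 : Type := EuclideanSpace ℝ (Fin 3)

/-- The unit sphere `S²`. -/
abbrev S2 : Type := Metric.sphere (0 : E3) 1

/-- The area measure on the unit sphere (total mass `4π`). -/
def sphereArea : Measure S2 := (volume : Measure E3).toSphere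

/-- The phase space `T*S¹ × S²`. -/
abbrev SpinPhase : Type := UnitAddCircle × ℝ × S2

/-- The measure `dx dξ dn` on `T*S¹ × S²`. -/
def spinPhaseVolume : Measure SpinPhase :=
  (volume : Measure UnitAddCircle).prod ((volume : Measure ℝ).prod sphereArea)

/-- The south pole of the sphere. -/
def southPole : S2 := ⟨EuclideanSpace.single 2 (-1 : ℝ), by simp⟩

open Classical in
/-- Radial projection of three-space (minus the origin) to the sphere; the value at the
origin plays no role. -/
def radialProj (v : E3) : S2 :=
  if h : v = 0 then southPole else ⟨‖v‖⁻¹ • v, by simp [norm_smul, h]⟩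

/-- The lift of a function on `T*S¹ × S²` to `ℝ × ℝ × ℝ³`: periodic in the first variable and
extended as a homogeneous function of degree `0` in the last one (relevant for `v ≠ 0`). -/
def spinLift (f : SpinPhase → ℝ) (z : ℝ × ℝ × E3) : ℝ :=
  f ((z.1 : UnitAddCircle), z.2.1, radialProj z.2.2)

/-- The symbol class `S^m_μ(T*S¹ × S²)`: families of smooth functions with
`|∂_x^α ∂_ξ^β ∂_n^γ a_ħ| ≤ C ħ^{-μ(α+β+|γ|)} ⟨ξ⟩^{m-β}` for `0 < ħ ≤ 1`. Smoothness and the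
derivatives in `n ∈ S²` are those of the homogeneous extension of degree `0` to `ℝ³ ∖ {0}`,
evaluated on the sphere. Here `p = α`, `q = β`, `r = |γ|`. -/
def IsSpinSymbol (μ m : ℝ) (a : ℝ → SpinPhase → ℝ) : Prop :=
  (∀ ħ : ℝ, 0 < ħ → ContDiffOn ℝ ∞ (spinLift (a ħ)) {z | z.2.2 ≠ 0}) ∧
  ∀ p q r : ℕ, ∃ C : ℝ, ∀ ħ : ℝ, 0 < ħ → ħ ≤ 1 →
    ∀ (x ξ : ℝ) (n : S2) (w : Fin r → E3),
      |iteratedFDeriv ℝ (p + q + r) (spinLift (a ħ)) (x, ξ, (n : E3))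
          (Fin.append (Fin.append (fun _ : Fin p => ((1 : ℝ), (0 : ℝ), (0 : E3)))
            (fun _ : Fin q => ((0 : ℝ), (1 : ℝ), (0 : E3))))
            (fun i => ((0 : ℝ), (0 : ℝ), w i)))| ≤
        C * ħ ^ (-μ * ((p : ℝ) + q + r)) * Real.sqrt (1 + ξ ^ 2) ^ (m - q) * ∏ i, ‖w i‖

/-! ### The representations of `SU(2)` and coherent states -/

/-- The space `Sym^N(ℂ²)` of symmetric tensors in `(ℂ²)^{⊗N}`, with the induced hermitian product. -/
def spinSpace (N : ℕ) : Submodule ℂ (EuclideanSpace ℂ (Fin N → Fin 2)) where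
  carrier := {v | ∀ (σ : Equiv.Perm (Fin N)) (s : Fin N → Fin 2), v (s ∘ σ) = v s}
  add_mem' := by
    intro v w hv hw σ s
    simp [hv σ s, hw σ s]
  zero_mem' := by
    intro σ s
    simp
  smul_mem' := by
    intro c v hv σ s
    simp [hv σ s]

/-- The irreducible representation space `𝓓_j` of `SU(2)`, `N = 2j`, realised as the Hilbert
space `Sym^N(ℂ²)`. -/
def SpinSpace (N : ℕ) : Type := spinSpace N

instance (N : ℕ) : NormedAddCommGroup (SpinSpace N) :=
  inferInstanceAs (NormedAddCommGroup (spinSpace N))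

instance (N : ℕ) : InnerProductSpace ℂ (SpinSpace N) :=
  inferInstanceAs (InnerProductSpace ℂ (spinSpace N))

instance (N : ℕ) : FiniteDimensional ℂ (SpinSpace N) :=
  inferInstanceAs (FiniteDimensional ℂ (spinSpace N))

instance (N : ℕ) : CompleteSpace (SpinSpace N) :=
  FiniteDimensional.complete ℂ _

/-- The operator `M^{⊗N}` restricted to symmetric tensors. -/
def tensorPow (N : ℕ) (M : Matrix (Fin 2) (Fin 2) ℂ) : SpinSpace N →ₗ[ℂ] SpinSpace N where
  toFun v := ⟨WithLp.toLp 2 (fun s => ∑ t, (∏ i, M (s i) (t i)) * v.1 t), by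
    intro σ s
    change ∑ t, (∏ i, M (s (σ i)) (t i)) * v.1 t = ∑ t, (∏ i, M (s i) (t i)) * v.1 t
    refine (Fintype.sum_equiv (Equiv.arrowCongr σ.symm (Equiv.refl (Fin 2))) _ _ ?_).symm
    intro t
    have h1 : (Equiv.arrowCongr σ.symm (Equiv.refl (Fin 2))) t = t ∘ σ := by
      ext i; simp [Equiv.arrowCongr]
    rw [h1, v.2 σ t]
    congr 1
    exact (Equiv.prod_comp σ (fun i => M (s i) (t i))).symm⟩
  map_add' v w := by
    apply Subtype.ext
    ext s
    change ∑ t, (∏ i, M (s i) (t i)) * (v.1 t + w.1 t) =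
      ∑ t, (∏ i, M (s i) (t i)) * v.1 t + ∑ t, (∏ i, M (s i) (t i)) * w.1 t
    simp [mul_add, Finset.sum_add_distrib]
  map_smul' c v := by
    apply Subtype.ext
    ext s
    change ∑ t, (∏ i, M (s i) (t i)) * (c * v.1 t) = c * ∑ t, (∏ i, M (s i) (t i)) * v.1 t
    simp [Finset.mul_sum, mul_left_comm]

/-- The representation `g ↦ ĝ_j` of `SU(2)` on `𝓓_j`, `N = 2j`. -/
def spinRep (N : ℕ) (g : Matrix.specialUnitaryGroup (Fin 2) ℂ) : SpinSpace N →ₗ[ℂ] SpinSpace N :=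
  tensorPow N (g : Matrix (Fin 2) (Fin 2) ℂ)

/-- The normalised vector `|0⟩ ∈ 𝓓_j` with `J₃|0⟩ = -j|0⟩`, that is `e₁^{⊗N}` where `(e₀, e₁)` is
the canonical basis of `ℂ²`. -/
def lowestState (N : ℕ) : SpinSpace N :=
  ⟨WithLp.toLp 2 (fun s => ∏ i, if s i = 1 then 1 else 0), by
    intro σ s
    exact Equiv.prod_comp σ (fun i => if s i = 1 then (1 : ℂ) else 0)⟩

/-- The matrix `u · σ = u₁σ₁ + u₂σ₂ + u₃σ₃`, with `σ_k` the Pauli matrices. -/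
def pauliDot (u : E3) : Matrix (Fin 2) (Fin 2) ℂ :=
  !![(u 2 : ℂ), (u 0 : ℂ) - Complex.I * (u 1 : ℂ);
     (u 0 : ℂ) + Complex.I * (u 1 : ℂ), -(u 2 : ℂ)]

/-- `R_g v = u`, where `g ↦ R_g ∈ SO(3)` is the adjoint representation of `SU(2)`, determined by
`g (v · σ) g⁻¹ = (R_g v) · σ`. -/
def Rotates (g : Matrix.specialUnitaryGroup (Fin 2) ℂ) (v u : S2) : Prop :=
  (g : Matrix (Fin 2) (Fin 2) ℂ) * pauliDot v * star (g : Matrix (Fin 2) (Fin 2) ℂ) = pauliDot u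

/-- `SU(2)` acts transitively on the sphere. -/
theorem exists_rotates (u : S2) : ∃ g, Rotates g southPole u := by
  have hu : (u : E3) 0 ^ 2 + (u : E3) 1 ^ 2 + (u : E3) 2 ^ 2 = 1 := by
    have h := u.2
    rw [mem_sphere_zero_iff_norm, EuclideanSpace.norm_eq, Real.sqrt_eq_one] at h
    simpa [Fin.sum_univ_three] using h
  have key : ∀ (r : ℝ) (w : ℂ), r ^ 2 + Complex.normSq w = 1 →
      r ^ 2 - Complex.normSq w = (u : E3) 2 →
      2 * r * w.re = (u : E3) 0 → 2 * r * w.im = (u : E3) 1 →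
      ∃ g, Rotates g southPole u := by
    intro r w h1 h2 h3 h4
    rw [Complex.normSq_apply] at h1 h2
    refine ⟨⟨!![(starRingEnd ℂ) w, (r : ℂ); -(r : ℂ), w], ?_⟩, ?_⟩
    · rw [Matrix.mem_specialUnitaryGroup_iff, Matrix.mem_unitaryGroup_iff]
      constructor
      · ext i j
        fin_cases i <;> fin_cases j <;>
          simp [Matrix.mul_apply, Fin.sum_univ_two, Matrix.star_apply, Complex.ext_iff] <;>
          constructor <;> nlinarith [h1]
      · simp [Matrix.det_fin_two, Complex.ext_iff]
        constructor <;> nlinarith [h1]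
    · unfold Rotates pauliDot southPole
      ext i j
      fin_cases i <;> fin_cases j <;>
        simp [Matrix.mul_apply, Fin.sum_univ_two, Matrix.star_apply, Complex.ext_iff] <;>
        constructor <;> nlinarith [h1, h2, h3, h4]
  by_cases hs : (u : E3) 2 = -1
  · have h0 : (u : E3) 0 = 0 := by nlinarith [sq_nonneg ((u : E3) 0), sq_nonneg ((u : E3) 1)]
    have h1 : (u : E3) 1 = 0 := by nlinarith [sq_nonneg ((u : E3) 0), sq_nonneg ((u : E3) 1)]
    exact key 0 1 (by simp) (by simp [hs]) (by simp [h0]) (by simp [h1])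
  · have hpos : 0 < (1 + (u : E3) 2) / 2 := by
      have : -1 ≤ (u : E3) 2 := by
        nlinarith [sq_nonneg ((u : E3) 0), sq_nonneg ((u : E3) 1)]
      have : -1 < (u : E3) 2 := lt_of_le_of_ne this (Ne.symm hs)
      linarith
    set r := Real.sqrt ((1 + (u : E3) 2) / 2) with hr
    have hr0 : 0 < r := Real.sqrt_pos.2 hpos
    have hr2 : r ^ 2 = (1 + (u : E3) 2) / 2 := Real.sq_sqrt hpos.le
    have hw : Complex.normSq ⟨(u : E3) 0 / (2 * r), (u : E3) 1 / (2 * r)⟩ =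
        (1 - (u : E3) 2) / 2 := by
      rw [Complex.normSq_mk]
      have : (u : E3) 0 / (2 * r) * ((u : E3) 0 / (2 * r)) +
          (u : E3) 1 / (2 * r) * ((u : E3) 1 / (2 * r)) =
          ((u : E3) 0 ^ 2 + (u : E3) 1 ^ 2) / (4 * r ^ 2) := by
        field_simp
        ring
      rw [this, hr2, div_eq_iff (by linarith)]
      nlinarith
    refine key r ⟨(u : E3) 0 / (2 * r), (u : E3) 1 / (2 * r)⟩ ?_ ?_ ?_ ?_
    · rw [hw, hr2]; ring
    · rw [hw, hr2]; ring
    · field_simp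
    · field_simp

/-- A coherent state `|n⟩ = ĝ_j|0⟩`, where `g ∈ SU(2)` is such that `R_g` maps the south pole
to `n`. -/
def coherentState (N : ℕ) (n : S2) : SpinSpace N :=
  spinRep N (exists_rotates n).choose (lowestState N)

/-- The orthogonal projector `|n⟩⟨n|` on `𝓓_j`. -/
def coherentProj (N : ℕ) (n : S2) : SpinSpace N →L[ℂ] SpinSpace N :=
  (innerSL ℂ (coherentState N n)).smulRight (coherentState N n)

/-- For every `g ∈ SU(2)` mapping the south pole to `n`, the rank one operator defined by
`ĝ_j|0⟩` is the tensor power of the spin one half projector `(1 + n · σ)/2`. -/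
theorem rankOne_eq_tensorPow (N : ℕ) (n : S2) (g : Matrix.specialUnitaryGroup (Fin 2) ℂ)
    (hg : Rotates g southPole n) (w : SpinSpace N) :
    inner ℂ (spinRep N g (lowestState N)) w • spinRep N g (lowestState N) =
      tensorPow N ((1 / 2 : ℂ) • (1 + pauliDot n)) w := by
  have hgu : (g : Matrix (Fin 2) (Fin 2) ℂ) * star (g : Matrix (Fin 2) (Fin 2) ℂ) = 1 :=
    Matrix.mem_unitaryGroup_iff.1 (Matrix.mem_specialUnitaryGroup_iff.1 g.2).1
  have hP : ∀ s t : Fin 2, ((1 / 2 : ℂ) • (1 + pauliDot n)) s t =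
      g.1 s 1 * (starRingEnd ℂ) (g.1 t 1) := by
    intro s t
    rw [← hg, ← hgu]
    simp only [Matrix.smul_apply, Matrix.add_apply, Matrix.mul_apply, Fin.sum_univ_two,
      Matrix.star_apply, pauliDot, southPole]
    simp
    ring
  have hz : ∀ s, (spinRep N g (lowestState N)).1 s = ∏ i, g.1 (s i) 1 := by
    intro s
    change ∑ t : Fin N → Fin 2, (∏ i, g.1 (s i) (t i)) * (∏ i, if t i = 1 then (1 : ℂ) else 0) = _
    simp_rw [← Finset.prod_mul_distrib]
    rw [← Fintype.prod_sum (fun i k => g.1 (s i) k * if k = 1 then (1 : ℂ) else 0)]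
    simp
  apply Subtype.ext
  ext s
  change inner ℂ (spinRep N g (lowestState N)).1 w.1 * (spinRep N g (lowestState N)).1 s =
    ∑ t : Fin N → Fin 2, (∏ i, ((1 / 2 : ℂ) • (1 + pauliDot n)) (s i) (t i)) * w.1 t
  rw [PiLp.inner_apply, Finset.sum_mul]
  refine Finset.sum_congr rfl fun t _ => ?_
  simp_rw [hP, Finset.prod_mul_distrib, hz]
  simp only [RCLike.inner_apply, map_prod]
  ring

/-- The projector `|n⟩⟨n|` does not depend on the choice of `g`. -/
theorem coherentProj_apply (N : ℕ) (n : S2) (g : Matrix.specialUnitaryGroup (Fin 2) ℂ)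
    (hg : Rotates g southPole n) (w : SpinSpace N) :
    coherentProj N n w =
      inner ℂ (spinRep N g (lowestState N)) w • spinRep N g (lowestState N) :=
  (rankOne_eq_tensorPow N n _ (exists_rotates n).choose_spec w).trans
    (rankOne_eq_tensorPow N n g hg w).symm

/-! ### The combined quantization on `T*S¹ × S²` -/

/-- The bounded operator `T` on `L²(S¹) ⊗ 𝓓_j = L²(S¹; 𝓓_j)`, `j = N/2`, is the (unique)
continuous extension of
`Op_j(f) = (dim 𝓓_j / 4π) ∫_{S²} Op^w_{1/j}(f(·, ·, n)) ⊗ |n⟩⟨n| dn`,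
where `Op^w` is the Weyl quantization on the circle. -/
def IsSpinQuantization (N : ℕ) (f : SpinPhase → ℝ)
    (T : Lp (SpinSpace N) 2 (volume : Measure UnitAddCircle) →L[ℂ]
      Lp (SpinSpace N) 2 (volume : Measure UnitAddCircle)) : Prop :=
  ∀ φ : UnitAddCircle → SpinSpace N, ContDiff ℝ ∞ (fun y : ℝ => φ (y : UnitAddCircle)) →
    ∀ u : Lp (SpinSpace N) 2 (volume : Measure UnitAddCircle), u =ᵐ[volume] φ →
      ∀ᵐ x : ℝ, T u (x : UnitAddCircle) =
        (Module.finrank ℂ (SpinSpace N) / (4 * Real.pi) : ℝ) •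
          ∫ n : S2, coherentProj N n
            (weylApply ((N / 2 : ℝ)⁻¹) (cylinderLift (fun z => f (z.1, z.2, n)))
              (fun y : ℝ => φ (y : UnitAddCircle)) x) ∂sphereArea

/-! ### Operators and counting -/

section Operators

variable {H : Type*} [NormedAddCommGroup H] [InnerProductSpace ℂ H] [CompleteSpace H]

/-- `T` is trace class: `∑ ⟨e, |T| e⟩ < ∞` over an orthonormal basis, with `|T| = (T*T)^{1/2}`. -/
def IsTraceClass (T : H →L[ℂ] H) : Prop :=
  ∃ (s : Set H) (b : HilbertBasis s ℂ H),
    Summable fun i => (inner ℂ (b i) (CFC.abs T (b i))).re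

/-- The span of the eigenvectors of `T` with (real) eigenvalue in `ℝ ∖ (-ε, ε)`. -/
def outerEigenspace (T : H →L[ℂ] H) (ε : ℝ) : Submodule ℂ H :=
  ⨆ (t : ℝ) (_ : ε ≤ |t|), Module.End.eigenspace (T : H →ₗ[ℂ] H) (t : ℂ)

/-- The eigenvalues of `T` in `ℝ ∖ (-ε, ε)` are finite in number, counted with multiplicity. -/
def FinitelyManyOuter (T : H →L[ℂ] H) (ε : ℝ) : Prop :=
  FiniteDimensional ℂ (outerEigenspace T ε)

/-- The number of eigenvalues of the self-adjoint operator `T` in `ℝ ∖ (-ε, ε)`, counted with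
multiplicity (when it is finite). -/
def outerCount (T : H →L[ℂ] H) (ε : ℝ) : ℕ :=
  Module.finrank ℂ (outerEigenspace T ε)

end Operators

section Counting

variable {ι M : Type*} [MeasurableSpace M]

/-- The volume of `{|f| > t}`, as a real number (used when it is finite). -/
def volAbove (vol : Measure M) (f : M → ℝ) (t : ℝ) : ℝ := vol.real {z | t < |f z|}

/-- The values of `|a_i|` do not concentrate at the level `ε`: for every `η > 0` there is `δ > 0`
such that eventually `Vol{ε - δ ≤ |a_i| ≤ ε + δ} ≤ η Vol{|a_i| > 0}`. For a fixed compactly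
supported `a` this means `Vol{|a| = ε} = 0`. -/
def NoConcentration (l : Filter ι) (vol : Measure M) (a : ι → M → ℝ) (ε : ℝ) : Prop :=
  ∀ η : ℝ, 0 < η → ∃ δ : ℝ, 0 < δ ∧ ∀ᶠ i in l,
    vol {z | |(|a i z| - ε)| ≤ δ} ≤ ENNReal.ofReal η * vol {z | 0 < |a i z|}

/-- The Weyl law `n_i = c_i (Vol{|a_i| > ε} + Vol{|a_i| > 0} o(1))` along the filter `l`. -/
def WeylLaw (l : Filter ι) (vol : Measure M) (c : ι → ℝ) (a : ι → M → ℝ) (n : ι → ℕ)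
    (ε : ℝ) : Prop :=
  ∃ r : ι → ℝ, Tendsto r l (𝓝 0) ∧ ∀ᶠ i in l,
    (n i : ℝ) = c i * (volAbove vol (a i) ε + volAbove vol (a i) 0 * r i)

/-- The two-sided estimate
`c_i (Vol{|a_i| > ε + δ} - Vol{|a_i| > 0} o(1)) ≤ n_i ≤
c_i (Vol{|a_i| > ε - δ} + Vol{|a_i| > 0} o(1))` for every `0 < δ < ε`. -/
def WeylBounds (l : Filter ι) (vol : Measure M) (c : ι → ℝ) (a : ι → M → ℝ) (n : ι → ℕ)
    (ε : ℝ) : Prop :=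
  ∀ δ : ℝ, 0 < δ → δ < ε → ∃ r : ι → ℝ, Tendsto r l (𝓝 0) ∧ ∀ᶠ i in l,
    c i * (volAbove vol (a i) (ε + δ) - volAbove vol (a i) 0 * r i) ≤ n i ∧
    (n i : ℝ) ≤ c i * (volAbove vol (a i) (ε - δ) + volAbove vol (a i) 0 * r i)

end Counting

end

set_option linter.unusedSectionVars false

/-! ### Compact self-adjoint operators: eigenbases, trace class, counting by coupling. -/

section SpectralTheory

/-! All three Weyl laws come from one transport argument, `card_eigenvalues_le_and_ge`. Let `A` be
compact and self-adjoint with orthonormal eigenbasis `b i` and eigenvalues `lam i`, and let unit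
vectors `ψ z`, indexed by a phase space with measure `ν`, resolve the identity. The weights `|⟨b i,
ψ z⟩|²` couple the counting measure on the eigenvalues with `ν`: their sum over `i` is `1` because
`ψ z` is a unit vector, and their integral over `z` is `1` because `b i` is one. The quadratic cost
of the coupling, the integral of `∑ (lam i - a z)² |⟨b i, ψ z⟩|²`, is exactly the mean square defect
`∫ ‖A ψ z - a z ψ z‖² dν`. Matching an eigenvalue outside `(-ε, ε)` with a point where `|a| ≤ ε -
δ`, or one inside with a point where `|a| > ε + δ`, costs at least `δ²`. So, as in Chebyshev's
inequality, the count lies between `ν{|a| > ε + δ}` and `ν{|a| > ε - δ}` up to the defect divided by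
`δ²`. It remains to find states whose defect is `o(1) ν{a ≠ 0}`; `weylBounds_and_weylLaw` then gives
both forms of the law. No composition formula for symbols is needed.

On `ℝ^d` the states are Gaussians. In the expanded square, the integral of `‖A ψ z‖²` is the squared
Hilbert-Schmidt norm of `A`, which equals `∫ a² dν` exactly, by Plancherel for the Weyl kernel. The
expectation `⟨ψ z, A ψ z⟩` is a Gaussian average of `a` and differs from `a z` by `O(ħ^(1/2 - μ))`.
The squares cancel, and the error carries a factor `a z`, hence lives on `{a ≠ 0}`
(`lintegral_gaussVec_defect_le`).

On the cylinder the quantization of `F` has, in the Fourier basis, the matrix element at `(l, k)`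
given by the `(l - k)`-th Fourier coefficient of `F` in `x` taken at `ξ = π ħ (l + k)`
(`IsCyl.hasSum_weylApply`). The states are packets of `L ≈ ħ^(-1/2)` consecutive frequencies. Their
defect has two sources: the coefficients vary over the window, and frequencies leak through its two
ends. Both are controlled by the `L²` norms of derivatives of `F`; integrating by parts and leaving
one factor `F` undifferentiated bounds these by the volume of `{F ≠ 0}`
(`IsCyl.lintegral_tsum_cylBracket_le`).

The quantization on `T*S¹ × S²` is treated together with the cylinder: an abstract family of unit
vectors `χ n` resolving the identity of a finite-dimensional space plays the role of the spin
coherent states, and a one-point family gives the circle. Synthesis `f ↦ ∫ f(n) χ n` is a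
contraction, so the defect is bounded by an average over `n'`, with weight `|⟨χ n', χ n⟩|²`, of the
cylinder defect of the slice at `n'` and of `|a(n') - a(n)|²` (`enorm_sq_defect_le`). For spin
coherent states the weight concentrates at distance `N^(-1/2)`, and the second term is small because
`a` has Lipschitz constant `O(ħ^(-μ))` along the sphere.

Two further points need an argument. Trace class: on `ℝ^d` the kernel is an integrable superposition
of rank one kernels; on the circle the matrix has summable norms. Resolution of the identity on the
sphere: with `Q` the frame operator, `‖Q - 1‖²` in Hilbert-Schmidt norm is computed from moments of
the overlap, and its nonnegativity together with `dim ≤ N + 1` forces both `dim = N + 1` and `Q = 1`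
(`finrank_spinSpace_and_frameMap`). -/

theorem HilbertBasis.hasSum_norm_sq {H ι : Type*} [NormedAddCommGroup H]
    [InnerProductSpace ℂ H] (b : HilbertBasis ι ℂ H) (v : H) :
    HasSum (fun i => ‖inner ℂ (b i) v‖ ^ 2) (‖v‖ ^ 2) := by
  have h := b.hasSum_inner_mul_inner v v
  have h2 := Complex.hasSum_re h
  convert h2 using 1
  · ext i
    rw [← inner_conj_symm v (b i), Complex.conj_mul', ← Complex.ofReal_pow, Complex.ofReal_re]
  · have := inner_self_eq_norm_sq (𝕜 := ℂ) v
    simpa using this.symm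

variable {H : Type*} [NormedAddCommGroup H] [InnerProductSpace ℂ H] [CompleteSpace H]

/-- A compact self-adjoint operator has a Hilbert basis of eigenvectors with real eigenvalues. -/
theorem exists_hilbertBasis_eigenvectors (A : H →L[ℂ] H) (hc : IsCompactOperator A)
    (hA : IsSelfAdjoint A) :
    ∃ (s : Set H) (b : HilbertBasis s ℂ H) (lam : s → ℝ), ∀ i, A (b i) = (lam i : ℂ) • b i := by
  have hsym : (A : H →ₗ[ℂ] H).IsSymmetric := hA.isSymmetric
  have hfam := hsym.orthogonalFamily_eigenspaces
  have hE : ∀ μ : ℂ, CompleteSpace (Module.End.eigenspace (A : H →ₗ[ℂ] H) μ) := fun μ => by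
    have : IsClosed ((Module.End.eigenspace (A : H →ₗ[ℂ] H) μ : Submodule ℂ H) : Set H) := by
      have : ((Module.End.eigenspace (A : H →ₗ[ℂ] H) μ : Submodule ℂ H) : Set H) =
          {x | A x = μ • x} := by
        ext x; simp
      rw [this]
      exact isClosed_eq A.continuous (continuous_const_smul μ)
    exact this.completeSpace_coe
  have hw := fun μ : ℂ => exists_hilbertBasis ℂ (Module.End.eigenspace (A : H →ₗ[ℂ] H) μ)
  choose w bw hbw using hw
  let v : (Σ μ : ℂ, w μ) → H := fun p => ((bw p.1 p.2 : Module.End.eigenspace (A : H →ₗ[ℂ] H) p.1) : H)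
  have hv : Orthonormal ℂ v :=
    hfam.orthonormal_sigma_orthonormal (v_family := fun μ i => bw μ i) fun μ => (bw μ).orthonormal
  have hAv : ∀ p, A (v p) = p.1 • v p := fun p =>
    Module.End.mem_eigenspace_iff.1 (bw p.1 p.2).2
  -- The sum of the eigenspaces is dense, and each eigenspace is the closed span of its own Hilbert
  -- basis. A vector orthogonal to every `v p` is therefore orthogonal to every eigenspace.
  have hort : (Submodule.span ℂ (Set.range (Subtype.val : Set.range v → H)))ᗮ = ⊥ := by
    rw [Subtype.range_coe, eq_bot_iff]
    intro x hx
    rw [← ContinuousLinearMap.orthogonalComplement_iSup_eigenspaces_eq_bot hc hsym]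
    rw [Submodule.mem_orthogonal] at hx ⊢
    intro u hu
    have hle : (⨆ μ, Module.End.eigenspace (A : H →ₗ[ℂ] H) μ) ≤ (ℂ ∙ x)ᗮ := by
      refine iSup_le fun μ y hy => ?_
      rw [Submodule.mem_orthogonal_singleton_iff_inner_right]
      have hs := ((bw μ).hasSum_repr ⟨y, hy⟩).mapL
        ((innerSL ℂ x).comp (Module.End.eigenspace (A : H →ₗ[ℂ] H) μ).subtypeL)
      refine hs.unique ?_
      convert hasSum_zero with i
      have h0 := hx (v ⟨μ, i⟩) (Submodule.subset_span ⟨_, rfl⟩)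
      rw [inner_eq_zero_symm] at h0
      simp only [map_smul, ContinuousLinearMap.comp_apply, Submodule.subtypeL_apply]
      erw [innerSL_apply_apply, h0]
      simp
    have := hle hu
    rwa [Submodule.mem_orthogonal_singleton_iff_inner_left] at this
  -- `IsTraceClass` asks for a basis indexed by a set of vectors, hence the passage from the family
  -- `v` to its range.
  let b : HilbertBasis (Set.range v) ℂ H := HilbertBasis.mkOfOrthogonalEqBot hv.toSubtypeRange hort
  have hb : ∀ i, b i = (i : H) := fun i => by
    simp [b]
  have hex : ∀ i : Set.range v, ∃ t : ℝ, A (b i) = (t : ℂ) • b i := by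
    rintro ⟨_, p, rfl⟩
    rw [hb]
    have hne : v p ≠ 0 := hv.ne_zero p
    have hp : (starRingEnd ℂ) p.1 = p.1 := hsym.conj_eigenvalue_eq_self
      (Module.End.hasEigenvalue_of_hasEigenvector ⟨(bw p.1 p.2).2, hne⟩)
    refine ⟨p.1.re, ?_⟩
    rw [Complex.conj_eq_iff_re.1 hp]
    exact hAv p
  choose lam hlam using hex
  exact ⟨_, b, lam, hlam⟩

/-- Let `S = |A|`. Since `S² v = t² v`, the vector `w = S v - |t| v` satisfies `S w = -|t| w`, and
positivity of `S` leaves only `|t| ‖w‖² = 0`. If `t = 0`, then `S² v = 0` already forces `S v = 0`.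
-/
theorem abs_apply_eigenvector (A : H →L[ℂ] H) (hA : IsSelfAdjoint A) {t : ℝ} {v : H}
    (hv : A v = (t : ℂ) • v) : CFC.abs A v = ((|t| : ℝ) : ℂ) • v := by
  set S := CFC.abs A with hS
  have hpos : 0 ≤ S := CFC.abs_nonneg A
  have hpos' : S.IsPositive := (ContinuousLinearMap.nonneg_iff_isPositive S).1 hpos
  have hSS : S (S v) = ((|t| : ℝ) : ℂ) • ((|t| : ℝ) : ℂ) • v := by
    have h1 : S * S = star A * A := CFC.abs_mul_abs A
    have h2 : (S * S) v = (star A * A) v := by rw [h1]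
    rw [hA.star_eq] at h2
    simp only [mul_apply_eq_comp, hv, map_smul] at h2
    rw [h2, smul_smul, smul_smul, ← Complex.ofReal_mul, ← Complex.ofReal_mul, abs_mul_abs_self]
  set w := S v - ((|t| : ℝ) : ℂ) • v with hw
  have hSw : S w = -(((|t| : ℝ) : ℂ) • w) := by
    rw [hw, map_sub, hSS, map_smul, smul_sub]; abel
  have h3 : 0 ≤ (inner ℂ (S w) w).re := hpos'.re_inner_nonneg_left w
  rw [hSw, inner_neg_left, inner_smul_left, Complex.conj_ofReal] at h3
  have h4 : (inner ℂ w w).re = ‖w‖ ^ 2 := by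
    have := inner_self_eq_norm_sq (𝕜 := ℂ) w
    simpa using this
  rw [Complex.neg_re, Complex.re_ofReal_mul, h4] at h3
  have hw0 : |t| * ‖w‖ ^ 2 = 0 := le_antisymm (by linarith) (by positivity)
  rcases mul_eq_zero.1 hw0 with h | h
  · rw [h] at hSS ⊢
    simp only [Complex.ofReal_zero, zero_smul] at hSS ⊢
    have h5 : inner ℂ (S v) (S v) = 0 := by
      have := hpos'.isSymmetric v (S v)
      simp only [ContinuousLinearMap.coe_coe] at this
      rw [this, hSS, inner_zero_right]
    exact inner_self_eq_zero.1 h5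
  · have : w = 0 := by simpa using h
    exact sub_eq_zero.1 this

theorem isTraceClass_of_summable_eigenvalues (A : H →L[ℂ] H) (hA : IsSelfAdjoint A) {s : Set H}
    (b : HilbertBasis s ℂ H) {lam : s → ℝ} (hb : ∀ i, A (b i) = (lam i : ℂ) • b i)
    (hs : Summable fun i => |lam i|) : IsTraceClass A := by
  refine ⟨s, b, ?_⟩
  convert hs with i
  rw [abs_apply_eigenvector A hA (hb i), inner_smul_right]
  simp [b.orthonormal.1 i]

theorem HilbertBasis.inner_apply_of_eigenvector {ι : Type*} (b : HilbertBasis ι ℂ H) {A : H →L[ℂ] H}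
    (hA : IsSelfAdjoint A) {lam : ι → ℝ} (hb : ∀ i, A (b i) = (lam i : ℂ) • b i) (i : ι) (v : H) :
    inner ℂ (b i) (A v) = lam i * inner ℂ (b i) v := by
  have := hA.isSymmetric (b i) v
  simp only [ContinuousLinearMap.coe_coe] at this
  rw [← this, hb, inner_smul_left, Complex.conj_ofReal]

/-- An eigenvector for `t` has no component along a basis vector with a different eigenvalue, so its
expansion reduces to a finite sum over the outer indices. -/
theorem outerEigenspace_eq_span (A : H →L[ℂ] H) (hA : IsSelfAdjoint A) {ι : Type*}
    (b : HilbertBasis ι ℂ H) {lam : ι → ℝ} (hb : ∀ i, A (b i) = (lam i : ℂ) • b i) {ε : ℝ}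
    (hfin : {i | ε ≤ |lam i|}.Finite) :
    outerEigenspace A ε = Submodule.span ℂ (Set.range fun i : {i | ε ≤ |lam i|} => b i) := by
  apply le_antisymm
  · refine iSup₂_le fun t ht v hv => ?_
    have hv : A v = (t : ℂ) • v := Module.End.mem_eigenspace_iff.1 hv
    have hz : ∀ i, i ∉ hfin.toFinset → b.repr v i • b i = 0 := by
      intro i hi
      have hi' : lam i ≠ t := by
        rintro rfl; exact hi (by simpa using ht)
      have h1 := b.inner_apply_of_eigenvector hA hb i v
      rw [hv, inner_smul_right] at h1
      have h2 : ((lam i : ℂ) - t) * inner ℂ (b i) v = 0 := by rw [sub_mul, ← h1, sub_self]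
      have h3 : ((lam i : ℂ) - t) ≠ 0 := by
        rw [sub_ne_zero]; exact_mod_cast hi'
      rw [b.repr_apply_apply, (mul_eq_zero.1 h2).resolve_left h3, zero_smul]
    have hsum := (b.hasSum_repr v).unique (hasSum_sum_of_ne_finset_zero hz)
    rw [hsum]
    refine Submodule.sum_mem _ fun i hi => Submodule.smul_mem _ _ (Submodule.subset_span ?_)
    exact ⟨⟨i, by simpa using hi⟩, rfl⟩
  · rw [Submodule.span_le]
    rintro _ ⟨i, rfl⟩
    refine Submodule.mem_iSup_of_mem (lam i) (Submodule.mem_iSup_of_mem i.2 ?_)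
    exact Module.End.mem_eigenspace_iff.2 (hb i)

theorem finitelyManyOuter_of_finite (A : H →L[ℂ] H) (hA : IsSelfAdjoint A) {ι : Type*}
    (b : HilbertBasis ι ℂ H) {lam : ι → ℝ} (hb : ∀ i, A (b i) = (lam i : ℂ) • b i) {ε : ℝ}
    (hfin : {i | ε ≤ |lam i|}.Finite) :
    FinitelyManyOuter A ε ∧ outerCount A ε = hfin.toFinset.card := by
  have := hfin.fintype
  unfold FinitelyManyOuter outerCount
  rw [outerEigenspace_eq_span A hA b hb hfin]
  refine ⟨FiniteDimensional.span_of_finite ℂ (Set.finite_range _), ?_⟩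
  have hli : LinearIndependent ℂ (fun i : {i | ε ≤ |lam i|} => b i) :=
    (b.orthonormal.comp _ Subtype.val_injective).linearIndependent
  rw [finrank_span_eq_card hli, ← Set.toFinset_card]
  congr 1
  ext; simp

/-- An operator with finite Hilbert-Schmidt norm is compact. -/
theorem isCompactOperator_of_summable_norm_sq (A : H →L[ℂ] H) {ι : Type*}
    (b : HilbertBasis ι ℂ H) (hs : Summable fun i => ‖A (b i)‖ ^ 2) : IsCompactOperator A := by
  classical
  let P : Finset ι → H →L[ℂ] H := fun F =>
    ∑ i ∈ F, (innerSL ℂ (b i)).smulRight (A (b i))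
  have hP : ∀ F, IsCompactOperator (P F) := fun F => by
    have : P F ∈ compactOperator (RingHom.id ℂ) H H := by
      refine Submodule.sum_mem _ fun i _ => ?_
      have h : IsCompactOperator (ContinuousLinearMap.toSpanSingleton ℂ (A (b i)) ∘L innerSL ℂ (b i)) :=
        (isCompactOperator_of_locallyCompactSpace_rng
          (ContinuousLinearMap.toSpanSingleton ℂ (A (b i)))).comp_clm _
      exact h
    exact this
  refine isCompactOperator_of_tendsto (l := atTop) (F := P) ?_ (Eventually.of_forall hP)
  rw [tendsto_iff_norm_sub_tendsto_zero]
  -- Cauchy-Schwarz: the truncation to finite rank errs by at most the tail of the Hilbert-Schmidt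
  -- norm.
  have hbound : ∀ F, ‖P F - A‖ ≤ √(∑' i : {i // i ∉ F}, ‖A (b i)‖ ^ 2) := by
    intro F
    refine ContinuousLinearMap.opNorm_le_bound _ (Real.sqrt_nonneg _) fun v => ?_
    have h1 : HasSum (fun i => inner ℂ (b i) v • A (b i)) (A v) := by
      have := (b.hasSum_repr v).mapL A
      simpa [b.repr_apply_apply] using this
    have h2 : HasSum (fun i : {i // i ∉ F} => inner ℂ (b i) v • A (b i)) (A v - P F v) := by
      have := (Finset.hasSum_compl_iff F (f := fun i => inner ℂ (b i) v • A (b i))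
        (a := A v - P F v)).2 (by simpa [P] using h1)
      exact this
    have h3 : Summable fun i : {i // i ∉ F} => ‖A (b i)‖ ^ 2 := hs.subtype _
    have h4 : Summable fun i : {i // i ∉ F} => ‖inner ℂ (b i) v‖ ^ 2 :=
      (b.hasSum_norm_sq v).summable.subtype _
    have h5 := Real.summable_and_inner_le_Lp_mul_Lq_tsum_of_nonneg (p := 2) (q := 2)
      (f := fun i : {i // i ∉ F} => ‖inner ℂ (b i) v‖) (g := fun i => ‖A (b i)‖)
      Real.HolderConjugate.two_two (fun _ => norm_nonneg _) (fun _ => norm_nonneg _)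
      (by simpa using h4) (by simpa using h3)
    have h6 : ‖A v - P F v‖ ≤ ∑' i : {i // i ∉ F}, ‖inner ℂ (b i) v‖ * ‖A (b i)‖ := by
      rw [← h2.tsum_eq]
      have := norm_tsum_le_tsum_norm (f := fun i : {i // i ∉ F} => inner ℂ (b i) v • A (b i))
        (by simpa [norm_smul] using h5.1)
      simpa [norm_smul] using this
    have h7 : ∑' i : {i // i ∉ F}, ‖inner ℂ (b i) v‖ ^ 2 ≤ ‖v‖ ^ 2 := by
      rw [← (b.hasSum_norm_sq v).tsum_eq]
      exact Summable.tsum_subtype_le _ _ (fun _ => by positivity) (b.hasSum_norm_sq v).summable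
    rw [sub_apply, norm_sub_rev, mul_comm]
    refine h6.trans (h5.2.trans ?_)
    rw [← Real.sqrt_eq_rpow, ← Real.sqrt_eq_rpow]
    simp only [Real.rpow_two]
    gcongr
    exact (Real.sqrt_le_sqrt h7).trans (by rw [Real.sqrt_sq (norm_nonneg v)])
  have hlim : Tendsto (fun F : Finset ι => √(∑' i : {i // i ∉ F}, ‖A (b i)‖ ^ 2)) atTop (𝓝 0) := by
    have := (tendsto_tsum_compl_atTop_zero fun i => ‖A (b i)‖ ^ 2).sqrt
    simpa using this
  exact squeeze_zero (fun _ => norm_nonneg _) hbound hlim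

/-- The coupling estimate: if `ψ` is a family of unit vectors resolving the identity and `A ψ_z` is
close to `a(z) ψ_z` in the mean, then the eigenvalues of `A` are distributed like the values
of `a`. -/
theorem card_eigenvalues_le_and_ge (A : H →L[ℂ] H) (hA : IsSelfAdjoint A) {ι : Type*}
    (b : HilbertBasis ι ℂ H) {lam : ι → ℝ} (hb : ∀ i, A (b i) = (lam i : ℂ) • b i)
    {Z : Type*} [MeasurableSpace Z] (ν : Measure Z) (ψ : Z → H) (hψ : ∀ z, ‖ψ z‖ = 1)
    (hmeas : ∀ v, Measurable fun z => inner ℂ v (ψ z))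
    (hres : ∀ v, ∫⁻ z, ‖inner ℂ v (ψ z)‖ₑ ^ 2 ∂ν = ‖v‖ₑ ^ 2)
    (a : Z → ℝ) (ha : Measurable a) (R : ENNReal)
    (hR : ∫⁻ z, ‖A (ψ z) - (a z : ℂ) • ψ z‖ₑ ^ 2 ∂ν ≤ R)
    {ε δ : ℝ} (hδ : 0 < δ) (hfin : {i | ε ≤ |lam i|}.Finite) :
    (hfin.toFinset.card : ENNReal) ≤ ν {z | ε - δ < |a z|} + R / ENNReal.ofReal (δ ^ 2) ∧
    ν {z | ε + δ < |a z|} ≤ hfin.toFinset.card + R / ENNReal.ofReal (δ ^ 2) := by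
  set F := hfin.toFinset with hF
  -- The density of the coupling: a probability vector in `i` for each `z`, and a probability
  -- density with respect to `ν` for each `i`. Its quadratic cost at `z` is `D z`.
  let p : ι → Z → ℝ := fun i z => ‖inner ℂ (b i) (ψ z)‖ ^ 2
  have hp0 : ∀ i z, 0 ≤ p i z := fun i z => by positivity
  have hpsum : ∀ z, HasSum (fun i => p i z) 1 := fun z => by
    have := b.hasSum_norm_sq (ψ z)
    rwa [hψ, one_pow] at this
  let D : Z → ℝ := fun z => ‖A (ψ z) - (a z : ℂ) • ψ z‖ ^ 2
  have hD : ∀ z, HasSum (fun i => (lam i - a z) ^ 2 * p i z) (D z) := fun z => by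
    convert b.hasSum_norm_sq (A (ψ z) - (a z : ℂ) • ψ z) using 2 with i
    rw [inner_sub_right, b.inner_apply_of_eigenvector hA hb, inner_smul_right, ← sub_mul, norm_mul,
      mul_pow, ← Complex.ofReal_sub, Complex.norm_real, Real.norm_eq_abs, sq_abs]
  have hD0 : ∀ z, 0 ≤ D z := fun z => by positivity
  have hFle : ∀ z, ∑ i ∈ F, p i z ≤ 1 := fun z => sum_le_hasSum _ (fun i _ => hp0 i z) (hpsum z)
  have hdist : ∀ x y : ℝ, δ ≤ |(|x| - |y|)| → δ ^ 2 ≤ (x - y) ^ 2 := fun x y h => by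
    rw [← sq_abs (x - y)]
    exact pow_le_pow_left₀ hδ.le (h.trans (abs_abs_sub_abs_le_abs_sub x y)) 2
  -- Chebyshev, first half: where `|a|` is small, mass on outer eigenvalues travels at least `δ`.
  -- The next claim is the mirror image, for mass on inner eigenvalues where `|a|` is large.
  have hup : ∀ z, |a z| ≤ ε - δ → δ ^ 2 * ∑ i ∈ F, p i z ≤ D z := by
    intro z hz
    rw [Finset.mul_sum]
    refine le_trans (Finset.sum_le_sum fun i hi => ?_)
      (sum_le_hasSum F (fun i _ => by positivity) (hD z))
    refine mul_le_mul_of_nonneg_right (hdist _ _ ?_) (hp0 i z)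
    have : ε ≤ |lam i| := by simpa [F] using hi
    rw [abs_of_nonneg (by linarith)]; linarith
  have hlow : ∀ z, ε + δ < |a z| → δ ^ 2 * (1 - ∑ i ∈ F, p i z) ≤ D z := by
    intro z hz
    have h1 : HasSum (fun i : {i // i ∉ F} => p i z) (1 - ∑ i ∈ F, p i z) :=
      (Finset.hasSum_compl_iff F (f := fun i => p i z)).2 (by simpa using hpsum z)
    have h2 : ∑' i : {i // i ∉ F}, (lam i - a z) ^ 2 * p i z ≤ D z := by
      rw [← (hD z).tsum_eq]
      exact Summable.tsum_subtype_le _ _ (fun i => by positivity) (hD z).summable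
    refine le_trans ?_ h2
    refine hasSum_le (fun i => ?_) (h1.mul_left (δ ^ 2)) ((hD z).summable.subtype _).hasSum
    refine mul_le_mul_of_nonneg_right (hdist _ _ ?_) (hp0 i z)
    have : |lam i| < ε := by simpa [F] using i.2
    rw [abs_sub_comm, abs_of_nonneg (by linarith)]; linarith
  have hmp : ∀ i, Measurable fun z => ENNReal.ofReal (p i z) := fun i =>
    (((hmeas (b i)).norm.pow_const 2)).ennreal_ofReal
  have hpe : ∀ i z, ENNReal.ofReal (p i z) = ‖inner ℂ (b i) (ψ z)‖ₑ ^ 2 := fun i z => by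
    rw [ENNReal.ofReal_pow (norm_nonneg _), ofReal_norm]
  have hpint : ∀ i, ∫⁻ z, ENNReal.ofReal (p i z) ∂ν = 1 := fun i => by
    simp_rw [hpe, hres, ← ofReal_norm, b.orthonormal.1 i]; simp
  have hcard : ∫⁻ z, ∑ i ∈ F, ENNReal.ofReal (p i z) ∂ν = F.card := by
    rw [lintegral_finsetSum _ fun i _ => hmp i]
    simp [hpint]
  have hDe : ∀ z, ENNReal.ofReal (D z) = ‖A (ψ z) - (a z : ℂ) • ψ z‖ₑ ^ 2 := fun z => by
    rw [ENNReal.ofReal_pow (norm_nonneg _), ofReal_norm]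
  have hδ2 : 0 < δ ^ 2 := by positivity
  have hDint : ∫⁻ z, ENNReal.ofReal (D z / δ ^ 2) ∂ν ≤ R / ENNReal.ofReal (δ ^ 2) := by
    have : ∀ z, ENNReal.ofReal (D z / δ ^ 2) = ENNReal.ofReal (D z) * (ENNReal.ofReal (δ ^ 2))⁻¹ :=
      fun z => by rw [ENNReal.ofReal_div_of_pos hδ2, div_eq_mul_inv]
    simp_rw [this]
    rw [lintegral_mul_const' _ _ (by simpa using hδ.ne'), div_eq_mul_inv]
    gcongr
    simpa only [hDe] using hR
  have hset : ∀ t : ℝ, MeasurableSet {z | t < |a z|} := fun t =>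
    measurableSet_lt measurable_const ha.abs
  have hsumE : ∀ z, ∑ i ∈ F, ENNReal.ofReal (p i z) = ENNReal.ofReal (∑ i ∈ F, p i z) := fun z =>
    (ENNReal.ofReal_sum_of_nonneg fun i _ => hp0 i z).symm
  constructor
  · calc (F.card : ENNReal) = ∫⁻ z, ∑ i ∈ F, ENNReal.ofReal (p i z) ∂ν := hcard.symm
      _ ≤ ∫⁻ z, ({z | ε - δ < |a z|}.indicator 1 z + ENNReal.ofReal (D z / δ ^ 2)) ∂ν := by
          refine lintegral_mono fun z => ?_
          by_cases hz : ε - δ < |a z|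
          · simp only [Set.indicator, Set.mem_ofPred_eq, hz, if_true, hsumE, Pi.one_apply]
            exact le_add_right (ENNReal.ofReal_le_one.2 (hFle z))
          · simp only [Set.indicator, Set.mem_ofPred_eq, hz, if_false, hsumE, zero_add]
            refine ENNReal.ofReal_le_ofReal ?_
            rw [le_div_iff₀ hδ2, mul_comm]
            exact hup z (not_lt.1 hz)
      _ = ν {z | ε - δ < |a z|} + ∫⁻ z, ENNReal.ofReal (D z / δ ^ 2) ∂ν := by
          rw [lintegral_add_left (measurable_one.indicator (hset _)), lintegral_indicator_one (hset _)]
      _ ≤ _ := by gcongr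
  · calc ν {z | ε + δ < |a z|} = ∫⁻ z, {z | ε + δ < |a z|}.indicator 1 z ∂ν :=
          (lintegral_indicator_one (hset _)).symm
      _ ≤ ∫⁻ z, (∑ i ∈ F, ENNReal.ofReal (p i z) + ENNReal.ofReal (D z / δ ^ 2)) ∂ν := by
          refine lintegral_mono fun z => ?_
          by_cases hz : ε + δ < |a z|
          · simp only [Set.indicator, Set.mem_ofPred_eq, hz, if_true, hsumE, Pi.one_apply]
            rw [← ENNReal.ofReal_add (Finset.sum_nonneg fun i _ => hp0 i z) (by have := hD0 z; positivity),
              ENNReal.one_le_ofReal]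
            have := hlow z hz
            rw [mul_comm, ← le_div_iff₀ hδ2] at this
            linarith
          · simp [Set.indicator, hz]
      _ = F.card + ∫⁻ z, ENNReal.ofReal (D z / δ ^ 2) ∂ν := by
          rw [lintegral_add_left (Finset.measurable_fun_sum _ fun i _ => hmp i), hcard]
      _ ≤ _ := by gcongr

/-- Consequences of compactness, self-adjointness and a bound on the sums `∑ |⟨e, A e⟩|` for the
spectrum of `A`, together with the coupling estimate. -/
theorem traceClass_and_counting (A : H →L[ℂ] H) (hc : IsCompactOperator A) (hA : IsSelfAdjoint A)
    (C : ℝ) (hC : ∀ (s : Set H) (b : HilbertBasis s ℂ H) (F : Finset s),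
      ∑ i ∈ F, ‖inner ℂ (b i) (A (b i))‖ ≤ C) :
    IsTraceClass A ∧ ∀ ε : ℝ, 0 < ε → FinitelyManyOuter A ε ∧
      ∀ {Z : Type} [MeasurableSpace Z] (ν : Measure Z) (ψ : Z → H), (∀ z, ‖ψ z‖ = 1) →
      (∀ v, Measurable fun z => inner ℂ v (ψ z)) →
      (∀ v, ∫⁻ z, ‖inner ℂ v (ψ z)‖ₑ ^ 2 ∂ν = ‖v‖ₑ ^ 2) →
      ∀ (a : Z → ℝ), Measurable a → ∀ R : ENNReal,
      ∫⁻ z, ‖A (ψ z) - (a z : ℂ) • ψ z‖ₑ ^ 2 ∂ν ≤ R → ∀ δ : ℝ, 0 < δ →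
      (outerCount A ε : ENNReal) ≤ ν {z | ε - δ < |a z|} + R / ENNReal.ofReal (δ ^ 2) ∧
      ν {z | ε + δ < |a z|} ≤ outerCount A ε + R / ENNReal.ofReal (δ ^ 2) := by
  obtain ⟨s, b, lam, hb⟩ := exists_hilbertBasis_eigenvectors A hc hA
  have hn : ∀ i, ‖inner ℂ (b i) (A (b i))‖ = |lam i| := fun i => by
    rw [hb, inner_smul_right, inner_self_eq_norm_sq_to_K, b.orthonormal.1 i]
    simp
  -- The bound `hC` holds for every Hilbert basis; on the eigenbasis it is a bound for the partial
  -- sums of `|lam i|`.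
  have hs : Summable fun i => |lam i| :=
    summable_of_sum_le (fun _ => abs_nonneg _) fun F => by simpa only [hn] using hC s b F
  refine ⟨isTraceClass_of_summable_eigenvalues A hA b hb hs, fun ε hε => ?_⟩
  have hfin : {i | ε ≤ |lam i|}.Finite := by
    have := (hs.tendsto_cofinite_zero.eventually (gt_mem_nhds hε))
    rw [Filter.eventually_cofinite] at this
    simpa using this
  obtain ⟨h1, h2⟩ := finitelyManyOuter_of_finite A hA b hb hfin
  refine ⟨h1, fun ν ψ hψ hm hr a ha R hR δ hδ => ?_⟩
  rw [h2]
  exact card_eigenvalues_le_and_ge A hA b hb ν ψ hψ hm hr a ha R hR hδ hfin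

end SpectralTheory

/-! ### From counting estimates to the two forms of the Weyl law. -/

section Asymptotics

variable {ι M : Type*} [MeasurableSpace M]

theorem volAbove_mono {vol : Measure M} {f : M → ℝ} (hf : vol {z | 0 < |f z|} ≠ ⊤) {s t : ℝ}
    (hs : 0 ≤ s) (hst : s ≤ t) : volAbove vol f t ≤ volAbove vol f s :=
  measureReal_mono (fun _ hz => lt_of_le_of_lt hst hz)
    (ne_top_of_le_ne_top hf (measure_mono fun _ hz => lt_of_le_of_lt hs hz))

/-- Non-concentration pays for moving the threshold. It is used with `(s, t)` equal to `(ε - δ, ε)`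
and to `(ε, ε + δ)`. -/
theorem volAbove_le_add {vol : Measure M} {f : M → ℝ} (hf : vol {z | 0 < |f z|} ≠ ⊤) {s t ε δ κ : ℝ}
    (ht : 0 ≤ t) (hκ : 0 ≤ κ) (hsub : ∀ x, s < x → t < x ∨ |x - ε| ≤ δ)
    (hδ : vol {z | |(|f z| - ε)| ≤ δ} ≤ ENNReal.ofReal κ * vol {z | 0 < |f z|}) :
    volAbove vol f s ≤ volAbove vol f t + κ * volAbove vol f 0 := by
  have h1 : vol {z | s < |f z|} ≤ vol {z | t < |f z|} + ENNReal.ofReal κ * vol {z | 0 < |f z|} := by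
    refine (measure_mono fun z hz => ?_).trans ((measure_union_le _ _).trans
      (add_le_add le_rfl hδ))
    exact hsub _ hz
  have ht' : vol {z | t < |f z|} ≠ ⊤ :=
    ne_top_of_le_ne_top hf (measure_mono fun _ hz => lt_of_le_of_lt ht hz)
  have h2 := ENNReal.toReal_mono (ENNReal.add_ne_top.2 ⟨ht', ENNReal.mul_ne_top (by simp) hf⟩) h1
  rw [ENNReal.toReal_add ht' (ENNReal.mul_ne_top (by simp) hf), ENNReal.toReal_mul,
    ENNReal.toReal_ofReal hκ] at h2
  exact h2

/-- Counting estimates with an error `η_i Vol{|a_i| > 0} / δ²`, `η_i → 0`, imply the Weyl law. -/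
theorem weylBounds_and_weylLaw (l : Filter ι) (vol : Measure M) (c : ι → ℝ) (a : ι → M → ℝ)
    (n : ι → ℕ) {ε : ℝ} (hε : 0 < ε) (η : ι → ℝ) (hη : Tendsto η l (𝓝 0))
    (hc : ∀ᶠ i in l, 0 < c i) (hfin : ∀ᶠ i in l, vol {z | 0 < |a i z|} ≠ ⊤)
    (hn : ∀ᶠ i in l, ∀ δ : ℝ, 0 < δ → δ < ε →
      (n i : ℝ) ≤ c i * (volAbove vol (a i) (ε - δ) + volAbove vol (a i) 0 * (η i / δ ^ 2)) ∧
      c i * (volAbove vol (a i) (ε + δ) - volAbove vol (a i) 0 * (η i / δ ^ 2)) ≤ n i) :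
    WeylBounds l vol c a n ε ∧ (NoConcentration l vol a ε → WeylLaw l vol c a n ε) := by
  have hηδ : ∀ δ : ℝ, Tendsto (fun i => η i / δ ^ 2) l (𝓝 0) := fun δ => by
    simpa using hη.div_const (δ ^ 2)
  constructor
  · intro δ hδ hδε
    refine ⟨fun i => η i / δ ^ 2, hηδ δ, ?_⟩
    filter_upwards [hn] with i hi
    exact ⟨(hi δ hδ hδε).2, (hi δ hδ hδε).1⟩
  · intro hnc
    -- The remainder is defined by solving the asserted equation for it. Where the support has
    -- volume zero the value is irrelevant, since the upper bound then forces `n i = 0`.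
    refine ⟨fun i => if volAbove vol (a i) 0 = 0 then 0 else
      ((n i : ℝ) / c i - volAbove vol (a i) ε) / volAbove vol (a i) 0, ?_, ?_⟩
    · rw [Metric.tendsto_nhds]
      intro κ hκ
      obtain ⟨δ₀, hδ₀, hnc'⟩ := hnc (κ / 2) (by positivity)
      -- The cap `ε / 2` ensures `δ < ε`, and shrinking `δ₀` keeps the non-concentration bound.
      set δ := min δ₀ (ε / 2) with hδdef
      have hδ : 0 < δ := lt_min hδ₀ (by positivity)
      have hδε : δ < ε := (min_le_right _ _).trans_lt (by linarith)
      have hsmall := (hηδ δ).eventually (Metric.ball_mem_nhds (0 : ℝ) (half_pos hκ))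
      filter_upwards [hnc', hsmall, hn, hc, hfin] with i h1 h2 h3 h4 h5
      rw [Real.dist_eq, sub_zero]
      split_ifs with h0
      · simpa using hκ
      have hV : 0 < volAbove vol (a i) 0 := lt_of_le_of_ne ENNReal.toReal_nonneg (Ne.symm h0)
      rw [dist_zero_right, Real.norm_eq_abs] at h2
      have h2' := (abs_lt.1 h2).2
      rw [abs_div, abs_of_pos hV, div_lt_iff₀ hV, abs_lt]
      obtain ⟨h6, h7⟩ := h3 δ hδ hδε
      have h1' : vol {z | |(|a i z| - ε)| ≤ δ} ≤ ENNReal.ofReal (κ / 2) * vol {z | 0 < |a i z|} :=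
        (measure_mono fun z (hz : |(|a i z| - ε)| ≤ δ) => hz.trans (min_le_left δ₀ _)).trans h1
      have h8 := volAbove_le_add h5 (s := ε - δ) (t := ε) hε.le (half_pos hκ).le (fun x hx => by
        by_cases hxe : ε < x
        · exact Or.inl hxe
        · right; rw [abs_le]; constructor <;> linarith) h1'
      have h9 := volAbove_le_add h5 (s := ε) (t := ε + δ) (by linarith) (half_pos hκ).le
        (fun x hx => by
        by_cases hxe : ε + δ < x
        · exact Or.inl hxe
        · right; rw [abs_le]; constructor <;> linarith) h1'
      have h10 : (n i : ℝ) / c i ≤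
          volAbove vol (a i) (ε - δ) + volAbove vol (a i) 0 * (η i / δ ^ 2) := by
        rw [div_le_iff₀ h4]; linarith
      have h11 : volAbove vol (a i) (ε + δ) - volAbove vol (a i) 0 * (η i / δ ^ 2) ≤
          (n i : ℝ) / c i := by
        rw [le_div_iff₀ h4]; linarith
      have h12 := mul_lt_mul_of_pos_left h2' hV
      constructor <;> nlinarith
    · filter_upwards [hn, hc, hfin] with i h3 h4 h5
      by_cases h0 : volAbove vol (a i) 0 = 0
      · have hle : ∀ t, 0 ≤ t → volAbove vol (a i) t = 0 := fun t ht =>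
          le_antisymm ((volAbove_mono h5 le_rfl ht).trans h0.le) ENNReal.toReal_nonneg
        have h6 := (h3 (ε / 2) (by positivity) (by linarith)).1
        rw [hle _ (by linarith), h0] at h6
        have h7 : (n i : ℝ) = 0 := le_antisymm (by linarith) (Nat.cast_nonneg _)
        rw [h7, hle _ hε.le, h0]; simp
      · simp only [h0, if_false]
        field_simp
        ring

theorem counting_toReal {vol : Measure M} {f : M → ℝ} (hf : vol {z | 0 < |f z|} ≠ ⊤) {n : ℕ}
    {c η ε δ : ℝ} (hc : 0 ≤ c) (hη : 0 ≤ η) (hδ : 0 < δ) (hδε : δ < ε)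
    (h1 : (n : ENNReal) ≤ (ENNReal.ofReal c • vol) {z | ε - δ < |f z|} +
      ENNReal.ofReal (c * η) * vol {z | 0 < |f z|} / ENNReal.ofReal (δ ^ 2))
    (h2 : (ENNReal.ofReal c • vol) {z | ε + δ < |f z|} ≤ n +
      ENNReal.ofReal (c * η) * vol {z | 0 < |f z|} / ENNReal.ofReal (δ ^ 2)) :
    (n : ℝ) ≤ c * (volAbove vol f (ε - δ) + volAbove vol f 0 * (η / δ ^ 2)) ∧
      c * (volAbove vol f (ε + δ) - volAbove vol f 0 * (η / δ ^ 2)) ≤ n := by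
  have hR : ENNReal.ofReal (c * η) * vol {z | 0 < |f z|} / ENNReal.ofReal (δ ^ 2) ≠ ⊤ :=
    ENNReal.div_ne_top (ENNReal.mul_ne_top (by simp) hf) (by simpa using hδ.ne')
  have hfin : ∀ t, 0 ≤ t → (ENNReal.ofReal c • vol) {z | t < |f z|} ≠ ⊤ := fun t ht =>
    ENNReal.mul_ne_top (by simp)
      (ne_top_of_le_ne_top hf (measure_mono fun _ hz => lt_of_le_of_lt ht hz))
  have hRr : (ENNReal.ofReal (c * η) * vol {z | 0 < |f z|} / ENNReal.ofReal (δ ^ 2)).toReal =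
      c * (volAbove vol f 0 * (η / δ ^ 2)) := by
    rw [ENNReal.toReal_div, ENNReal.toReal_mul, ENNReal.toReal_ofReal (by positivity),
      ENNReal.toReal_ofReal (by positivity)]
    change c * η * volAbove vol f 0 / δ ^ 2 = _
    ring
  have hv : ∀ t, ((ENNReal.ofReal c • vol) {z | t < |f z|}).toReal = c * volAbove vol f t :=
    fun t => by
      rw [Measure.smul_apply, smul_eq_mul, ENNReal.toReal_mul, ENNReal.toReal_ofReal hc]; rfl
  constructor
  · have := ENNReal.toReal_mono (ENNReal.add_ne_top.2 ⟨hfin _ (by linarith), hR⟩) h1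
    rw [ENNReal.toReal_add (hfin _ (by linarith)) hR, hRr, hv, ENNReal.toReal_natCast] at this
    linarith
  · have := ENNReal.toReal_mono (ENNReal.add_ne_top.2 ⟨by simp, hR⟩) h2
    rw [ENNReal.toReal_add (by simp) hR, hRr, hv, ENNReal.toReal_natCast] at this
    linarith

end Asymptotics

/-! ### Plancherel's theorem for concrete Fourier integrals. -/

section Plancherel

open FourierTransform

variable {E : Type*} [NormedAddCommGroup E] [InnerProductSpace ℝ E] [FiniteDimensional ℝ E]
  [MeasurableSpace E] [BorelSpace E]

/-- Plancherel's theorem for functions in `L¹ ∩ L²`. -/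
theorem lintegral_enorm_sq_fourier {g : E → ℂ} (h1 : Integrable g) (h2 : MemLp g 2) :
    ∫⁻ w, ‖𝓕 g w‖ₑ ^ 2 = ∫⁻ x, ‖g x‖ₑ ^ 2 := by
  set u : Lp ℂ 2 (volume : Measure E) := 𝓕 (h2.toLp g) with hu
  have hcont : Continuous (𝓕 g) :=
    VectorFourier.fourierIntegral_continuous Real.continuous_fourierChar
      (by exact continuous_inner) h1
  -- The Fourier integral of `g` and its `L²` transform `u` agree as distributions: tested against
  -- `Φ`, both give `∫ 𝓕 Φ • g`. For `u` this is the duality for tempered distributions, for the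
  -- integral it is the multiplication formula.
  have hae : ∀ᵐ w, 𝓕 g w = u w := by
    refine ae_eq_of_integral_contDiff_smul_eq hcont.locallyIntegrable
      ((Lp.memLp u).locallyIntegrable (by norm_num)) fun φ hφ hφc => ?_
    have hφ' : ContDiff ℝ ∞ (fun x => (φ x : ℂ)) := Complex.ofRealCLM.contDiff.comp hφ
    have hφc' : HasCompactSupport (fun x => (φ x : ℂ)) := hφc.comp_left (g := fun t : ℝ => (t : ℂ)) (by simp)
    set Φ : 𝓢(E, ℂ) := hφc'.toSchwartzMap hφ' with hΦ
    have hΦx : ∀ x, Φ x = φ x := fun x => rfl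
    have e1 : ∫ x, Φ x • u x = ∫ x, (𝓕 Φ) x • g x := by
      have := congrArg (fun T => T Φ) (Lp.fourier_toTemperedDistribution_eq (h2.toLp g))
      simp only [TemperedDistribution.fourier_apply, Lp.toTemperedDistribution_apply] at this
      rw [← hu] at this
      rw [← this]
      refine integral_congr_ae ?_
      filter_upwards [h2.coeFn_toLp] with x hx
      rw [hx]
    have e2 : ∫ x, 𝓕 Φ x • g x = ∫ x, Φ x • 𝓕 g x := by
      have := VectorFourier.integral_fourierIntegral_smul_eq_flip (L := innerₗ E)
        (μ := (volume : Measure E)) (ν := (volume : Measure E)) Real.continuous_fourierChar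
        continuous_inner Φ.integrable h1
      simpa using! this
    calc ∫ x, φ x • 𝓕 g x = ∫ x, Φ x • 𝓕 g x := by simp [hΦx]
      _ = ∫ x, Φ x • u x := by rw [e1, e2]
      _ = _ := by simp [hΦx]
  have hL : ∀ v : Lp ℂ 2 (volume : Measure E), ∫⁻ x, ‖v x‖ₑ ^ 2 = ‖v‖ₑ ^ 2 := fun v => by
    rw [Lp.enorm_def, eLpNorm_eq_lintegral_rpow_enorm_toReal (by norm_num) (by norm_num)]
    simp only [ENNReal.toReal_ofNat, ENNReal.rpow_ofNat]
    rw [← ENNReal.rpow_natCast, ← ENNReal.rpow_mul]; norm_num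
  calc ∫⁻ w, ‖𝓕 g w‖ₑ ^ 2 = ∫⁻ w, ‖u w‖ₑ ^ 2 :=
        lintegral_congr_ae (by filter_upwards [hae] with w hw; rw [hw])
    _ = ‖h2.toLp g‖ₑ ^ 2 := by
        rw [hL, ← ofReal_norm, hu, Lp.norm_fourier_eq, ofReal_norm]
    _ = _ := by
        rw [← hL]
        exact lintegral_congr_ae (by filter_upwards [h2.coeFn_toLp] with w hw; rw [hw])

theorem lintegral_comp_smul_of_pos (f : E → ENNReal) {c : ℝ} (hc : 0 < c) :
    ∫⁻ x, f (c • x) = ENNReal.ofReal ((c ^ Module.finrank ℝ E)⁻¹) * ∫⁻ x, f x := by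
  have h := Measure.map_addHaar_smul (volume : Measure E) hc.ne'
  have h2 := lintegral_map_equiv (μ := (volume : Measure E)) f (MeasurableEquiv.smul₀ c hc.ne')
  simp only [MeasurableEquiv.coe_smul₀] at h2
  rw [← h2]
  erw [h]
  rw [lintegral_smul_measure, abs_of_pos (by positivity), smul_eq_mul]

end Plancherel

/-! ### Integral operators with square integrable kernels. -/

section KernelOperator

variable {X : Type*} [MeasurableSpace X] {μ : Measure X}

theorem lintegral_enorm_sq_coeFn {V : Type*} [NormedAddCommGroup V] (v : Lp V 2 μ) :
    ∫⁻ x, ‖v x‖ₑ ^ 2 ∂μ = ‖v‖ₑ ^ 2 := by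
  rw [Lp.enorm_def, eLpNorm_eq_lintegral_rpow_enorm_toReal (by norm_num) (by norm_num)]
  simp only [ENNReal.toReal_ofNat, ENNReal.rpow_ofNat]
  rw [← ENNReal.rpow_natCast, ← ENNReal.rpow_mul]; norm_num

theorem memLp_two_iff_lintegral {V : Type*} [NormedAddCommGroup V] {g : X → V}
    (hg : AEStronglyMeasurable g μ) : MemLp g 2 μ ↔ ∫⁻ x, ‖g x‖ₑ ^ 2 ∂μ < ⊤ := by
  have := eLpNorm_lt_top_iff_lintegral_rpow_enorm_lt_top (f := g) (μ := μ) (p := 2)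
    (by norm_num) (by norm_num)
  simp only [ENNReal.toReal_ofNat, ENNReal.rpow_ofNat] at this
  rw [MemLp, this]
  exact ⟨fun h => h.2, fun h => ⟨hg, h⟩⟩

theorem enorm_sq_toLp {V : Type*} [NormedAddCommGroup V] {g : X → V} (hg : MemLp g 2 μ) :
    ‖hg.toLp g‖ₑ ^ 2 = ∫⁻ x, ‖g x‖ₑ ^ 2 ∂μ := by
  rw [← lintegral_enorm_sq_coeFn]
  exact lintegral_congr_ae (by filter_upwards [hg.coeFn_toLp] with x hx; rw [hx])

theorem sq_lintegral_mul_le {f g : X → ENNReal} (hf : AEMeasurable f μ) (hg : AEMeasurable g μ) :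
    (∫⁻ x, f x * g x ∂μ) ^ 2 ≤ (∫⁻ x, f x ^ 2 ∂μ) * ∫⁻ x, g x ^ 2 ∂μ := by
  have h := ENNReal.lintegral_mul_le_Lp_mul_Lq μ Real.HolderConjugate.two_two hf hg
  calc (∫⁻ x, f x * g x ∂μ) ^ 2 ≤ ((∫⁻ x, f x ^ (2 : ℝ) ∂μ) ^ (1 / 2 : ℝ) *
        (∫⁻ x, g x ^ (2 : ℝ) ∂μ) ^ (1 / 2 : ℝ)) ^ 2 := by gcongr; exact h
    _ = _ := by
      rw [mul_pow, ← ENNReal.rpow_natCast, ← ENNReal.rpow_natCast, ← ENNReal.rpow_mul,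
        ← ENNReal.rpow_mul]
      norm_num

theorem enorm_integral_mul_sq_le {f g : X → ℂ} (hf : AEStronglyMeasurable f μ)
    (hg : AEStronglyMeasurable g μ) :
    ‖∫ x, f x * g x ∂μ‖ₑ ^ 2 ≤ (∫⁻ x, ‖f x‖ₑ ^ 2 ∂μ) * ∫⁻ x, ‖g x‖ₑ ^ 2 ∂μ := by
  refine le_trans ?_ (sq_lintegral_mul_le hf.enorm hg.enorm)
  gcongr
  refine (enorm_integral_le_lintegral_enorm _).trans (le_of_eq ?_)
  simp_rw [enorm_mul]

/-- Turns a row of a kernel into a vector of `L²`, so that linearity, Bessel's inequality and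
resolutions of the identity apply to the integral operator at almost every point. -/
theorem exists_inner_eq_integral_mul {k : X → ℂ} (hk : MemLp k 2 μ) :
    ∃ κ : Lp ℂ 2 μ, (∀ v : Lp ℂ 2 μ, inner ℂ κ v = ∫ y, k y * v y ∂μ) ∧
      ‖κ‖ₑ ^ 2 = ∫⁻ y, ‖k y‖ₑ ^ 2 ∂μ := by
  have hk' : MemLp (fun y => (starRingEnd ℂ) (k y)) 2 μ := hk.star
  refine ⟨hk'.toLp _, fun v => ?_, ?_⟩
  · rw [L2.inner_def]
    refine integral_congr_ae ?_
    filter_upwards [hk'.coeFn_toLp] with y hy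
    rw [hy, RCLike.inner_apply]
    simp [mul_comm]
  · rw [enorm_sq_toLp]
    simp

variable [SFinite μ] {K : X → X → ℂ}

/-- Cauchy-Schwarz in each row bounds the operator norm by the `L²` norm of the kernel. -/
theorem exists_kernelOperator (hK : StronglyMeasurable (Function.uncurry K))
    (hK2 : ∫⁻ x, ∫⁻ y, ‖K x y‖ₑ ^ 2 ∂μ ∂μ ≠ ⊤) :
    ∃ T : Lp ℂ 2 μ →L[ℂ] Lp ℂ 2 μ, ∀ v, T v =ᵐ[μ] fun x => ∫ y, K x y * v y ∂μ := by
  set B := ∫⁻ x, ∫⁻ y, ‖K x y‖ₑ ^ 2 ∂μ ∂μ with hB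
  have hKx : ∀ x, StronglyMeasurable (K x) := fun x => hK.comp_measurable measurable_prodMk_left
  have hvm : ∀ v : Lp ℂ 2 μ, StronglyMeasurable fun x => ∫ y, K x y * v y ∂μ := fun v =>
    StronglyMeasurable.integral_prod_right'
      (f := fun p : X × X => K p.1 p.2 * v p.2)
      (hK.mul ((Lp.stronglyMeasurable v).comp_measurable measurable_snd))
  have hbd : ∀ v : Lp ℂ 2 μ, ∫⁻ x, ‖∫ y, K x y * v y ∂μ‖ₑ ^ 2 ∂μ ≤ B * ‖v‖ₑ ^ 2 := fun v => by
    calc ∫⁻ x, ‖∫ y, K x y * v y ∂μ‖ₑ ^ 2 ∂μ ≤ ∫⁻ x, (∫⁻ y, ‖K x y‖ₑ ^ 2 ∂μ) * ‖v‖ₑ ^ 2 ∂μ := by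
          refine lintegral_mono fun x => ?_
          rw [← lintegral_enorm_sq_coeFn]
          exact enorm_integral_mul_sq_le (hKx x).aestronglyMeasurable (Lp.aestronglyMeasurable v)
      _ = _ := lintegral_mul_const' _ _ (by simp)
  have hmem : ∀ v : Lp ℂ 2 μ, MemLp (fun x => ∫ y, K x y * v y ∂μ) 2 μ := fun v =>
    (memLp_two_iff_lintegral (hvm v).aestronglyMeasurable).2
      ((hbd v).trans_lt (ENNReal.mul_lt_top hK2.lt_top (by simp)))
  -- Only almost every row is square integrable. On the exceptional rows the integral takes junk
  -- values, so linearity is checked almost everywhere.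
  have hrow : ∀ᵐ x ∂μ, MemLp (K x) 2 μ := by
    have hm : Measurable fun x => ∫⁻ y, ‖K x y‖ₑ ^ 2 ∂μ :=
      Measurable.lintegral_prod_right' (f := fun p : X × X => ‖K p.1 p.2‖ₑ ^ 2)
        (hK.enorm.pow_const 2)
    filter_upwards [ae_lt_top hm hK2] with x hx
    exact (memLp_two_iff_lintegral (hKx x).aestronglyMeasurable).2 hx
  let T₀ : Lp ℂ 2 μ →ₗ[ℂ] Lp ℂ 2 μ :=
    { toFun := fun v => (hmem v).toLp _
      map_add' := fun v w => by
        ext1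
        filter_upwards [(hmem (v + w)).coeFn_toLp, Lp.coeFn_add ((hmem v).toLp _) ((hmem w).toLp _),
          (hmem v).coeFn_toLp, (hmem w).coeFn_toLp, hrow] with x h1 h2 h3 h4 h5
        rw [h1, h2, Pi.add_apply, h3, h4]
        obtain ⟨κ, hκ, -⟩ := exists_inner_eq_integral_mul h5
        rw [← hκ, ← hκ, ← hκ, inner_add_right]
      map_smul' := fun c v => by
        ext1
        filter_upwards [(hmem (c • v)).coeFn_toLp, Lp.coeFn_smul c ((hmem v).toLp _),
          (hmem v).coeFn_toLp, hrow] with x h1 h2 h3 h5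
        rw [RingHom.id_apply, h1, h2, Pi.smul_apply, h3]
        obtain ⟨κ, hκ, -⟩ := exists_inner_eq_integral_mul h5
        rw [← hκ, ← hκ, inner_smul_right, smul_eq_mul] }
  refine ⟨T₀.mkContinuous (√B.toReal) fun v => ?_, fun v => (hmem v).coeFn_toLp⟩
  refine le_of_sq_le_sq ?_ (by positivity)
  rw [mul_pow, Real.sq_sqrt ENNReal.toReal_nonneg]
  have h1 : ‖T₀ v‖ₑ ^ 2 ≤ B * ‖v‖ₑ ^ 2 := (enorm_sq_toLp (hmem v)).trans_le (hbd v)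
  have h2 := ENNReal.toReal_mono (ENNReal.mul_ne_top hK2 (by simp)) h1
  simpa using h2

theorem integrable_kernel_mul (hK : StronglyMeasurable (Function.uncurry K))
    (hK2 : ∫⁻ x, ∫⁻ y, ‖K x y‖ₑ ^ 2 ∂μ ∂μ ≠ ⊤) {u v : X → ℂ} (hu : MemLp u 2 μ)
    (hv : MemLp v 2 μ) :
    Integrable (Function.uncurry fun x y => (starRingEnd ℂ) (u x) * (K x y * v y))
      (μ.prod μ) := by
  have hm1 : AEStronglyMeasurable (Function.uncurry fun x y => (starRingEnd ℂ) (u x) * v y)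
      (μ.prod μ) :=
    (Complex.continuous_conj.comp_aestronglyMeasurable
      (hu.1.comp_fst)).mul (hv.1.comp_snd)
  have h1 : MemLp (Function.uncurry fun x y => (starRingEnd ℂ) (u x) * v y) 2 (μ.prod μ) := by
    rw [memLp_two_iff_lintegral hm1, lintegral_prod _ (hm1.enorm.pow_const 2)]
    have hu2 := (memLp_two_iff_lintegral hu.1).1 hu
    have hv2 := (memLp_two_iff_lintegral hv.1).1 hv
    simp only [Function.uncurry, enorm_mul, mul_pow, RCLike.enorm_conj]
    calc ∫⁻ x, ∫⁻ y, ‖u x‖ₑ ^ 2 * ‖v y‖ₑ ^ 2 ∂μ ∂μ =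
          (∫⁻ x, ‖u x‖ₑ ^ 2 ∂μ) * ∫⁻ y, ‖v y‖ₑ ^ 2 ∂μ := by
          rw [← lintegral_mul_const' _ _ hv2.ne]
          congr with x
          rw [lintegral_const_mul' _ _ (by simp)]
      _ < ⊤ := ENNReal.mul_lt_top hu2 hv2
  have h2 : MemLp (Function.uncurry K) 2 (μ.prod μ) := by
    rw [memLp_two_iff_lintegral hK.aestronglyMeasurable, lintegral_prod _
      (hK.enorm.pow_const 2).aemeasurable]
    exact hK2.lt_top
  refine (MemLp.integrable_mul h1 h2).congr (Eventually.of_forall fun p => ?_)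
  simp only [Pi.mul_apply, Function.uncurry]
  ring

theorem isSelfAdjoint_of_kernel (hK : StronglyMeasurable (Function.uncurry K))
    (hK2 : ∫⁻ x, ∫⁻ y, ‖K x y‖ₑ ^ 2 ∂μ ∂μ ≠ ⊤) (hsym : ∀ x y, K y x = (starRingEnd ℂ) (K x y))
    {T : Lp ℂ 2 μ →L[ℂ] Lp ℂ 2 μ} (hT : ∀ v, T v =ᵐ[μ] fun x => ∫ y, K x y * v y ∂μ) :
    IsSelfAdjoint T := by
  rw [ContinuousLinearMap.isSelfAdjoint_iff_isSymmetric]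
  intro u v
  simp only [ContinuousLinearMap.coe_coe]
  have hmul := integrable_kernel_mul hK hK2 (Lp.memLp u) (Lp.memLp v)
  have e1 : inner ℂ u (T v) = ∫ x, ∫ y, (starRingEnd ℂ) (u x) * (K x y * v y) ∂μ ∂μ := by
    rw [L2.inner_def]
    refine integral_congr_ae ?_
    filter_upwards [hT v] with x hx
    rw [hx, RCLike.inner_apply, integral_const_mul, mul_comm]
  have e2 : inner ℂ (T u) v = ∫ y, ∫ x, (starRingEnd ℂ) (u x) * (K x y * v y) ∂μ ∂μ := by
    rw [L2.inner_def]
    refine integral_congr_ae ?_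
    filter_upwards [hT u] with y hy
    rw [hy, RCLike.inner_apply, ← integral_conj, ← integral_const_mul]
    refine integral_congr_ae (Eventually.of_forall fun x => ?_)
    simp only [map_mul]
    rw [hsym x y, Complex.conj_conj]
    ring
  rw [e1, e2, integral_integral_swap hmul]

/-- Bessel's inequality for each row, integrated over the rows. This is the Hilbert-Schmidt property
from which compactness follows. -/
theorem summable_norm_sq_of_kernel (hK : StronglyMeasurable (Function.uncurry K))
    (hK2 : ∫⁻ x, ∫⁻ y, ‖K x y‖ₑ ^ 2 ∂μ ∂μ ≠ ⊤)
    {T : Lp ℂ 2 μ →L[ℂ] Lp ℂ 2 μ} (hT : ∀ v, T v =ᵐ[μ] fun x => ∫ y, K x y * v y ∂μ)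
    {ι : Type*} {b : ι → Lp ℂ 2 μ} (hb : Orthonormal ℂ b) :
    Summable fun i => ‖T (b i)‖ ^ 2 := by
  set B := ∫⁻ x, ∫⁻ y, ‖K x y‖ₑ ^ 2 ∂μ ∂μ with hB
  have hKx : ∀ x, StronglyMeasurable (K x) := fun x => hK.comp_measurable measurable_prodMk_left
  have hrow : ∀ᵐ x ∂μ, MemLp (K x) 2 μ := by
    have hm : Measurable fun x => ∫⁻ y, ‖K x y‖ₑ ^ 2 ∂μ :=
      Measurable.lintegral_prod_right' (f := fun p : X × X => ‖K p.1 p.2‖ₑ ^ 2)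
        (hK.enorm.pow_const 2)
    filter_upwards [ae_lt_top hm hK2] with x hx
    exact (memLp_two_iff_lintegral (hKx x).aestronglyMeasurable).2 hx
  refine summable_of_sum_le (c := B.toReal) (fun i => by positivity) fun F => ?_
  have hkey : ∑ i ∈ F, ‖T (b i)‖ₑ ^ 2 ≤ B := by
    have hm : ∀ i, AEMeasurable (fun x => ‖T (b i) x‖ₑ ^ 2) μ := fun i =>
      (Lp.aestronglyMeasurable _).enorm.pow_const 2
    calc ∑ i ∈ F, ‖T (b i)‖ₑ ^ 2 = ∫⁻ x, ∑ i ∈ F, ‖T (b i) x‖ₑ ^ 2 ∂μ := by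
          rw [lintegral_finsetSum' _ fun i _ => hm i]
          simp_rw [lintegral_enorm_sq_coeFn]
      _ ≤ B := by
          refine lintegral_mono_ae ?_
          have hall : ∀ᵐ x ∂μ, ∀ i ∈ F, T (b i) x = ∫ y, K x y * b i y ∂μ :=
            (Finset.eventually_all F).2 fun i _ => hT (b i)
          filter_upwards [hrow, hall] with x h1 h2
          obtain ⟨κ, hκ, hκn⟩ := exists_inner_eq_integral_mul h1
          rw [← hκn]
          have h3 := hb.sum_inner_products_le (s := F) κ
          rw [← ofReal_norm, ← ENNReal.ofReal_pow (norm_nonneg _)]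
          refine le_trans (le_of_eq ?_) (ENNReal.ofReal_le_ofReal h3)
          rw [ENNReal.ofReal_sum_of_nonneg fun i _ => by positivity]
          refine Finset.sum_congr rfl fun i hi => ?_
          rw [h2 i hi, ← hκ, ENNReal.ofReal_pow (norm_nonneg _), norm_inner_symm, ofReal_norm]
  have := ENNReal.toReal_mono hK2 hkey
  rw [ENNReal.toReal_sum (fun i _ => by simp)] at this
  simpa using this

end KernelOperator

/-! ### The Weyl kernel and its exact Hilbert-Schmidt norm. -/

section WeylKernel

open FourierTransform

variable {E : Type*} [NormedAddCommGroup E] [InnerProductSpace ℝ E] [FiniteDimensional ℝ E]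
  [MeasurableSpace E] [BorelSpace E]

theorem weylKernel_eq_fourier {ħ : ℝ} (f : E × E → ℝ) (x y : E) :
    weylKernel ħ f x y = ((((2 * Real.pi * ħ) ^ Module.finrank ℝ E)⁻¹ : ℝ) : ℂ) *
      𝓕 (fun ξ => (f ((1 / 2 : ℝ) • (x + y), ξ) : ℂ)) ((2 * Real.pi * ħ)⁻¹ • (y - x)) := by
  rw [weylKernel, Real.fourier_eq']
  congr 1
  refine integral_congr_ae (Eventually.of_forall fun ξ => ?_)
  simp only [smul_eq_mul]
  congr 2
  rw [inner_smul_right, inner_sub_right, inner_sub_right]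
  push_cast
  by_cases h : (ħ : ℂ) = 0
  · simp [h]
  · field_simp
    ring

theorem stronglyMeasurable_weylKernel (ħ : ℝ) {f : E × E → ℝ} (hf : Continuous f) :
    StronglyMeasurable (Function.uncurry (weylKernel ħ f)) := by
  have h : StronglyMeasurable fun p : (E × E) × E =>
      Complex.exp (Complex.I * ((inner ℝ p.2 (p.1.1 - p.1.2) / ħ : ℝ) : ℂ)) *
      (f ((1 / 2 : ℝ) • (p.1.1 + p.1.2), p.2) : ℂ) := by
    apply Continuous.stronglyMeasurable
    fun_prop
  exact (h.integral_prod_right' (ν := (volume : Measure E))).const_mul _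

theorem weylKernel_symm (ħ : ℝ) (f : E × E → ℝ) (x y : E) :
    weylKernel ħ f y x = (starRingEnd ℂ) (weylKernel ħ f x y) := by
  rw [weylKernel, weylKernel, map_mul, Complex.conj_ofReal, ← integral_conj]
  congr 1
  refine integral_congr_ae (Eventually.of_forall fun ξ => ?_)
  simp only [map_mul, ← Complex.exp_conj, Complex.conj_I, Complex.conj_ofReal]
  rw [add_comm y x, ← neg_sub x y, inner_neg_right, neg_div]
  push_cast
  congr 2
  ring

/-- Centre and difference coordinates have Jacobian one: the substitution is a reflected translation
in `y` followed by a translation in `x`. -/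
theorem lintegral_prod_eq_center (g : E × E → ENNReal) (hg : Measurable g) :
    ∫⁻ x, ∫⁻ y, g (x, y) = ∫⁻ X, ∫⁻ u, g (X + (1 / 2 : ℝ) • u, X - (1 / 2 : ℝ) • u) := by
  calc ∫⁻ x, ∫⁻ y, g (x, y) = ∫⁻ x, ∫⁻ u, g (x, x - u) := by
        congr with x
        exact (lintegral_sub_left_eq_self (fun y => g (x, y)) x).symm
    _ = ∫⁻ u, ∫⁻ x, g (x, x - u) := lintegral_lintegral_swap (by
        apply Measurable.aemeasurable
        exact hg.comp (measurable_fst.prodMk (measurable_fst.sub measurable_snd)))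
    _ = ∫⁻ u, ∫⁻ X, g (X + (1 / 2 : ℝ) • u, X - (1 / 2 : ℝ) • u) := by
        congr with u
        rw [← lintegral_add_right_eq_self _ ((1 / 2 : ℝ) • u)]
        congr with X
        congr 2
        rw [add_sub_assoc, sub_eq_add_neg X, add_right_inj]
        nth_rw 2 [← one_smul ℝ u]
        rw [← sub_smul, ← neg_smul]
        norm_num
    _ = _ := lintegral_lintegral_swap (by
        apply Measurable.aemeasurable
        apply hg.comp
        apply Continuous.measurable
        fun_prop)

theorem half_smul_center (X u : E) :
    (1 / 2 : ℝ) • ((X + (1 / 2 : ℝ) • u) + (X - (1 / 2 : ℝ) • u)) = X := by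
  module

theorem center_sub (X u : E) : (X + (1 / 2 : ℝ) • u) - (X - (1 / 2 : ℝ) • u) = u := by
  module

theorem HasCompactSupport.slice {F : Type*} [TopologicalSpace F] {α β : Type*} [TopologicalSpace α]
    [TopologicalSpace β] [Zero F] [T1Space α] {f : α × β → F} (hf : HasCompactSupport f) (X : α) :
    HasCompactSupport fun ξ => f (X, ξ) := by
  refine hf.comp_isClosedEmbedding (g := fun ξ => (X, ξ)) ⟨isEmbedding_prodMkRight X, ?_⟩
  have : Set.range (fun ξ : β => (X, ξ)) = Prod.fst ⁻¹' {X} := by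
    ext ⟨a, b⟩; simp [eq_comm]
  rw [this]
  exact isClosed_singleton.preimage continuous_fst

/-- For each centre `X` the kernel is a Fourier transform of `f(X, ·)` in the difference variable,
and Plancherel applies. That this is an equality, not an estimate, is what makes the main terms of
the Gaussian defect cancel. -/
theorem lintegral_enorm_sq_weylKernel {ħ : ℝ} (hħ : 0 < ħ) {f : E × E → ℝ} (hf : Continuous f)
    (hfc : HasCompactSupport f) :
    ∫⁻ x, ∫⁻ y, ‖weylKernel ħ f x y‖ₑ ^ 2 =
      ENNReal.ofReal ((2 * Real.pi * ħ) ^ Module.finrank ℝ E)⁻¹ * ∫⁻ z, ‖f z‖ₑ ^ 2 := by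
  have hh : 0 < 2 * Real.pi * ħ := by positivity
  set h := 2 * Real.pi * ħ with hdef
  set n := Module.finrank ℝ E with hn
  rw [lintegral_prod_eq_center (fun p => ‖weylKernel ħ f p.1 p.2‖ₑ ^ 2)
    ((stronglyMeasurable_weylKernel ħ hf).enorm.pow_const 2)]
  have hslice : ∀ X, ∫⁻ u, ‖weylKernel ħ f (X + (1 / 2 : ℝ) • u) (X - (1 / 2 : ℝ) • u)‖ₑ ^ 2 =
      ENNReal.ofReal (h ^ n)⁻¹ * ∫⁻ ξ, ‖f (X, ξ)‖ₑ ^ 2 := by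
    intro X
    have hc : Continuous fun ξ => (f (X, ξ) : ℂ) := by fun_prop
    have hcs : HasCompactSupport fun ξ => (f (X, ξ) : ℂ) :=
      (hfc.slice X).comp_left (g := fun t : ℝ => (t : ℂ)) (by simp)
    have hpl := lintegral_enorm_sq_fourier (hc.integrable_of_hasCompactSupport hcs)
      (hc.memLp_of_hasCompactSupport hcs)
    simp_rw [weylKernel_eq_fourier, half_smul_center, ← neg_sub (X + _), center_sub, enorm_mul,
      mul_pow]
    rw [lintegral_const_mul' _ _ (ENNReal.pow_ne_top enorm_ne_top)]
    rw [lintegral_neg_eq_self (fun u : E => ‖𝓕 (fun ξ => (f (X, ξ) : ℂ)) (h⁻¹ • u)‖ₑ ^ 2),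
      lintegral_comp_smul_of_pos (fun w : E => ‖𝓕 (fun ξ => (f (X, ξ) : ℂ)) w‖ₑ ^ 2) (inv_pos.2 hh),
      hpl, ← mul_assoc]
    congr 1
    · rw [← ofReal_norm, Complex.norm_real, Real.norm_of_nonneg (by positivity),
        ← ENNReal.ofReal_pow (by positivity), ← ENNReal.ofReal_mul (by positivity)]
      congr 1
      rw [← hn, ← mul_pow, ← mul_pow, ← hdef, inv_pow h, inv_inv, sq, mul_assoc,
        inv_mul_cancel₀ (by positivity), mul_one]
    · congr with ξ
      rw [← ofReal_norm, Complex.norm_real, ofReal_norm]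
  simp_rw [hslice]
  rw [lintegral_const_mul' _ _ (by simp), Measure.volume_eq_prod,
    lintegral_prod _ (hf.measurable.enorm.pow_const 2).aemeasurable]

theorem lintegral_enorm_sq_weylKernel_ne_top {ħ : ℝ} (hħ : 0 < ħ) {f : E × E → ℝ}
    (hf : Continuous f) (hfc : HasCompactSupport f) :
    ∫⁻ x, ∫⁻ y, ‖weylKernel ħ f x y‖ₑ ^ 2 ≠ ⊤ := by
  rw [lintegral_enorm_sq_weylKernel hħ hf hfc]
  refine ENNReal.mul_ne_top (by simp) (ne_of_lt ?_)
  exact (memLp_two_iff_lintegral hf.aestronglyMeasurable).1 (hf.memLp_of_hasCompactSupport hfc)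

end WeylKernel

/-! ### Gaussian coherent states on phase space. -/

section GaussianStates

open FourierTransform

variable {E : Type*} [NormedAddCommGroup E] [InnerProductSpace ℝ E] [FiniteDimensional ℝ E]
  [MeasurableSpace E] [BorelSpace E]

/-- `∫ e^{-|y|²/ħ} dy = (πħ)^{d/2}`. -/
noncomputable def gaussMass (E : Type*) [NormedAddCommGroup E] [InnerProductSpace ℝ E] (ħ : ℝ) : ℝ :=
  (Real.pi * ħ) ^ ((Module.finrank ℝ E : ℝ) / 2)

theorem gaussMass_pos {ħ : ℝ} (hħ : 0 < ħ) : 0 < gaussMass E ħ := by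
  unfold gaussMass; positivity

theorem integral_gauss {ħ : ℝ} (hħ : 0 < ħ) : ∫ y : E, Real.exp (-‖y‖ ^ 2 / ħ) = gaussMass E ħ := by
  have := GaussianFourier.integral_rexp_neg_mul_sq_norm (V := E) (inv_pos.2 hħ)
  rw [gaussMass]
  convert this using 2
  · ext y; congr 1; field_simp
  · field_simp

theorem integrable_gauss {ħ : ℝ} (hħ : 0 < ħ) : Integrable fun y : E => Real.exp (-‖y‖ ^ 2 / ħ) := by
  -- A non-integrable function would have Bochner integral zero, whereas the value computed above is
  -- positive.
  by_contra h
  have := integral_undef h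
  rw [integral_gauss hħ] at this
  exact (gaussMass_pos hħ).ne' this

/-- The Gaussian coherent state at `(q, p)`, normalised in `L²`. -/
noncomputable def gaussState (ħ : ℝ) (z : E × E) (y : E) : ℂ :=
  (((√(gaussMass E ħ))⁻¹ * Real.exp (-‖y - z.1‖ ^ 2 / (2 * ħ)) : ℝ) : ℂ) *
    Complex.exp (Complex.I * ((inner ℝ z.2 y / ħ : ℝ) : ℂ))

theorem norm_gaussState {ħ : ℝ} (z : E × E) (y : E) :
    ‖gaussState ħ z y‖ = (√(gaussMass E ħ))⁻¹ * Real.exp (-‖y - z.1‖ ^ 2 / (2 * ħ)) := by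
  rw [gaussState, norm_mul, mul_comm Complex.I, Complex.norm_exp_ofReal_mul_I, mul_one,
    Complex.norm_real, Real.norm_of_nonneg (by positivity)]

theorem continuous_gaussState (ħ : ℝ) :
    Continuous fun p : (E × E) × E => gaussState ħ p.1 p.2 := by
  unfold gaussState; fun_prop

theorem norm_sq_gaussState {ħ : ℝ} (hħ : 0 < ħ) (z : E × E) (y : E) :
    ‖gaussState ħ z y‖ ^ 2 = (gaussMass E ħ)⁻¹ * Real.exp (-‖y - z.1‖ ^ 2 / ħ) := by
  rw [norm_gaussState, mul_pow, inv_pow, Real.sq_sqrt (gaussMass_pos hħ).le, ← Real.exp_nat_mul]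
  congr 2
  push_cast; field_simp

theorem lintegral_gauss_center {ħ : ℝ} (hħ : 0 < ħ) (y : E) :
    ∫⁻ q, ENNReal.ofReal ((gaussMass E ħ)⁻¹ * Real.exp (-‖y - q‖ ^ 2 / ħ)) = 1 := by
  rw [lintegral_sub_left_eq_self
    (fun u : E => ENNReal.ofReal ((gaussMass E ħ)⁻¹ * Real.exp (-‖u‖ ^ 2 / ħ))) y,
    ← ofReal_integral_eq_lintegral_ofReal ((integrable_gauss hħ).const_mul _)
    (Eventually.of_forall fun u => by have := gaussMass_pos (E := E) hħ; positivity),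
    integral_const_mul, integral_gauss hħ, inv_mul_cancel₀ (gaussMass_pos hħ).ne', ENNReal.ofReal_one]

theorem enorm_sq_gaussState {ħ : ℝ} (hħ : 0 < ħ) (z : E × E) (y : E) :
    ‖gaussState ħ z y‖ₑ ^ 2 =
      ENNReal.ofReal ((gaussMass E ħ)⁻¹ * Real.exp (-‖y - z.1‖ ^ 2 / ħ)) := by
  rw [← norm_sq_gaussState hħ, ENNReal.ofReal_pow (norm_nonneg _), ofReal_norm]

theorem lintegral_enorm_sq_gaussState {ħ : ℝ} (hħ : 0 < ħ) (z : E × E) :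
    ∫⁻ y, ‖gaussState ħ z y‖ₑ ^ 2 = 1 := by
  simp_rw [enorm_sq_gaussState hħ, norm_sub_rev _ z.1]
  exact lintegral_gauss_center hħ z.1

theorem stronglyMeasurable_gaussState (ħ : ℝ) (z : E × E) : StronglyMeasurable (gaussState ħ z) :=
  ((continuous_gaussState ħ).comp (by fun_prop : Continuous fun y : E => (z, y))).stronglyMeasurable

theorem memLp_gaussState {ħ : ℝ} (hħ : 0 < ħ) (z : E × E) : MemLp (gaussState ħ z) 2 :=
  (memLp_two_iff_lintegral (stronglyMeasurable_gaussState ħ z).aestronglyMeasurable).2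
    (by rw [lintegral_enorm_sq_gaussState hħ]; simp)

open Classical in
/-- The Gaussian coherent state as a vector of `L²`. -/
noncomputable def gaussVec (ħ : ℝ) (z : E × E) : Lp ℂ 2 (volume : Measure E) :=
  if h : MemLp (gaussState ħ z) 2 then h.toLp _ else 0

theorem gaussVec_coeFn {ħ : ℝ} (hħ : 0 < ħ) (z : E × E) :
    gaussVec ħ z =ᵐ[volume] gaussState ħ z := by
  rw [gaussVec, dif_pos (memLp_gaussState hħ z)]
  exact (memLp_gaussState hħ z).coeFn_toLp

theorem norm_gaussVec {ħ : ℝ} (hħ : 0 < ħ) (z : E × E) : ‖gaussVec ħ z‖ = 1 := by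
  have h : ‖gaussVec ħ z‖ₑ ^ 2 = 1 := by
    rw [gaussVec, dif_pos (memLp_gaussState hħ z), enorm_sq_toLp, lintegral_enorm_sq_gaussState hħ]
  have h2 := congrArg ENNReal.toReal h
  simp only [ENNReal.toReal_pow, toReal_enorm, ENNReal.toReal_one] at h2
  exact (pow_eq_one_iff_of_nonneg (norm_nonneg _) two_ne_zero).1 h2

theorem inner_gaussVec {ħ : ℝ} (hħ : 0 < ħ) (z : E × E) (v : Lp ℂ 2 (volume : Measure E)) :
    inner ℂ v (gaussVec ħ z) = ∫ y, gaussState ħ z y * (starRingEnd ℂ) (v y) := by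
  rw [L2.inner_def]
  refine integral_congr_ae ?_
  filter_upwards [gaussVec_coeFn hħ z] with y hy
  rw [hy, RCLike.inner_apply]

theorem measurable_inner_gaussVec {ħ : ℝ} (hħ : 0 < ħ) (v : Lp ℂ 2 (volume : Measure E)) :
    Measurable fun z => inner ℂ v (gaussVec ħ z) := by
  simp_rw [inner_gaussVec hħ]
  refine StronglyMeasurable.measurable (StronglyMeasurable.integral_prod_right'
    (f := fun p : (E × E) × E => gaussState ħ p.1 p.2 * (starRingEnd ℂ) (v p.2)) ?_)
  exact (continuous_gaussState ħ).stronglyMeasurable.mul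
    (Complex.continuous_conj.comp_stronglyMeasurable
      ((Lp.stronglyMeasurable v).comp_measurable measurable_snd))

/-- The resolution of the identity. For fixed `q` the overlap with `v` is, in `p`, the Fourier
transform of a Gaussian centred at `q` times the conjugate of `v`. Plancherel integrates out `p`;
then the normalised Gaussian integrates to one in `q`. -/
theorem lintegral_enorm_sq_inner_gaussVec {ħ : ℝ} (hħ : 0 < ħ) (v : Lp ℂ 2 (volume : Measure E)) :
    ∫⁻ z, ‖inner ℂ v (gaussVec ħ z)‖ₑ ^ 2
      ∂(ENNReal.ofReal (1 / (2 * Real.pi * ħ) ^ Module.finrank ℝ E) • (volume : Measure (E × E))) =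
      ‖v‖ₑ ^ 2 := by
  have hh : 0 < 2 * Real.pi * ħ := by positivity
  set h := 2 * Real.pi * ħ with hdef
  set n := Module.finrank ℝ E with hn
  have hM := gaussMass_pos (E := E) hħ
  let g : E → E → ℂ := fun q y => gaussState ħ (q, (0 : E)) y * (starRingEnd ℂ) (v y)
  have hgm : ∀ q, AEStronglyMeasurable (g q) := fun q =>
    (stronglyMeasurable_gaussState ħ (q, (0 : E))).aestronglyMeasurable.mul
      (Complex.continuous_conj.comp_aestronglyMeasurable (Lp.aestronglyMeasurable v))
  have hvc : MemLp (fun y => (starRingEnd ℂ) (v y)) 2 := (Lp.memLp v).star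
  have hg1 : ∀ q, Integrable (g q) := fun q => MemLp.integrable_mul (memLp_gaussState hħ (q, (0 : E))) hvc
  have hle : ∀ q y, ‖gaussState ħ (q, (0 : E)) y‖ ≤ (√(gaussMass E ħ))⁻¹ := fun q y => by
    rw [norm_gaussState]
    refine mul_le_of_le_one_right (by positivity) (Real.exp_le_one_iff.2 ?_)
    rw [neg_div]
    exact neg_nonpos.2 (by positivity)
  have hg2 : ∀ q, MemLp (g q) 2 := fun q =>
    hvc.of_le_mul (c := (√(gaussMass E ħ))⁻¹) (hgm q) (Eventually.of_forall fun y => by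
      rw [norm_mul]
      exact mul_le_mul_of_nonneg_right (hle q y) (norm_nonneg _))
  have hF : ∀ q p, inner ℂ v (gaussVec ħ (q, p)) = 𝓕 (g q) (h⁻¹ • (-p)) := fun q p => by
    rw [inner_gaussVec hħ, Real.fourier_eq']
    refine integral_congr_ae (Eventually.of_forall fun y => ?_)
    simp only [g, gaussState, inner_zero_left, zero_div, Complex.ofReal_zero, mul_zero,
      Complex.exp_zero, mul_one, smul_eq_mul]
    have : Complex.I * ((inner ℝ p y / ħ : ℝ) : ℂ) =
        ((-2 * Real.pi * inner ℝ y (h⁻¹ • -p) : ℝ) : ℂ) * Complex.I := by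
      rw [inner_smul_right, inner_neg_right, real_inner_comm, mul_comm, hdef]
      congr 2
      field_simp
    rw [this]
    ring
  rw [lintegral_smul_measure, Measure.volume_eq_prod, lintegral_prod _
    ((measurable_inner_gaussVec hħ v).enorm.pow_const 2).aemeasurable]
  have hq : ∀ q, ∫⁻ p, ‖inner ℂ v (gaussVec ħ (q, p))‖ₑ ^ 2 =
      ENNReal.ofReal (h ^ n) * ∫⁻ y, ‖g q y‖ₑ ^ 2 := fun q => by
    simp_rw [hF]
    rw [lintegral_neg_eq_self (fun p : E => ‖𝓕 (g q) (h⁻¹ • p)‖ₑ ^ 2),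
      lintegral_comp_smul_of_pos (fun w : E => ‖𝓕 (g q) w‖ₑ ^ 2) (inv_pos.2 hh),
      lintegral_enorm_sq_fourier (hg1 q) (hg2 q), inv_pow, inv_inv]
  have hgm2 : Measurable fun p : E × E => ‖g p.1 p.2‖ₑ ^ 2 := by
    refine Measurable.pow_const (Measurable.enorm (Measurable.mul ?_ ?_)) 2
    · exact ((continuous_gaussState ħ).comp
        (by fun_prop : Continuous fun p : E × E => ((p.1, (0 : E)), p.2))).measurable
    · exact Complex.continuous_conj.measurable.comp
        ((Lp.stronglyMeasurable v).measurable.comp measurable_snd)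
  simp_rw [hq]
  rw [lintegral_const_mul' _ _ (by simp), lintegral_lintegral_swap hgm2.aemeasurable]
  have hy : ∀ y, ∫⁻ q, ‖g q y‖ₑ ^ 2 = ‖v y‖ₑ ^ 2 := fun y => by
    simp only [g, enorm_mul, mul_pow, RCLike.enorm_conj, enorm_sq_gaussState hħ]
    rw [lintegral_mul_const' _ _ (by simp), lintegral_gauss_center hħ, one_mul]
  simp_rw [hy]
  rw [lintegral_enorm_sq_coeFn, smul_eq_mul, ← mul_assoc, ← ENNReal.ofReal_mul (by positivity),
    one_div, inv_mul_cancel₀ (by positivity), ENNReal.ofReal_one, one_mul]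

end GaussianStates

/-! ### Expectations in Gaussian states and the defect estimate on `ℝ^d`. -/

section LowerSymbol

variable {E : Type*} [NormedAddCommGroup E] [InnerProductSpace ℝ E] [FiniteDimensional ℝ E]
  [MeasurableSpace E] [BorelSpace E]

theorem measurePreserving_center :
    MeasurePreserving (fun p : E × E => (p.1 + (1 / 2 : ℝ) • p.2, p.1 - (1 / 2 : ℝ) • p.2))
      volume volume := by
  have hm : Measurable (fun p : E × E => (p.1 + (1 / 2 : ℝ) • p.2, p.1 - (1 / 2 : ℝ) • p.2)) := by
    apply Continuous.measurable; fun_prop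
  refine ⟨hm, Measure.ext fun s hs => ?_⟩
  rw [Measure.map_apply hm hs, ← lintegral_indicator_one hs, ← lintegral_indicator_one (hm hs)]
  have hi : Measurable (s.indicator (1 : E × E → ENNReal)) := measurable_one.indicator hs
  have hi' := hi.comp hm
  rw [Measure.volume_eq_prod, lintegral_prod _ hi.aemeasurable, lintegral_prod_eq_center _ hi]
  exact lintegral_prod _ hi'.aemeasurable

theorem integral_prod_eq_center {F : E × E → ℂ} (hF : Integrable F) :
    ∫ x, ∫ y, F (x, y) = ∫ X, ∫ u, F (X + (1 / 2 : ℝ) • u, X - (1 / 2 : ℝ) • u) := by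
  have h1 := measurePreserving_center (E := E)
  have h2 := h1.integrable_comp_of_integrable hF
  rw [Measure.volume_eq_prod] at hF h2
  rw [← integral_prod _ hF]
  have h3 := integral_prod _ h2
  simp only [Function.comp_apply] at h3
  rw [← h3, ← Measure.volume_eq_prod, ← integral_map h1.aemeasurable
    (by rw [h1.map_eq]; exact hF.aestronglyMeasurable), h1.map_eq]

/-- The normalised Gaussian `(πħ)^{-d/2} e^{-|s|²/ħ}`. -/
noncomputable def gaussWeight (ħ : ℝ) (s : E) : ℝ := (gaussMass E ħ)⁻¹ * Real.exp (-‖s‖ ^ 2 / ħ)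

theorem gaussWeight_nonneg {ħ : ℝ} (hħ : 0 < ħ) (s : E) : 0 ≤ gaussWeight ħ s := by
  have := gaussMass_pos (E := E) hħ
  unfold gaussWeight; positivity

theorem integrable_gaussWeight {ħ : ℝ} (hħ : 0 < ħ) : Integrable (gaussWeight (E := E) ħ) :=
  (integrable_gauss hħ).const_mul _

theorem integral_gaussWeight {ħ : ℝ} (hħ : 0 < ħ) : ∫ s : E, gaussWeight ħ s = 1 := by
  unfold gaussWeight
  rw [integral_const_mul, integral_gauss hħ, inv_mul_cancel₀ (gaussMass_pos hħ).ne']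

theorem integrable_gaussWeight_center {ħ : ℝ} (hħ : 0 < ħ) (q : E) :
    Integrable fun x : E => gaussWeight ħ (x - q) :=
  (integrable_gaussWeight hħ).comp_sub_right q

theorem integral_gaussWeight_center {ħ : ℝ} (hħ : 0 < ħ) (q : E) :
    ∫ x : E, gaussWeight ħ (x - q) = 1 := by
  rw [integral_sub_right_eq_self, integral_gaussWeight hħ]

/-- The inequality `t ≤ exp (t² / 2)` with `t = ‖s‖ / √ħ` trades the factor `‖s‖` for a Gaussian of
twice the variance. The first moment is then `O(√ħ)` without being computed. -/
theorem norm_mul_gaussWeight_le {ħ : ℝ} (hħ : 0 < ħ) (s : E) :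
    ‖s‖ * gaussWeight ħ s ≤
      √ħ * 2 ^ ((Module.finrank ℝ E : ℝ) / 2) * gaussWeight (2 * ħ) s := by
  have hM := gaussMass_pos (E := E) hħ
  have hM2 : gaussMass E (2 * ħ) = 2 ^ ((Module.finrank ℝ E : ℝ) / 2) * gaussMass E ħ := by
    unfold gaussMass
    rw [← Real.mul_rpow (by norm_num) (by positivity)]
    congr 1; ring
  have hs : ‖s‖ ≤ √ħ * Real.exp (‖s‖ ^ 2 / (2 * ħ)) := by
    have h0 : ‖s‖ = √ħ * (‖s‖ / √ħ) := by field_simp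
    rw [h0]
    have h1 : ‖s‖ / √ħ ≤ Real.exp ((‖s‖ / √ħ) ^ 2 / 2) := by
      have := Real.add_one_le_exp ((‖s‖ / √ħ) ^ 2 / 2)
      nlinarith [sq_nonneg (‖s‖ / √ħ - 1)]
    rw [← h0]
    have h2 : (‖s‖ / √ħ) ^ 2 / 2 = ‖s‖ ^ 2 / (2 * ħ) := by
      rw [div_pow, Real.sq_sqrt hħ.le]; field_simp
    rw [h2] at h1
    calc ‖s‖ = √ħ * (‖s‖ / √ħ) := h0
      _ ≤ _ := by gcongr
  unfold gaussWeight
  rw [hM2, mul_inv]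
  have h3 : Real.exp (-‖s‖ ^ 2 / (2 * ħ)) = Real.exp (‖s‖ ^ 2 / (2 * ħ)) * Real.exp (-‖s‖ ^ 2 / ħ) := by
    rw [← Real.exp_add]; congr 1; field_simp; ring
  rw [h3]
  calc ‖s‖ * ((gaussMass E ħ)⁻¹ * Real.exp (-‖s‖ ^ 2 / ħ)) ≤
      (√ħ * Real.exp (‖s‖ ^ 2 / (2 * ħ))) * ((gaussMass E ħ)⁻¹ * Real.exp (-‖s‖ ^ 2 / ħ)) := by
        gcongr
    _ = _ := by field_simp

theorem integrable_norm_mul_gaussWeight {ħ : ℝ} (hħ : 0 < ħ) :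
    Integrable fun s : E => ‖s‖ * gaussWeight ħ s := by
  refine ((integrable_gaussWeight (E := E) (ħ := 2 * ħ) (by positivity)).const_mul
    (√ħ * 2 ^ ((Module.finrank ℝ E : ℝ) / 2))).mono' ?_ (Eventually.of_forall fun s => ?_)
  · apply Continuous.aestronglyMeasurable
    unfold gaussWeight; fun_prop
  · rw [Real.norm_of_nonneg (mul_nonneg (norm_nonneg _) (gaussWeight_nonneg hħ s))]
    exact norm_mul_gaussWeight_le hħ s

theorem integral_norm_mul_gaussWeight_le {ħ : ℝ} (hħ : 0 < ħ) :
    ∫ s : E, ‖s‖ * gaussWeight ħ s ≤ √ħ * 2 ^ ((Module.finrank ℝ E : ℝ) / 2) := by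
  have h2 : 0 < 2 * ħ := by positivity
  calc ∫ s : E, ‖s‖ * gaussWeight ħ s ≤
      ∫ s : E, √ħ * 2 ^ ((Module.finrank ℝ E : ℝ) / 2) * gaussWeight (2 * ħ) s :=
        integral_mono (integrable_norm_mul_gaussWeight hħ)
          ((integrable_gaussWeight h2).const_mul _) fun s => norm_mul_gaussWeight_le hħ s
    _ = _ := by rw [integral_const_mul, integral_gaussWeight h2, mul_one]

/-- The Gaussian average of a function on phase space. -/
noncomputable def gaussAverage (ħ : ℝ) (f : E × E → ℝ) (z : E × E) : ℝ :=
  ∫ X, (∫ ξ, f (X, ξ) * gaussWeight ħ (ξ - z.2)) * gaussWeight ħ (X - z.1)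

/-- The mean displacement under the Gaussian weight is at most `κ = O(√ħ)` in position and likewise
in momentum, whence the factor `2`. -/
theorem abs_gaussAverage_sub_le {ħ : ℝ} (hħ : 0 < ħ) {f : E × E → ℝ} (hf : Continuous f)
    (hfc : HasCompactSupport f) {Λ : ℝ} (hΛ0 : 0 ≤ Λ)
    (hΛ : ∀ w z : E × E, |f w - f z| ≤ Λ * (‖w.1 - z.1‖ + ‖w.2 - z.2‖)) (z : E × E) :
    |gaussAverage ħ f z - f z| ≤ Λ * (2 * (√ħ * 2 ^ ((Module.finrank ℝ E : ℝ) / 2))) := by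
  set κ := √ħ * 2 ^ ((Module.finrank ℝ E : ℝ) / 2) with hκ
  have hw : Continuous (gaussWeight (E := E) ħ) := by unfold gaussWeight; fun_prop
  obtain ⟨C, hC⟩ := hf.bounded_above_of_compact_support hfc
  have hI1 : ∀ X, Integrable fun ξ => f (X, ξ) * gaussWeight ħ (ξ - z.2) := fun X =>
    (integrable_gaussWeight_center hħ z.2).bdd_mul (c := C)
      (by apply Continuous.aestronglyMeasurable; fun_prop) (Eventually.of_forall fun ξ => hC _)
  have hgi := integrable_gaussWeight_center hħ z.1
  have hngi : Integrable fun X : E => ‖X - z.1‖ * gaussWeight ħ (X - z.1) :=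
    (integrable_norm_mul_gaussWeight hħ).comp_sub_right z.1
  have hngi2 : Integrable fun X : E => ‖X - z.2‖ * gaussWeight ħ (X - z.2) :=
    (integrable_norm_mul_gaussWeight hħ).comp_sub_right z.2
  have hngl : ∀ q : E, ∫ X : E, ‖X - q‖ * gaussWeight ħ (X - q) ≤ κ := fun q => by
    rw [integral_sub_right_eq_self (fun s : E => ‖s‖ * gaussWeight ħ s)]
    exact integral_norm_mul_gaussWeight_le hħ
  have hin : ∀ X, ‖(∫ ξ, f (X, ξ) * gaussWeight ħ (ξ - z.2)) - f z‖ ≤ Λ * (‖X - z.1‖ + κ) := by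
    intro X
    have e : (∫ ξ, f (X, ξ) * gaussWeight ħ (ξ - z.2)) - f z =
        ∫ ξ, (f (X, ξ) - f z) * gaussWeight ħ (ξ - z.2) := by
      simp_rw [sub_mul]
      rw [integral_sub (hI1 X) ((integrable_gaussWeight_center hħ z.2).const_mul _),
        integral_const_mul, integral_gaussWeight_center hħ, mul_one]
    rw [e]
    have hb : ∀ ξ, ‖(f (X, ξ) - f z) * gaussWeight ħ (ξ - z.2)‖ ≤
        Λ * (‖X - z.1‖ * gaussWeight ħ (ξ - z.2) + ‖ξ - z.2‖ * gaussWeight ħ (ξ - z.2)) := by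
      intro ξ
      rw [norm_mul, Real.norm_of_nonneg (gaussWeight_nonneg hħ _), ← add_mul, ← mul_assoc]
      exact mul_le_mul_of_nonneg_right (hΛ (X, ξ) z) (gaussWeight_nonneg hħ _)
    refine (norm_integral_le_of_norm_le (((((integrable_gaussWeight_center hħ z.2).const_mul _).add
      hngi2)).const_mul Λ) (Eventually.of_forall hb)).trans ?_
    simp only [Pi.add_apply]
    rw [integral_const_mul, integral_add ((integrable_gaussWeight_center hħ z.2).const_mul _) hngi2,
      integral_const_mul, integral_gaussWeight_center hħ, mul_one]
    gcongr
    exact hngl z.2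
  have hm : Continuous fun X => ∫ ξ, f (X, ξ) * gaussWeight ħ (ξ - z.2) := by
    refine continuous_of_dominated (bound := fun ξ => C * gaussWeight ħ (ξ - z.2))
      (fun X => (hI1 X).aestronglyMeasurable) (fun X => Eventually.of_forall fun ξ => ?_)
      ((integrable_gaussWeight_center hħ z.2).const_mul _) (Eventually.of_forall fun ξ => by fun_prop)
    rw [norm_mul, Real.norm_of_nonneg (gaussWeight_nonneg hħ _)]
    exact mul_le_mul_of_nonneg_right (hC _) (gaussWeight_nonneg hħ _)
  have hI2 : Integrable fun X =>
      ((∫ ξ, f (X, ξ) * gaussWeight ħ (ξ - z.2)) - f z) * gaussWeight ħ (X - z.1) := by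
    refine ((hngi.add (hgi.const_mul κ)).const_mul Λ).mono' ?_ (Eventually.of_forall fun X => ?_)
    · apply Continuous.aestronglyMeasurable; fun_prop
    · rw [norm_mul, Real.norm_of_nonneg (gaussWeight_nonneg hħ _), Pi.add_apply, ← add_mul,
        ← mul_assoc]
      exact mul_le_mul_of_nonneg_right (hin X) (gaussWeight_nonneg hħ _)
  have e : gaussAverage ħ f z - f z = ∫ X,
      ((∫ ξ, f (X, ξ) * gaussWeight ħ (ξ - z.2)) - f z) * gaussWeight ħ (X - z.1) := by
    have hI3 := hI2.add (hgi.const_mul (f z))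
    have h4 : gaussAverage ħ f z = ∫ X,
        (((∫ ξ, f (X, ξ) * gaussWeight ħ (ξ - z.2)) - f z) * gaussWeight ħ (X - z.1) +
          f z * gaussWeight ħ (X - z.1)) := by
      unfold gaussAverage; congr with X; ring
    rw [h4, integral_add hI2 (hgi.const_mul _), integral_const_mul, integral_gaussWeight_center hħ]
    ring
  rw [e, ← Real.norm_eq_abs]
  refine (norm_integral_le_of_norm_le ((hngi.add (hgi.const_mul κ)).const_mul Λ)
    (Eventually.of_forall fun X => ?_)).trans ?_
  · rw [norm_mul, Real.norm_of_nonneg (gaussWeight_nonneg hħ _), Pi.add_apply, ← add_mul,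
        ← mul_assoc]
    exact mul_le_mul_of_nonneg_right (hin X) (gaussWeight_nonneg hħ _)
  · simp only [Pi.add_apply]
    rw [integral_const_mul, integral_add hngi (hgi.const_mul _), integral_const_mul,
      integral_gaussWeight_center hħ, mul_one, two_mul]
    gcongr
    exact hngl z.1

theorem integral_gauss_fourier {ħ : ℝ} (hħ : 0 < ħ) (η : E) :
    ∫ u : E, Complex.exp (Complex.I * ((inner ℝ η u / ħ : ℝ) : ℂ)) *
      ((Real.exp (-‖u‖ ^ 2 / (4 * ħ)) : ℝ) : ℂ) =
      (((4 * Real.pi * ħ) ^ ((Module.finrank ℝ E : ℝ) / 2) * Real.exp (-‖η‖ ^ 2 / ħ) : ℝ) : ℂ) := by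
  have h := GaussianFourier.integral_cexp_neg_mul_sq_norm_add (V := E)
    (b := (((4 * ħ)⁻¹ : ℝ) : ℂ)) (by rw [Complex.ofReal_re]; positivity) (Complex.I / ħ) η
  have hħ' : (ħ : ℂ) ≠ 0 := by exact_mod_cast hħ.ne'
  convert h using 1
  · refine integral_congr_ae (Eventually.of_forall fun u => ?_)
    simp only
    rw [Complex.ofReal_exp, ← Complex.exp_add]
    congr 1
    push_cast
    field_simp
    ring
  · rw [Complex.ofReal_mul, Complex.ofReal_cpow (by positivity), Complex.ofReal_exp]
    congr 1
    · congr 1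
      · push_cast; field_simp
      · push_cast; rfl
    · congr 1
      rw [div_pow, Complex.I_sq]
      push_cast
      field_simp

/-- The parallelogram law: a product of two Gaussians at `X ± u/2` separates into a Gaussian in the
centre and one in the difference. -/
theorem gauss_exponent (X u q : E) (ħ : ℝ) :
    -‖X + (1 / 2 : ℝ) • u - q‖ ^ 2 / (2 * ħ) + -‖X - (1 / 2 : ℝ) • u - q‖ ^ 2 / (2 * ħ) =
      -‖X - q‖ ^ 2 / ħ + -‖u‖ ^ 2 / (4 * ħ) := by
  have h1 : X + (1 / 2 : ℝ) • u - q = (X - q) + (1 / 2 : ℝ) • u := by abel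
  have h2 : X - (1 / 2 : ℝ) • u - q = (X - q) - (1 / 2 : ℝ) • u := by abel
  rw [h1, h2]
  generalize X - q = s
  rw [norm_add_sq_real, norm_sub_sq_real, norm_smul, Real.norm_of_nonneg (by norm_num)]
  by_cases h : ħ = 0
  · simp [h]
  field_simp
  ring

theorem gaussState_mul_center {ħ : ℝ} (hħ : 0 < ħ) (z : E × E) (X u : E) :
    (starRingEnd ℂ) (gaussState ħ z (X + (1 / 2 : ℝ) • u)) * gaussState ħ z (X - (1 / 2 : ℝ) • u) =
      ((gaussWeight ħ (X - z.1) : ℝ) : ℂ) * (((Real.exp (-‖u‖ ^ 2 / (4 * ħ)) : ℝ) : ℂ) *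
        Complex.exp (Complex.I * ((inner ℝ (-z.2) u / ħ : ℝ) : ℂ))) := by
  have hM := gaussMass_pos (E := E) hħ
  simp only [gaussState, map_mul, Complex.conj_ofReal, ← Complex.exp_conj, Complex.conj_I]
  have e1 : ∀ a b c d : ℂ, a * Complex.exp c * (b * Complex.exp d) = a * b * Complex.exp (c + d) :=
    fun a b c d => by rw [Complex.exp_add]; ring
  rw [e1, ← mul_assoc, ← Complex.ofReal_mul, ← Complex.ofReal_mul]
  congr 2
  · have e2 : ∀ m a b : ℝ, m⁻¹ * Real.exp a * (m⁻¹ * Real.exp b) = (m * m)⁻¹ * Real.exp (a + b) :=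
      fun m a b => by rw [Real.exp_add, mul_inv]; ring
    rw [e2, Real.mul_self_sqrt hM.le, gauss_exponent, Real.exp_add, gaussWeight, mul_assoc]
  · rw [inner_add_right, inner_sub_right, inner_smul_right, inner_neg_left]
    push_cast
    ring

/-- The Wigner function of a Gaussian state is itself a Gaussian on phase space. In centre and
difference coordinates the integral over `u` is a Gaussian Fourier transform and yields the weight
in `ξ - p`. -/
theorem inner_gaussVec_apply {ħ : ℝ} (hħ : 0 < ħ) {f : E × E → ℝ} (hf : Continuous f)
    (hfc : HasCompactSupport f) {T : Lp ℂ 2 (volume : Measure E) →L[ℂ] Lp ℂ 2 (volume : Measure E)}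
    (hT : ∀ v, T v =ᵐ[volume] fun x => ∫ y, weylKernel ħ f x y * v y) (z : E × E) :
    inner ℂ (gaussVec ħ z) (T (gaussVec ħ z)) = (gaussAverage ħ f z : ℂ) := by
  have hK := stronglyMeasurable_weylKernel ħ hf
  have hK2 := lintegral_enorm_sq_weylKernel_ne_top hħ hf hfc
  have hψ := memLp_gaussState hħ z
  have hI : Integrable (fun p : E × E => (starRingEnd ℂ) (gaussState ħ z p.1) *
      (weylKernel ħ f p.1 p.2 * gaussState ħ z p.2)) :=
    integrable_kernel_mul hK hK2 hψ hψ
  have e1 : inner ℂ (gaussVec ħ z) (T (gaussVec ħ z)) = ∫ x, ∫ y,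
      (starRingEnd ℂ) (gaussState ħ z x) * (weylKernel ħ f x y * gaussState ħ z y) := by
    rw [L2.inner_def]
    refine integral_congr_ae ?_
    filter_upwards [hT (gaussVec ħ z), gaussVec_coeFn hħ z] with x hx hx2
    rw [hx, hx2, RCLike.inner_apply, integral_const_mul, mul_comm]
    congr 1
    refine integral_congr_ae ?_
    filter_upwards [gaussVec_coeFn hħ z] with y hy
    rw [hy]
  rw [e1, integral_prod_eq_center hI, gaussAverage, ← integral_complex_ofReal]
  congr with X
  set n := Module.finrank ℝ E with hn
  set h := 2 * Real.pi * ħ with hh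
  obtain ⟨C, hC⟩ := hf.bounded_above_of_compact_support hfc
  have hfX : Continuous fun ξ => f (X, ξ) := by fun_prop
  have hfXi : Integrable fun ξ => f (X, ξ) := hfX.integrable_of_hasCompactSupport (hfc.slice X)
  have hgi : Integrable fun u : E => Real.exp (-‖u‖ ^ 2 / (4 * ħ)) :=
    integrable_gauss (by positivity)
  have hswap : Integrable (Function.uncurry fun u ξ : E => (f (X, ξ) : ℂ) *
      (Complex.exp (Complex.I * ((inner ℝ (ξ - z.2) u / ħ : ℝ) : ℂ)) *
      ((Real.exp (-‖u‖ ^ 2 / (4 * ħ)) : ℝ) : ℂ))) (volume.prod volume) := by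
    refine (hgi.mul_prod hfXi).mono ?_ (Eventually.of_forall fun p => ?_)
    · apply Continuous.aestronglyMeasurable
      unfold Function.uncurry
      fun_prop
    · simp only [Function.uncurry, norm_mul, Complex.norm_real]
      rw [mul_comm Complex.I, Complex.norm_exp_ofReal_mul_I, one_mul, mul_comm]
  have e2 : ∀ u, (starRingEnd ℂ) (gaussState ħ z (X + (1 / 2 : ℝ) • u)) *
      (weylKernel ħ f (X + (1 / 2 : ℝ) • u) (X - (1 / 2 : ℝ) • u) *
        gaussState ħ z (X - (1 / 2 : ℝ) • u)) = (((h ^ n)⁻¹ * gaussWeight ħ (X - z.1) : ℝ) : ℂ) *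
      ∫ ξ, (f (X, ξ) : ℂ) * (Complex.exp (Complex.I * ((inner ℝ (ξ - z.2) u / ħ : ℝ) : ℂ)) *
      ((Real.exp (-‖u‖ ^ 2 / (4 * ħ)) : ℝ) : ℂ)) := by
    intro u
    rw [mul_left_comm, gaussState_mul_center hħ, weylKernel, half_smul_center, center_sub]
    have e3 : ∀ c g J e p : ℂ, c * J * (g * (e * p)) = c * g * (J * (e * p)) :=
      fun c g J e p => by ring
    rw [e3, ← integral_mul_const, Complex.ofReal_mul]
    congr 1
    refine integral_congr_ae (Eventually.of_forall fun ξ => ?_)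
    have e4 : Complex.exp (Complex.I * ((inner ℝ (ξ - z.2) u / ħ : ℝ) : ℂ)) =
        Complex.exp (Complex.I * ((inner ℝ ξ u / ħ : ℝ) : ℂ)) *
          Complex.exp (Complex.I * ((inner ℝ (-z.2) u / ħ : ℝ) : ℂ)) := by
      rw [← Complex.exp_add, sub_eq_add_neg, inner_add_left]
      congr 1
      push_cast
      ring
    simp only
    rw [e4]
    ring
  simp_rw [e2]
  rw [integral_const_mul, integral_integral_swap hswap]
  have hM := gaussMass_pos (E := E) hħ
  -- The constants match because `4πħ · πħ = (2πħ)²`.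
  have hconst : (h ^ n)⁻¹ * (4 * Real.pi * ħ) ^ ((n : ℝ) / 2) = (gaussMass E ħ)⁻¹ := by
    have : (4 * Real.pi * ħ) ^ ((n : ℝ) / 2) * gaussMass E ħ = h ^ n := by
      rw [gaussMass, ← hn, ← Real.mul_rpow (by positivity) (by positivity),
        show 4 * Real.pi * ħ * (Real.pi * ħ) = h ^ 2 by rw [hh]; ring, ← Real.rpow_natCast h 2,
        ← Real.rpow_mul (by positivity), ← Real.rpow_natCast h n]
      congr 1
      push_cast
      ring
    rw [← this]
    have h4 : (0 : ℝ) < (4 * Real.pi * ħ) ^ ((n : ℝ) / 2) := by positivity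
    field_simp
  have e5 : ∀ ξ, (f (X, ξ) : ℂ) * (((4 * Real.pi * ħ) ^ ((n : ℝ) / 2) *
      Real.exp (-‖ξ - z.2‖ ^ 2 / ħ) : ℝ) : ℂ) =
      ((h ^ n * (f (X, ξ) * gaussWeight ħ (ξ - z.2)) : ℝ) : ℂ) := by
    intro ξ
    rw [← Complex.ofReal_mul, gaussWeight, ← hconst]
    congr 1
    have : h ^ n ≠ 0 := by positivity
    field_simp
  have e6 : ∀ ξ, ∫ u, (f (X, ξ) : ℂ) * (Complex.exp (Complex.I *
      ((inner ℝ (ξ - z.2) u / ħ : ℝ) : ℂ)) * ((Real.exp (-‖u‖ ^ 2 / (4 * ħ)) : ℝ) : ℂ)) =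
      ((h ^ n * (f (X, ξ) * gaussWeight ħ (ξ - z.2)) : ℝ) : ℂ) := fun ξ => by
    rw [integral_const_mul, integral_gauss_fourier hħ, ← hn]
    exact e5 ξ
  rw [integral_congr_ae (Eventually.of_forall e6), integral_complex_ofReal, integral_const_mul, ← Complex.ofReal_mul]
  congr 1
  have : h ^ n ≠ 0 := by positivity
  field_simp

theorem measurable_enorm_sq_weyl_gaussState {ħ : ℝ} {f : E × E → ℝ} (hf : Continuous f) :
    Measurable fun p : (E × E) × E => ‖∫ y, weylKernel ħ f p.2 y * gaussState ħ p.1 y‖ₑ ^ 2 := by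
  have h1 : StronglyMeasurable fun p : ((E × E) × E) × E => weylKernel ħ f p.1.2 p.2 :=
    (stronglyMeasurable_weylKernel ħ hf).comp_measurable
      (g := fun p : ((E × E) × E) × E => (p.1.2, p.2)) (measurable_fst.snd.prodMk measurable_snd)
  have h2 : StronglyMeasurable fun p : ((E × E) × E) × E => gaussState ħ p.1.1 p.2 :=
    (continuous_gaussState ħ).stronglyMeasurable.comp_measurable
      (g := fun p : ((E × E) × E) × E => (p.1.1, p.2)) (measurable_fst.fst.prodMk measurable_snd)
  have h3 := (h1.mul h2).integral_prod_right' (ν := (volume : Measure E))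
  exact h3.measurable.enorm.pow_const 2

/-- Gaussian coherent states are approximate eigenvectors of the Weyl quantization in the mean. -/
theorem lintegral_gaussVec_defect_le {ħ : ℝ} (hħ : 0 < ħ) {f : E × E → ℝ} (hf : Continuous f)
    (hfc : HasCompactSupport f) {C Λ : ℝ} (hC : ∀ z, |f z| ≤ C) (hΛ0 : 0 ≤ Λ)
    (hΛ : ∀ w z : E × E, |f w - f z| ≤ Λ * (‖w.1 - z.1‖ + ‖w.2 - z.2‖))
    {T : Lp ℂ 2 (volume : Measure E) →L[ℂ] Lp ℂ 2 (volume : Measure E)}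
    (hT : ∀ v, T v =ᵐ[volume] fun x => ∫ y, weylKernel ħ f x y * v y) :
    ∫⁻ z, ‖T (gaussVec ħ z) - (f z : ℂ) • gaussVec ħ z‖ₑ ^ 2
      ∂(ENNReal.ofReal (1 / (2 * Real.pi * ħ) ^ Module.finrank ℝ E) • (volume : Measure (E × E))) ≤
    ENNReal.ofReal ((1 / (2 * Real.pi * ħ) ^ Module.finrank ℝ E) *
      (4 * C * Λ * (√ħ * 2 ^ ((Module.finrank ℝ E : ℝ) / 2)))) * volume {z | 0 < |f z|} := by
  have hC0 : 0 ≤ C := (abs_nonneg _).trans (hC 0)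
  set κ := √ħ * 2 ^ ((Module.finrank ℝ E : ℝ) / 2) with hκ
  set c := 1 / (2 * Real.pi * ħ) ^ Module.finrank ℝ E with hc
  set ν := ENNReal.ofReal c • (volume : Measure (E × E)) with hν
  have hK := stronglyMeasurable_weylKernel ħ hf
  have hK2 := lintegral_enorm_sq_weylKernel_ne_top hħ hf hfc
  -- Adding `f²` on the left turns the expanded square into `‖T ψ‖² - 2 f (average - f)`, with no
  -- negative square left over. The last term vanishes where `f` does, which is why the error is an
  -- indicator of `{f ≠ 0}`.
  have hpt : ∀ z, ‖T (gaussVec ħ z) - (f z : ℂ) • gaussVec ħ z‖ ^ 2 + f z ^ 2 ≤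
      ‖T (gaussVec ħ z)‖ ^ 2 + {z | 0 < |f z|}.indicator (fun _ => 4 * C * Λ * κ) z := by
    intro z
    have h1 : ‖T (gaussVec ħ z) - (f z : ℂ) • gaussVec ħ z‖ ^ 2 =
        ‖T (gaussVec ħ z)‖ ^ 2 - 2 * (f z * gaussAverage ħ f z) + f z ^ 2 := by
      rw [@norm_sub_sq ℂ, inner_smul_right, norm_smul, norm_gaussVec hħ,
        ← inner_conj_symm, inner_gaussVec_apply hħ hf hfc hT, Complex.conj_ofReal,
        ← Complex.ofReal_mul]
      simp
    rw [h1]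
    have h2 := abs_gaussAverage_sub_le hħ hf hfc hΛ0 hΛ z
    by_cases h0 : f z = 0
    · simp [h0]
    · rw [Set.indicator_of_mem (by simpa using h0)]
      have h3 : -(f z * (gaussAverage ħ f z - f z)) ≤ C * (Λ * (2 * κ)) := by
        refine (neg_le_abs _).trans ?_
        rw [abs_mul]
        exact mul_le_mul (hC z) h2 (abs_nonneg _) hC0
      nlinarith
  have hms : MeasurableSet {z | 0 < |f z|} := measurableSet_lt measurable_const hf.measurable.abs
  have hf2 : ∫⁻ z, ENNReal.ofReal (f z ^ 2) ∂ν = ∫⁻ x, ∫⁻ y, ‖weylKernel ħ f x y‖ₑ ^ 2 := by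
    rw [lintegral_enorm_sq_weylKernel hħ hf hfc, hν, lintegral_smul_measure, smul_eq_mul, hc, one_div]
    congr 1
    refine lintegral_congr fun z => ?_
    rw [← ofReal_norm, ← ENNReal.ofReal_pow (norm_nonneg _), Real.norm_eq_abs, sq_abs]
  have hmT := measurable_enorm_sq_weyl_gaussState (ħ := ħ) hf
  have hTz : ∀ z, ‖T (gaussVec ħ z)‖ₑ ^ 2 =
      ∫⁻ x, ‖∫ y, weylKernel ħ f x y * gaussState ħ z y‖ₑ ^ 2 := fun z => by
    rw [← lintegral_enorm_sq_coeFn]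
    refine lintegral_congr_ae ?_
    filter_upwards [hT (gaussVec ħ z)] with x hx
    rw [hx]
    congr 2
    refine integral_congr_ae ?_
    filter_upwards [gaussVec_coeFn hħ z] with y hy
    rw [hy]
  have hTmeas : Measurable fun z => ‖T (gaussVec ħ z)‖ₑ ^ 2 := by
    simp_rw [hTz]; exact hmT.lintegral_prod_right'
  -- The resolution of the identity, applied to each row of the kernel.
  have hHS : ∫⁻ z, ‖T (gaussVec ħ z)‖ₑ ^ 2 ∂ν = ∫⁻ x, ∫⁻ y, ‖weylKernel ħ f x y‖ₑ ^ 2 := by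
    simp_rw [hTz]
    rw [lintegral_lintegral_swap hmT.aemeasurable]
    have hrow : ∀ᵐ x, MemLp (weylKernel ħ f x) 2 volume := by
      have hm : Measurable fun x => ∫⁻ y, ‖weylKernel ħ f x y‖ₑ ^ 2 :=
        Measurable.lintegral_prod_right' (f := fun p : E × E => ‖weylKernel ħ f p.1 p.2‖ₑ ^ 2)
          (hK.enorm.pow_const 2)
      filter_upwards [ae_lt_top hm hK2] with x hx
      exact (memLp_two_iff_lintegral
        (hK.comp_measurable measurable_prodMk_left).aestronglyMeasurable).2 hx
    refine lintegral_congr_ae ?_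
    filter_upwards [hrow] with x hx
    obtain ⟨k, hk, hkn⟩ := exists_inner_eq_integral_mul hx
    rw [← hkn, ← lintegral_enorm_sq_inner_gaussVec hħ k]
    refine lintegral_congr fun z => ?_
    rw [hk]
    congr 2
    refine integral_congr_ae ?_
    filter_upwards [gaussVec_coeFn hħ z] with y hy
    rw [hy]
  have hsum : ∫⁻ z, ‖T (gaussVec ħ z) - (f z : ℂ) • gaussVec ħ z‖ₑ ^ 2 ∂ν +
      ∫⁻ z, ENNReal.ofReal (f z ^ 2) ∂ν ≤ ENNReal.ofReal (c * (4 * C * Λ * κ)) *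
        volume {z | 0 < |f z|} + ∫⁻ z, ENNReal.ofReal (f z ^ 2) ∂ν := by
    rw [← lintegral_add_right _ ((hf.measurable.pow_const 2).ennreal_ofReal)]
    calc _ ≤ ∫⁻ z, (‖T (gaussVec ħ z)‖ₑ ^ 2 +
          {z | 0 < |f z|}.indicator (fun _ => ENNReal.ofReal (4 * C * Λ * κ)) z) ∂ν := by
          refine lintegral_mono fun z => ?_
          have h1 := ENNReal.ofReal_le_ofReal (hpt z)
          rw [ENNReal.ofReal_add (by positivity) (by positivity),
            ENNReal.ofReal_add (by positivity)
              (Set.indicator_nonneg (fun _ _ => by positivity) _),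
            ENNReal.ofReal_pow (norm_nonneg _), ENNReal.ofReal_pow (norm_nonneg _),
            ofReal_norm, ofReal_norm] at h1
          refine h1.trans (le_of_eq ?_)
          congr 1
          by_cases hz : z ∈ {z | 0 < |f z|}
          · rw [Set.indicator_of_mem hz, Set.indicator_of_mem hz]
          · rw [Set.indicator_of_notMem hz, Set.indicator_of_notMem hz, ENNReal.ofReal_zero]
      _ = _ := by
          rw [lintegral_add_left hTmeas, hHS, ← hf2, lintegral_indicator_const hms, add_comm]
          congr 1
          rw [hν, Measure.smul_apply, smul_eq_mul, ← mul_assoc, mul_comm (ENNReal.ofReal _),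
            ← ENNReal.ofReal_mul (by positivity)]
  -- The common term `∫ f² dν`, equal to the squared Hilbert-Schmidt norm, is finite and may be
  -- cancelled.
  exact (ENNReal.add_le_add_iff_right (by rw [hf2]; exact hK2)).1 hsum

end LowerSymbol

/-! ### Trace norm of an integrable superposition of rank one operators. -/

section Superposition

theorem Orthonormal.sum_norm_inner_mul_norm_inner_le {H : Type*} [NormedAddCommGroup H]
    [InnerProductSpace ℂ H] {ι : Type*} {e : ι → H} (he : Orthonormal ℂ e) (F : Finset ι)
    (u v : H) : ∑ i ∈ F, ‖inner ℂ (e i) u‖ * ‖inner ℂ v (e i)‖ ≤ ‖u‖ * ‖v‖ := by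
  have h1 := he.sum_inner_products_le u (s := F)
  have h2 := he.sum_inner_products_le v (s := F)
  simp_rw [norm_inner_symm v]
  refine abs_le_of_sq_le_sq' ?_ (by positivity) |>.2
  refine (Finset.sum_mul_sq_le_sq_mul_sq F _ _).trans ?_
  rw [mul_pow]
  gcongr

variable {X W : Type*} [MeasurableSpace X] [MeasurableSpace W] {μ : Measure X} [SFinite μ]
  {ρ : Measure W} [SFinite ρ]

/-- The trace norm bound for a superposition of rank one operators `∫ b(w) |g_w⟩⟨g'_w| dw`. -/
theorem sum_norm_inner_superposition_le {b : W → ℂ} (hb : Integrable b ρ) {g g' : W → X → ℂ}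
    (hg : StronglyMeasurable (Function.uncurry g)) (hg' : StronglyMeasurable (Function.uncurry g'))
    (hg1 : ∀ w, ∫⁻ x, ‖g w x‖ₑ ^ 2 ∂μ = 1) (hg1' : ∀ w, ∫⁻ x, ‖g' w x‖ₑ ^ 2 ∂μ = 1)
    {K : X → X → ℂ} (hK : StronglyMeasurable (Function.uncurry K))
    (hK2 : ∫⁻ x, ∫⁻ y, ‖K x y‖ₑ ^ 2 ∂μ ∂μ ≠ ⊤)
    {T : Lp ℂ 2 μ →L[ℂ] Lp ℂ 2 μ} (hT : ∀ v, T v =ᵐ[μ] fun x => ∫ y, K x y * v y ∂μ)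
    (hKg : ∀ x y, K x y = ∫ w, b w * (g w x * (starRingEnd ℂ) (g' w y)) ∂ρ)
    {ι : Type*} {e : ι → Lp ℂ 2 μ} (he : Orthonormal ℂ e) (F : Finset ι) :
    ∑ i ∈ F, ‖inner ℂ (e i) (T (e i))‖ ≤ ∫ w, ‖b w‖ ∂ρ := by
  have hgw : ∀ w, MemLp (g w) 2 μ := fun w => (memLp_two_iff_lintegral
    (hg.comp_measurable measurable_prodMk_left).aestronglyMeasurable).2 (by simp [hg1])
  have hgw' : ∀ w, MemLp (g' w) 2 μ := fun w => (memLp_two_iff_lintegral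
    (hg'.comp_measurable measurable_prodMk_left).aestronglyMeasurable).2 (by simp [hg1'])
  have hn : ∀ w, ‖(hgw w).toLp (g w)‖ = 1 := fun w => by
    have h : ‖(hgw w).toLp (g w)‖ₑ ^ 2 = 1 := by rw [enorm_sq_toLp, hg1]
    have h2 : ‖(hgw w).toLp (g w)‖ ^ 2 = 1 := by
      rw [← ofReal_norm, ← ENNReal.ofReal_pow (norm_nonneg _), ENNReal.ofReal_eq_one] at h
      exact h
    nlinarith [norm_nonneg ((hgw w).toLp (g w))]
  have hn' : ∀ w, ‖(hgw' w).toLp (g' w)‖ = 1 := fun w => by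
    have h : ‖(hgw' w).toLp (g' w)‖ₑ ^ 2 = 1 := by rw [enorm_sq_toLp, hg1']
    have h2 : ‖(hgw' w).toLp (g' w)‖ ^ 2 = 1 := by
      rw [← ofReal_norm, ← ENNReal.ofReal_pow (norm_nonneg _), ENNReal.ofReal_eq_one] at h
      exact h
    nlinarith [norm_nonneg ((hgw' w).toLp (g' w))]
  have hi : ∀ (v : Lp ℂ 2 μ) w, inner ℂ v ((hgw w).toLp (g w)) =
      ∫ x, (starRingEnd ℂ) (v x) * g w x ∂μ := fun v w => by
    rw [L2.inner_def]
    refine integral_congr_ae ?_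
    filter_upwards [(hgw w).coeFn_toLp] with x hx
    rw [hx, RCLike.inner_apply, mul_comm]
  have hi' : ∀ (v : Lp ℂ 2 μ) w, inner ℂ ((hgw' w).toLp (g' w)) v =
      ∫ x, (starRingEnd ℂ) (g' w x) * v x ∂μ := fun v w => by
    rw [L2.inner_def]
    refine integral_congr_ae ?_
    filter_upwards [(hgw' w).coeFn_toLp] with x hx
    rw [hx, RCLike.inner_apply, mul_comm]
  have hm : ∀ v : Lp ℂ 2 μ, AEStronglyMeasurable
      (fun w => inner ℂ v ((hgw w).toLp (g w))) ρ := fun v => by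
    simp_rw [hi]
    exact (StronglyMeasurable.integral_prod_right'
      (f := fun p : W × X => (starRingEnd ℂ) (v p.2) * g p.1 p.2)
      ((Complex.continuous_conj.comp_stronglyMeasurable
        ((Lp.stronglyMeasurable v).comp_measurable measurable_snd)).mul hg)).aestronglyMeasurable
  have hm' : ∀ v : Lp ℂ 2 μ, AEStronglyMeasurable
      (fun w => inner ℂ ((hgw' w).toLp (g' w)) v) ρ := fun v => by
    simp_rw [hi']
    exact (StronglyMeasurable.integral_prod_right'
      (f := fun p : W × X => (starRingEnd ℂ) (g' p.1 p.2) * v p.2)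
      ((Complex.continuous_conj.comp_stronglyMeasurable hg').mul
        ((Lp.stronglyMeasurable v).comp_measurable measurable_snd))).aestronglyMeasurable
  have hint : ∀ u v : Lp ℂ 2 μ, Integrable (fun w => b w *
      (inner ℂ v ((hgw w).toLp (g w)) * inner ℂ ((hgw' w).toLp (g' w)) u)) ρ := fun u v => by
    refine hb.mul_bdd (c := ‖v‖ * ‖u‖) ((hm v).mul (hm' u)) (Eventually.of_forall fun w => ?_)
    rw [norm_mul]
    gcongr
    · simpa [hn] using norm_inner_le_norm (𝕜 := ℂ) v ((hgw w).toLp (g w))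
    · simpa [hn'] using norm_inner_le_norm (𝕜 := ℂ) ((hgw' w).toLp (g' w)) u
  -- Fubini over `X × X × W`. Integrability comes from that of `b`, since each rank one form is
  -- bounded by `‖v‖ ‖u‖` uniformly in `w`.
  have key : ∀ u v : Lp ℂ 2 μ, inner ℂ v (T u) = ∫ w, b w *
      (inner ℂ v ((hgw w).toLp (g w)) * inner ℂ ((hgw' w).toLp (g' w)) u) ∂ρ := fun u v => by
    set G : (X × X) × W → ℂ := fun p => b p.2 * (((starRingEnd ℂ) (v p.1.1) * g p.2 p.1.1) *
      ((starRingEnd ℂ) (g' p.2 p.1.2) * u p.1.2)) with hG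
    have hv := Lp.memLp v
    have hu := Lp.memLp u
    have hvg : ∀ w, Integrable (fun x => (starRingEnd ℂ) (v x) * g w x) μ := fun w =>
      MemLp.integrable_mul (p := 2) (q := 2) hv.star (hgw w)
    have hgu : ∀ w, Integrable (fun x => (starRingEnd ℂ) (g' w x) * u x) μ := fun w =>
      MemLp.integrable_mul (p := 2) (q := 2) (hgw' w).star hu
    have m1 : Measurable fun p : (X × X) × W => (p.2, p.1.1) :=
      measurable_snd.prodMk measurable_fst.fst
    have m2 : Measurable fun p : (X × X) × W => (p.2, p.1.2) :=
      measurable_snd.prodMk measurable_fst.snd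
    have a1 : StronglyMeasurable fun p : (X × X) × W => (starRingEnd ℂ) (v p.1.1) * g p.2 p.1.1 :=
      (Complex.continuous_conj.comp_stronglyMeasurable
        ((Lp.stronglyMeasurable v).comp_measurable measurable_fst.fst)).mul
        (hg.comp_measurable m1)
    have a2 : StronglyMeasurable fun p : (X × X) × W =>
        (starRingEnd ℂ) (g' p.2 p.1.2) * u p.1.2 :=
      (Complex.continuous_conj.comp_stronglyMeasurable (hg'.comp_measurable m2)).mul
        ((Lp.stronglyMeasurable u).comp_measurable measurable_fst.snd)
    have hGm : AEStronglyMeasurable G ((μ.prod μ).prod ρ) :=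
      (hb.1.comp_snd).mul (a1.mul a2).aestronglyMeasurable
    have hGi : Integrable G ((μ.prod μ).prod ρ) := by
      rw [integrable_prod_iff' hGm]
      refine ⟨Eventually.of_forall fun w => ((hvg w).mul_prod (hgu w)).const_mul (b w), ?_⟩
      refine Integrable.mono' (g := fun w => ‖b w‖ * (‖v‖ * ‖u‖)) (hb.norm.mul_const _)
        hGm.prod_swap.norm.integral_prod_right' ?_
      refine Eventually.of_forall fun w => ?_
      have e : ∫ p : X × X, ‖G (p, w)‖ ∂μ.prod μ = ‖b w‖ *
          ((∫ x, ‖(starRingEnd ℂ) (v x) * g w x‖ ∂μ) *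
            ∫ x, ‖(starRingEnd ℂ) (g' w x) * u x‖ ∂μ) := by
        rw [← integral_prod_mul, ← integral_const_mul]
        simp [hG]
      rw [e, Real.norm_of_nonneg (by positivity)]
      have cs : ∀ (f k : X → ℂ) (hf : MemLp f 2 μ) (hk : MemLp k 2 μ),
          ∫ x, ‖f x * k x‖ ∂μ ≤ ‖hf.toLp f‖ * ‖hk.toLp k‖ := fun f k hf hk => by
        have h1 : ENNReal.ofReal (∫ x, ‖f x * k x‖ ∂μ) ^ 2 ≤
            ENNReal.ofReal (‖hf.toLp f‖ * ‖hk.toLp k‖) ^ 2 := by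
          rw [ENNReal.ofReal_mul (norm_nonneg _), mul_pow, ofReal_norm, ofReal_norm, enorm_sq_toLp,
            enorm_sq_toLp, ofReal_integral_norm_eq_lintegral_enorm (f := fun x => f x * k x)
              (MemLp.integrable_mul (p := 2) (q := 2) hf hk)]
          simp_rw [enorm_mul]
          exact sq_lintegral_mul_le hf.1.enorm hk.1.enorm
        rw [← ENNReal.ofReal_pow (by positivity), ← ENNReal.ofReal_pow (by positivity),
          ENNReal.ofReal_le_ofReal_iff (by positivity)] at h1
        exact abs_le_of_sq_le_sq' h1 (by positivity) |>.2
      have c1 := cs (fun x => (starRingEnd ℂ) (v x)) (g w) hv.star (hgw w)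
      have c2 := cs (fun x => (starRingEnd ℂ) (g' w x)) u (hgw' w).star hu
      have n1 : ‖(hv.star).toLp (star (v : X → ℂ))‖ = ‖v‖ := by
        rw [Lp.norm_toLp, eLpNorm_star, ← Lp.norm_def]
      have n2 : ‖((hgw' w).star).toLp (star (g' w))‖ = 1 := by
        rw [Lp.norm_toLp, eLpNorm_star, ← Lp.norm_toLp _ (hgw' w), hn']
      have n3 : ‖hu.toLp (u : X → ℂ)‖ = ‖u‖ := by rw [Lp.toLp_coeFn]
      gcongr
      · refine c1.trans (le_of_eq ?_)
        rw [hn, mul_one]; exact n1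
      · refine c2.trans (le_of_eq ?_)
        rw [n3]; erw [n2]; rw [one_mul]
    have hI : Integrable (fun p : X × X => (starRingEnd ℂ) (v p.1) * (K p.1 p.2 * u p.2))
        (μ.prod μ) := integrable_kernel_mul hK hK2 hv hu
    have e1 : inner ℂ v (T u) = ∫ p : X × X, (starRingEnd ℂ) (v p.1) * (K p.1 p.2 * u p.2)
        ∂μ.prod μ := by
      rw [integral_prod _ hI, L2.inner_def]
      refine integral_congr_ae ?_
      filter_upwards [hT u] with x hx
      rw [hx, RCLike.inner_apply, integral_const_mul, mul_comm]
    have e2 : ∀ p : X × X, (starRingEnd ℂ) (v p.1) * (K p.1 p.2 * u p.2) = ∫ w, G (p, w) ∂ρ := by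
      intro p
      rw [hKg, ← integral_mul_const, ← integral_const_mul]
      congr with w
      simp only [hG]
      ring
    rw [e1]
    simp_rw [e2]
    rw [integral_integral_swap hGi]
    congr with w
    rw [hi, hi', ← integral_prod_mul, ← integral_const_mul]
  calc ∑ i ∈ F, ‖inner ℂ (e i) (T (e i))‖ ≤ ∑ i ∈ F, ∫ w, ‖b w *
      (inner ℂ (e i) ((hgw w).toLp (g w)) * inner ℂ ((hgw' w).toLp (g' w)) (e i))‖ ∂ρ := by
        refine Finset.sum_le_sum fun i _ => ?_
        rw [key]
        exact norm_integral_le_integral_norm _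
    _ = ∫ w, ∑ i ∈ F, ‖b w *
      (inner ℂ (e i) ((hgw w).toLp (g w)) * inner ℂ ((hgw' w).toLp (g' w)) (e i))‖ ∂ρ :=
        (integral_finsetSum _ fun i _ => (hint _ _).norm).symm
    _ ≤ ∫ w, ‖b w‖ ∂ρ := by
        refine integral_mono (integrable_finsetSum _ fun i _ => (hint _ _).norm) hb.norm
          fun w => ?_
        simp only [norm_mul]
        rw [← Finset.mul_sum]
        refine mul_le_of_le_one_right (norm_nonneg _) ?_
        have := he.sum_norm_inner_mul_norm_inner_le F ((hgw w).toLp (g w)) ((hgw' w).toLp (g' w))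
        rwa [hn, hn', one_mul] at this

end Superposition

/-! ### Weyl quantizations of smooth compactly supported symbols are trace class. -/

section WeylTrace

variable {E : Type*} [NormedAddCommGroup E] [InnerProductSpace ℝ E] [FiniteDimensional ℝ E]
  [MeasurableSpace E] [BorelSpace E]

/-- A smooth compactly supported symbol is a Gaussian times an integrable superposition of
characters. -/
theorem exists_gauss_superposition {ħ : ℝ} {f : E × E → ℝ} (hf : ContDiff ℝ ∞ f)
    (hfc : HasCompactSupport f) :
    ∃ b : WithLp 2 (E × E) → ℂ, Integrable b ∧ ∀ X ξ, (f (X, ξ) : ℂ) =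
      ((Real.exp (-‖X‖ ^ 2 / ħ) * Real.exp (-‖ξ‖ ^ 2 / ħ) : ℝ) : ℂ) *
      ∫ w : WithLp 2 (E × E), Complex.exp (Complex.I *
        ((2 * Real.pi * (inner ℝ w.fst X + inner ℝ w.snd ξ) : ℝ) : ℂ)) * b w := by
  set L := WithLp.prodContinuousLinearEquiv 2 ℝ E E with hL
  -- The symbol divided by the Gaussian. Compact support makes the growth of the inverse Gaussian
  -- harmless, so `F` is a Schwartz function and its Fourier transform is integrable.
  set F : WithLp 2 (E × E) → ℂ := fun v =>
    ((f (L v) * (Real.exp (‖(L v).1‖ ^ 2 / ħ) * Real.exp (‖(L v).2‖ ^ 2 / ħ)) : ℝ) : ℂ) with hF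
  have hFs : ContDiff ℝ ∞ F := by
    refine Complex.ofRealCLM.contDiff.comp ((hf.comp L.contDiff).mul (ContDiff.mul ?_ ?_))
    · exact Real.contDiff_exp.comp
        ((((contDiff_fst.comp L.contDiff)).norm_sq ℝ).div_const _)
    · exact Real.contDiff_exp.comp
        ((((contDiff_snd.comp L.contDiff)).norm_sq ℝ).div_const _)
  have hFc : HasCompactSupport F := by
    have h1 : HasCompactSupport fun v => f (L v) := hfc.comp_homeomorph L.toHomeomorph
    exact (h1.mul_right (f' := fun v => Real.exp (‖(L v).1‖ ^ 2 / ħ) *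
      Real.exp (‖(L v).2‖ ^ 2 / ħ))).comp_left (g := fun r : ℝ => (r : ℂ)) (by simp)
  set φ : 𝓢(WithLp 2 (E × E), ℂ) := hFc.toSchwartzMap hFs with hφ
  refine ⟨FourierTransform.fourier φ, (FourierTransform.fourier φ).integrable, fun X ξ => ?_⟩
  have h1 : (φ : WithLp 2 (E × E) → ℂ) (L.symm (X, ξ)) =
      FourierTransformInv.fourierInv (FourierTransform.fourier φ : WithLp 2 (E × E) → ℂ)
        (L.symm (X, ξ)) := by
    rw [← SchwartzMap.fourierInv_coe, FourierTransform.fourierInv_fourier_eq]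
  rw [Real.fourierInv_eq'] at h1
  have h2 : φ (L.symm (X, ξ)) = F (L.symm (X, ξ)) := rfl
  have h3 : F (L.symm (X, ξ)) =
      ((f (X, ξ) * (Real.exp (‖X‖ ^ 2 / ħ) * Real.exp (‖ξ‖ ^ 2 / ħ)) : ℝ) : ℂ) := by
    simp only [hF, ContinuousLinearEquiv.apply_symm_apply]
  have h4 : ∫ w : WithLp 2 (E × E), Complex.exp (Complex.I *
        ((2 * Real.pi * (inner ℝ w.fst X + inner ℝ w.snd ξ) : ℝ) : ℂ)) *
          FourierTransform.fourier φ w =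
      ((f (X, ξ) * (Real.exp (‖X‖ ^ 2 / ħ) * Real.exp (‖ξ‖ ^ 2 / ħ)) : ℝ) : ℂ) := by
    rw [← h3, ← h2, h1]
    congr with w
    rw [mul_comm Complex.I, WithLp.prod_inner_apply]
    rfl
  rw [h4, ← Complex.ofReal_mul]
  congr 1
  have e : ∀ a : ℝ, Real.exp (-a / ħ) * Real.exp (a / ħ) = 1 := fun a => by
    rw [← Real.exp_add, ← add_div]; simp
  calc f (X, ξ) = f (X, ξ) * ((Real.exp (-‖X‖ ^ 2 / ħ) * Real.exp (‖X‖ ^ 2 / ħ)) *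
        (Real.exp (-‖ξ‖ ^ 2 / ħ) * Real.exp (‖ξ‖ ^ 2 / ħ))) := by rw [e, e]; ring
    _ = _ := by ring

theorem gauss_exponent_shift (x y s : E) (ħ : ℝ) :
    -‖x + s‖ ^ 2 / (2 * ħ) + -‖y - s‖ ^ 2 / (2 * ħ) =
      -‖(1 / 2 : ℝ) • (x + y)‖ ^ 2 / ħ + -‖x - y + (2 : ℝ) • s‖ ^ 2 / (4 * ħ) := by
  have h := gauss_exponent ((1 / 2 : ℝ) • (x + y)) (x - y + (2 : ℝ) • s) 0 ħ
  rw [sub_zero, sub_zero, sub_zero] at h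
  rw [← h, show (1 / 2 : ℝ) • (x + y) + (1 / 2 : ℝ) • (x - y + (2 : ℝ) • s) = x + s by module,
    show (1 / 2 : ℝ) • (x + y) - (1 / 2 : ℝ) • (x - y + (2 : ℝ) • s) = y - s by module]

/-- With opposite centres `(-s, p)` and `(s, -p)` the product oscillates in `x + y` only, and its
Gaussian in `x - y` is shifted by `2 s`. Up to a constant this is the Weyl kernel of a Gaussian
times a character. -/
theorem gaussState_mul_conj {ħ : ℝ} (hħ : 0 < ħ) (s p x y : E) :
    gaussState ħ (-s, p) x * (starRingEnd ℂ) (gaussState ħ (s, -p) y) =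
      (((gaussMass E ħ)⁻¹ * (Real.exp (-‖(1 / 2 : ℝ) • (x + y)‖ ^ 2 / ħ) *
        Real.exp (-‖x - y + (2 : ℝ) • s‖ ^ 2 / (4 * ħ))) : ℝ) : ℂ) *
        Complex.exp (Complex.I * ((inner ℝ p (x + y) / ħ : ℝ) : ℂ)) := by
  have hM := gaussMass_pos (E := E) hħ
  simp only [gaussState, map_mul, Complex.conj_ofReal, ← Complex.exp_conj, Complex.conj_I]
  have e1 : ∀ a b c d : ℂ, a * Complex.exp c * (b * Complex.exp d) = a * b * Complex.exp (c + d) :=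
    fun a b c d => by rw [Complex.exp_add]; ring
  rw [e1, ← Complex.ofReal_mul]
  congr 1
  · have e2 : ∀ m a b : ℝ, m⁻¹ * Real.exp a * (m⁻¹ * Real.exp b) = (m * m)⁻¹ * Real.exp (a + b) :=
      fun m a b => by rw [Real.exp_add, mul_inv]; ring
    rw [e2, Real.mul_self_sqrt hM.le, sub_neg_eq_add, gauss_exponent_shift, Real.exp_add]
  · congr 1
    rw [inner_add_right, inner_neg_left]
    push_cast
    ring

/-- The Weyl kernel of a smooth compactly supported symbol is an integrable superposition of
products of coherent states. -/
theorem exists_weylKernel_superposition {ħ : ℝ} (hħ : 0 < ħ) {f : E × E → ℝ}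
    (hf : ContDiff ℝ ∞ f) (hfc : HasCompactSupport f) :
    ∃ b : WithLp 2 (E × E) → ℂ, Integrable b ∧ ∀ x y, weylKernel ħ f x y =
      ∫ w : WithLp 2 (E × E), b w *
        (gaussState ħ (-((Real.pi * ħ) • w.snd), (Real.pi * ħ) • w.fst) x *
        (starRingEnd ℂ) (gaussState ħ ((Real.pi * ħ) • w.snd, -((Real.pi * ħ) • w.fst)) y)) := by
  obtain ⟨b, hb, hfb⟩ := exists_gauss_superposition (ħ := ħ) hf hfc
  set n := Module.finrank ℝ E with hn
  set κ : ℝ := ((2 * Real.pi * ħ) ^ n)⁻¹ * ((4 * Real.pi * (ħ / 4)) ^ ((n : ℝ) / 2) *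
    gaussMass E ħ) with hκ
  have hM := gaussMass_pos (E := E) hħ
  refine ⟨fun w => (κ : ℂ) * b w, hb.const_mul _, fun x y => ?_⟩
  set X := (1 / 2 : ℝ) • (x + y) with hX
  have hswap : Integrable (Function.uncurry fun (ξ : E) (w : WithLp 2 (E × E)) =>
      Complex.exp (Complex.I * ((inner ℝ ξ (x - y) / ħ : ℝ) : ℂ)) *
      (((Real.exp (-‖X‖ ^ 2 / ħ) * Real.exp (-‖ξ‖ ^ 2 / ħ) : ℝ) : ℂ) *
      (Complex.exp (Complex.I *
        ((2 * Real.pi * (inner ℝ w.fst X + inner ℝ w.snd ξ) : ℝ) : ℂ)) * b w)))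
      (volume.prod volume) := by
    have h0 : Integrable fun ξ : E => Real.exp (-‖X‖ ^ 2 / ħ) * Real.exp (-‖ξ‖ ^ 2 / ħ) :=
      (integrable_gauss hħ).const_mul _
    refine (h0.norm.mul_prod hb.norm).mono' ?_ (Eventually.of_forall fun p => ?_)
    · have hc : Continuous fun p : E × WithLp 2 (E × E) => Complex.exp (Complex.I *
          ((2 * Real.pi * (inner ℝ p.2.fst X + inner ℝ p.2.snd p.1) : ℝ) : ℂ)) := by fun_prop
      have hc1 : Continuous fun p : E × WithLp 2 (E × E) =>
          Complex.exp (Complex.I * ((inner ℝ p.1 (x - y) / ħ : ℝ) : ℂ)) := by fun_prop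
      have hc2 : Continuous fun p : E × WithLp 2 (E × E) =>
          ((Real.exp (-‖X‖ ^ 2 / ħ) * Real.exp (-‖p.1‖ ^ 2 / ħ) : ℝ) : ℂ) := by fun_prop
      exact hc1.aestronglyMeasurable.mul (hc2.aestronglyMeasurable.mul
        (hc.aestronglyMeasurable.mul hb.1.comp_snd))
    · simp only [Function.uncurry, norm_mul, Complex.norm_real]
      rw [mul_comm Complex.I, Complex.norm_exp_ofReal_mul_I, mul_comm Complex.I,
        Complex.norm_exp_ofReal_mul_I, one_mul, one_mul]
  have e1 : ∀ ξ : E, Complex.exp (Complex.I * ((inner ℝ ξ (x - y) / ħ : ℝ) : ℂ)) *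
      (f (X, ξ) : ℂ) = ∫ w : WithLp 2 (E × E),
      Complex.exp (Complex.I * ((inner ℝ ξ (x - y) / ħ : ℝ) : ℂ)) *
      (((Real.exp (-‖X‖ ^ 2 / ħ) * Real.exp (-‖ξ‖ ^ 2 / ħ) : ℝ) : ℂ) *
      (Complex.exp (Complex.I *
        ((2 * Real.pi * (inner ℝ w.fst X + inner ℝ w.snd ξ) : ℝ) : ℂ)) * b w)) := fun ξ => by
    rw [hfb, integral_const_mul, integral_const_mul]
  rw [weylKernel, integral_congr_ae (Eventually.of_forall e1), integral_integral_swap hswap,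
    ← integral_const_mul]
  refine integral_congr_ae (Eventually.of_forall fun w => ?_)
  simp only
  set u := x - y + (2 : ℝ) • ((Real.pi * ħ) • w.snd) with hu
  have e2 : ∀ ξ : E, Complex.exp (Complex.I * ((inner ℝ ξ (x - y) / ħ : ℝ) : ℂ)) *
      (((Real.exp (-‖X‖ ^ 2 / ħ) * Real.exp (-‖ξ‖ ^ 2 / ħ) : ℝ) : ℂ) *
      (Complex.exp (Complex.I *
        ((2 * Real.pi * (inner ℝ w.fst X + inner ℝ w.snd ξ) : ℝ) : ℂ)) * b w)) =
      (((Real.exp (-‖X‖ ^ 2 / ħ) : ℝ) : ℂ) * Complex.exp (Complex.I *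
        ((inner ℝ ((Real.pi * ħ) • w.fst) (x + y) / ħ : ℝ) : ℂ)) * b w) *
      (Complex.exp (Complex.I * ((inner ℝ ((1 / 4 : ℝ) • u) ξ / (ħ / 4) : ℝ) : ℂ)) *
        ((Real.exp (-‖ξ‖ ^ 2 / (4 * (ħ / 4))) : ℝ) : ℂ)) := fun ξ => by
    have e3 : Complex.exp (Complex.I * ((inner ℝ ξ (x - y) / ħ : ℝ) : ℂ)) * Complex.exp (Complex.I *
        ((2 * Real.pi * (inner ℝ w.fst X + inner ℝ w.snd ξ) : ℝ) : ℂ)) =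
        Complex.exp (Complex.I * ((inner ℝ ((Real.pi * ħ) • w.fst) (x + y) / ħ : ℝ) : ℂ)) *
        Complex.exp (Complex.I * ((inner ℝ ((1 / 4 : ℝ) • u) ξ / (ħ / 4) : ℝ) : ℂ)) := by
      rw [← Complex.exp_add, ← Complex.exp_add, ← mul_add, ← mul_add, ← Complex.ofReal_add,
        ← Complex.ofReal_add]
      congr 3
      rw [hX, hu, inner_smul_left, inner_smul_left, inner_smul_right, inner_add_left, inner_smul_left,
        inner_smul_left, real_inner_comm ξ (x - y)]
      simp only [conj_trivial]
      field_simp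
      ring
    -- The Gaussian Fourier formula is written for width `4 ħ`; here the width is `ħ`, so it is
    -- applied with `ħ / 4`.
    have e4 : ħ = 4 * (ħ / 4) := by ring
    rw [← e4]
    rw [Complex.ofReal_mul (Real.exp (-‖X‖ ^ 2 / ħ))]
    linear_combination (((Real.exp (-‖X‖ ^ 2 / ħ) : ℝ) : ℂ) *
      ((Real.exp (-‖ξ‖ ^ 2 / ħ) : ℝ) : ℂ) * b w) * e3
  rw [integral_congr_ae (Eventually.of_forall e2), integral_const_mul,
    integral_gauss_fourier (by positivity), gaussState_mul_conj hħ, ← hn]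
  have e5 : -‖(1 / 4 : ℝ) • u‖ ^ 2 / (ħ / 4) = -‖u‖ ^ 2 / (4 * ħ) := by
    rw [norm_smul, Real.norm_of_nonneg (by norm_num)]
    field_simp
  rw [e5, ← hX, ← hu, hκ]
  have hM' : (gaussMass E ħ : ℂ) ≠ 0 := by exact_mod_cast hM.ne'
  push_cast
  field_simp

/-- The trace norm of the Weyl quantization of a smooth compactly supported symbol is finite. -/
theorem exists_sum_norm_inner_weyl_le {ħ : ℝ} (hħ : 0 < ħ) {f : E × E → ℝ}
    (hf : ContDiff ℝ ∞ f) (hfc : HasCompactSupport f)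
    {T : Lp ℂ 2 (volume : Measure E) →L[ℂ] Lp ℂ 2 (volume : Measure E)}
    (hT : ∀ v, T v =ᵐ[volume] fun x => ∫ y, weylKernel ħ f x y * v y) :
    ∃ C : ℝ, ∀ {ι : Type _} {e : ι → Lp ℂ 2 (volume : Measure E)}, Orthonormal ℂ e →
      ∀ F : Finset ι, ∑ i ∈ F, ‖inner ℂ (e i) (T (e i))‖ ≤ C := by
  obtain ⟨b, hb, hK⟩ := exists_weylKernel_superposition hħ hf hfc
  have h1 : Continuous fun p : WithLp 2 (E × E) × E =>
      ((-((Real.pi * ħ) • p.1.snd), (Real.pi * ħ) • p.1.fst), p.2) := by fun_prop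
  have h2 : Continuous fun p : WithLp 2 (E × E) × E =>
      (((Real.pi * ħ) • p.1.snd, -((Real.pi * ħ) • p.1.fst)), p.2) := by fun_prop
  exact ⟨_, fun he F => sum_norm_inner_superposition_le hb
    (g := fun w => gaussState ħ (-((Real.pi * ħ) • w.snd), (Real.pi * ħ) • w.fst))
    (g' := fun w => gaussState ħ ((Real.pi * ħ) • w.snd, -((Real.pi * ħ) • w.fst)))
    ((continuous_gaussState ħ).comp h1).stronglyMeasurable
    ((continuous_gaussState ħ).comp h2).stronglyMeasurable
    (fun w => lintegral_enorm_sq_gaussState hħ _) (fun w => lintegral_enorm_sq_gaussState hħ _)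
    (stronglyMeasurable_weylKernel ħ hf.continuous)
    (lintegral_enorm_sq_weylKernel_ne_top hħ hf.continuous hfc) hT hK he F⟩

end WeylTrace

theorem weylBounds_and_weylLaw_of_ennreal {ι M : Type*} [MeasurableSpace M] (l : Filter ι)
    (vol : Measure M) (c : ι → ℝ) (a : ι → M → ℝ) (n : ι → ℕ) {ε : ℝ} (hε : 0 < ε) (η : ι → ℝ)
    (hη : Tendsto η l (𝓝 0)) (hη0 : ∀ᶠ i in l, 0 ≤ η i) (hc : ∀ᶠ i in l, 0 < c i)
    (hfin : ∀ᶠ i in l, vol {z | 0 < |a i z|} ≠ ⊤)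
    (hn : ∀ᶠ i in l, ∀ δ : ℝ, 0 < δ →
      (n i : ENNReal) ≤ (ENNReal.ofReal (c i) • vol) {z | ε - δ < |a i z|} +
        ENNReal.ofReal (c i * η i) * vol {z | 0 < |a i z|} / ENNReal.ofReal (δ ^ 2) ∧
      (ENNReal.ofReal (c i) • vol) {z | ε + δ < |a i z|} ≤ n i +
        ENNReal.ofReal (c i * η i) * vol {z | 0 < |a i z|} / ENNReal.ofReal (δ ^ 2)) :
    WeylBounds l vol c a n ε ∧ (NoConcentration l vol a ε → WeylLaw l vol c a n ε) := by
  refine weylBounds_and_weylLaw l vol c a n hε η hη hc hfin ?_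
  filter_upwards [hη0, hc, hfin, hn] with i h0 hci hf hi δ hδ hδε
  exact counting_toReal hf hci.le h0 hδ hδε (hi δ hδ).1 (hi δ hδ).2

theorem HasCompactSupport.measure_abs_pos_ne_top {M : Type*} [TopologicalSpace M]
    [MeasurableSpace M] {vol : Measure M} [IsFiniteMeasureOnCompacts vol] {f : M → ℝ}
    (hf : HasCompactSupport f) : vol {z | 0 < |f z|} ≠ ⊤ := by
  refine ne_top_of_le_ne_top hf.isCompact.measure_lt_top.ne (measure_mono fun z hz => ?_)
  exact subset_tsupport _ (abs_pos.1 hz)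

/-! ### Uniform symbol bounds and the Weyl law on `ℝ^d`. -/

section SymbolBounds

variable {E : Type*} [NormedAddCommGroup E] [NormedSpace ℝ E] {μ : ℝ} {a : ℝ → E × E → ℝ}

theorem IsSymbol.exists_abs_le (ha : IsSymbol μ 0 a) :
    ∃ C, 0 ≤ C ∧ ∀ ħ, 0 < ħ → ħ ≤ 1 → ∀ z, |a ħ z| ≤ C := by
  obtain ⟨C, hC⟩ := ha.2 0 0
  refine ⟨max C 0, le_max_right _ _, fun ħ h0 h1 z => ?_⟩
  have := hC ħ h0 h1 z.1 z.2 Fin.elim0 Fin.elim0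
  simp at this
  exact this.trans (le_max_left _ _)

/-- The order `m` is taken equal to the number of `ξ` derivatives, so that the weight `⟨ξ⟩^(m - q)`
is `1` and the bound is uniform on phase space. -/
theorem IsSymbol.exists_abs_fderiv_le (ha0 : IsSymbol μ 0 a) (ha1 : IsSymbol μ 1 a) :
    ∃ C, 0 ≤ C ∧ ∀ ħ, 0 < ħ → ħ ≤ 1 → ∀ z u,
      |fderiv ℝ (a ħ) z (u, 0)| ≤ C * ħ ^ (-μ) * ‖u‖ ∧
      |fderiv ℝ (a ħ) z (0, u)| ≤ C * ħ ^ (-μ) * ‖u‖ := by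
  obtain ⟨C, hC⟩ := ha0.2 1 0
  obtain ⟨D, hD⟩ := ha1.2 0 1
  refine ⟨max 0 (max C D), le_max_left _ _, fun ħ h0 h1 z u => ⟨?_, ?_⟩⟩
  · have := hC ħ h0 h1 z.1 z.2 (fun _ => u) Fin.elim0
    rw [show ∀ m, iteratedFDeriv ℝ (1 + 0) (a ħ) (z.1, z.2) m = fderiv ℝ (a ħ) z (m 0) from
      fun m => iteratedFDeriv_one_apply m] at this
    have e : Fin.append (fun _ : Fin 1 => (u, (0 : E))) (fun i : Fin 0 => ((0 : E), i.elim0)) 0 =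
      (u, 0) := Fin.append_left _ _ 0
    simp [e] at this
    refine this.trans ?_
    gcongr
    exact (le_max_left _ _).trans (le_max_right _ _)
  · have := hD ħ h0 h1 z.1 z.2 Fin.elim0 (fun _ => u)
    rw [show ∀ m, iteratedFDeriv ℝ (0 + 1) (a ħ) (z.1, z.2) m = fderiv ℝ (a ħ) z (m 0) from
      fun m => iteratedFDeriv_one_apply m] at this
    have e : Fin.append (fun i : Fin 0 => (i.elim0, (0 : E))) (fun _ : Fin 1 => ((0 : E), u)) 0 =
      (0, u) := Fin.append_right _ _ 0
    simp [e] at this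
    refine this.trans ?_
    gcongr
    exact (le_max_right _ _).trans (le_max_right _ _)

theorem abs_sub_le_of_abs_fderiv_le {F : Type*} [NormedAddCommGroup F] [NormedSpace ℝ F]
    {f : E × F → ℝ} (hf : Differentiable ℝ f) {Λ : ℝ}
    (h1 : ∀ z u, |fderiv ℝ f z (u, 0)| ≤ Λ * ‖u‖) (h2 : ∀ z u, |fderiv ℝ f z (0, u)| ≤ Λ * ‖u‖)
    (hΛ : 0 ≤ Λ) (w z : E × F) : |f w - f z| ≤ Λ * (‖w.1 - z.1‖ + ‖w.2 - z.2‖) := by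
  have e1 : |f (w.1, w.2) - f (z.1, w.2)| ≤ Λ * ‖w.1 - z.1‖ := by
    refine Convex.norm_image_sub_le_of_norm_hasFDerivWithin_le (𝕜 := ℝ)
      (f := fun x => f (x, w.2)) (s := Set.univ)
      (f' := fun x => (fderiv ℝ f (x, w.2)).comp (.inl ℝ E F))
      (fun x _ => (((hf (x, w.2)).hasFDerivAt).comp x
        (hasFDerivAt_prodMk_left x w.2)).hasFDerivWithinAt)
      (fun x _ => ContinuousLinearMap.opNorm_le_bound _ hΛ fun u => by
        simpa using h1 (x, w.2) u) convex_univ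
      (Set.mem_univ _) (Set.mem_univ _)
  have e2 : |f (z.1, w.2) - f (z.1, z.2)| ≤ Λ * ‖w.2 - z.2‖ := by
    refine Convex.norm_image_sub_le_of_norm_hasFDerivWithin_le (𝕜 := ℝ)
      (f := fun x => f (z.1, x)) (s := Set.univ)
      (f' := fun x => (fderiv ℝ f (z.1, x)).comp (.inr ℝ E F))
      (fun x _ => (((hf (z.1, x)).hasFDerivAt).comp x
        (hasFDerivAt_prodMk_right z.1 x)).hasFDerivWithinAt)
      (fun x _ => ContinuousLinearMap.opNorm_le_bound _ hΛ fun u => by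
        simpa using h2 (z.1, x) u) convex_univ
      (Set.mem_univ _) (Set.mem_univ _)
  calc |f w - f z| = |(f (w.1, w.2) - f (z.1, w.2)) + (f (z.1, w.2) - f (z.1, z.2))| := by
        congr 1; ring
    _ ≤ _ := (abs_add_le _ _).trans (by rw [mul_add]; exact add_le_add e1 e2)

end SymbolBounds

/-- The Weyl law on `ℝ^d`. -/
theorem weylLaw_euclidean (μ : ℝ) (hμ : μ < 1 / 2)
    (d : ℕ) (a : ℝ → EuclideanSpace ℝ (Fin d) × EuclideanSpace ℝ (Fin d) → ℝ)
    (ha : ∀ m : ℝ, IsSymbol μ m a) (hac : ∀ ħ : ℝ, 0 < ħ → HasCompactSupport (a ħ)) :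
    ∃ A : ℝ → (Lp ℂ 2 (volume : Measure (EuclideanSpace ℝ (Fin d))) →L[ℂ]
        Lp ℂ 2 (volume : Measure (EuclideanSpace ℝ (Fin d)))),
      (∀ ħ : ℝ, 0 < ħ → IsWeylQuantization ħ (a ħ) (A ħ) ∧
        IsSelfAdjoint (A ħ) ∧ IsTraceClass (A ħ)) ∧
      ∀ ε : ℝ, 0 < ε →
        (∀ ħ : ℝ, 0 < ħ → FinitelyManyOuter (A ħ) ε) ∧
        WeylBounds (𝓝[>] (0 : ℝ)) volume (fun ħ => 1 / (2 * Real.pi * ħ) ^ d) a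
          (fun ħ => outerCount (A ħ) ε) ε ∧
        (NoConcentration (𝓝[>] (0 : ℝ)) volume a ε →
          WeylLaw (𝓝[>] (0 : ℝ)) volume (fun ħ => 1 / (2 * Real.pi * ħ) ^ d) a
            (fun ħ => outerCount (A ħ) ε) ε) := by
  have hs : ∀ ħ, 0 < ħ → ContDiff ℝ ∞ (a ħ) := (ha 0).1
  have hex : ∀ ħ : ℝ, ∃ T : Lp ℂ 2 (volume : Measure (EuclideanSpace ℝ (Fin d))) →L[ℂ]
      Lp ℂ 2 (volume : Measure (EuclideanSpace ℝ (Fin d))), 0 < ħ →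
      ∀ v, T v =ᵐ[volume] fun x => ∫ y, weylKernel ħ (a ħ) x y * v y := fun ħ => by
    by_cases hħ : 0 < ħ
    · obtain ⟨T, hT⟩ := exists_kernelOperator
        (stronglyMeasurable_weylKernel ħ (hs ħ hħ).continuous)
        (lintegral_enorm_sq_weylKernel_ne_top hħ (hs ħ hħ).continuous (hac ħ hħ))
      exact ⟨T, fun _ => hT⟩
    · exact ⟨0, fun h => absurd h hħ⟩
  choose A hA using hex
  have hsa : ∀ ħ, 0 < ħ → IsSelfAdjoint (A ħ) := fun ħ hħ => isSelfAdjoint_of_kernel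
    (stronglyMeasurable_weylKernel ħ (hs ħ hħ).continuous)
    (lintegral_enorm_sq_weylKernel_ne_top hħ (hs ħ hħ).continuous (hac ħ hħ))
    (weylKernel_symm ħ (a ħ)) (hA ħ hħ)
  have hcp : ∀ ħ, 0 < ħ → IsCompactOperator (A ħ) := fun ħ hħ => by
    obtain ⟨w, b, -⟩ := exists_hilbertBasis ℂ
      (Lp ℂ 2 (volume : Measure (EuclideanSpace ℝ (Fin d))))
    exact isCompactOperator_of_summable_norm_sq (A ħ) b (summable_norm_sq_of_kernel
      (stronglyMeasurable_weylKernel ħ (hs ħ hħ).continuous)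
      (lintegral_enorm_sq_weylKernel_ne_top hħ (hs ħ hħ).continuous (hac ħ hħ))
      (hA ħ hħ) b.orthonormal)
  have htr : ∀ ħ, 0 < ħ → ∃ C : ℝ, ∀ (s : Set (Lp ℂ 2 (volume : Measure (EuclideanSpace ℝ (Fin d)))))
      (b : HilbertBasis s ℂ (Lp ℂ 2 (volume : Measure (EuclideanSpace ℝ (Fin d))))) (F : Finset s),
      ∑ i ∈ F, ‖inner ℂ (b i) (A ħ (b i))‖ ≤ C := fun ħ hħ => by
    obtain ⟨C, hC⟩ := exists_sum_norm_inner_weyl_le hħ (hs ħ hħ) (hac ħ hħ) (hA ħ hħ)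
    exact ⟨C, fun s b F => hC b.orthonormal F⟩
  have hpk := fun (ħ : ℝ) (hħ : 0 < ħ) => traceClass_and_counting (A ħ) (hcp ħ hħ) (hsa ħ hħ)
    (htr ħ hħ).choose (htr ħ hħ).choose_spec
  refine ⟨A, fun ħ hħ => ⟨fun φ => ?_, hsa ħ hħ, (hpk ħ hħ).1⟩, fun ε hε =>
    ⟨fun ħ hħ => ((hpk ħ hħ).2 ε hε).1, ?_⟩⟩
  · filter_upwards [hA ħ hħ (φ.toLp 2 volume)] with x hx
    rw [hx, weylApply]
    refine integral_congr_ae ?_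
    filter_upwards [φ.coeFn_toLp 2 volume] with y hy
    rw [hy, smul_eq_mul]
  · obtain ⟨C, hC0, hC⟩ := (ha 0).exists_abs_le
    obtain ⟨D, hD0, hD⟩ := (ha 0).exists_abs_fderiv_le (ha 1)
    have hev : ∀ᶠ ħ in 𝓝[>] (0 : ℝ), 0 < ħ ∧ ħ ≤ 1 := by
      filter_upwards [Ioc_mem_nhdsGT (zero_lt_one' ℝ)] with ħ h using h
    -- The relative defect: sup bound times Lipschitz constant `D ħ^(-μ)` times Gaussian width `√ħ`.
    -- It is of order `ħ^(1/2 - μ)`.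
    refine weylBounds_and_weylLaw_of_ennreal _ _ _ _ _ hε
      (fun ħ => 4 * C * (D * ħ ^ (-μ)) * (√ħ * 2 ^ ((d : ℝ) / 2))) ?_ ?_ ?_ ?_ ?_
    · have h1 : Tendsto (fun ħ : ℝ => (4 * C * D * 2 ^ ((d : ℝ) / 2)) * ħ ^ (1 / 2 - μ))
          (𝓝[>] 0) (𝓝 0) := by
        have h2 : Tendsto (fun ħ : ℝ => ħ ^ (1 / 2 - μ)) (𝓝[>] 0) (𝓝 0) := by
          have := (Real.continuousAt_rpow_const 0 (1 / 2 - μ) (Or.inr (by linarith))).tendsto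
          rw [Real.zero_rpow (by linarith)] at this
          exact this.mono_left nhdsWithin_le_nhds
        simpa using h2.const_mul (4 * C * D * 2 ^ ((d : ℝ) / 2))
      refine h1.congr' ?_
      filter_upwards [hev] with ħ hħ
      rw [sub_eq_add_neg, Real.rpow_add hħ.1, Real.sqrt_eq_rpow]
      ring
    · filter_upwards [hev] with ħ hħ
      have := hħ.1
      positivity
    · filter_upwards [hev] with ħ hħ
      have := hħ.1
      positivity
    · filter_upwards [hev] with ħ hħ using (hac ħ hħ.1).measure_abs_pos_ne_top
    · filter_upwards [hev] with ħ hħ δ hδ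
      have hΛ0 : 0 ≤ D * ħ ^ (-μ) := mul_nonneg hD0 (Real.rpow_nonneg hħ.1.le _)
      have hR := lintegral_gaussVec_defect_le hħ.1 (hs ħ hħ.1).continuous (hac ħ hħ.1)
        (hC ħ hħ.1 hħ.2) hΛ0 (abs_sub_le_of_abs_fderiv_le
          ((hs ħ hħ.1).differentiable (by simp)) (fun z u => (hD ħ hħ.1 hħ.2 z u).1)
          (fun z u => (hD ħ hħ.1 hħ.2 z u).2) hΛ0) (hA ħ hħ.1)
      have hres := lintegral_enorm_sq_inner_gaussVec (E := EuclideanSpace ℝ (Fin d)) hħ.1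
      rw [finrank_euclideanSpace_fin] at hR hres
      exact ((hpk ħ hħ.1).2 ε hε).2 _ (gaussVec ħ) (norm_gaussVec hħ.1)
        (measurable_inner_gaussVec hħ.1) hres (a ħ) (hs ħ hħ.1).continuous.measurable _ hR δ hδ

/-! ### Operators given by a summable block matrix. -/

section Frames

variable {H D : Type*} [NormedAddCommGroup H] [InnerProductSpace ℂ H] [CompleteSpace H]
  [NormedAddCommGroup D] [InnerProductSpace ℂ D] [CompleteSpace D]

/-- The operators `J k` are isometries of `D` onto mutually orthogonal subspaces spanning `H`. -/
structure IsFrame (J : ℤ → D →L[ℂ] H) : Prop where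
  inner_apply : ∀ k l d d', inner ℂ (J k d) (J l d') = if k = l then inner ℂ d d' else 0
  tsum_enorm_sq : ∀ v, ∑' k, ‖(J k).adjoint v‖ₑ ^ 2 = ‖v‖ₑ ^ 2

namespace IsFrame

variable {J : ℤ → D →L[ℂ] H}

theorem adjoint_apply (hJ : IsFrame J) (k l : ℤ) (d : D) : (J l).adjoint (J k d) = if k = l then d else 0 := by
  refine ext_inner_left ℂ fun d' => ?_
  rw [ContinuousLinearMap.adjoint_inner_right, hJ.inner_apply]
  by_cases h : k = l
  · simp [h]
  · simp [h, Ne.symm h]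

theorem norm_apply (hJ : IsFrame J) (k : ℤ) (d : D) : ‖J k d‖ = ‖d‖ := by
  have h : ‖J k d‖ ^ 2 = ‖d‖ ^ 2 := by
    rw [← inner_self_eq_norm_sq (𝕜 := ℂ), ← inner_self_eq_norm_sq (𝕜 := ℂ), hJ.inner_apply, if_pos rfl]
  exact (sq_eq_sq₀ (norm_nonneg _) (norm_nonneg _)).1 h

theorem norm_le_one (hJ : IsFrame J) (k : ℤ) : ‖J k‖ ≤ 1 :=
  ContinuousLinearMap.opNorm_le_bound _ zero_le_one fun d => by rw [hJ.norm_apply, one_mul]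

theorem norm_adjoint_le_one (hJ : IsFrame J) (k : ℤ) : ‖(J k).adjoint‖ ≤ 1 := by
  rw [LinearIsometryEquiv.norm_map]; exact hJ.norm_le_one k

end IsFrame

/-- The operator on `H` with matrix `M` in the frame `J`. -/
noncomputable def matrixOp (J : ℤ → D →L[ℂ] H) (M : ℤ × ℤ → D →L[ℂ] D) : H →L[ℂ] H :=
  ∑' p, (J p.1).comp ((M p).comp (J p.2).adjoint)

namespace IsFrame

variable {J : ℤ → D →L[ℂ] H} {M : ℤ × ℤ → D →L[ℂ] D}

theorem norm_comp_le (hJ : IsFrame J) (p : ℤ × ℤ) : ‖(J p.1).comp ((M p).comp (J p.2).adjoint)‖ ≤ ‖M p‖ := by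
  refine (ContinuousLinearMap.opNorm_comp_le _ _).trans ?_
  refine (mul_le_of_le_one_left (norm_nonneg _) (hJ.norm_le_one _)).trans ?_
  refine (ContinuousLinearMap.opNorm_comp_le _ _).trans ?_
  exact mul_le_of_le_one_right (norm_nonneg _) (hJ.norm_adjoint_le_one _)

theorem hasSum_matrixOp (hJ : IsFrame J) (hM : Summable fun p => ‖M p‖) : HasSum (fun p => (J p.1).comp ((M p).comp (J p.2).adjoint))
    (matrixOp J M) :=
  (Summable.of_norm_bounded hM fun p => hJ.norm_comp_le p).hasSum

theorem hasSum_matrixOp_apply (hJ : IsFrame J) (hM : Summable fun p => ‖M p‖)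
    (v : H) :
    HasSum (fun p => J p.1 (M p ((J p.2).adjoint v))) (matrixOp J M v) :=
  (hJ.hasSum_matrixOp hM).mapL (ContinuousLinearMap.apply ℂ H v)

theorem hasSum_adjoint_matrixOp (hJ : IsFrame J) (hM : Summable fun p => ‖M p‖)
    (v : H) (l : ℤ) :
    HasSum (fun k => M (l, k) ((J k).adjoint v)) ((J l).adjoint (matrixOp J M v)) := by
  have h := (hJ.hasSum_matrixOp_apply hM v).mapL (J l).adjoint
  have hinj : Function.Injective fun k : ℤ => (l, k) := fun a b h => (Prod.mk.inj h).2
  rw [← hinj.hasSum_iff] at h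
  · convert h using 2 with k
    simp [hJ.adjoint_apply]
  · rintro ⟨a, b⟩ hab
    have : a ≠ l := fun h => hab ⟨b, by simp [h]⟩
    simp [hJ.adjoint_apply, this]

theorem isSelfAdjoint_matrixOp (hsym : ∀ l k, (M (l, k)).adjoint = M (k, l)) :
    IsSelfAdjoint (matrixOp J M) := by
  rw [IsSelfAdjoint, matrixOp, tsum_star, ← (Equiv.prodComm ℤ ℤ).tsum_eq]
  congr 1
  ext1 p
  rw [ContinuousLinearMap.star_eq_adjoint, Equiv.prodComm_apply]
  simp only [Prod.swap, ContinuousLinearMap.adjoint_comp, ContinuousLinearMap.adjoint_adjoint]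
  rw [hsym, ContinuousLinearMap.comp_assoc]

/-- Each block factors through the finite-dimensional space `D`, and the series of blocks converges
in operator norm. -/
theorem isCompactOperator_matrixOp [FiniteDimensional ℂ D] (hJ : IsFrame J)
    (hM : Summable fun p => ‖M p‖) : IsCompactOperator (matrixOp J M) := by
  refine isCompactOperator_of_tendsto (hJ.hasSum_matrixOp hM) (Eventually.of_forall fun F => ?_)
  have h : ∀ p, (J p.1).comp ((M p).comp (J p.2).adjoint) ∈ compactOperator (RingHom.id ℂ) H H :=
    fun p => by
      have := FiniteDimensional.proper ℂ D
      have h1 : IsCompactOperator (J p.1) := isCompactOperator_of_locallyCompactSpace_rng (J p.1)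
      exact h1.comp_clm _
  exact Submodule.sum_mem _ fun p _ => h p

/-- A block has trace norm at most `dim D` times its operator norm: by Bessel the sums of `‖(J k)* b
i‖²` over `i` are at most `dim D`, and the arithmetic-geometric mean inequality separates the two
factors of each matrix element. -/
theorem sum_norm_inner_matrixOp_le [FiniteDimensional ℂ D] (hJ : IsFrame J)
    (hM : Summable fun p => ‖M p‖) {ι : Type*} {b : ι → H}
    (hb : Orthonormal ℂ b) (F : Finset ι) :
    ∑ i ∈ F, ‖inner ℂ (b i) (matrixOp J M (b i))‖ ≤ Module.finrank ℂ D * ∑' p, ‖M p‖ := by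
  have h1 : ∀ k, ∑ i ∈ F, ‖(J k).adjoint (b i)‖ ^ 2 ≤ Module.finrank ℂ D := fun k => by
    let d := stdOrthonormalBasis ℂ D
    calc ∑ i ∈ F, ‖(J k).adjoint (b i)‖ ^ 2 = ∑ i ∈ F, ∑ j, ‖inner ℂ (b i) (J k (d j))‖ ^ 2 := by
          refine Finset.sum_congr rfl fun i _ => ?_
          rw [← d.sum_sq_norm_inner_right]
          simp_rw [ContinuousLinearMap.adjoint_inner_right, norm_inner_symm (b i)]
      _ = ∑ j, ∑ i ∈ F, ‖inner ℂ (b i) (J k (d j))‖ ^ 2 := Finset.sum_comm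
      _ ≤ ∑ j : Fin (Module.finrank ℂ D), (1 : ℝ) := by
          refine Finset.sum_le_sum fun j _ => (hb.sum_inner_products_le _).trans ?_
          rw [hJ.norm_apply, d.norm_eq_one, one_pow]
      _ = _ := by simp
  have h2 : ∀ i, HasSum (fun p => inner ℂ (b i) (J p.1 (M p ((J p.2).adjoint (b i)))))
      (inner ℂ (b i) (matrixOp J M (b i))) := fun i =>
    (hJ.hasSum_matrixOp_apply hM (b i)).mapL (innerSL ℂ (b i))
  have h3 : ∀ i p, ‖inner ℂ (b i) (J p.1 (M p ((J p.2).adjoint (b i))))‖ ≤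
      ‖M p‖ * ((‖(J p.1).adjoint (b i)‖ ^ 2 + ‖(J p.2).adjoint (b i)‖ ^ 2) / 2) := fun i p => by
    rw [← ContinuousLinearMap.adjoint_inner_left]
    refine (norm_inner_le_norm _ _).trans ?_
    have := (M p).le_opNorm ((J p.2).adjoint (b i))
    have h4 := two_mul_le_add_sq ‖(J p.1).adjoint (b i)‖ ‖(J p.2).adjoint (b i)‖
    calc _ ≤ ‖(J p.1).adjoint (b i)‖ * (‖M p‖ * ‖(J p.2).adjoint (b i)‖) := by gcongr
      _ = ‖M p‖ * (‖(J p.1).adjoint (b i)‖ * ‖(J p.2).adjoint (b i)‖) := by ring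
      _ ≤ _ := by gcongr; linarith
  have h6 : ∀ i, Summable fun p => ‖inner ℂ (b i) (J p.1 (M p ((J p.2).adjoint (b i))))‖ :=
    fun i => by
      refine Summable.of_nonneg_of_le (fun _ => norm_nonneg _) (fun p => ?_)
        (hM.mul_right (‖b i‖ ^ 2))
      refine (h3 i p).trans ?_
      have e : ∀ k, ‖(J k).adjoint (b i)‖ ≤ ‖b i‖ := fun k =>
        ((J k).adjoint.le_opNorm _).trans
          (mul_le_of_le_one_left (norm_nonneg _) (hJ.norm_adjoint_le_one k))
      have e1 := pow_le_pow_left₀ (norm_nonneg _) (e p.1) 2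
      have e2 := pow_le_pow_left₀ (norm_nonneg _) (e p.2) 2
      gcongr
      linarith
  calc ∑ i ∈ F, ‖inner ℂ (b i) (matrixOp J M (b i))‖ ≤
      ∑ i ∈ F, ∑' p, ‖inner ℂ (b i) (J p.1 (M p ((J p.2).adjoint (b i))))‖ := by
        refine Finset.sum_le_sum fun i _ => ?_
        rw [← (h2 i).tsum_eq]
        exact norm_tsum_le_tsum_norm (h6 i)
    _ = ∑' p, ∑ i ∈ F, ‖inner ℂ (b i) (J p.1 (M p ((J p.2).adjoint (b i))))‖ :=
        (Summable.tsum_finsetSum fun i _ => h6 i).symm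
    _ ≤ ∑' p, Module.finrank ℂ D * ‖M p‖ := by
        refine (summable_sum fun i _ => h6 i).tsum_le_tsum (fun p => ?_) (hM.mul_left _)
        refine (Finset.sum_le_sum fun i _ => h3 i p).trans ?_
        rw [← Finset.mul_sum, ← Finset.sum_div, Finset.sum_add_distrib, mul_comm]
        gcongr
        linarith [h1 p.1, h1 p.2]
    _ = _ := tsum_mul_left

end IsFrame

end Frames

/-! ### The Fourier basis of `L²(S¹; D)` as a frame. -/

section CircleFrame

theorem volume_unitAddCircle_eq :
    (volume : Measure UnitAddCircle) = AddCircle.haarAddCircle (T := (1 : ℝ)) := by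
  have := AddCircle.volume_eq_smul_haarAddCircle (T := (1 : ℝ))
  simpa using this

/-- Parseval's identity on the circle. -/
theorem tsum_enorm_sq_fourierCoeff {g : UnitAddCircle → ℂ} (hg : MemLp g 2 volume) :
    ∑' k, ‖fourierCoeff g k‖ₑ ^ 2 = ∫⁻ x, ‖g x‖ₑ ^ 2 := by
  rw [volume_unitAddCircle_eq] at hg ⊢
  have h1 := hasSum_sq_fourierCoeff (T := (1 : ℝ)) (hg.toLp g)
  have h2 : ∀ k, fourierCoeff (hg.toLp g : UnitAddCircle → ℂ) k = fourierCoeff g k :=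
    fun k => congrFun (fourierCoeff_congr_ae hg.coeFn_toLp) k
  simp_rw [h2] at h1
  have h3 : ∑' k, ‖fourierCoeff g k‖ₑ ^ 2 = ENNReal.ofReal (∑' k, ‖fourierCoeff g k‖ ^ 2) := by
    rw [ENNReal.ofReal_tsum_of_nonneg (fun _ => by positivity) h1.summable]
    simp_rw [ENNReal.ofReal_pow (norm_nonneg _), ofReal_norm]
  rw [h3, h1.tsum_eq, ofReal_integral_eq_lintegral_ofReal
    ((memLp_two_iff_integrable_sq_norm (Lp.memLp _).1).1 (Lp.memLp _))
    (Eventually.of_forall fun _ => by positivity)]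
  refine lintegral_congr_ae ?_
  filter_upwards [hg.coeFn_toLp] with x hx
  rw [hx, ENNReal.ofReal_pow (norm_nonneg _), ofReal_norm]

theorem norm_fourier_apply (k : ℤ) (x : UnitAddCircle) : ‖fourier k x‖ = 1 := by
  rw [fourier_apply]; exact Circle.norm_coe _

variable (D : Type*) [NormedAddCommGroup D] [InnerProductSpace ℂ D] [CompleteSpace D]
  [FiniteDimensional ℂ D]

/-- The function `x ↦ e_k(x) d` as a continuous map depending linearly on `d`. -/
noncomputable def fourierSmul (k : ℤ) : D →L[ℂ] C(UnitAddCircle, D) :=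
  LinearMap.mkContinuous
    { toFun := fun d => ⟨fun x => fourier k x • d, by fun_prop⟩
      map_add' := fun a b => by ext x; exact smul_add _ _ _
      map_smul' := fun c a => by ext x; exact smul_comm _ _ _ } 1 fun d => by
    rw [ContinuousMap.norm_le _ (by positivity)]
    intro x
    change ‖fourier k x • d‖ ≤ 1 * ‖d‖
    rw [norm_smul, norm_fourier_apply]

/-- The isometry `d ↦ e_k ⊗ d` of `D` into `L²(S¹; D)`. -/
noncomputable def circleFrame (k : ℤ) : D →L[ℂ] Lp D 2 (volume : Measure UnitAddCircle) :=
  (ContinuousMap.toLp 2 volume ℂ).comp (fourierSmul D k)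

variable {D}

theorem circleFrame_coeFn (k : ℤ) (d : D) :
    circleFrame D k d =ᵐ[volume] fun x => fourier k x • d :=
  ContinuousMap.coeFn_toLp (volume : Measure UnitAddCircle) (p := 2) (𝕜 := ℂ) (fourierSmul D k d)

theorem integral_fourier_unitAddCircle (k : ℤ) :
    ∫ x : UnitAddCircle, fourier k x = if k = 0 then 1 else 0 := by
  have h := fourierCoeff_fourier (T := 1) k
  have h2 := congrFun h 0
  simp only [fourierCoeff, neg_zero, fourier_zero, one_smul] at h2
  rw [volume_unitAddCircle_eq, h2, Pi.single_apply]
  simp [eq_comm]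

theorem inner_circleFrame (k : ℤ) (d : D) (v : Lp D 2 (volume : Measure UnitAddCircle)) :
    inner ℂ (circleFrame D k d) v = fourierCoeff (fun x => inner ℂ d (v x)) k := by
  rw [L2.inner_def, fourierCoeff, ← volume_unitAddCircle_eq]
  refine integral_congr_ae ?_
  filter_upwards [circleFrame_coeFn k d] with x hx
  rw [hx, inner_smul_left, fourier_neg, smul_eq_mul]

theorem memLp_inner_of_memLp (d : D) (v : Lp D 2 (volume : Measure UnitAddCircle)) :
    MemLp (fun x => inner ℂ d (v x)) 2 volume :=
  (innerSL ℂ d).comp_memLp' (Lp.memLp v)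

theorem inner_adjoint_circleFrame (k : ℤ) (d : D) (v : Lp D 2 (volume : Measure UnitAddCircle)) :
    inner ℂ d ((circleFrame D k).adjoint v) = fourierCoeff (fun x => inner ℂ d (v x)) k := by
  rw [ContinuousLinearMap.adjoint_inner_right, inner_circleFrame]

theorem isFrame_circleFrame : IsFrame (circleFrame D) where
  inner_apply k l d d' := by
    rw [L2.inner_def]
    have h : (fun x => inner ℂ (circleFrame D k d x) (circleFrame D l d' x)) =ᵐ[volume]
        fun x => fourier (l - k) x * inner ℂ d d' := by
      filter_upwards [circleFrame_coeFn k d, circleFrame_coeFn l d'] with x h1 h2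
      rw [h1, h2, inner_smul_left, inner_smul_right, sub_eq_add_neg, fourier_add, fourier_neg]
      ring
    rw [integral_congr_ae h, integral_mul_const, integral_fourier_unitAddCircle]
    by_cases hkl : k = l
    · simp [hkl]
    · have : l - k ≠ 0 := fun h => hkl (by omega)
      simp [hkl, this]
  tsum_enorm_sq v := by
    let d := stdOrthonormalBasis ℂ D
    have e : ∀ w : D, ‖w‖ₑ ^ 2 = ∑ j, ‖inner ℂ (d j) w‖ₑ ^ 2 := fun w => by
      rw [← ofReal_norm, ← ENNReal.ofReal_pow (norm_nonneg _), ← d.sum_sq_norm_inner_right,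
        ENNReal.ofReal_sum_of_nonneg fun _ _ => by positivity]
      simp_rw [ENNReal.ofReal_pow (norm_nonneg _), ofReal_norm]
    simp_rw [e, inner_adjoint_circleFrame]
    rw [Summable.tsum_finsetSum fun _ _ => ENNReal.summable]
    simp_rw [tsum_enorm_sq_fourierCoeff (memLp_inner_of_memLp _ v)]
    rw [← lintegral_enorm_sq_coeFn, ← lintegral_finsetSum' _ fun j _ =>
      ((memLp_inner_of_memLp (d j) v).1.enorm.pow_const 2)]
    simp_rw [← e]

theorem adjoint_circleFrame_eq_fourierCoeff (k : ℤ) {u : Lp D 2 (volume : Measure UnitAddCircle)}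
    {φ : UnitAddCircle → D} (h : u =ᵐ[volume] φ) :
    (circleFrame D k).adjoint u = fourierCoeff φ k := by
  have h' : u =ᵐ[AddCircle.haarAddCircle] φ := by rwa [← volume_unitAddCircle_eq]
  have h2 : fourierCoeff φ k = fourierCoeff (u : UnitAddCircle → D) k :=
    congrFun (fourierCoeff_congr_ae h'.symm) k
  rw [h2]
  refine ext_inner_left ℂ fun d => ?_
  rw [inner_adjoint_circleFrame, fourierCoeff, fourierCoeff]
  have hi : Integrable (u : UnitAddCircle → D) AddCircle.haarAddCircle := by
    rw [← volume_unitAddCircle_eq]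
    exact (Lp.memLp u).integrable (by norm_num)
  rw [← integral_inner (hi.fourier_smul _)]
  simp_rw [inner_smul_right, smul_eq_mul]

/-- Absolute summability gives convergence in the uniform norm, so a sum taken in `L²` may be
evaluated pointwise almost everywhere. -/
theorem coeFn_eq_tsum_of_hasSum {ι : Type*} {l : ι → ℤ} {c : ι → D}
    (hc : Summable fun i => ‖c i‖) {u : Lp D 2 (volume : Measure UnitAddCircle)}
    (hu : HasSum (fun i => circleFrame D (l i) (c i)) u) :
    u =ᵐ[volume] fun x => ∑' i, fourier (l i) x • c i := by
  have hG : Summable fun i => fourierSmul D (l i) (c i) := by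
    refine Summable.of_norm_bounded hc fun i => ?_
    rw [ContinuousMap.norm_le _ (norm_nonneg _)]
    intro x
    change ‖fourier (l i) x • c i‖ ≤ _
    rw [norm_smul, norm_fourier_apply, one_mul]
  have h1 := hG.hasSum.mapL (ContinuousMap.toLp (E := D) 2 (volume : Measure UnitAddCircle) ℂ)
  rw [hu.unique h1]
  filter_upwards [ContinuousMap.coeFn_toLp (volume : Measure UnitAddCircle) (p := 2) (𝕜 := ℂ)
    (∑' i, fourierSmul D (l i) (c i))] with x hx
  rw [hx]
  exact (ContinuousMap.tsum_apply hG x).symm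

end CircleFrame

/-! ### Smooth functions on the cylinder and their Fourier coefficients in `x`. -/

section Cylinder

/-- The partial derivative in the first variable. -/
noncomputable def dX (F : ℝ × ℝ → ℝ) (z : ℝ × ℝ) : ℝ := fderiv ℝ F z (1, 0)

/-- The partial derivative in the second variable. -/
noncomputable def dXi (F : ℝ × ℝ → ℝ) (z : ℝ × ℝ) : ℝ := fderiv ℝ F z (0, 1)

/-- Smooth functions on the plane, `1`-periodic in the first variable and supported in
`|ξ| ≤ R`. -/
structure IsCyl (R : ℝ) (F : ℝ × ℝ → ℝ) : Prop where
  smooth : ContDiff ℝ ∞ F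
  periodic : ∀ x ξ, F (x + 1, ξ) = F (x, ξ)
  supp : ∀ x ξ, R < |ξ| → F (x, ξ) = 0

namespace IsCyl

variable {R : ℝ} {F : ℝ × ℝ → ℝ}

theorem differentiable (hF : IsCyl R F) : Differentiable ℝ F := hF.smooth.differentiable (by simp)

theorem continuous (hF : IsCyl R F) : Continuous F := hF.smooth.continuous

theorem fderiv_apply (hF : IsCyl R F) (v : ℝ × ℝ) : IsCyl R fun z => fderiv ℝ F z v where
  smooth := (hF.smooth.fderiv_right (m := ∞) (by simp)).clm_apply contDiff_const
  periodic x ξ := by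
    have h : (fun z => F (z + (1, 0))) = F := by
      ext ⟨a, b⟩
      simpa using hF.periodic a b
    have h2 := fderiv_comp_add_right (𝕜 := ℝ) (f := F) (x := (x, ξ)) ((1 : ℝ), (0 : ℝ))
    rw [h] at h2
    simp only [Prod.mk_add_mk, add_zero] at h2
    rw [← h2]
  supp x ξ h := by
    have h1 : F =ᶠ[𝓝 (x, ξ)] fun _ => 0 := by
      have h2 : {z : ℝ × ℝ | R < |z.2|} ∈ 𝓝 (x, ξ) :=
        (isOpen_lt continuous_const (by fun_prop)).mem_nhds h
      filter_upwards [h2] with z hz using hF.supp z.1 z.2 hz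
    rw [h1.fderiv_eq]
    simp

theorem deriv_fst (hF : IsCyl R F) : IsCyl R (dX F) := hF.fderiv_apply (1, 0)

theorem deriv_snd (hF : IsCyl R F) : IsCyl R (dXi F) := hF.fderiv_apply (0, 1)

theorem hasDerivAt_fst (hF : IsCyl R F) (x ξ : ℝ) :
    HasDerivAt (fun x => F (x, ξ)) (dX F (x, ξ)) x :=
  (hF.differentiable (x, ξ)).hasFDerivAt.comp_hasDerivAt x
    ((hasDerivAt_id x).prodMk (hasDerivAt_const x ξ))

theorem hasDerivAt_snd (hF : IsCyl R F) (x ξ : ℝ) :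
    HasDerivAt (fun ξ => F (x, ξ)) (dXi F (x, ξ)) ξ :=
  (hF.differentiable (x, ξ)).hasFDerivAt.comp_hasDerivAt ξ
    ((hasDerivAt_const ξ x).prodMk (hasDerivAt_id ξ))

theorem dXi_dX (hF : IsCyl R F) : dXi (dX F) = dX (dXi F) := by
  ext z
  have hs := (hF.smooth.contDiffAt (x := z)).isSymmSndFDerivAt
      (by simp only [minSmoothness_of_isRCLikeNormedField]; exact WithTop.coe_le_coe.2 le_top)
  have hd : DifferentiableAt ℝ (fderiv ℝ F) z :=
    ((hF.smooth.fderiv_right (m := ∞) (by simp)).differentiable (by simp)) z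
  have e : ∀ v w, fderiv ℝ (fun z => fderiv ℝ F z v) z w = fderiv ℝ (fderiv ℝ F) z w v :=
    fun v w => by
      rw [fderiv_clm_apply hd (differentiableAt_const v)]
      simp
  change fderiv ℝ (fun z => fderiv ℝ F z (1, 0)) z (0, 1) =
    fderiv ℝ (fun z => fderiv ℝ F z (0, 1)) z (1, 0)
  rw [e, e]
  exact hs _ _

theorem periodic_fst (hF : IsCyl R F) (ξ : ℝ) : Function.Periodic (fun x => F (x, ξ)) 1 :=
  fun x => hF.periodic x ξ

theorem exists_abs_le (hF : IsCyl R F) : ∃ B, 0 ≤ B ∧ ∀ z, |F z| ≤ B := by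
  obtain ⟨B, hB⟩ := (isCompact_Icc.prod isCompact_Icc : IsCompact
    (Set.Icc (0 : ℝ) 1 ×ˢ Set.Icc (-R) R)).exists_bound_of_continuousOn hF.continuous.continuousOn
  refine ⟨max B 0, le_max_right _ _, fun z => ?_⟩
  by_cases h : R < |z.2|
  · rw [show F z = 0 from hF.supp z.1 z.2 h]; simp
  · obtain ⟨y, hy, hy2⟩ := (hF.periodic_fst z.2).exists_mem_Ico₀ one_pos z.1
    have : F z = F (y, z.2) := hy2
    rw [this]
    exact (hB (y, z.2) ⟨⟨hy.1, hy.2.le⟩, abs_le.1 (not_lt.1 h)⟩).trans (le_max_left _ _)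

theorem hasCompactSupport_snd (hF : IsCyl R F) (x : ℝ) : HasCompactSupport fun ξ => F (x, ξ) := by
  refine HasCompactSupport.intro (isCompact_Icc (a := -R) (b := R)) fun ξ hξ => hF.supp x ξ ?_
  by_contra h
  exact hξ (abs_le.1 (not_lt.1 h))

theorem continuous_snd (hF : IsCyl R F) (x : ℝ) : Continuous fun ξ => F (x, ξ) :=
  hF.continuous.comp (by fun_prop)

theorem continuous_fst (hF : IsCyl R F) (ξ : ℝ) : Continuous fun x => F (x, ξ) :=
  hF.continuous.comp (by fun_prop)

end IsCyl

/-- The `m`-th Fourier coefficient of `F` in the first variable. -/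
noncomputable def cylCoef (F : ℝ × ℝ → ℝ) (m : ℤ) (ξ : ℝ) : ℂ :=
  ∫ x in (0 : ℝ)..1, fourier (-m) (x : UnitAddCircle) * (F (x, ξ) : ℂ)

theorem continuous_fourier_coe (m : ℤ) : Continuous fun x : ℝ => fourier m (x : UnitAddCircle) :=
  (fourier m).continuous.comp (AddCircle.continuous_mk' 1)

namespace IsCyl

variable {R : ℝ} {F : ℝ × ℝ → ℝ}

theorem norm_cylCoef_le {B : ℝ} (hB : ∀ z, |F z| ≤ B) (m : ℤ) (ξ : ℝ) : ‖cylCoef F m ξ‖ ≤ B := by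
  have := intervalIntegral.norm_integral_le_of_norm_le_const (a := (0 : ℝ)) (b := 1) (C := B)
    (f := fun x : ℝ => fourier (-m) (x : UnitAddCircle) * (F (x, ξ) : ℂ)) fun x _ => by
      rw [norm_mul, norm_fourier_apply, one_mul, Complex.norm_real]
      exact hB _
  rwa [sub_zero, abs_one, mul_one] at this

theorem cylCoef_dX (hF : IsCyl R F) (m : ℤ) (ξ : ℝ) :
    cylCoef (dX F) m ξ = 2 * Real.pi * Complex.I * m * cylCoef F m ξ := by
  have hd : ∀ x : ℝ, HasDerivAt (fun x : ℝ => fourier (-m) (x : UnitAddCircle) * (F (x, ξ) : ℂ))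
      (-2 * Real.pi * Complex.I * m * (fourier (-m) (x : UnitAddCircle) * (F (x, ξ) : ℂ)) +
        fourier (-m) (x : UnitAddCircle) * (dX F (x, ξ) : ℂ)) x := fun x => by
    have h1 := hasDerivAt_fourier_neg 1 m x
    have h2 := (hF.hasDerivAt_fst x ξ).ofReal_comp
    refine (h1.mul h2).congr_deriv ?_
    push_cast
    ring
  have c1 : Continuous fun x : ℝ => fourier (-m) (x : UnitAddCircle) * (F (x, ξ) : ℂ) :=
    (continuous_fourier_coe _).mul (Complex.continuous_ofReal.comp (hF.continuous_fst ξ))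
  have c2 : Continuous fun x : ℝ => fourier (-m) (x : UnitAddCircle) * (dX F (x, ξ) : ℂ) :=
    (continuous_fourier_coe _).mul (Complex.continuous_ofReal.comp (hF.deriv_fst.continuous_fst ξ))
  have c3 : Continuous fun x : ℝ => -2 * Real.pi * Complex.I * m *
      (fourier (-m) (x : UnitAddCircle) * (F (x, ξ) : ℂ)) := continuous_const.mul c1
  have h := intervalIntegral.integral_eq_sub_of_hasDerivAt (a := (0 : ℝ)) (b := 1)
    (fun x _ => hd x) ((c3.add c2).intervalIntegrable _ _)
  rw [intervalIntegral.integral_add (c3.intervalIntegrable _ _)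
    (c2.intervalIntegrable _ _), intervalIntegral.integral_const_mul] at h
  have e : fourier (-m) ((1 : ℝ) : UnitAddCircle) * (F (1, ξ) : ℂ) -
      fourier (-m) ((0 : ℝ) : UnitAddCircle) * (F (0, ξ) : ℂ) = 0 := by
    have h1 : ((1 : ℝ) : UnitAddCircle) = ((0 : ℝ) : UnitAddCircle) := by
      simp
    have h2 := hF.periodic 0 ξ
    rw [zero_add] at h2
    rw [h1, h2, sub_self]
  rw [e] at h
  unfold cylCoef
  linear_combination h

/-- Two integrations by parts in `x`; the factor `(2π)²` they produce exceeds `1` and is dropped. -/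
theorem one_add_sq_mul_norm_cylCoef_le (hF : IsCyl R F) {B : ℝ} (hB : ∀ z, |F z| ≤ B)
    (hB2 : ∀ z, |dX (dX F) z| ≤ B) (m : ℤ) (ξ : ℝ) :
    (1 + (m : ℝ) ^ 2) * ‖cylCoef F m ξ‖ ≤ 2 * B := by
  have h1 := norm_cylCoef_le hB m ξ
  have h2 := norm_cylCoef_le hB2 m ξ
  rw [hF.deriv_fst.cylCoef_dX, hF.cylCoef_dX] at h2
  simp only [norm_mul, Complex.norm_I, Complex.norm_real, Complex.norm_intCast, mul_one,
    Complex.norm_ofNat, Real.norm_of_nonneg Real.pi_pos.le] at h2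
  have h3 : (m : ℝ) ^ 2 * ‖cylCoef F m ξ‖ ≤ 2 * Real.pi * |(m : ℝ)| *
      (2 * Real.pi * |(m : ℝ)| * ‖cylCoef F m ξ‖) := by
    have : 2 * Real.pi * |(m : ℝ)| * (2 * Real.pi * |(m : ℝ)| * ‖cylCoef F m ξ‖) =
      (2 * Real.pi) ^ 2 * ((m : ℝ) ^ 2 * ‖cylCoef F m ξ‖) := by
      rw [← sq_abs (m : ℝ)]; ring
    rw [this]
    refine le_mul_of_one_le_left (by positivity) ?_
    nlinarith [Real.pi_gt_three]
  linarith

theorem continuous_cylCoef (hF : IsCyl R F) (m : ℤ) : Continuous (cylCoef F m) := by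
  refine intervalIntegral.continuous_parametric_intervalIntegral_of_continuous' (f := fun ξ x =>
    fourier (-m) ((x : ℝ) : UnitAddCircle) * (F (x, ξ) : ℂ)) ?_ 0 1
  have := hF.continuous
  have h2 := (continuous_fourier_coe (-m)).comp (_root_.continuous_snd (X := ℝ) (Y := ℝ))
  exact h2.mul (by fun_prop)

theorem hasDerivAt_cylCoef (hF : IsCyl R F) (m : ℤ) (ξ : ℝ) :
    HasDerivAt (cylCoef F m) (cylCoef (dXi F) m ξ) ξ := by
  obtain ⟨B, -, hB⟩ := hF.deriv_snd.exists_abs_le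
  have hc : ∀ {G : ℝ × ℝ → ℝ}, IsCyl R G → ∀ ξ, Continuous fun x : ℝ =>
      fourier (-m) (x : UnitAddCircle) * (G (x, ξ) : ℂ) := fun hG ξ =>
    (continuous_fourier_coe _).mul (Complex.continuous_ofReal.comp (hG.continuous_fst ξ))
  refine (intervalIntegral.hasDerivAt_integral_of_dominated_loc_of_deriv_le (bound := fun _ => B)
    (F' := fun ξ x => fourier (-m) ((x : ℝ) : UnitAddCircle) * (dXi F (x, ξ) : ℂ))
    (Filter.univ_mem) (Eventually.of_forall fun η => (hc hF η).aestronglyMeasurable)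
    ((hc hF ξ).intervalIntegrable _ _) (hc hF.deriv_snd ξ).aestronglyMeasurable
    (Eventually.of_forall fun x _ η _ => ?_) (by simp) (Eventually.of_forall fun x _ η _ => ?_)).2
  · rw [norm_mul, norm_fourier_apply, one_mul, Complex.norm_real]
    exact hB _
  · exact ((hF.hasDerivAt_snd x η).ofReal_comp).const_mul _

theorem cylCoef_eq_zero (hF : IsCyl R F) (m : ℤ) {ξ : ℝ} (h : R < |ξ|) : cylCoef F m ξ = 0 := by
  simp [cylCoef, hF.supp _ ξ h]

/-- The restriction of `F` to a circle `ξ = const`. -/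
noncomputable def onCircle (hF : IsCyl R F) (ξ : ℝ) : C(UnitAddCircle, ℂ) where
  toFun := (hF.periodic_fst ξ).lift.comp id |> fun g x => (g x : ℂ)
  continuous_toFun := by
    refine Complex.continuous_ofReal.comp ?_
    exact continuous_quot_lift _ (hF.continuous_fst ξ)

theorem onCircle_coe (hF : IsCyl R F) (ξ x : ℝ) : hF.onCircle ξ (x : UnitAddCircle) = F (x, ξ) := rfl

theorem fourierCoeff_onCircle (hF : IsCyl R F) (m : ℤ) (ξ : ℝ) :
    fourierCoeff (hF.onCircle ξ) m = cylCoef F m ξ := by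
  rw [fourierCoeff_eq_intervalIntegral _ m 0, cylCoef]
  simp [hF.onCircle_coe]

theorem tsum_enorm_sq_cylCoef (hF : IsCyl R F) (ξ : ℝ) :
    ∑' m, ‖cylCoef F m ξ‖ₑ ^ 2 = ∫⁻ x in Set.Ioc (0 : ℝ) 1, ‖F (x, ξ)‖ₑ ^ 2 := by
  have h := tsum_enorm_sq_fourierCoeff (g := hF.onCircle ξ)
    ((hF.onCircle ξ).continuous.memLp_of_hasCompactSupport (HasCompactSupport.of_compactSpace _))
  simp_rw [hF.fourierCoeff_onCircle] at h
  rw [h, ← UnitAddCircle.lintegral_preimage 0, zero_add]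
  refine lintegral_congr fun x => ?_
  rw [hF.onCircle_coe, ← ofReal_norm, Complex.norm_real, ofReal_norm]

theorem hasSum_cylCoef (hF : IsCyl R F) (x ξ : ℝ) :
    HasSum (fun m => cylCoef F m ξ * fourier m (x : UnitAddCircle)) (F (x, ξ) : ℂ) := by
  obtain ⟨B, -, hB⟩ := hF.exists_abs_le
  obtain ⟨B', -, hB'⟩ := hF.deriv_fst.deriv_fst.exists_abs_le
  have hs : Summable (fourierCoeff (hF.onCircle ξ)) := by
    have h1 : Summable fun m : ℤ => (2 * max B B') * (1 / (1 + (m : ℝ) ^ 2)) := by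
      refine Summable.mul_left _ ?_
      refine Summable.of_norm_bounded_eventually
        (Real.summable_one_div_int_pow (p := 2).2 one_lt_two) ?_
      filter_upwards [(Set.finite_singleton (0 : ℤ)).compl_mem_cofinite] with m hm
      have hm' : (0 : ℝ) < (m : ℝ) ^ 2 := by
        have : (m : ℝ) ≠ 0 := by simpa using hm
        positivity
      rw [Real.norm_of_nonneg (by positivity)]
      gcongr
      linarith
    refine Summable.of_norm_bounded h1 fun m => ?_
    rw [hF.fourierCoeff_onCircle, mul_one_div, le_div_iff₀ (by positivity), mul_comm]
    exact hF.one_add_sq_mul_norm_cylCoef_le (fun z => (hB z).trans (le_max_left _ _))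
      (fun z => (hB' z).trans (le_max_right _ _)) m ξ
  have h2 := has_pointwise_sum_fourier_series_of_summable hs (x : UnitAddCircle)
  simp_rw [hF.fourierCoeff_onCircle, smul_eq_mul] at h2
  exact h2

/-! Energy estimates by integration by parts. -/

theorem integral_sq_dX (hF : IsCyl R F) (ξ : ℝ) : ∫ x in (0 : ℝ)..1, dX F (x, ξ) ^ 2 =
    -∫ x in (0 : ℝ)..1, F (x, ξ) * dX (dX F) (x, ξ) := by
  have h := intervalIntegral.integral_mul_deriv_eq_deriv_mul (a := (0 : ℝ)) (b := 1)
    (fun x _ => hF.hasDerivAt_fst x ξ) (fun x _ => hF.deriv_fst.hasDerivAt_fst x ξ)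
    ((hF.deriv_fst.continuous_fst ξ).intervalIntegrable _ _)
    ((hF.deriv_fst.deriv_fst.continuous_fst ξ).intervalIntegrable _ _)
  have h1 := hF.periodic 0 ξ
  have h2 := hF.deriv_fst.periodic 0 ξ
  rw [zero_add] at h1 h2
  rw [h, h1, h2, sub_self, zero_sub, neg_neg]
  simp_rw [sq]

theorem integral_mul_dXi (hF : IsCyl R F) {G : ℝ × ℝ → ℝ} (hG : IsCyl R G) (x : ℝ) :
    ∫ ξ, F (x, ξ) * dXi G (x, ξ) = -∫ ξ, dXi F (x, ξ) * G (x, ξ) := by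
  have hi : ∀ {F G : ℝ × ℝ → ℝ}, IsCyl R F → IsCyl R G →
      Integrable fun ξ => F (x, ξ) * G (x, ξ) := fun hF hG =>
    ((hF.continuous_snd x).mul (hG.continuous_snd x)).integrable_of_hasCompactSupport
      ((hF.hasCompactSupport_snd x).mul_right)
  exact integral_mul_deriv_eq_deriv_mul_of_integrable (u := fun ξ => F (x, ξ))
    (v := fun ξ => G (x, ξ)) (fun ξ _ => hF.hasDerivAt_snd x ξ) (fun ξ _ => hG.hasDerivAt_snd x ξ)
    (hi hF hG.deriv_snd) (hi hF.deriv_snd hG) (hi hF hG)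

end IsCyl

end Cylinder

/-! ### Energies of derivatives, bounded by the volume of the set where `F` is nonzero. -/

section CylinderEnergy

/-- Lebesgue measure on the fundamental domain `(0, 1] × ℝ` of the cylinder. -/
noncomputable def cylMeasure : Measure (ℝ × ℝ) :=
  ((volume : Measure ℝ).restrict (Set.Ioc 0 1)).prod volume

namespace IsCyl

variable {R : ℝ} {F G : ℝ × ℝ → ℝ}

theorem mul (hF : IsCyl R F) (hG : IsCyl R G) : IsCyl R fun z => F z * G z where
  smooth := hF.smooth.mul hG.smooth
  periodic x ξ := by rw [hF.periodic, hG.periodic]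
  supp x ξ h := by rw [hF.supp x ξ h, zero_mul]

theorem integrable (hF : IsCyl R F) : Integrable F cylMeasure := by
  obtain ⟨B, -, hB⟩ := hF.exists_abs_le
  have h1 : Integrable (fun ξ : ℝ => (Set.Icc (-R) R).indicator (fun _ => B) ξ) :=
    (integrable_indicator_iff measurableSet_Icc).2 (by simp)
  have h2 : Integrable (fun _ : ℝ => (1 : ℝ)) (volume.restrict (Set.Ioc 0 1)) := by simp
  refine (h2.mul_prod h1).mono' hF.continuous.aestronglyMeasurable (Eventually.of_forall fun z => ?_)
  rw [one_mul]
  by_cases h : z.2 ∈ Set.Icc (-R) R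
  · rw [Set.indicator_of_mem h]; exact hB z
  · rw [Set.indicator_of_notMem h, show F z = 0 from hF.supp z.1 z.2 ?_, norm_zero]
    by_contra h2
    exact h (abs_le.1 (not_lt.1 h2))

theorem integral_cylMeasure (hF : IsCyl R F) :
    ∫ z, F z ∂cylMeasure = ∫ x in Set.Ioc (0 : ℝ) 1, ∫ ξ, F (x, ξ) :=
  integral_prod _ hF.integrable

theorem integral_cylMeasure_symm (hF : IsCyl R F) :
    ∫ z, F z ∂cylMeasure = ∫ ξ, ∫ x in (0 : ℝ)..1, F (x, ξ) := by
  simp_rw [intervalIntegral.integral_of_le zero_le_one]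
  exact integral_prod_symm _ hF.integrable

theorem integral_dX_mul_dX (hF : IsCyl R F) :
    ∫ z, dX F z * dX F z ∂cylMeasure = -∫ z, F z * dX (dX F) z ∂cylMeasure := by
  rw [(hF.deriv_fst.mul hF.deriv_fst).integral_cylMeasure_symm,
    (hF.mul hF.deriv_fst.deriv_fst).integral_cylMeasure_symm, ← integral_neg]
  congr with ξ
  rw [← hF.integral_sq_dX]
  simp_rw [sq]

theorem integral_mul_dXi_cylMeasure (hF : IsCyl R F) (hG : IsCyl R G) :
    ∫ z, F z * dXi G z ∂cylMeasure = -∫ z, dXi F z * G z ∂cylMeasure := by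
  rw [(hF.mul hG.deriv_snd).integral_cylMeasure, (hF.deriv_snd.mul hG).integral_cylMeasure,
    ← integral_neg]
  congr with x
  exact hF.integral_mul_dXi hG x

/-- Meant for `G` a derivative of `F`, with `V` what integration by parts leaves beside `F`. Keeping
the factor `F` undifferentiated produces the volume of `{F ≠ 0}` itself, as the Weyl law requires,
and not that of a closed support. -/
theorem lintegral_enorm_sq_le (hF : IsCyl R F) (hG : IsCyl R G) {V : ℝ × ℝ → ℝ}
    (h : |∫ z, G z * G z ∂cylMeasure| = |∫ z, F z * V z ∂cylMeasure|) {C C' : ℝ} (hC : ∀ z, |F z| ≤ C)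
    (hC' : ∀ z, |V z| ≤ C') :
    ∫⁻ z, ‖G z‖ₑ ^ 2 ∂cylMeasure ≤ ENNReal.ofReal (C * C') * cylMeasure {z | F z ≠ 0} := by
  have hC0 : 0 ≤ C := (abs_nonneg _).trans (hC 0)
  have e1 : ∫⁻ z, ‖G z‖ₑ ^ 2 ∂cylMeasure = ENNReal.ofReal (∫ z, G z * G z ∂cylMeasure) := by
    rw [ofReal_integral_eq_lintegral_ofReal (hG.mul hG).integrable
      (Eventually.of_forall fun z => mul_self_nonneg _)]
    refine lintegral_congr fun z => ?_
    rw [← ofReal_norm, ← ENNReal.ofReal_pow (norm_nonneg _), Real.norm_eq_abs, sq_abs, sq]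
  have hs : MeasurableSet {z | F z ≠ 0} := (measurableSet_eq_fun hF.continuous.measurable
    measurable_const).compl
  rw [e1, ← abs_of_nonneg (integral_nonneg (μ := cylMeasure) fun z => mul_self_nonneg (G z)), h,
    ← Real.norm_eq_abs, ofReal_norm]
  refine (enorm_integral_le_lintegral_enorm _).trans ?_
  rw [← lintegral_indicator_const hs]
  refine lintegral_mono fun z => ?_
  by_cases hz : F z = 0
  · simp [hz]
  · rw [Set.indicator_of_mem (by exact hz), ← ofReal_norm]
    refine ENNReal.ofReal_le_ofReal ?_
    rw [norm_mul]
    exact mul_le_mul (hC z) (hC' z) (norm_nonneg _) hC0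

theorem tsum_lintegral_enorm_sq_cylCoef (hF : IsCyl R F) :
    ∑' m, ∫⁻ ξ, ‖cylCoef F m ξ‖ₑ ^ 2 = ∫⁻ z, ‖F z‖ₑ ^ 2 ∂cylMeasure := by
  rw [← lintegral_tsum fun m => ((hF.continuous_cylCoef m).enorm.measurable.pow_const 2).aemeasurable]
  simp_rw [hF.tsum_enorm_sq_cylCoef]
  exact (lintegral_prod_symm _ (hF.continuous.enorm.measurable.pow_const 2).aemeasurable).symm

theorem energy_zero (hF : IsCyl R F) {C : ℝ} (hC : ∀ z, |F z| ≤ C) :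
    ∑' m, ∫⁻ ξ, ‖cylCoef F m ξ‖ₑ ^ 2 ≤ ENNReal.ofReal (C * C) * cylMeasure {z | F z ≠ 0} := by
  rw [hF.tsum_lintegral_enorm_sq_cylCoef]
  exact hF.lintegral_enorm_sq_le hF rfl hC hC

theorem energy_fst (hF : IsCyl R F) {C C' : ℝ} (hC : ∀ z, |F z| ≤ C)
    (hC' : ∀ z, |dX (dX F) z| ≤ C') :
    ∑' m : ℤ, ∫⁻ ξ, ‖(m : ℂ) * cylCoef F m ξ‖ₑ ^ 2 ≤
      ENNReal.ofReal (C * C') * cylMeasure {z | F z ≠ 0} := by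
  refine le_trans ?_ (hF.lintegral_enorm_sq_le hF.deriv_fst
    (by rw [hF.integral_dX_mul_dX, abs_neg]) hC hC')
  rw [← hF.deriv_fst.tsum_lintegral_enorm_sq_cylCoef]
  refine ENNReal.tsum_le_tsum fun m => lintegral_mono fun ξ => ?_
  rw [hF.cylCoef_dX]
  gcongr
  rw [enorm_mul, enorm_mul]
  gcongr
  rw [enorm_mul]
  refine le_mul_of_one_le_left' ?_
  rw [← ofReal_norm, ENNReal.one_le_ofReal]
  simp only [norm_mul, Complex.norm_I, Complex.norm_real, mul_one,
    Complex.norm_ofNat, Real.norm_of_nonneg Real.pi_pos.le]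
  linarith [Real.pi_gt_three]

theorem energy_snd (hF : IsCyl R F) {C C' : ℝ} (hC : ∀ z, |F z| ≤ C)
    (hC' : ∀ z, |dXi (dXi F) z| ≤ C') :
    ∑' m : ℤ, ∫⁻ ξ, ‖cylCoef (dXi F) m ξ‖ₑ ^ 2 ≤
      ENNReal.ofReal (C * C') * cylMeasure {z | F z ≠ 0} := by
  rw [hF.deriv_snd.tsum_lintegral_enorm_sq_cylCoef]
  refine hF.lintegral_enorm_sq_le hF.deriv_snd ?_ hC hC'
  rw [hF.integral_mul_dXi_cylMeasure hF.deriv_snd, abs_neg]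

/-- Integration by parts once in each variable moves both derivatives to the other factor; the
orders of differentiation are matched by `dXi_dX`. -/
theorem energy_mixed (hF : IsCyl R F) {C C' : ℝ} (hC : ∀ z, |F z| ≤ C)
    (hC' : ∀ z, |dX (dX (dXi (dXi F))) z| ≤ C') :
    ∑' m : ℤ, ∫⁻ ξ, ‖(m : ℂ) * cylCoef (dXi F) m ξ‖ₑ ^ 2 ≤
      ENNReal.ofReal (C * C') * cylMeasure {z | F z ≠ 0} := by
  have e : |∫ z, dX (dXi F) z * dX (dXi F) z ∂cylMeasure| =
      |∫ z, F z * dX (dX (dXi (dXi F))) z ∂cylMeasure| := by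
    have h1 : dX (dX (dXi (dXi F))) = dXi (dX (dX (dXi F))) := by
      rw [← hF.deriv_snd.dXi_dX, ← hF.deriv_snd.deriv_fst.dXi_dX]
    rw [hF.deriv_snd.integral_dX_mul_dX, abs_neg, h1,
      hF.integral_mul_dXi_cylMeasure hF.deriv_snd.deriv_fst.deriv_fst, abs_neg]
  refine le_trans ?_ (hF.lintegral_enorm_sq_le hF.deriv_snd.deriv_fst e hC hC')
  rw [← hF.deriv_snd.deriv_fst.tsum_lintegral_enorm_sq_cylCoef]
  refine ENNReal.tsum_le_tsum fun m => lintegral_mono fun ξ => ?_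
  rw [hF.deriv_snd.cylCoef_dX]
  gcongr
  rw [enorm_mul, enorm_mul]
  gcongr
  rw [enorm_mul]
  refine le_mul_of_one_le_left' ?_
  rw [← ofReal_norm, ENNReal.one_le_ofReal]
  simp only [norm_mul, Complex.norm_I, Complex.norm_real, mul_one,
    Complex.norm_ofNat, Real.norm_of_nonneg Real.pi_pos.le]
  linarith [Real.pi_gt_three]

/-- The increment of a Fourier coefficient is controlled by the energy of its derivative. -/
theorem enorm_sq_cylCoef_sub_le (hF : IsCyl R F) (m : ℤ) {W ξ p : ℝ} (h : |ξ - p| ≤ W) :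
    ‖cylCoef F m ξ - cylCoef F m p‖ₑ ^ 2 ≤ ENNReal.ofReal W *
      ∫⁻ s, (Set.Icc (p - W) (p + W)).indicator (fun s => ‖cylCoef (dXi F) m s‖ₑ ^ 2) s := by
  have hc := hF.deriv_snd.continuous_cylCoef m
  have h1 := intervalIntegral.integral_eq_sub_of_hasDerivAt (a := p) (b := ξ)
    (fun s _ => hF.hasDerivAt_cylCoef m s) (hc.intervalIntegrable _ _)
  rw [← h1, lintegral_indicator measurableSet_Icc]
  have h2 : ‖∫ s in p..ξ, cylCoef (dXi F) m s‖ₑ ≤ ∫⁻ s in Set.uIoc p ξ, ‖cylCoef (dXi F) m s‖ₑ := by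
    rw [← ofReal_norm, intervalIntegral.norm_intervalIntegral_eq, ofReal_norm]
    exact enorm_integral_le_lintegral_enorm _
  have h3 : volume (Set.uIoc p ξ) ≤ ENNReal.ofReal W := by
    rw [Set.uIoc, Real.volume_Ioc]
    refine ENNReal.ofReal_le_ofReal ?_
    rw [max_sub_min_eq_abs]; exact h
  have h4 : Set.uIoc p ξ ⊆ Set.Icc (p - W) (p + W) := fun s hs => by
    have h5 := abs_le.1 h
    rcases Set.mem_uIoc.1 hs with h6 | h6 <;> constructor <;> linarith [h6.1, h6.2, h5.1, h5.2,
      (abs_nonneg _).trans h]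
  calc ‖∫ s in p..ξ, cylCoef (dXi F) m s‖ₑ ^ 2 ≤
      (∫⁻ s in Set.uIoc p ξ, 1 * ‖cylCoef (dXi F) m s‖ₑ) ^ 2 := by
        simp_rw [one_mul]; gcongr
    _ ≤ (∫⁻ _ in Set.uIoc p ξ, 1 ^ 2) * ∫⁻ s in Set.uIoc p ξ, ‖cylCoef (dXi F) m s‖ₑ ^ 2 :=
        sq_lintegral_mul_le aemeasurable_const hc.enorm.measurable.aemeasurable
    _ ≤ _ := by
        refine mul_le_mul' (by simpa using h3) (lintegral_mono_set h4)

/-- By Tonelli, since each `s` lies in the windows whose centres fill an interval of length `2 W`.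
-/
theorem lintegral_indicator_window (g : ℝ → ENNReal) (hg : Measurable g) (W : ℝ) :
    ∫⁻ p : ℝ, ∫⁻ s, (Set.Icc (p - W) (p + W)).indicator g s =
      ENNReal.ofReal (2 * W) * ∫⁻ s, g s := by
  have h0 : ∀ p s : ℝ, (Set.Icc (p - W) (p + W)).indicator g s =
      (Set.Icc (s - W) (s + W)).indicator (fun _ => g s) p := fun p s => by
    have : s ∈ Set.Icc (p - W) (p + W) ↔ p ∈ Set.Icc (s - W) (s + W) := by
      constructor <;> rintro ⟨h1, h2⟩ <;> constructor <;> linarith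
    by_cases h : s ∈ Set.Icc (p - W) (p + W)
    · rw [Set.indicator_of_mem h, Set.indicator_of_mem (this.1 h)]
    · rw [Set.indicator_of_notMem h, Set.indicator_of_notMem fun h' => h (this.2 h')]
  have hm : Measurable fun z : ℝ × ℝ => (Set.Icc (z.1 - W) (z.1 + W)).indicator g z.2 := by
    have : MeasurableSet {z : ℝ × ℝ | z.1 - W ≤ z.2 ∧ z.2 ≤ z.1 + W} :=
      ((isClosed_le (f := fun z : ℝ × ℝ => z.1 - W) (g := fun z => z.2) (by fun_prop)
        (by fun_prop)).inter (isClosed_le (f := fun z : ℝ × ℝ => z.2) (g := fun z => z.1 + W)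
        (by fun_prop) (by fun_prop))).measurableSet
    exact (hg.comp measurable_snd).indicator this
  rw [lintegral_lintegral_swap hm.aemeasurable]
  simp_rw [h0, lintegral_indicator_const measurableSet_Icc, Real.volume_Icc]
  rw [← lintegral_const_mul _ hg]
  refine lintegral_congr fun s => ?_
  rw [mul_comm]
  congr 2
  ring

end IsCyl

end CylinderEnergy

/-! ### The Weyl quantization on the circle as a matrix in Fourier modes. -/

open scoped FourierTransform

namespace IsCyl

variable {R : ℝ} {F : ℝ × ℝ → ℝ}

theorem exists_norm_cylCoef_le (hF : IsCyl R F) :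
    ∃ B, 0 ≤ B ∧ ∀ m ξ, ‖cylCoef F m ξ‖ ≤ B * (1 + (m : ℝ) ^ 2)⁻¹ := by
  obtain ⟨B, hB0, hB⟩ := hF.exists_abs_le
  obtain ⟨B', -, hB'⟩ := hF.deriv_fst.deriv_fst.exists_abs_le
  refine ⟨2 * max B B', by positivity, fun m ξ => ?_⟩
  rw [← div_eq_mul_inv, le_div_iff₀ (by positivity), mul_comm]
  exact hF.one_add_sq_mul_norm_cylCoef_le (fun z => (hB z).trans (le_max_left _ _))
    (fun z => (hB' z).trans (le_max_right _ _)) m ξ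

theorem hasCompactSupport_cylCoef (hF : IsCyl R F) (m : ℤ) : HasCompactSupport (cylCoef F m) := by
  refine HasCompactSupport.intro (isCompact_Icc (a := -R) (b := R)) fun ξ hξ =>
    hF.cylCoef_eq_zero m ?_
  by_contra h
  exact hξ (abs_le.1 (not_lt.1 h))

theorem integrable_cylCoef (hF : IsCyl R F) (m : ℤ) : Integrable (cylCoef F m) :=
  (hF.continuous_cylCoef m).integrable_of_hasCompactSupport (hF.hasCompactSupport_cylCoef m)

theorem exists_integral_norm_cylCoef_le (hF : IsCyl R F) :
    ∃ C, 0 ≤ C ∧ ∀ m, ∫ ξ, ‖cylCoef F m ξ‖ ≤ C * (1 + (m : ℝ) ^ 2)⁻¹ := by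
  obtain ⟨B, hB0, hB⟩ := hF.exists_norm_cylCoef_le
  refine ⟨B * (volume : Measure ℝ).real (Set.Icc (-R) R), by positivity, fun m => ?_⟩
  rw [← setIntegral_eq_integral_of_forall_compl_eq_zero (s := Set.Icc (-R) R)]
  · have := norm_setIntegral_le_of_norm_le_const (μ := (volume : Measure ℝ))
      (s := Set.Icc (-R) R) (C := B * (1 + (m : ℝ) ^ 2)⁻¹) (f := fun ξ => ‖cylCoef F m ξ‖)
      (by simp) fun ξ _ => by rw [norm_norm]; exact hB m ξ
    refine (le_abs_self _).trans (this.trans_eq (by ring))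
  · intro ξ hξ
    rw [hF.cylCoef_eq_zero m, norm_zero]
    by_contra h
    exact hξ (abs_le.1 (not_lt.1 h))

theorem norm_fourier_le_integral_norm (f : ℝ → ℂ) (w : ℝ) : ‖𝓕 f w‖ ≤ ∫ ξ, ‖f ξ‖ :=
  VectorFourier.norm_fourierIntegral_le_integral_norm _ _ _ f w

theorem fourier_cylCoef_dXi (hF : IsCyl R F) (m : ℤ) (w : ℝ) :
    𝓕 (cylCoef (dXi F) m) w = (2 * Real.pi * Complex.I * w) * 𝓕 (cylCoef F m) w := by
  have h : deriv (cylCoef F m) = cylCoef (dXi F) m :=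
    funext fun ξ => (hF.hasDerivAt_cylCoef m ξ).deriv
  have h2 := Real.fourier_deriv (hF.integrable_cylCoef m)
    (fun ξ => (hF.hasDerivAt_cylCoef m ξ).differentiableAt)
    (by rw [h]; exact hF.deriv_snd.integrable_cylCoef m)
  rw [h] at h2
  exact congrFun h2 w

theorem exists_norm_fourier_cylCoef_le (hF : IsCyl R F) :
    ∃ C, 0 ≤ C ∧ ∀ (m : ℤ) (w : ℝ),
      ‖𝓕 (cylCoef F m) w‖ ≤ C * (1 + (m : ℝ) ^ 2)⁻¹ * (1 + w ^ 2)⁻¹ := by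
  obtain ⟨C, hC0, hC⟩ := hF.exists_integral_norm_cylCoef_le
  obtain ⟨C', hC'0, hC'⟩ := hF.deriv_snd.deriv_snd.exists_integral_norm_cylCoef_le
  refine ⟨C + C', by positivity, fun m w => ?_⟩
  have h1 := (norm_fourier_le_integral_norm (cylCoef F m) w).trans (hC m)
  have h2 := (norm_fourier_le_integral_norm (cylCoef (dXi (dXi F)) m) w).trans (hC' m)
  rw [hF.deriv_snd.fourier_cylCoef_dXi, hF.fourier_cylCoef_dXi] at h2
  simp only [norm_mul, Complex.norm_I, Complex.norm_real, mul_one,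
    Complex.norm_ofNat, Real.norm_of_nonneg Real.pi_pos.le, Real.norm_eq_abs] at h2
  have h3 : w ^ 2 * ‖𝓕 (cylCoef F m) w‖ ≤ 2 * Real.pi * |w| *
      (2 * Real.pi * |w| * ‖𝓕 (cylCoef F m) w‖) := by
    have : 2 * Real.pi * |w| * (2 * Real.pi * |w| * ‖𝓕 (cylCoef F m) w‖) =
      (2 * Real.pi) ^ 2 * (w ^ 2 * ‖𝓕 (cylCoef F m) w‖) := by
      rw [← sq_abs w]; ring
    rw [this]
    refine le_mul_of_one_le_left (by positivity) ?_
    nlinarith [Real.pi_gt_three]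
  rw [← div_eq_mul_inv _ (1 + w ^ 2), le_div_iff₀ (by positivity)]
  linarith

theorem summable_inv_one_add_sq_int : Summable fun m : ℤ => (1 + (m : ℝ) ^ 2)⁻¹ := by
  refine Summable.of_norm_bounded_eventually
    (Real.summable_one_div_int_pow (p := 2).2 one_lt_two) ?_
  filter_upwards [(Set.finite_singleton (0 : ℤ)).compl_mem_cofinite] with m hm
  have hm' : (0 : ℝ) < (m : ℝ) ^ 2 := by
    have : (m : ℝ) ≠ 0 := by simpa using hm
    positivity
  rw [Real.norm_of_nonneg (by positivity), one_div]
  gcongr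
  linarith

theorem continuous_fourier_cylCoef (hF : IsCyl R F) (m : ℤ) : Continuous (𝓕 (cylCoef F m)) :=
  VectorFourier.fourierIntegral_continuous Real.continuous_fourierChar
    (by exact continuous_inner) (hF.integrable_cylCoef m)

theorem integrable_fourier_cylCoef (hF : IsCyl R F) (m : ℤ) : Integrable (𝓕 (cylCoef F m)) := by
  obtain ⟨C, -, hC⟩ := hF.exists_norm_fourier_cylCoef_le
  exact (integrable_inv_one_add_sq.const_mul _).mono'
    (hF.continuous_fourier_cylCoef m).aestronglyMeasurable (Eventually.of_forall (hC m))

theorem fourier_expansion (hF : IsCyl R F) (x w : ℝ) :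
    HasSum (fun m => fourier m (x : UnitAddCircle) * 𝓕 (cylCoef F m) w)
      (𝓕 (fun ξ => (F (x, ξ) : ℂ)) w) := by
  obtain ⟨C, hC0, hC⟩ := hF.exists_integral_norm_cylCoef_le
  have e : ∀ f : ℝ → ℂ, 𝓕 f w = ∫ v, Real.fourierChar (-(v * w)) • f v := fun f => by
    rw [Real.fourier_real_eq]
  simp_rw [e, ← integral_const_mul]
  have hc : Continuous fun ξ : ℝ => Real.fourierChar (-(ξ * w)) :=
    Real.continuous_fourierChar.comp (by fun_prop)
  have h := hasSum_integral_of_summable_integral_norm (μ := (volume : Measure ℝ))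
    (F := fun (m : ℤ) ξ => fourier m (x : UnitAddCircle) *
      (Real.fourierChar (-(ξ * w)) • cylCoef F m ξ)) (fun m => ?_) ?_
  · have h3 : ∀ ξ, Real.fourierChar (-(ξ * w)) • (F (x, ξ) : ℂ) =
        ∑' m, fourier m (x : UnitAddCircle) *
          (Real.fourierChar (-(ξ * w)) • cylCoef F m ξ) := fun ξ => ?_
    · simp_rw [h3]
      exact h
    have h2 := (hF.hasSum_cylCoef x ξ).const_smul (Real.fourierChar (-(ξ * w)))
    refine h2.tsum_eq.symm.trans (tsum_congr fun m => ?_)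
    simp only [Circle.smul_def, smul_eq_mul]
    ring
  · have hc2 : Continuous fun ξ => fourier m (x : UnitAddCircle) *
        (Real.fourierChar (-(ξ * w)) • cylCoef F m ξ) :=
      continuous_const.mul (hc.smul (hF.continuous_cylCoef m))
    exact (hF.integrable_cylCoef m).norm.mono' hc2.aestronglyMeasurable
      (Eventually.of_forall fun ξ => by
        rw [norm_mul, norm_fourier_apply, one_mul, Circle.norm_smul])
  · refine Summable.of_nonneg_of_le (fun m => by positivity) (fun m => ?_)
      (summable_inv_one_add_sq_int.mul_left C)
    simp only [norm_mul, norm_fourier_apply, one_mul, Circle.norm_smul]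
    exact hC m

/-- The Weyl quantization in Fourier coefficients. -/
theorem hasSum_weylApply {V : Type*} [NormedAddCommGroup V] [NormedSpace ℂ V] [CompleteSpace V]
    (hF : IsCyl R F) {ħ : ℝ} (hħ : 0 < ħ) {c : ℤ → V} (hc : Summable fun k => ‖c k‖)
    {φ : ℝ → V} (hφ : ∀ y : ℝ, φ y = ∑' k, fourier k (y : UnitAddCircle) • c k) (x : ℝ) :
    HasSum (fun p : ℤ × ℤ => fourier p.1 (x : UnitAddCircle) •
      cylCoef F (p.1 - p.2) (Real.pi * ħ * (p.1 + p.2)) • c p.2) (weylApply ħ F φ x) := by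
  obtain ⟨C, hC0, hC⟩ := hF.exists_norm_fourier_cylCoef_le
  have hh : 0 < 2 * Real.pi * ħ := by positivity
  set h := 2 * Real.pi * ħ with hdef
  -- The substitution `y = x + 2πħ w` absorbs the prefactor of the kernel and leaves a Fourier
  -- transform at `w`.
  have e1 : weylApply ħ F φ x =
      ∫ w : ℝ, 𝓕 (fun ξ => (F (x + h * w / 2, ξ) : ℂ)) w • φ (x + h * w) := by
    unfold weylApply
    rw [← integral_add_left_eq_self _ x]
    have h1 := Measure.integral_comp_mul_left
      (fun y : ℝ => weylKernel ħ F x (x + y) • φ (x + y)) h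
    rw [abs_of_pos (inv_pos.2 hh), eq_inv_smul_iff₀ hh.ne'] at h1
    rw [← h1, ← integral_smul]
    refine integral_congr_ae (Eventually.of_forall fun w => ?_)
    simp only
    rw [weylKernel_eq_fourier, ← hdef]
    have a1 : (h⁻¹ : ℝ) • (x + h * w - x) = w := by
      rw [smul_eq_mul]; field_simp; ring
    have a2 : (1 / 2 : ℝ) • (x + (x + h * w)) = x + h * w / 2 := by
      rw [smul_eq_mul]; ring
    rw [a1, a2, Module.finrank_self, pow_one, ← smul_assoc]
    congr 1
    rw [Complex.real_smul, ← mul_assoc, ← Complex.ofReal_mul, mul_inv_cancel₀ hh.ne',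
      Complex.ofReal_one, one_mul]
  set T : ℤ × ℤ → ℝ → V := fun p w => (fourier p.1 ((x + h * w / 2 : ℝ) : UnitAddCircle) *
    𝓕 (cylCoef F p.1) w) • fourier p.2 ((x + h * w : ℝ) : UnitAddCircle) • c p.2 with hT
  have hTn : ∀ p w, ‖T p w‖ ≤ C * ((1 + (p.1 : ℝ) ^ 2)⁻¹ * ‖c p.2‖) * (1 + w ^ 2)⁻¹ := fun p w => by
    simp only [hT, norm_smul, norm_mul, norm_fourier_apply, one_mul]
    calc _ ≤ (C * (1 + (p.1 : ℝ) ^ 2)⁻¹ * (1 + w ^ 2)⁻¹) * ‖c p.2‖ := by gcongr; exact hC _ _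
      _ = _ := by ring
  have hprod : Summable fun p : ℤ × ℤ => (1 + (p.1 : ℝ) ^ 2)⁻¹ * ‖c p.2‖ :=
    summable_inv_one_add_sq_int.mul_of_nonneg hc (fun m => by positivity) (fun k => norm_nonneg _)
  have hTc : ∀ p, Continuous (T p) := fun p => by
    have h1 := (continuous_fourier_coe p.1).comp (by fun_prop : Continuous fun w : ℝ => x + h * w / 2)
    have h2 := (continuous_fourier_coe p.2).comp (by fun_prop : Continuous fun w : ℝ => x + h * w)
    exact (h1.mul (hF.continuous_fourier_cylCoef p.1)).smul (h2.smul continuous_const)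
  have hTi : ∀ p, Integrable (T p) := fun p =>
    (integrable_inv_one_add_sq.const_mul _).mono' (hTc p).aestronglyMeasurable
      (Eventually.of_forall (hTn p))
  have hsum := hasSum_integral_of_summable_integral_norm (μ := (volume : Measure ℝ)) (F := T) hTi (by
    refine Summable.of_nonneg_of_le (fun p => by positivity) (fun p => ?_)
      ((hprod.mul_left C).mul_right (∫ w : ℝ, (1 + w ^ 2)⁻¹))
    rw [← integral_const_mul]
    exact integral_mono (hTi p).norm (integrable_inv_one_add_sq.const_mul _) (hTn p))
  have e2 : ∫ w, ∑' p, T p w = weylApply ħ F φ x := by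
    rw [e1]
    refine integral_congr_ae (Eventually.of_forall fun w => ?_)
    simp only
    rw [hφ]
    have hk : Summable fun k => fourier k ((x + h * w : ℝ) : UnitAddCircle) • c k :=
      Summable.of_norm (by simpa only [norm_smul, norm_fourier_apply, one_mul] using hc)
    refine ((hF.fourier_expansion (x + h * w / 2) w).smul hk.hasSum ?_).tsum_eq
    exact Summable.of_norm_bounded ((hprod.mul_left C).mul_right _) fun p => hTn p w
  rw [e2] at hsum
  -- The mode `m` of the symbol contributes `πħ m w` to the phase, evaluated as it is at the
  -- midpoint, and the mode `k` of `φ` contributes `2πħ k w`. Fourier inversion then evaluates the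
  -- coefficient at `πħ (m + 2k)`.
  have e3 : ∀ p : ℤ × ℤ, ∫ w, T p w = fourier (p.1 + p.2) (x : UnitAddCircle) •
      cylCoef F p.1 (Real.pi * ħ * ((p.1 + p.2 : ℤ) + p.2)) • c p.2 := fun p => by
    have h1 : ∀ w, T p w = (fourier (p.1 + p.2) (x : UnitAddCircle) *
        (Real.fourierChar (w * (Real.pi * ħ * ((p.1 + p.2 : ℤ) + p.2))) • 𝓕 (cylCoef F p.1) w)) •
          c p.2 := fun w => by
      simp only [hT]
      rw [smul_smul]
      congr 1
      rw [Circle.smul_def, smul_eq_mul, Real.fourierChar_apply]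
      simp only [fourier_coe_apply]
      rw [mul_right_comm, ← Complex.exp_add, ← mul_assoc, ← Complex.exp_add]
      congr 2
      rw [hdef]
      push_cast
      ring
    simp_rw [h1]
    rw [integral_smul_const, integral_const_mul, ← smul_smul]
    congr 2
    have h2 := (hF.continuous_cylCoef p.1).fourierInv_fourier_eq (hF.integrable_cylCoef p.1)
      (hF.integrable_fourier_cylCoef p.1)
    have h3 := congrFun h2 (Real.pi * ħ * ((p.1 + p.2 : ℤ) + p.2))
    rw [Real.fourierInv_eq'] at h3
    rw [← h3]
    refine integral_congr_ae (Eventually.of_forall fun w => ?_)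
    simp only [Circle.smul_def, smul_eq_mul, Real.fourierChar_apply]
    congr 2
    simp
    ring
  simp_rw [e3] at hsum
  -- Reindexing from (symbol frequency, input frequency) to (output frequency, input frequency).
  let E : ℤ × ℤ ≃ ℤ × ℤ := ⟨fun p => (p.1 + p.2, p.2), fun p => (p.1 - p.2, p.2),
    fun p => by simp, fun p => by simp⟩
  rw [← E.hasSum_iff]
  convert hsum using 2 with p
  simp [E, Function.comp]

end IsCyl

/-! ### Fourier series of smooth periodic functions with vector values. -/

section SmoothPeriodic

variable {V : Type*} [NormedAddCommGroup V] [NormedSpace ℂ V] [CompleteSpace V]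

theorem ae_real_of_ae_unitAddCircle {p : UnitAddCircle → Prop} (h : ∀ᵐ x, p x) :
    ∀ᵐ x : ℝ, p (x : UnitAddCircle) := by
  have h1 : ∀ n : ℤ, ∀ᵐ x : ℝ ∂volume.restrict (Set.Ioc (n : ℝ) (n + 1)),
      p (x : UnitAddCircle) := fun n =>
    (UnitAddCircle.measurePreserving_mk (n : ℝ)).quasiMeasurePreserving.ae h
  have h2 := (ae_restrict_iUnion_iff (fun n : ℤ => Set.Ioc (n : ℝ) (n + 1)) _).2 h1
  rwa [iUnion_Ioc_intCast, Measure.restrict_univ] at h2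

theorem continuous_of_continuous_coe {X : Type*} [TopologicalSpace X] {φ : UnitAddCircle → X}
    (h : Continuous fun y : ℝ => φ y) : Continuous φ :=
  (QuotientAddGroup.isQuotientMap_mk (N := AddSubgroup.zmultiples (1 : ℝ))).continuous_iff.2 h

/-- Integration by parts against a character over a period. -/
theorem integral_fourier_smul_deriv {f f' : ℝ → V} (hf : ∀ y, HasDerivAt f (f' y) y)
    (hf' : Continuous f') (hp : f 1 = f 0) (k : ℤ) :
    ∫ y in (0 : ℝ)..1, fourier (-k) (y : UnitAddCircle) • f' y =
      (2 * Real.pi * Complex.I * k) • ∫ y in (0 : ℝ)..1, fourier (-k) (y : UnitAddCircle) • f y := by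
  have hc : Continuous f := continuous_iff_continuousAt.2 fun y => (hf y).continuousAt
  have hd : ∀ x : ℝ, HasDerivAt (fun x : ℝ => fourier (-k) (x : UnitAddCircle) • f x)
      (fourier (-k) (x : UnitAddCircle) • f' x -
        (2 * Real.pi * Complex.I * k) • (fourier (-k) (x : UnitAddCircle) • f x)) x := fun x => by
    refine ((hasDerivAt_fourier_neg 1 k x).smul (hf x)).congr_deriv ?_
    rw [sub_eq_add_neg, ← neg_smul, smul_smul]
    push_cast
    congr 2
    ring
  have c1 : Continuous fun x : ℝ => fourier (-k) (x : UnitAddCircle) • f' x :=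
    (continuous_fourier_coe _).smul hf'
  have c2 : Continuous fun x : ℝ =>
      (2 * Real.pi * Complex.I * k) • (fourier (-k) (x : UnitAddCircle) • f x) :=
    continuous_const.smul ((continuous_fourier_coe _).smul hc)
  have h := intervalIntegral.integral_eq_sub_of_hasDerivAt (a := (0 : ℝ)) (b := 1)
    (fun x _ => hd x) ((c1.sub c2).intervalIntegrable _ _)
  have h1 : ((1 : ℝ) : UnitAddCircle) = ((0 : ℝ) : UnitAddCircle) := by simp
  rw [intervalIntegral.integral_sub (c1.intervalIntegrable _ _) (c2.intervalIntegrable _ _),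
    intervalIntegral.integral_smul, hp, h1, sub_self, sub_eq_zero] at h
  exact h

theorem summable_norm_fourierCoeff_of_contDiff {φ : UnitAddCircle → V}
    (hφ : ContDiff ℝ ∞ fun y : ℝ => φ y) : Summable fun k => ‖fourierCoeff φ k‖ := by
  set f : ℝ → V := fun y => φ y with hf
  have hper : ∀ y, f (y + 1) = f y := fun y => by
    simp only [hf]; congr 1; simp
  have hd1 : ContDiff ℝ ∞ (deriv f) := (contDiff_infty_iff_deriv.1 hφ).2
  have hd2 : ContDiff ℝ ∞ (deriv (deriv f)) := (contDiff_infty_iff_deriv.1 hd1).2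
  have hper1 : ∀ y, deriv f (y + 1) = deriv f y := fun y => by
    rw [← deriv_comp_add_const]
    simp_rw [hper]
  have e1 := integral_fourier_smul_deriv (f := f) (f' := deriv f)
    (fun y => ((hφ.differentiable (by simp)) y).hasDerivAt) hd1.continuous
    (by simpa using hper 0)
  have e2 := integral_fourier_smul_deriv (f := deriv f) (f' := deriv (deriv f))
    (fun y => ((hd1.differentiable (by simp)) y).hasDerivAt) hd2.continuous
    (by simpa using hper1 0)
  have e0 : ∀ k, fourierCoeff φ k =
      ∫ y in (0 : ℝ)..1, fourier (-k) (y : UnitAddCircle) • f y := fun k => by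
    rw [fourierCoeff_eq_intervalIntegral _ k 0]
    simp [hf]
  have hb : ∀ g : ℝ → V, Continuous g → ∃ B, 0 ≤ B ∧ ∀ k : ℤ,
      ‖∫ y in (0 : ℝ)..1, fourier (-k) (y : UnitAddCircle) • g y‖ ≤ B := fun g hg => by
    obtain ⟨B, hB⟩ := (isCompact_Icc : IsCompact (Set.Icc (0 : ℝ) 1)).exists_bound_of_continuousOn
      hg.continuousOn
    refine ⟨max B 0, le_max_right _ _, fun k => ?_⟩
    have := intervalIntegral.norm_integral_le_of_norm_le_const (a := (0 : ℝ)) (b := 1)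
      (C := max B 0) (f := fun y : ℝ => fourier (-k) (y : UnitAddCircle) • g y) fun x hx => by
        rw [norm_smul, norm_fourier_apply, one_mul]
        rw [Set.uIoc_of_le zero_le_one] at hx
        exact (hB x ⟨hx.1.le, hx.2⟩).trans (le_max_left _ _)
    simpa using this
  obtain ⟨B, hB0, hB⟩ := hb f hφ.continuous
  obtain ⟨B', hB'0, hB'⟩ := hb _ hd2.continuous
  refine Summable.of_nonneg_of_le (fun k => norm_nonneg _) (fun k => ?_)
    (IsCyl.summable_inv_one_add_sq_int.mul_left (B + B'))
  rw [← div_eq_mul_inv, le_div_iff₀ (by positivity), e0]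
  have h1 := hB k
  have h2 := hB' k
  rw [e2, e1] at h2
  simp only [norm_smul, norm_mul, Complex.norm_I, Complex.norm_real, Complex.norm_intCast, mul_one,
    Complex.norm_ofNat, Real.norm_of_nonneg Real.pi_pos.le] at h2
  set z := ‖∫ y in (0 : ℝ)..1, fourier (-k) (y : UnitAddCircle) • f y‖
  have hz : 0 ≤ z := norm_nonneg _
  have h3 : z * (k : ℝ) ^ 2 ≤ 2 * Real.pi * |(k : ℝ)| * (2 * Real.pi * |(k : ℝ)| * z) := by
    have : 2 * Real.pi * |(k : ℝ)| * (2 * Real.pi * |(k : ℝ)| * z) =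
      (2 * Real.pi) ^ 2 * (z * (k : ℝ) ^ 2) := by
      rw [← sq_abs (k : ℝ)]; ring
    rw [this]
    refine le_mul_of_one_le_left (by positivity) ?_
    nlinarith [Real.pi_gt_three]
  linarith

end SmoothPeriodic

section

variable {D : Type*} [NormedAddCommGroup D] [InnerProductSpace ℂ D] [CompleteSpace D]

theorem ContinuousLinearMap.map_fourierCoeff {W : Type*} [NormedAddCommGroup W] [NormedSpace ℂ W]
    [CompleteSpace W] (T : D →L[ℂ] W) {φ : UnitAddCircle → D} (hφ : Continuous φ) (k : ℤ) :
    T (fourierCoeff φ k) = fourierCoeff (fun x => T (φ x)) k := by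
  rw [fourierCoeff, fourierCoeff, ← T.integral_comp_comm]
  · simp
  · exact ((by fun_prop : Continuous fun t => fourier (-k) t • φ t)).integrable_of_hasCompactSupport
      (HasCompactSupport.of_compactSpace _)

theorem eq_tsum_fourierCoeff_of_contDiff {φ : UnitAddCircle → D}
    (hφ : ContDiff ℝ ∞ fun y : ℝ => φ y) (x : UnitAddCircle) :
    φ x = ∑' k, fourier k x • fourierCoeff φ k := by
  have hc : Continuous φ := continuous_of_continuous_coe hφ.continuous
  have hs := summable_norm_fourierCoeff_of_contDiff hφ
  have hs2 : Summable fun k => fourier k x • fourierCoeff φ k :=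
    Summable.of_norm (by simpa only [norm_smul, norm_fourier_apply, one_mul] using hs)
  refine ext_inner_left ℂ fun d => ?_
  have h1 := hs2.hasSum.mapL (innerSL ℂ d)
  have h2 : Summable (fourierCoeff (⟨fun y => inner ℂ d (φ y), by fun_prop⟩ : C(UnitAddCircle, ℂ))) := by
    refine Summable.of_norm_bounded (hs.mul_left ‖d‖) fun k => ?_
    have := (innerSL ℂ d).map_fourierCoeff hc k
    simp only [innerSL_apply_apply] at this
    simp only [ContinuousMap.coe_mk]
    rw [← this]
    exact norm_inner_le_norm _ _
  have h3 := has_pointwise_sum_fourier_series_of_summable h2 x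
  have e : (fun k => (innerSL ℂ d) (fourier k x • fourierCoeff φ k)) = fun k =>
      fourierCoeff (⟨fun y => inner ℂ d (φ y), by fun_prop⟩ : C(UnitAddCircle, ℂ)) k •
        fourier k x := by
    ext k
    rw [map_smul, (innerSL ℂ d).map_fourierCoeff hc k, smul_eq_mul, smul_eq_mul, mul_comm]
    rfl
  rw [e] at h1
  exact h3.unique h1

end

/-! ### Quantization of a family of symbols with coherent states. -/

/-- A continuous family of smooth functions on the cylinder with uniformly summable Fourier
coefficients. -/
structure IsCylFamily {Ω : Type*} [TopologicalSpace Ω] (R B : ℝ) (F : Ω → ℝ × ℝ → ℝ) : Prop where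
  cyl : ∀ n, IsCyl R (F n)
  continuous_uncurry : Continuous fun p : Ω × (ℝ × ℝ) => F p.1 p.2
  bound : ∀ n m ξ, ‖cylCoef (F n) m ξ‖ ≤ B * (1 + (m : ℝ) ^ 2)⁻¹

/-- A measurable family of unit vectors with a resolution of the identity. -/
structure IsCoherent {Ω D : Type*} [MeasurableSpace Ω] [NormedAddCommGroup D]
    [InnerProductSpace ℂ D] (ρ : Measure Ω) (χ : Ω → D) : Prop where
  meas : StronglyMeasurable χ
  norm_eq : ∀ n, ‖χ n‖ = 1
  lintegral_eq : ∀ v, ∫⁻ n, ‖inner ℂ (χ n) v‖ₑ ^ 2 ∂ρ = ‖v‖ₑ ^ 2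

theorem cylCoef_conj (F : ℝ × ℝ → ℝ) (m : ℤ) (ξ : ℝ) :
    (starRingEnd ℂ) (cylCoef F m ξ) = cylCoef F (-m) ξ := by
  simp only [cylCoef, intervalIntegral.integral_of_le zero_le_one]
  rw [← integral_conj]
  simp

theorem injective_sub_add : Function.Injective fun p : ℤ × ℤ => (p.1 - p.2, p.1 + p.2) := by
  rintro ⟨a, b⟩ ⟨c, d⟩ h
  simp only [Prod.mk.injEq] at h ⊢
  omega

/-- The integers `l - k` and `l + k` have equal parity, so the change of indices is only injective;
that suffices for summability. -/
theorem summable_mul_sub_add {f g : ℤ → ℝ} (hf0 : ∀ m, 0 ≤ f m) (hg0 : ∀ m, 0 ≤ g m)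
    (hf : Summable f) (hg : Summable g) :
    Summable fun p : ℤ × ℤ => f (p.1 - p.2) * g (p.1 + p.2) := by
  have h2 : Summable fun p : ℤ × ℤ => f p.1 * g p.2 := hf.mul_of_nonneg hg hf0 hg0
  have h3 := h2.comp_injective injective_sub_add
  exact h3

theorem injective_sub_snd : Function.Injective fun p : ℤ × ℤ => (p.1 - p.2, p.2) := by
  rintro ⟨a, b⟩ ⟨c, d⟩ h
  simp only [Prod.mk.injEq] at h ⊢
  omega

theorem summable_mul_sub {f g : ℤ → ℝ} (hf0 : ∀ m, 0 ≤ f m) (hg0 : ∀ m, 0 ≤ g m)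
    (hf : Summable f) (hg : Summable g) :
    Summable fun p : ℤ × ℤ => f (p.1 - p.2) * g p.2 := by
  have h2 : Summable fun p : ℤ × ℤ => f p.1 * g p.2 := hf.mul_of_nonneg hg hf0 hg0
  have h3 := h2.comp_injective injective_sub_snd
  exact h3

section Family

variable {Ω D : Type*} [TopologicalSpace Ω] [MeasurableSpace Ω] [BorelSpace Ω]
  [SecondCountableTopology Ω]
  [NormedAddCommGroup D] [InnerProductSpace ℂ D] [CompleteSpace D] [FiniteDimensional ℂ D]

theorem IsCylFamily.continuous_cylCoef {R B : ℝ} {F : Ω → ℝ × ℝ → ℝ} (hF : IsCylFamily R B F)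
    (m : ℤ) : Continuous fun q : Ω × ℝ => cylCoef (F q.1) m q.2 := by
  refine intervalIntegral.continuous_parametric_intervalIntegral_of_continuous'
    (f := fun (q : Ω × ℝ) x => fourier (-m) ((x : ℝ) : UnitAddCircle) * (F q.1 (x, q.2) : ℂ)) ?_ 0 1
  have h1 := (continuous_fourier_coe (-m)).comp (continuous_snd (X := Ω × ℝ) (Y := ℝ))
  have h2 : Continuous fun p : (Ω × ℝ) × ℝ => F p.1.1 (p.2, p.1.2) :=
    hF.continuous_uncurry.comp (by fun_prop : Continuous fun p : (Ω × ℝ) × ℝ =>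
      (p.1.1, (p.2, p.1.2)))
  exact h1.mul (Complex.continuous_ofReal.comp h2)

/-- The matrix of the quantization of `F` in the Fourier basis. -/
noncomputable def cylMatrix (ρ : Measure Ω) (χ : Ω → D) (F : Ω → ℝ × ℝ → ℝ) (ħ : ℝ) (p : ℤ × ℤ) :
    D →L[ℂ] D :=
  ∫ n, cylCoef (F n) (p.1 - p.2) (Real.pi * ħ * (p.1 + p.2)) •
    (innerSL ℂ (χ n)).smulRight (χ n) ∂ρ

variable {ρ : Measure Ω} [IsFiniteMeasure ρ] {χ : Ω → D} {R B ħ : ℝ} {F : Ω → ℝ × ℝ → ℝ}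

theorem IsCoherent.stronglyMeasurable_proj (hχ : IsCoherent ρ χ) :
    StronglyMeasurable fun n => (innerSL ℂ (χ n)).smulRight (χ n) := by
  have h : Continuous fun v : D => (innerSL ℂ v).smulRight v := by
    have h2 : Continuous fun v : D => ContinuousLinearMap.smulRightL ℂ D D (innerSL ℂ v) v :=
      ((ContinuousLinearMap.smulRightL ℂ D D).continuous.comp
        (innerSL ℂ (E := D)).continuous).clm_apply continuous_id
    exact h2
  exact h.comp_stronglyMeasurable hχ.meas

theorem IsCoherent.norm_proj (hχ : IsCoherent ρ χ) (n : Ω) :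
    ‖(innerSL ℂ (χ n)).smulRight (χ n)‖ = 1 := by
  rw [ContinuousLinearMap.norm_smulRight_apply, innerSL_apply_norm, hχ.norm_eq, one_mul]

theorem IsCylFamily.continuous_cylCoef_left (hF : IsCylFamily R B F) (m : ℤ) (ξ : ℝ) :
    Continuous fun n => cylCoef (F n) m ξ :=
  (hF.continuous_cylCoef m).comp (by fun_prop : Continuous fun n : Ω => (n, ξ))

theorem integrable_cylMatrix (hF : IsCylFamily R B F) (hχ : IsCoherent ρ χ) (m : ℤ) (ξ : ℝ) :
    Integrable (fun n => cylCoef (F n) m ξ • (innerSL ℂ (χ n)).smulRight (χ n)) ρ := by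
  refine (integrable_const (B * (1 + (m : ℝ) ^ 2)⁻¹)).mono'
    ((hF.continuous_cylCoef_left m ξ).stronglyMeasurable.smul
      hχ.stronglyMeasurable_proj).aestronglyMeasurable (Eventually.of_forall fun n => ?_)
  rw [norm_smul, hχ.norm_proj, mul_one]
  exact hF.bound n m ξ

theorem cylMatrix_apply (hF : IsCylFamily R B F) (hχ : IsCoherent ρ χ) (p : ℤ × ℤ) (d : D) :
    cylMatrix ρ χ F ħ p d = ∫ n, (cylCoef (F n) (p.1 - p.2) (Real.pi * ħ * (p.1 + p.2)) *
      inner ℂ (χ n) d) • χ n ∂ρ := by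
  rw [cylMatrix, ContinuousLinearMap.integral_apply (integrable_cylMatrix hF hχ _ _)]
  refine integral_congr_ae (Eventually.of_forall fun n => ?_)
  simp [smul_smul]

theorem adjoint_cylMatrix (hF : IsCylFamily R B F) (hχ : IsCoherent ρ χ) (l k : ℤ) :
    (cylMatrix ρ χ F ħ (l, k)).adjoint = cylMatrix ρ χ F ħ (k, l) := by
  refine (ContinuousLinearMap.eq_adjoint_iff _ _).2 (fun x y => ?_) |>.symm
  rw [cylMatrix, cylMatrix, ContinuousLinearMap.integral_apply (integrable_cylMatrix hF hχ _ _),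
    ContinuousLinearMap.integral_apply (integrable_cylMatrix hF hχ _ _),
    ← integral_inner ((integrable_cylMatrix hF hχ _ _).apply_continuousLinearMap _),
    ← inner_conj_symm, ← integral_inner ((integrable_cylMatrix hF hχ _ _).apply_continuousLinearMap _),
    ← integral_conj]
  refine integral_congr_ae (Eventually.of_forall fun n => ?_)
  simp only [_root_.smul_apply, ContinuousLinearMap.smulRight_apply, inner_smul_right,
    innerSL_apply_apply, map_mul, inner_conj_symm, cylCoef_conj]
  rw [neg_sub, add_comm (k : ℝ)]
  ring

/-- Smoothness in `x` gives decay in `l - k`, while compact support in `ξ` confines `l + k` to a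
finite band because the coefficient is taken at `πħ (l + k)`. Together these make the matrix norms
summable. -/
theorem norm_cylMatrix_le (hF : IsCylFamily R B F) (hχ : IsCoherent ρ χ) (hħ : 0 < ħ) (p : ℤ × ℤ) :
    ‖cylMatrix ρ χ F ħ p‖ ≤ B * ρ.real Set.univ * ((1 + ((p.1 - p.2 : ℤ) : ℝ) ^ 2)⁻¹ *
      Set.indicator (Set.Icc (-⌈R / (Real.pi * ħ)⌉) ⌈R / (Real.pi * ħ)⌉) (fun _ => (1 : ℝ))
        (p.1 + p.2)) := by
  by_cases hp : p.1 + p.2 ∈ Set.Icc (-⌈R / (Real.pi * ħ)⌉) ⌈R / (Real.pi * ħ)⌉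
  · rw [Set.indicator_of_mem hp, mul_one]
    refine (norm_integral_le_of_norm_le_const (Eventually.of_forall fun n => ?_)).trans_eq
      (mul_right_comm B _ _)
    rw [norm_smul, hχ.norm_proj, mul_one]
    exact hF.bound n _ _
  · rw [Set.indicator_of_notMem hp, mul_zero, mul_zero, cylMatrix, norm_le_zero_iff]
    refine integral_eq_zero_of_ae (Eventually.of_forall fun n => ?_)
    have hπ : 0 < Real.pi * ħ := by positivity
    have h1 : R < |Real.pi * ħ * (p.1 + p.2)| := by
      rw [abs_mul, abs_of_pos hπ, mul_comm, ← div_lt_iff₀ hπ]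
      by_contra! h2
      refine hp (abs_le.1 ?_)
      have h3 : (|p.1 + p.2| : ℝ) ≤ ⌈R / (Real.pi * ħ)⌉ := h2.trans (Int.le_ceil _)
      exact_mod_cast h3
    simp [(hF.cyl n).cylCoef_eq_zero _ h1]

theorem summable_norm_cylMatrix (hF : IsCylFamily R B F) (hχ : IsCoherent ρ χ) (hħ : 0 < ħ) :
    Summable fun p => ‖cylMatrix ρ χ F ħ p‖ := by
  refine Summable.of_nonneg_of_le (fun p => norm_nonneg _) (norm_cylMatrix_le hF hχ hħ) ?_
  refine Summable.mul_left _ ?_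
  refine summable_mul_sub_add (f := fun m : ℤ => (1 + (m : ℝ) ^ 2)⁻¹)
    (g := Set.indicator (Set.Icc (-⌈R / (Real.pi * ħ)⌉) ⌈R / (Real.pi * ħ)⌉) fun _ => (1 : ℝ))
    (fun m => by positivity)
    (fun m => Set.indicator_nonneg (fun _ _ => zero_le_one) m) IsCyl.summable_inv_one_add_sq_int ?_
  exact summable_of_hasFiniteSupport
    ((Set.finite_Icc _ _).subset Set.support_indicator_subset)

/-- The quantization of the family `F` with coherent states `χ`. -/
noncomputable def cylOp (ρ : Measure Ω) (χ : Ω → D) (F : Ω → ℝ × ℝ → ℝ) (ħ : ℝ) :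
    Lp D 2 (volume : Measure UnitAddCircle) →L[ℂ] Lp D 2 (volume : Measure UnitAddCircle) :=
  matrixOp (circleFrame D) (cylMatrix ρ χ F ħ)

/-- Both sides are the same double series over modes. The integral over `n` is exchanged with it
thanks to bounds uniform in `n`, and the `L²` sum on the left is read pointwise by
`coeFn_eq_tsum_of_hasSum`. -/
theorem cylOp_apply_ae (hF : IsCylFamily R B F) (hχ : IsCoherent ρ χ) (hħ : 0 < ħ)
    {φ : UnitAddCircle → D} (hφ : ContDiff ℝ ∞ fun y : ℝ => φ y)
    {u : Lp D 2 (volume : Measure UnitAddCircle)} (hu : u =ᵐ[volume] φ) :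
    ∀ᵐ x : ℝ, cylOp ρ χ F ħ u (x : UnitAddCircle) =
      ∫ n, (innerSL ℂ (χ n)).smulRight (χ n)
        (weylApply ħ (F n) (fun y : ℝ => φ (y : UnitAddCircle)) x) ∂ρ := by
  have hM := summable_norm_cylMatrix hF hχ hħ
  have hc := summable_norm_fourierCoeff_of_contDiff hφ
  have hsum := isFrame_circleFrame.hasSum_matrixOp_apply hM u
  simp_rw [adjoint_circleFrame_eq_fourierCoeff _ hu] at hsum
  have hb : ∀ k, ‖fourierCoeff φ k‖ ≤ ∑' k, ‖fourierCoeff φ k‖ := fun k =>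
    hc.le_tsum k fun _ _ => norm_nonneg _
  have h1 := coeFn_eq_tsum_of_hasSum (Summable.of_nonneg_of_le (fun p => norm_nonneg _)
    (fun p => (ContinuousLinearMap.le_opNorm _ _).trans
      (mul_le_mul_of_nonneg_left (hb _) (norm_nonneg _))) (hM.mul_right _)) hsum
  filter_upwards [ae_real_of_ae_unitAddCircle h1] with x hx
  rw [cylOp, hx]
  have hw : ∀ n, HasSum (fun p : ℤ × ℤ => (innerSL ℂ (χ n)).smulRight (χ n)
      (fourier p.1 (x : UnitAddCircle) •
        cylCoef (F n) (p.1 - p.2) (Real.pi * ħ * (p.1 + p.2)) • fourierCoeff φ p.2))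
      ((innerSL ℂ (χ n)).smulRight (χ n)
        (weylApply ħ (F n) (fun y : ℝ => φ (y : UnitAddCircle)) x)) := fun n =>
    ((hF.cyl n).hasSum_weylApply hħ hc
      (fun y => eq_tsum_fourierCoeff_of_contDiff hφ (y : UnitAddCircle)) x).mapL _
  have hint : ∀ p : ℤ × ℤ, Integrable (fun n => (innerSL ℂ (χ n)).smulRight (χ n)
      (fourier p.1 (x : UnitAddCircle) •
        cylCoef (F n) (p.1 - p.2) (Real.pi * ħ * (p.1 + p.2)) • fourierCoeff φ p.2)) ρ := fun p => by
    have := ((integrable_cylMatrix hF hχ (p.1 - p.2) (Real.pi * ħ * (p.1 + p.2))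
      ).apply_continuousLinearMap (fourierCoeff φ p.2)).smul (fourier p.1 (x : UnitAddCircle))
    refine this.congr (Eventually.of_forall fun n => ?_)
    simp only [Pi.smul_apply, _root_.smul_apply, map_smul]
  have hn : ∀ (p : ℤ × ℤ) n, ‖(innerSL ℂ (χ n)).smulRight (χ n)
      (fourier p.1 (x : UnitAddCircle) •
        cylCoef (F n) (p.1 - p.2) (Real.pi * ħ * (p.1 + p.2)) • fourierCoeff φ p.2)‖ ≤
      B * ((1 + ((p.1 - p.2 : ℤ) : ℝ) ^ 2)⁻¹ * ‖fourierCoeff φ p.2‖) := fun p n => by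
    refine (ContinuousLinearMap.le_opNorm _ _).trans ?_
    rw [hχ.norm_proj, one_mul, norm_smul, norm_smul, norm_fourier_apply, one_mul, ← mul_assoc]
    exact mul_le_mul_of_nonneg_right (hF.bound n _ _) (norm_nonneg _)
  have hs : Summable fun p : ℤ × ℤ => (1 + ((p.1 - p.2 : ℤ) : ℝ) ^ 2)⁻¹ * ‖fourierCoeff φ p.2‖ :=
    summable_mul_sub (f := fun m : ℤ => (1 + (m : ℝ) ^ 2)⁻¹) (g := fun k => ‖fourierCoeff φ k‖)
      (fun m => by positivity) (fun m => norm_nonneg _) IsCyl.summable_inv_one_add_sq_int hc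
  have h2 := hasSum_integral_of_summable_integral_norm hint
    (Summable.of_nonneg_of_le (fun p => by positivity) (fun p => by
      refine (integral_mono (hint p).norm (integrable_const _) (hn p)).trans_eq ?_
      rw [integral_const, smul_eq_mul, mul_comm]) ((hs.mul_left B).mul_right _))
  simp_rw [(hw _).tsum_eq] at h2
  rw [← h2.tsum_eq]
  refine tsum_congr fun p => ?_
  simp_rw [map_smul]
  rw [integral_smul, cylMatrix, ContinuousLinearMap.integral_apply (integrable_cylMatrix hF hχ _ _)]
  rfl

theorem cylOp_properties (hF : IsCylFamily R B F) (hχ : IsCoherent ρ χ) (hħ : 0 < ħ) :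
    IsCompactOperator (cylOp ρ χ F ħ) ∧ IsSelfAdjoint (cylOp ρ χ F ħ) ∧
    ∀ (s : Set (Lp D 2 (volume : Measure UnitAddCircle))) (b : HilbertBasis s ℂ _) (G : Finset s),
      ∑ i ∈ G, ‖inner ℂ (b i) (cylOp ρ χ F ħ (b i))‖ ≤
        Module.finrank ℂ D * ∑' p, ‖cylMatrix ρ χ F ħ p‖ :=
  ⟨isFrame_circleFrame.isCompactOperator_matrixOp (summable_norm_cylMatrix hF hχ hħ),
    IsFrame.isSelfAdjoint_matrixOp (adjoint_cylMatrix hF hχ), fun _ b G =>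
    isFrame_circleFrame.sum_norm_inner_matrixOp_le (summable_norm_cylMatrix hF hχ hħ)
      b.orthonormal G⟩

end Family

/-! ### Trigonometric polynomials and windows of frequencies. -/

section Trig

theorem fourierCoeff_sum_fourier_neg (S : Finset ℤ) (c : ℤ → ℂ) (n : ℤ) :
    fourierCoeff (fun q : UnitAddCircle => ∑ k ∈ S, fourier (-k) q * c k) n =
      if -n ∈ S then c (-n) else 0 := by
  rw [fourierCoeff, ← volume_unitAddCircle_eq]
  simp only [smul_eq_mul, Finset.mul_sum]
  rw [integral_finsetSum]
  · have h : ∀ k, ∫ q : UnitAddCircle, fourier (-n) q * (fourier (-k) q * c k) =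
        if k = -n then c k else 0 := fun k => by
      simp_rw [← mul_assoc, ← fourier_add]
      rw [integral_mul_const, integral_fourier_unitAddCircle]
      by_cases hk : k = -n
      · simp [hk]
      · rw [if_neg hk, if_neg (by omega), zero_mul]
    simp_rw [h]
    rw [Finset.sum_ite_eq']
  · intro k _
    exact (by fun_prop : Continuous fun q : UnitAddCircle =>
      fourier (-n) q * (fourier (-k) q * c k)).integrable_of_hasCompactSupport
        (HasCompactSupport.of_compactSpace _)

theorem lintegral_enorm_sq_sum_fourier_neg (S : Finset ℤ) (c : ℤ → ℂ) :
    ∫⁻ q : UnitAddCircle, ‖∑ k ∈ S, fourier (-k) q * c k‖ₑ ^ 2 = ∑ k ∈ S, ‖c k‖ₑ ^ 2 := by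
  rw [← tsum_enorm_sq_fourierCoeff (g := fun q : UnitAddCircle => ∑ k ∈ S, fourier (-k) q * c k)]
  · simp_rw [fourierCoeff_sum_fourier_neg]
    rw [← (Equiv.neg ℤ).tsum_eq, tsum_eq_sum (s := S)]
    · refine Finset.sum_congr rfl fun k hk => ?_
      simp [hk]
    · intro k hk
      simp [hk]
  · exact (by fun_prop : Continuous fun q : UnitAddCircle => ∑ k ∈ S, fourier (-k) q * c k
      ).memLp_of_hasCompactSupport (HasCompactSupport.of_compactSpace _)

theorem lintegral_comp_floor_div {h : ℝ} (hh : 0 < h) (c : ℤ → ENNReal) :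
    ∫⁻ p : ℝ, c ⌊p / h⌋ = ENNReal.ofReal h * ∑' k, c k := by
  have hm : Measurable fun p : ℝ => ⌊p / h⌋ := Int.measurable_floor.comp (by fun_prop)
  rw [← lintegral_map (f := c) (measurable_of_countable c) hm, lintegral_countable', ← ENNReal.tsum_mul_left]
  refine tsum_congr fun k => ?_
  rw [Measure.map_apply hm (measurableSet_singleton k), mul_comm]
  congr 1
  have : (fun p : ℝ => ⌊p / h⌋) ⁻¹' {k} = Set.Ico (k * h) ((k + 1) * h) := by
    ext p
    simp only [Set.mem_preimage, Set.mem_singleton_iff, Int.floor_eq_iff, Set.mem_Ico,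
      le_div_iff₀ hh, div_lt_iff₀ hh]
  rw [this, Real.volume_Ico]
  congr 1
  ring

theorem sum_Ico_int_eq {M : Type*} [AddCommMonoid M] (c : ℤ → M) (r : ℤ) (L : ℕ) :
    ∑ k ∈ Finset.Ico r (r + L), c k = ∑ j ∈ Finset.range L, c (r + j) := by
  refine (Finset.sum_nbij' (fun j : ℕ => r + j) (fun k => (k - r).toNat) ?_ ?_ ?_ ?_ ?_).symm
  · intro j hj
    simp only [Finset.mem_range, Finset.mem_Ico] at hj ⊢
    omega
  · intro j hj
    simp only [Finset.mem_range, Finset.mem_Ico] at hj ⊢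
    omega
  · intro j hj
    simp
  · intro j hj
    simp only [Finset.mem_Ico] at hj
    omega
  · intro j hj
    rfl

/-- Each frequency belongs to the windows of `L` values of `⌊p / h⌋`, and each such value is taken
on an interval of length `h`. -/
theorem lintegral_sum_window {h : ℝ} (hh : 0 < h) (L : ℕ) (c : ℤ → ENNReal) :
    ∫⁻ p : ℝ, ∑ k ∈ Finset.Ico ⌊p / h⌋ (⌊p / h⌋ + L), c k =
      L * (ENNReal.ofReal h * ∑' k, c k) := by
  simp_rw [sum_Ico_int_eq]
  have hm : Measurable fun p : ℝ => ⌊p / h⌋ := Int.measurable_floor.comp (by fun_prop)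
  have hm2 : ∀ j ∈ Finset.range L, Measurable fun p : ℝ => c (⌊p / h⌋ + (j : ℤ)) := fun j _ =>
    (measurable_of_countable fun k : ℤ => c (k + j)).comp hm
  rw [lintegral_finsetSum _ hm2]
  simp_rw [fun j : ℕ => lintegral_comp_floor_div hh fun k => c (k + j)]
  simp_rw [fun j : ℕ => (Equiv.addRight (j : ℤ)).tsum_eq c |> fun h : ∑' k : ℤ, c (k + j) = _ => h]
  simp

end Trig

/-! ### Wave packets on the circle tensored with coherent states. -/

section States

variable {Ω D H : Type*} [MeasurableSpace Ω]
  [NormedAddCommGroup D] [InnerProductSpace ℂ D] [CompleteSpace D]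
  [NormedAddCommGroup H] [InnerProductSpace ℂ H] [CompleteSpace H]

/-- Wave packets with momentum in a window of length `L h` at `p`. -/
noncomputable def cylState (J : ℤ → D →L[ℂ] H) (χ : Ω → D) (h : ℝ) (L : ℕ)
    (z : UnitAddCircle × ℝ × Ω) : H :=
  (((Real.sqrt L)⁻¹ : ℝ) : ℂ) • ∑ k ∈ Finset.Ico ⌊z.2.1 / h⌋ (⌊z.2.1 / h⌋ + L),
    fourier (-k) z.1 • J k (χ z.2.2)

/-- The phase space measure `h⁻¹ dq dp dn`. -/
noncomputable def cylPhaseMeasure (h : ℝ) (ρ : Measure Ω) : Measure (UnitAddCircle × ℝ × Ω) :=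
  ENNReal.ofReal h⁻¹ • (volume : Measure UnitAddCircle).prod ((volume : Measure ℝ).prod ρ)

variable {J : ℤ → D →L[ℂ] H} {ρ : Measure Ω} {χ : Ω → D} {h : ℝ} {L : ℕ}

theorem enorm_sq_inv_sqrt (h : 0 < L) :
    ‖(((Real.sqrt L)⁻¹ : ℝ) : ℂ)‖ₑ ^ 2 = (L : ENNReal)⁻¹ := by
  have hL : (0 : ℝ) < L := by exact_mod_cast h
  rw [← ofReal_norm, Complex.norm_real, Real.norm_of_nonneg (by positivity),
    ← ENNReal.ofReal_pow (by positivity), inv_pow, Real.sq_sqrt hL.le,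
    ENNReal.ofReal_inv_of_pos hL, ENNReal.ofReal_natCast]

theorem adjoint_cylState (hJ : IsFrame J) (l : ℤ) (z : UnitAddCircle × ℝ × Ω) :
    (J l).adjoint (cylState J χ h L z) = if l ∈ Finset.Ico ⌊z.2.1 / h⌋ (⌊z.2.1 / h⌋ + L) then
      ((((Real.sqrt L)⁻¹ : ℝ) : ℂ) * fourier (-l) z.1) • χ z.2.2 else 0 := by
  simp only [cylState, map_smul, map_sum, hJ.adjoint_apply, smul_ite, smul_zero]
  rw [Finset.sum_ite_eq']
  split_ifs
  · rw [smul_smul]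
  · rw [smul_zero]

theorem norm_cylState (hJ : IsFrame J) (hχ : IsCoherent ρ χ) (hL : 0 < L)
    (z : UnitAddCircle × ℝ × Ω) : ‖cylState J χ h L z‖ = 1 := by
  have h1 := hJ.tsum_enorm_sq (cylState J χ h L z)
  have h2 : ∀ l, ‖(J l).adjoint (cylState J χ h L z)‖ₑ ^ 2 =
      if l ∈ Finset.Ico ⌊z.2.1 / h⌋ (⌊z.2.1 / h⌋ + L) then (L : ENNReal)⁻¹ else 0 := fun l => by
    rw [adjoint_cylState hJ]
    split_ifs
    · rw [enorm_smul, enorm_mul, mul_pow, mul_pow, enorm_sq_inv_sqrt hL,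
        ← ofReal_norm (χ _), hχ.norm_eq, ← ofReal_norm (fourier (-l) z.1), norm_fourier_apply]
      simp
    · simp
  simp_rw [h2] at h1
  rw [tsum_eq_sum (s := Finset.Ico ⌊z.2.1 / h⌋ (⌊z.2.1 / h⌋ + L)) (fun l hl => if_neg hl),
    Finset.sum_congr rfl (fun l hl => if_pos hl), Finset.sum_const, Int.card_Ico,
    add_sub_cancel_left, Int.toNat_natCast, nsmul_eq_mul,
    ENNReal.mul_inv_cancel (by exact_mod_cast hL.ne') (ENNReal.natCast_ne_top L)] at h1
  rw [← ofReal_norm, ← ENNReal.ofReal_pow (norm_nonneg _), eq_comm, ENNReal.ofReal_eq_one] at h1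
  exact (pow_eq_one_iff_of_nonneg (norm_nonneg _) two_ne_zero).1 h1

theorem inner_cylState (v : H) (z : UnitAddCircle × ℝ × Ω) :
    inner ℂ v (cylState J χ h L z) = (((Real.sqrt L)⁻¹ : ℝ) : ℂ) *
      ∑ k ∈ Finset.Ico ⌊z.2.1 / h⌋ (⌊z.2.1 / h⌋ + L),
        fourier (-k) z.1 * inner ℂ ((J k).adjoint v) (χ z.2.2) := by
  simp only [cylState, inner_smul_right, inner_sum, ContinuousLinearMap.adjoint_inner_left]

/-- A function on the phase space given by measurable functions indexed by `⌊p / h⌋`. -/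
theorem measurable_of_floor {α β : Type*} [MeasurableSpace α] [MeasurableSpace β] (h : ℝ)
    {f : ℤ → α → β} (hf : ∀ r, Measurable (f r)) {p : α → ℝ} (hp : Measurable p) :
    Measurable fun z => f ⌊p z / h⌋ z := by
  have h1 : Measurable fun w : α × ℤ => f w.2 w.1 := measurable_from_prod_countable_left hf
  exact h1.comp (measurable_id.prodMk (Int.measurable_floor.comp (hp.div_const h)))

theorem measurable_fourier (k : ℤ) : Measurable (fourier k : UnitAddCircle → ℂ) :=
  (fourier k).continuous.measurable

theorem measurable_inner_cylState (hχ : IsCoherent ρ χ) (v : H) :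
    Measurable fun z => inner ℂ v (cylState J χ h L z) := by
  simp_rw [inner_cylState]
  refine measurable_of_floor h (f := fun r (z : UnitAddCircle × ℝ × Ω) =>
    (((Real.sqrt L)⁻¹ : ℝ) : ℂ) * ∑ k ∈ Finset.Ico r (r + L),
        fourier (-k) z.1 * inner ℂ ((J k).adjoint v) (χ z.2.2)) (fun r => ?_) (by fun_prop)
  refine (Finset.measurable_sum _ fun k _ => ?_).const_mul _
  have h1 : Measurable fun n => inner ℂ ((J k).adjoint v) (χ n) :=
    ((innerSL ℂ ((J k).adjoint v)).continuous.comp_stronglyMeasurable hχ.meas).measurable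
  exact ((measurable_fourier _).comp measurable_fst).mul (h1.comp (by fun_prop))

/-- The position `q` is integrated by Parseval, the parameter `n` by the resolution of the identity
of `χ`, the momentum `p` by counting windows. The constants `L⁻¹`, `L h` and `h⁻¹` multiply to one.
-/
theorem lintegral_inner_cylState [SFinite ρ] (hJ : IsFrame J) (hχ : IsCoherent ρ χ) (hh : 0 < h)
    (hL : 0 < L) (v : H) :
    ∫⁻ z, ‖inner ℂ v (cylState J χ h L z)‖ₑ ^ 2 ∂(cylPhaseMeasure h ρ) = ‖v‖ₑ ^ 2 := by
  have hm := ((measurable_inner_cylState (h := h) (L := L) (J := J) hχ v).enorm.pow_const 2)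
  rw [cylPhaseMeasure, lintegral_smul_measure, lintegral_prod_symm _ hm.aemeasurable]
  have h1 : ∀ y : ℝ × Ω, ∫⁻ q, ‖inner ℂ v (cylState J χ h L (q, y))‖ₑ ^ 2 =
      (L : ENNReal)⁻¹ * ∑ k ∈ Finset.Ico ⌊y.1 / h⌋ (⌊y.1 / h⌋ + L),
        ‖inner ℂ ((J k).adjoint v) (χ y.2)‖ₑ ^ 2 := fun y => by
    simp_rw [inner_cylState, enorm_mul, mul_pow, enorm_sq_inv_sqrt hL]
    rw [lintegral_const_mul' _ _ (by simpa using hL.ne'), lintegral_enorm_sq_sum_fourier_neg]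
  have hm2 : ∀ k, Measurable fun n => ‖inner ℂ ((J k).adjoint v) (χ n)‖ₑ ^ 2 := fun k =>
    ((innerSL ℂ ((J k).adjoint v)).continuous.comp_stronglyMeasurable
      hχ.meas).measurable.enorm.pow_const 2
  simp_rw [h1]
  rw [lintegral_const_mul' _ _ (by simpa using hL.ne'), lintegral_prod]
  · have h2 : ∀ p : ℝ, ∫⁻ n, ∑ k ∈ Finset.Ico ⌊p / h⌋ (⌊p / h⌋ + L),
        ‖inner ℂ ((J k).adjoint v) (χ n)‖ₑ ^ 2 ∂ρ = ∑ k ∈ Finset.Ico ⌊p / h⌋ (⌊p / h⌋ + L),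
          ‖(J k).adjoint v‖ₑ ^ 2 := fun p => by
      rw [lintegral_finsetSum _ fun k _ => hm2 k]
      refine Finset.sum_congr rfl fun k _ => ?_
      rw [← hχ.lintegral_eq]
      refine lintegral_congr fun n => ?_
      rw [← ofReal_norm, norm_inner_symm, ofReal_norm]
    simp_rw [h2]
    rw [lintegral_sum_window hh, hJ.tsum_enorm_sq, smul_eq_mul, ← mul_assoc (L : ENNReal)⁻¹,
      ENNReal.inv_mul_cancel (by exact_mod_cast hL.ne') (ENNReal.natCast_ne_top L), one_mul,
      ← mul_assoc, ← ENNReal.ofReal_mul (by positivity), inv_mul_cancel₀ hh.ne',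
      ENNReal.ofReal_one, one_mul]
  · refine (measurable_of_floor h (f := fun r (y : ℝ × Ω) => ∑ k ∈ Finset.Ico r (r + L),
      ‖inner ℂ ((J k).adjoint v) (χ y.2)‖ₑ ^ 2) (fun r => ?_) (by fun_prop)).aemeasurable
    exact Finset.measurable_sum _ fun k _ => (hm2 k).comp measurable_snd

end States

/-! ### The wave packet defect for a single symbol on the cylinder. -/

theorem enorm_add_sq_le {E : Type*} [SeminormedAddGroup E] (a b : E) :
    ‖a + b‖ₑ ^ 2 ≤ 2 * ‖a‖ₑ ^ 2 + 2 * ‖b‖ₑ ^ 2 := by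
  simp_rw [← ofReal_norm]
  rw [← ENNReal.ofReal_pow (norm_nonneg _), ← ENNReal.ofReal_pow (norm_nonneg _),
    ← ENNReal.ofReal_pow (norm_nonneg _), ← ENNReal.ofReal_ofNat 2,
    ← ENNReal.ofReal_mul zero_le_two, ← ENNReal.ofReal_mul zero_le_two,
    ← ENNReal.ofReal_add (by positivity) (by positivity)]
  refine ENNReal.ofReal_le_ofReal ?_
  nlinarith [norm_add_le a b, norm_nonneg (a + b), sq_nonneg (‖a‖ - ‖b‖), norm_nonneg a, norm_nonneg b]

/-- The window of length `L` at `p`. -/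
noncomputable def cylWindow (h : ℝ) (L : ℕ) (p : ℝ) : Finset ℤ :=
  Finset.Ico ⌊p / h⌋ (⌊p / h⌋ + L)

/-- The Fourier coefficients of the defect of a wave packet. -/
noncomputable def cylBracket (F : ℝ × ℝ → ℝ) (ħ : ℝ) (L : ℕ) (p : ℝ) (l k : ℤ) : ℂ :=
  (if k ∈ cylWindow (2 * Real.pi * ħ) L p then cylCoef F (l - k) (Real.pi * ħ * (l + k)) else 0) -
    if l ∈ cylWindow (2 * Real.pi * ħ) L p then cylCoef F (l - k) p else 0

/-- The defect of a wave packet. -/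
noncomputable def cylDefect (F : ℝ × ℝ → ℝ) (g : UnitAddCircle → ℂ) (ħ : ℝ) (L : ℕ) (p : ℝ) (l : ℤ)
    (q : UnitAddCircle) : ℂ :=
  (∑ k ∈ cylWindow (2 * Real.pi * ħ) L p,
    fourier (-k) q * cylCoef F (l - k) (Real.pi * ħ * (l + k))) -
    if l ∈ cylWindow (2 * Real.pi * ħ) L p then fourier (-l) q * g q else 0

namespace IsCyl

variable {R : ℝ} {F : ℝ × ℝ → ℝ}

theorem fourierCoeff_fourier_mul (g : UnitAddCircle → ℂ) (j n : ℤ) :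
    fourierCoeff (fun q => fourier j q * g q) n = fourierCoeff g (n - j) := by
  simp only [fourierCoeff, smul_eq_mul, ← mul_assoc, ← fourier_add]
  congr with q
  rw [show -n + j = -(n - j) by ring]

/-- Parseval in the position `q` of the packet: the `l`-th Fourier component of the defect is itself
a function of `q`, and its coefficient at `-k` is the bracket. -/
theorem lintegral_enorm_sq_cylDefect (hF : IsCyl R F) (ħ : ℝ) (L : ℕ) (p : ℝ) (l : ℤ) :
    ∫⁻ q, ‖cylDefect F (hF.onCircle p) ħ L p l q‖ₑ ^ 2 =
      ∑' k, ‖cylBracket F ħ L p l k‖ₑ ^ 2 := by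
  set S := cylWindow (2 * Real.pi * ħ) L p with hS
  have c1 : Continuous fun q : UnitAddCircle => ∑ k ∈ S,
      fourier (-k) q * cylCoef F (l - k) (Real.pi * ħ * (l + k)) := by fun_prop
  have c2 : Continuous fun q : UnitAddCircle =>
      if l ∈ S then fourier (-l) q * hF.onCircle p q else 0 := by
    split_ifs <;> fun_prop
  have hcont : Continuous (cylDefect F (hF.onCircle p) ħ L p l) := c1.sub c2
  rw [← tsum_enorm_sq_fourierCoeff
    (hcont.memLp_of_hasCompactSupport (HasCompactSupport.of_compactSpace _)),
    ← (Equiv.neg ℤ).tsum_eq]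
  refine tsum_congr fun k => ?_
  rw [Equiv.neg_apply]
  congr 2
  have hi : ∀ {f : UnitAddCircle → ℂ}, Continuous f →
      Integrable f (AddCircle.haarAddCircle (T := 1)) := fun hf =>
    hf.integrable_of_hasCompactSupport (HasCompactSupport.of_compactSpace _)
  have h1 : fourierCoeff (cylDefect F (hF.onCircle p) ħ L p l) (-k) =
      fourierCoeff (fun q : UnitAddCircle => ∑ k ∈ S,
        fourier (-k) q * cylCoef F (l - k) (Real.pi * ħ * (l + k))) (-k) -
      fourierCoeff (fun q : UnitAddCircle =>
        if l ∈ S then fourier (-l) q * hF.onCircle p q else 0) (-k) := by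
    simp only [fourierCoeff, cylDefect, smul_sub, ← hS]
    exact integral_sub (hi (by fun_prop)) (hi (by fun_prop))
  rw [h1, fourierCoeff_sum_fourier_neg S fun k => cylCoef F (l - k) (Real.pi * ħ * (l + k)), neg_neg,
    cylBracket, ← hS]
  congr 1
  split_ifs
  · rw [fourierCoeff_fourier_mul, hF.fourierCoeff_onCircle]
    congr 1
    ring
  · simp [fourierCoeff]

/-- A shift by `m` carries at most `|m|` indices through each of the two ends of the window. The
bound does not involve `L`, so after division by `L` the edge effect is small. -/
theorem tsum_window_xor_le (r : ℤ) (L : ℕ) (m : ℤ) :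
    ∑' k : ℤ, (if (k ∈ Finset.Ico r (r + L) ↔ m + k ∈ Finset.Ico r (r + L)) then (0 : ENNReal) else 1) ≤
      2 * m.natAbs := by
  set T : Finset ℤ := Finset.Ico (min r (r - m)) (max r (r - m)) ∪
    Finset.Ico (r + L - max 0 m) (r + L - min 0 m) with hT
  rw [tsum_eq_sum (s := T)]
  · refine (Finset.sum_le_card_nsmul _ _ 1 fun k _ => by split_ifs <;> simp).trans ?_
    rw [nsmul_one]
    have : T.card ≤ 2 * m.natAbs := by
      refine (Finset.card_union_le _ _).trans ?_
      rw [Int.card_Ico, Int.card_Ico]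
      omega
    exact_mod_cast this
  · intro k hk
    refine if_pos ?_
    simp only [hT, Finset.mem_union, Finset.mem_Ico] at hk ⊢
    omega

/-- With `h = 2πħ` the momentum in the matrix element is `(k + m/2) h`, while `p` lies in the cell
of `h ℤ` at the left end of the window containing `k`. -/
theorem abs_window_sub_le {ħ : ℝ} (hħ : 0 < ħ) {L : ℕ} {p : ℝ} {k : ℤ}
    (hk : k ∈ cylWindow (2 * Real.pi * ħ) L p) (m : ℤ) :
    |Real.pi * ħ * (((m + k : ℤ) : ℝ) + k) - p| ≤ 2 * Real.pi * ħ * (L + |(m : ℝ)|) := by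
  have hh : 0 < 2 * Real.pi * ħ := by positivity
  rw [cylWindow, Finset.mem_Ico] at hk
  set r := ⌊p / (2 * Real.pi * ħ)⌋
  have h1 : (r : ℝ) * (2 * Real.pi * ħ) ≤ p := by
    rw [← le_div_iff₀ hh]; exact Int.floor_le _
  have h2 : p < (r + 1) * (2 * Real.pi * ħ) := by
    rw [← div_lt_iff₀ hh]; exact Int.lt_floor_add_one _
  have h3 : (r : ℝ) ≤ k := by exact_mod_cast hk.1
  have h4 : (k : ℝ) + 1 ≤ r + L := by exact_mod_cast hk.2
  have e : Real.pi * ħ * (((m + k : ℤ) : ℝ) + k) = (k + m / 2) * (2 * Real.pi * ħ) := by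
    push_cast; ring
  rw [e, abs_le]
  have h5 := neg_abs_le (m : ℝ)
  have h6 := le_abs_self (m : ℝ)
  have h7 := abs_nonneg (m : ℝ)
  constructor <;> nlinarith

/-- The bracket splits into the error of freezing the momentum at `p`, which occurs for the `L`
input frequencies of the window, and the frozen coefficient at pairs `(k, m + k)` with exactly one
member in the window. -/
theorem tsum_enorm_sq_cylBracket_le (hF : IsCyl R F) {ħ : ℝ} (hħ : 0 < ħ) (L : ℕ) (p : ℝ) :
    ∑' l, ∑' k, ‖cylBracket F ħ L p l k‖ₑ ^ 2 ≤
      2 * (L * ∑' m : ℤ, ENNReal.ofReal (2 * Real.pi * ħ * (L + |(m : ℝ)|)) *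
        ∫⁻ s, (Set.Icc (p - 2 * Real.pi * ħ * (L + |(m : ℝ)|))
          (p + 2 * Real.pi * ħ * (L + |(m : ℝ)|))).indicator
            (fun s => ‖cylCoef (dXi F) m s‖ₑ ^ 2) s) +
      2 * ∑' m : ℤ, 2 * m.natAbs * ‖cylCoef F m p‖ₑ ^ 2 := by
  set S := cylWindow (2 * Real.pi * ħ) L p with hS
  set A : ℤ → ENNReal := fun m => ENNReal.ofReal (2 * Real.pi * ħ * (L + |(m : ℝ)|)) *
        ∫⁻ s, (Set.Icc (p - 2 * Real.pi * ħ * (L + |(m : ℝ)|))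
          (p + 2 * Real.pi * ħ * (L + |(m : ℝ)|))).indicator
            (fun s => ‖cylCoef (dXi F) m s‖ₑ ^ 2) s
  have h1 : ∀ m k : ℤ, ‖cylBracket F ħ L p (m + k) k‖ₑ ^ 2 ≤
      2 * (if k ∈ S then A m else 0) +
      2 * ((if (k ∈ S ↔ m + k ∈ S) then 0 else 1) * ‖cylCoef F m p‖ₑ ^ 2) := fun m k => by
    have e : cylBracket F ħ L p (m + k) k =
        (if k ∈ S then cylCoef F m (Real.pi * ħ * (((m + k : ℤ) : ℝ) + k)) - cylCoef F m p else 0) +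
        ((if k ∈ S then cylCoef F m p else 0) - if m + k ∈ S then cylCoef F m p else 0) := by
      rw [cylBracket, ← hS, add_sub_cancel_right]
      split_ifs <;> ring
    rw [e]
    refine (enorm_add_sq_le _ _).trans ?_
    gcongr
    · split_ifs with hk
      · exact hF.enorm_sq_cylCoef_sub_le m (abs_window_sub_le hħ hk m)
      · simp
    · by_cases h1 : k ∈ S <;> by_cases h2 : m + k ∈ S <;> simp [h1, h2]
  rw [ENNReal.tsum_comm]
  have h2 : ∀ k, ∑' l, ‖cylBracket F ħ L p l k‖ₑ ^ 2 = ∑' m, ‖cylBracket F ħ L p (m + k) k‖ₑ ^ 2 :=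
    fun k => ((Equiv.addRight k).tsum_eq fun l => ‖cylBracket F ħ L p l k‖ₑ ^ 2).symm
  simp_rw [h2]
  refine (ENNReal.tsum_le_tsum fun k => ENNReal.tsum_le_tsum fun m => h1 m k).trans ?_
  simp_rw [ENNReal.tsum_add, ENNReal.tsum_mul_left]
  refine add_le_add (mul_le_mul_right (le_of_eq ?_) _) (mul_le_mul_right ?_ _)
  · rw [tsum_eq_sum (s := S) fun k hk => by simp [hk],
      Finset.sum_congr rfl (fun k hk => tsum_congr fun m => if_pos hk), Finset.sum_const, hS,
      cylWindow, Int.card_Ico, add_sub_cancel_left, Int.toNat_natCast, nsmul_eq_mul]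
  · rw [ENNReal.tsum_comm]
    refine ENNReal.tsum_le_tsum fun m => ?_
    rw [ENNReal.tsum_mul_right]
    gcongr
    exact tsum_window_xor_le _ _ _

/-- Integrated over `p`, the freezing error of mode `m` becomes `2 W²` times the energy of its `ξ`
derivative, with `W = h (L + |m|)` and `W² ≤ 2 h² (L² + m²)`; this calls for the pure and the mixed
energy. The edge error needs half a derivative in `x`, obtained by interpolation. -/
theorem lintegral_tsum_cylBracket_le (hF : IsCyl R F) {ħ : ℝ} (hħ : 0 < ħ) (L : ℕ) {C τ : ℝ}
    (hτ : 0 < τ) (hC : ∀ z, |F z| ≤ C) (hx : ∀ z, |dX (dX F) z| ≤ C * τ ^ 2)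
    (hξ : ∀ z, |dXi (dXi F) z| ≤ C * τ ^ 2) (hxξ : ∀ z, |dX (dX (dXi (dXi F))) z| ≤ C * τ ^ 4) :
    ∫⁻ p, ∑' l, ∑' k, ‖cylBracket F ħ L p l k‖ₑ ^ 2 ≤
      ENNReal.ofReal (C ^ 2 * (8 * L * (2 * Real.pi * ħ) ^ 2 * (L ^ 2 * τ ^ 2 + τ ^ 4) + 4 * τ)) *
        cylMeasure {z | F z ≠ 0} := by
  set h := 2 * Real.pi * ħ with hh
  have hh0 : 0 < h := by positivity
  have hC0 : 0 ≤ C := (abs_nonneg _).trans (hC 0)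
  set V := cylMeasure {z | F z ≠ 0}
  refine (lintegral_mono fun p => hF.tsum_enorm_sq_cylBracket_le hħ L p).trans ?_
  rw [← hh]
  have hm : ∀ m, Measurable fun s => ‖cylCoef (dXi F) m s‖ₑ ^ 2 := fun m =>
    (hF.deriv_snd.continuous_cylCoef m).enorm.measurable.pow_const 2
  have hm0 : ∀ m, Measurable fun s => ‖cylCoef F m s‖ₑ ^ 2 := fun m =>
    (hF.continuous_cylCoef m).enorm.measurable.pow_const 2
  have hm1 : ∀ m : ℤ, Measurable fun p : ℝ => ENNReal.ofReal (h * (L + |(m : ℝ)|)) *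
      ∫⁻ s, (Set.Icc (p - h * (L + |(m : ℝ)|)) (p + h * (L + |(m : ℝ)|))).indicator
            (fun s => ‖cylCoef (dXi F) m s‖ₑ ^ 2) s := fun m => by
    refine Measurable.const_mul ?_ _
    refine Measurable.lintegral_prod_right' (f := fun w : ℝ × ℝ =>
      (Set.Icc (w.1 - h * (L + |(m : ℝ)|)) (w.1 + h * (L + |(m : ℝ)|))).indicator
            (fun s => ‖cylCoef (dXi F) m s‖ₑ ^ 2) w.2) ?_
    have e : (fun w : ℝ × ℝ =>
      (Set.Icc (w.1 - h * (L + |(m : ℝ)|)) (w.1 + h * (L + |(m : ℝ)|))).indicator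
            (fun s => ‖cylCoef (dXi F) m s‖ₑ ^ 2) w.2) =
        {w : ℝ × ℝ | w.1 - h * (L + |(m : ℝ)|) ≤ w.2 ∧ w.2 ≤ w.1 + h * (L + |(m : ℝ)|)}.indicator
          fun w => ‖cylCoef (dXi F) m w.2‖ₑ ^ 2 := by
      ext w
      simp [Set.indicator_apply]
    rw [e]
    have s1 : MeasurableSet {w : ℝ × ℝ | w.1 - h * (L + |(m : ℝ)|) ≤ w.2} :=
      measurableSet_le (by fun_prop) (by fun_prop)
    have s2 : MeasurableSet {w : ℝ × ℝ | w.2 ≤ w.1 + h * (L + |(m : ℝ)|)} :=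
      measurableSet_le (by fun_prop) (by fun_prop)
    exact ((hm m).comp measurable_snd).indicator (s1.inter s2)
  rw [lintegral_add_right _ ((Measurable.tsum fun m => (hm0 m).const_mul _).const_mul _),
    lintegral_const_mul _ (Measurable.const_mul (Measurable.tsum hm1) _),
    lintegral_const_mul _ (Measurable.tsum hm1),
    lintegral_const_mul _ (Measurable.tsum fun m => (hm0 m).const_mul _),
    lintegral_tsum fun m => (hm1 m).aemeasurable,
    lintegral_tsum fun m => ((hm0 m).const_mul _).aemeasurable]
  have b1 : ∑' m : ℤ, ∫⁻ p : ℝ, ENNReal.ofReal (h * (L + |(m : ℝ)|)) *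
      ∫⁻ s, (Set.Icc (p - h * (L + |(m : ℝ)|)) (p + h * (L + |(m : ℝ)|))).indicator
            (fun s => ‖cylCoef (dXi F) m s‖ₑ ^ 2) s ≤
      ENNReal.ofReal (4 * h ^ 2 * (L ^ 2 * (C * (C * τ ^ 2)) + C * (C * τ ^ 4))) * V := by
    have e1 : ∀ m : ℤ, ∫⁻ p : ℝ, ENNReal.ofReal (h * (L + |(m : ℝ)|)) *
      ∫⁻ s, (Set.Icc (p - h * (L + |(m : ℝ)|)) (p + h * (L + |(m : ℝ)|))).indicator
            (fun s => ‖cylCoef (dXi F) m s‖ₑ ^ 2) s ≤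
        ENNReal.ofReal (4 * h ^ 2 * L ^ 2) * (∫⁻ s, ‖cylCoef (dXi F) m s‖ₑ ^ 2) +
        ENNReal.ofReal (4 * h ^ 2) * ∫⁻ s, ‖(m : ℂ) * cylCoef (dXi F) m s‖ₑ ^ 2 := fun m => by
      have hm2 : ‖(m : ℂ)‖ₑ ^ 2 = ENNReal.ofReal ((m : ℝ) ^ 2) := by
        rw [← ofReal_norm, ← ENNReal.ofReal_pow (norm_nonneg _), Complex.norm_intCast, sq_abs]
      rw [lintegral_const_mul' _ _ ENNReal.ofReal_ne_top, lintegral_indicator_window _ (hm m)]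
      simp_rw [enorm_mul, mul_pow]
      rw [lintegral_const_mul _ (hm m)]
      simp only [← mul_assoc]
      rw [← add_mul, hm2, ← ENNReal.ofReal_mul (by positivity), ← ENNReal.ofReal_mul (by positivity),
        ← ENNReal.ofReal_add (by positivity) (by positivity)]
      gcongr
      rw [← sq_abs (m : ℝ)]
      nlinarith [mul_nonneg (sq_nonneg h) (sq_nonneg ((L : ℝ) - |(m : ℝ)|))]
    refine (ENNReal.tsum_le_tsum e1).trans ?_
    rw [ENNReal.tsum_add, ENNReal.tsum_mul_left, ENNReal.tsum_mul_left]
    refine (add_le_add (mul_le_mul_right (hF.energy_snd hC hξ) _)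
      (mul_le_mul_right (hF.energy_mixed hC hxξ) _)).trans_eq ?_
    rw [← mul_assoc, ← mul_assoc (ENNReal.ofReal _) _ (cylMeasure _), ← add_mul,
      ← ENNReal.ofReal_mul (by positivity), ← ENNReal.ofReal_mul (by positivity), ← ENNReal.ofReal_add (by positivity) (by positivity)]
    congr 2
    ring
  have b2 : ∑' m : ℤ, ∫⁻ p, 2 * m.natAbs * ‖cylCoef F m p‖ₑ ^ 2 ≤
      ENNReal.ofReal (2 * C ^ 2 * τ) * V := by
    -- Interpolation by `2 |m| ≤ τ + m² / τ`: as each derivative costs a factor `τ`, the two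
    -- resulting terms have the same size `C² τ`.
    have e1 : ∀ m : ℤ, ∫⁻ p, 2 * m.natAbs * ‖cylCoef F m p‖ₑ ^ 2 ≤
        ENNReal.ofReal τ * (∫⁻ s, ‖cylCoef F m s‖ₑ ^ 2) +
        ENNReal.ofReal τ⁻¹ * ∫⁻ s, ‖(m : ℂ) * cylCoef F m s‖ₑ ^ 2 := fun m => by
      have hm2 : ‖(m : ℂ)‖ₑ ^ 2 = ENNReal.ofReal ((m : ℝ) ^ 2) := by
        rw [← ofReal_norm, ← ENNReal.ofReal_pow (norm_nonneg _), Complex.norm_intCast, sq_abs]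
      have hm3 : (2 * m.natAbs : ENNReal) = ENNReal.ofReal (2 * |(m : ℝ)|) := by
        rw [ENNReal.ofReal_mul zero_le_two, ENNReal.ofReal_ofNat, ← Int.cast_abs,
          ← Int.natCast_natAbs, Int.cast_natCast, ENNReal.ofReal_natCast]
      simp_rw [enorm_mul, mul_pow]
      rw [lintegral_const_mul _ (hm0 m), lintegral_const_mul _ (hm0 m), ← mul_assoc, ← add_mul, hm2,
        hm3, ← ENNReal.ofReal_mul (by positivity), ← ENNReal.ofReal_add (by positivity) (by positivity)]
      gcongr
      rw [← sq_abs (m : ℝ)]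
      have h1 : τ * τ⁻¹ = 1 := mul_inv_cancel₀ hτ.ne'
      have h2 : τ + τ⁻¹ * |(m : ℝ)| ^ 2 - 2 * |(m : ℝ)| = τ⁻¹ * (τ - |(m : ℝ)|) ^ 2 := by
        field_simp
        ring
      have h3 : 0 ≤ τ⁻¹ * (τ - |(m : ℝ)|) ^ 2 := by positivity
      linarith
    refine (ENNReal.tsum_le_tsum e1).trans ?_
    rw [ENNReal.tsum_add, ENNReal.tsum_mul_left, ENNReal.tsum_mul_left]
    refine (add_le_add (mul_le_mul_right (hF.energy_zero hC) _)
      (mul_le_mul_right (hF.energy_fst hC hx) _)).trans_eq ?_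
    rw [← mul_assoc, ← mul_assoc (ENNReal.ofReal _) _ (cylMeasure _), ← add_mul,
      ← ENNReal.ofReal_mul (by positivity), ← ENNReal.ofReal_mul (by positivity), ← ENNReal.ofReal_add (by positivity) (by positivity)]
    congr 2
    field_simp
    ring
  refine (add_le_add (mul_le_mul_right (mul_le_mul_right b1 _) _) (mul_le_mul_right b2 _)).trans_eq ?_
  rw [← ENNReal.ofReal_natCast, ← ENNReal.ofReal_ofNat 2]
  simp only [← mul_assoc]
  rw [← add_mul, ← ENNReal.ofReal_mul (by positivity), ← ENNReal.ofReal_mul (by positivity),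
    ← ENNReal.ofReal_mul (by positivity), ← ENNReal.ofReal_add (by positivity) (by positivity)]
  congr 2
  ring

end IsCyl

/-! ### Analysis and synthesis with coherent states. -/

section Synthesis

variable {Ω D : Type*} [TopologicalSpace Ω] [MeasurableSpace Ω] [BorelSpace Ω]
  [SecondCountableTopology Ω]
  [NormedAddCommGroup D] [InnerProductSpace ℂ D] [CompleteSpace D] [FiniteDimensional ℂ D]
  {ρ : Measure Ω} [IsFiniteMeasure ρ] {χ : Ω → D}

theorem IsCoherent.integrable_smul (hχ : IsCoherent ρ χ) {f : Ω → ℂ} (hf : Integrable f ρ) :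
    Integrable (fun n => f n • χ n) ρ :=
  hf.norm.mono' (hf.aestronglyMeasurable.smul hχ.meas.aestronglyMeasurable)
    (Eventually.of_forall fun n => by rw [norm_smul, hχ.norm_eq, mul_one])

theorem IsCoherent.measurable_inner (hχ : IsCoherent ρ χ) (v : D) :
    Measurable fun n => inner ℂ (χ n) v :=
  ((continuous_id.inner continuous_const : Continuous fun d : D => inner ℂ d v).comp_stronglyMeasurable
    hχ.meas).measurable

theorem IsCoherent.norm_inner_le (hχ : IsCoherent ρ χ) (n n' : Ω) : ‖inner ℂ (χ n') (χ n)‖ ≤ 1 := by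
  have := norm_inner_le_norm (𝕜 := ℂ) (χ n') (χ n)
  rwa [hχ.norm_eq, hχ.norm_eq, one_mul] at this

theorem IsCoherent.integrable_inner (hχ : IsCoherent ρ χ) (v : D) :
    Integrable (fun n => inner ℂ (χ n) v) ρ :=
  (integrable_const ‖v‖).mono' (hχ.measurable_inner v).aestronglyMeasurable
    (Eventually.of_forall fun n => by
      have := norm_inner_le_norm (𝕜 := ℂ) (χ n) v
      rwa [hχ.norm_eq, one_mul] at this)

/-- Synthesis is the adjoint of the isometry `v ↦ ⟨χ n, v⟩`, hence a contraction. Concretely, the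
integral is paired with itself and one factor is cancelled after Cauchy-Schwarz. -/
theorem IsCoherent.enorm_sq_integral_smul_le (hχ : IsCoherent ρ χ) {f : Ω → ℂ}
    (hf : Integrable f ρ) : ‖∫ n, f n • χ n ∂ρ‖ₑ ^ 2 ≤ ∫⁻ n, ‖f n‖ₑ ^ 2 ∂ρ := by
  set v := ∫ n, f n • χ n ∂ρ with hv
  by_cases h0 : v = 0
  · simp [h0]
  have h1 : inner ℂ v v = ∫ n, f n * inner ℂ v (χ n) ∂ρ := by
    conv_lhs => arg 3; rw [hv]
    rw [← integral_inner (hχ.integrable_smul hf)]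
    simp_rw [inner_smul_right]
  have h2 : ‖v‖ₑ ^ 2 ≤ ∫⁻ n, ‖f n‖ₑ * ‖inner ℂ (χ n) v‖ₑ ∂ρ := by
    have h3 : ‖inner ℂ v v‖ₑ = ‖v‖ₑ ^ 2 := by
      rw [← ofReal_norm, inner_self_eq_norm_sq_to_K, ← ofReal_norm, ← ENNReal.ofReal_pow (norm_nonneg _)]
      simp
    rw [← h3, h1]
    refine (enorm_integral_le_lintegral_enorm _).trans_eq (lintegral_congr fun n => ?_)
    rw [enorm_mul, ← ofReal_norm (inner ℂ v (χ n)), norm_inner_symm, ofReal_norm]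
  have h3 := sq_lintegral_mul_le (μ := ρ) (f := fun n => ‖f n‖ₑ)
    (g := fun n => ‖inner ℂ (χ n) v‖ₑ) hf.aestronglyMeasurable.enorm
    (hχ.measurable_inner v).enorm.aemeasurable
  rw [hχ.lintegral_eq] at h3
  have h4 : ‖v‖ₑ ^ 2 * ‖v‖ₑ ^ 2 ≤ (∫⁻ n, ‖f n‖ₑ ^ 2 ∂ρ) * ‖v‖ₑ ^ 2 := by
    rw [← sq]
    exact (pow_le_pow_left' h2 2).trans h3
  have h5 : ‖v‖ₑ ^ 2 ≠ 0 := by simpa using h0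
  have h6 : ‖v‖ₑ ^ 2 ≠ ⊤ := by simp
  exact (ENNReal.mul_le_mul_iff_left h5 h6).1 h4

/-- The quadratic form of `∫ |χ n⟩⟨χ n| - 1` vanishes, and over the complex numbers this determines
the operator. -/
theorem IsCoherent.integral_inner_smul (hχ : IsCoherent ρ χ) (v : D) :
    ∫ n, inner ℂ (χ n) v • χ n ∂ρ = v := by
  have hi : Integrable (fun n => (innerSL ℂ (χ n)).smulRight (χ n)) ρ := by
    refine (integrable_const (1 : ℝ)).mono' hχ.stronglyMeasurable_proj.aestronglyMeasurable
      (Eventually.of_forall fun n => ?_)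
    rw [hχ.norm_proj]
  set T : D →L[ℂ] D := ∫ n, (innerSL ℂ (χ n)).smulRight (χ n) ∂ρ with hT
  have hTv : ∀ w, T w = ∫ n, inner ℂ (χ n) w • χ n ∂ρ := fun w => by
    rw [hT, ContinuousLinearMap.integral_apply hi]
    rfl
  have h1 : (T - 1 : D →ₗ[ℂ] D) = 0 := by
    refine (inner_map_self_eq_zero _).1 fun w => ?_
    rw [← inner_conj_symm, map_eq_zero]
    simp only [LinearMap.sub_apply, ContinuousLinearMap.coe_coe, Module.End.one_apply,
      inner_sub_right]
    rw [sub_eq_zero, hTv, ← integral_inner (hχ.integrable_smul (hχ.integrable_inner w))]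
    have e : ∀ n, inner ℂ w (inner ℂ (χ n) w • χ n) = ((‖inner ℂ (χ n) w‖ ^ 2 : ℝ) : ℂ) := fun n => by
      rw [inner_smul_right, ← inner_conj_symm w, Complex.mul_conj, Complex.normSq_eq_norm_sq]
    simp_rw [e]
    rw [integral_complex_ofReal, inner_self_eq_norm_sq_to_K, integral_eq_lintegral_of_nonneg_ae
      (Eventually.of_forall fun n => by positivity)
      ((hχ.measurable_inner w).norm.pow_const 2).aestronglyMeasurable]
    simp_rw [ENNReal.ofReal_pow (norm_nonneg _), ofReal_norm]
    rw [hχ.lintegral_eq, ← ofReal_norm, ← ENNReal.ofReal_pow (norm_nonneg _),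
      ENNReal.toReal_ofReal (by positivity)]
    push_cast
    rfl
  have h2 := LinearMap.congr_fun h1 v
  simp only [LinearMap.sub_apply, ContinuousLinearMap.coe_coe, Module.End.one_apply,
    LinearMap.zero_apply, sub_eq_zero] at h2
  rw [← hTv, h2]

end Synthesis

/-! ### Pointwise reduction of the coherent defect to the single-symbol defect. -/

section Defect

variable {Ω D : Type*} [TopologicalSpace Ω] [MeasurableSpace Ω] [BorelSpace Ω]
  [SecondCountableTopology Ω]
  [NormedAddCommGroup D] [InnerProductSpace ℂ D] [CompleteSpace D] [FiniteDimensional ℂ D]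
  {ρ : Measure Ω} [IsFiniteMeasure ρ] {χ : Ω → D} {R B ħ : ℝ} {F : Ω → ℝ × ℝ → ℝ} {L : ℕ}
  {a : UnitAddCircle × ℝ × Ω → ℝ}

/-- The coefficients of the defect of a coherent wave packet. -/
noncomputable def cohDefect (F : Ω → ℝ × ℝ → ℝ) (a : UnitAddCircle × ℝ × Ω → ℝ) (ħ : ℝ) (L : ℕ)
    (z : UnitAddCircle × ℝ × Ω) (l : ℤ) (n' : Ω) : ℂ :=
  cylDefect (F n') (fun _ => (a z : ℂ)) ħ L z.2.1 l z.1

theorem IsCylFamily.integrable_cylCoef_left (hF : IsCylFamily R B F) (m : ℤ) (ξ : ℝ) :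
    Integrable (fun n => cylCoef (F n) m ξ) ρ :=
  (integrable_const (B * (1 + (m : ℝ) ^ 2)⁻¹)).mono'
    (hF.continuous_cylCoef_left m ξ).aestronglyMeasurable
    (Eventually.of_forall fun n => hF.bound n m ξ)

theorem integrable_cohDefect (hF : IsCylFamily R B F) (z : UnitAddCircle × ℝ × Ω) (l : ℤ) :
    Integrable (cohDefect F a ħ L z l) ρ := by
  refine Integrable.sub ?_ (integrable_const _)
  exact integrable_finsetSum _ fun k _ => (hF.integrable_cylCoef_left _ _).const_mul _

/-- The reproducing identity `χ n = ∫ ⟨χ n', χ n⟩ χ n'` puts the multiple `a z` of the state under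
the same integral as the operator. Each Fourier component of the defect is then the synthesis of one
explicit function of `n'`. -/
theorem adjoint_defect_eq (hF : IsCylFamily R B F) (hχ : IsCoherent ρ χ) (hħ : 0 < ħ)
    (z : UnitAddCircle × ℝ × Ω) (l : ℤ) :
    (circleFrame D l).adjoint (cylOp ρ χ F ħ (cylState (circleFrame D) χ (2 * Real.pi * ħ) L z) -
      (a z : ℂ) • cylState (circleFrame D) χ (2 * Real.pi * ħ) L z) =
    ∫ n', ((((Real.sqrt L)⁻¹ : ℝ) : ℂ) * (inner ℂ (χ n') (χ z.2.2) * cohDefect F a ħ L z l n')) •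
      χ n' ∂ρ := by
  set s : ℂ := (((Real.sqrt L)⁻¹ : ℝ) : ℂ) with hs
  set S := cylWindow (2 * Real.pi * ħ) L z.2.1 with hS
  set ψ := cylState (circleFrame D) χ (2 * Real.pi * ħ) L z with hψ
  have hJ := isFrame_circleFrame (D := D)
  have h1 := hJ.hasSum_adjoint_matrixOp (summable_norm_cylMatrix hF hχ hħ) ψ l
  have hadj : ∀ k, (circleFrame D k).adjoint ψ = if k ∈ S then (s * fourier (-k) z.1) • χ z.2.2 else 0 :=
    fun k => adjoint_cylState hJ k z
  have h2 : (circleFrame D l).adjoint (cylOp ρ χ F ħ ψ) =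
      ∑ k ∈ S, cylMatrix ρ χ F ħ (l, k) ((s * fourier (-k) z.1) • χ z.2.2) := by
    refine h1.unique ?_
    have h3 : HasSum (fun k => cylMatrix ρ χ F ħ (l, k) ((circleFrame D k).adjoint ψ))
        (∑ k ∈ S, cylMatrix ρ χ F ħ (l, k) ((circleFrame D k).adjoint ψ)) :=
      hasSum_sum_of_ne_finset_zero fun k hk => by simp [hadj, hk]
    rwa [Finset.sum_congr rfl (fun k hk => by rw [hadj, if_pos hk])] at h3
  have hi : ∀ k : ℤ, Integrable (fun n' => (cylCoef (F n') (l - k) (Real.pi * ħ * (l + k)) *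
      inner ℂ (χ n') (χ z.2.2)) • χ n') ρ := fun k => by
    have := (integrable_cylMatrix hF hχ (l - k) (Real.pi * ħ * (l + k))).apply_continuousLinearMap
      (χ z.2.2)
    refine this.congr (Eventually.of_forall fun n => ?_)
    simp [smul_smul]
  have hi2 : Integrable (fun n' => (if l ∈ S then s * fourier (-l) z.1 * a z else 0) •
      (inner ℂ (χ n') (χ z.2.2) • χ n')) ρ :=
    (hχ.integrable_smul (hχ.integrable_inner (χ z.2.2))).smul _
  have hi3 : ∀ k ∈ S, Integrable (fun n' => (s * fourier (-k) z.1) •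
      ((cylCoef (F n') (l - k) (Real.pi * ħ * (l + k)) * inner ℂ (χ n') (χ z.2.2)) • χ n')) ρ :=
    fun k _ => (hi k).smul _
  rw [map_sub, h2, map_smul, hadj]
  have e1 : (a z : ℂ) • (if l ∈ S then (s * fourier (-l) z.1) • χ z.2.2 else 0) =
      ∫ n', ((if l ∈ S then s * fourier (-l) z.1 * a z else 0) • (inner ℂ (χ n') (χ z.2.2) • χ n')) ∂ρ := by
    rw [integral_smul, hχ.integral_inner_smul]
    split_ifs
    · rw [smul_smul, mul_comm]
    · simp
  have e2 : ∑ k ∈ S, cylMatrix ρ χ F ħ (l, k) ((s * fourier (-k) z.1) • χ z.2.2) =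
      ∫ n', ∑ k ∈ S, (s * fourier (-k) z.1) • ((cylCoef (F n') (l - k) (Real.pi * ħ * (l + k)) *
      inner ℂ (χ n') (χ z.2.2)) • χ n') ∂ρ := by
    rw [integral_finsetSum _ hi3]
    refine Finset.sum_congr rfl fun k _ => ?_
    rw [map_smul, cylMatrix_apply hF hχ, integral_smul]
  rw [e1, e2, ← integral_sub (integrable_finsetSum _ hi3) hi2]
  refine integral_congr_ae (Eventually.of_forall fun n' => ?_)
  simp only [cohDefect, cylDefect, smul_smul, ← Finset.sum_smul, ← sub_smul, ← hS]
  congr 1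
  rw [mul_sub, mul_sub, Finset.mul_sum, Finset.mul_sum]
  congr 1
  · refine Finset.sum_congr rfl fun k _ => ?_
    ring
  · split_ifs <;> ring

theorem cohDefect_eq (z : UnitAddCircle × ℝ × Ω) (l : ℤ) (n' : Ω) :
    cohDefect F a ħ L z l n' =
      cylDefect (F n') (fun q => (a (q, z.2.1, n') : ℂ)) ħ L z.2.1 l z.1 +
      if l ∈ cylWindow (2 * Real.pi * ħ) L z.2.1 then
        fourier (-l) z.1 * ((a (z.1, z.2.1, n') - a z : ℝ) : ℂ) else 0 := by
  simp only [cohDefect, cylDefect]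
  split_ifs
  · push_cast; ring
  · simp

/-- Replacing `a` at `n` by its value at `n'` alters the coefficients of the `L` frequencies of the
window only, each by the same modulus, and `L⁻¹ · L = 1`. -/
theorem tsum_enorm_sq_cohDefect_le (hL : 0 < L) (z : UnitAddCircle × ℝ × Ω) (n' : Ω) :
    (L : ENNReal)⁻¹ * ∑' l, ‖cohDefect F a ħ L z l n'‖ₑ ^ 2 ≤
      2 * (L : ENNReal)⁻¹ * ∑' l,
        ‖cylDefect (F n') (fun q => (a (q, z.2.1, n') : ℂ)) ħ L z.2.1 l z.1‖ₑ ^ 2 +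
      2 * ‖a (z.1, z.2.1, n') - a z‖ₑ ^ 2 := by
  set S := cylWindow (2 * Real.pi * ħ) L z.2.1 with hS
  have h1 : ∀ l, ‖cohDefect F a ħ L z l n'‖ₑ ^ 2 ≤
      2 * ‖cylDefect (F n') (fun q => (a (q, z.2.1, n') : ℂ)) ħ L z.2.1 l z.1‖ₑ ^ 2 +
      2 * (if l ∈ S then ‖a (z.1, z.2.1, n') - a z‖ₑ ^ 2 else 0) := fun l => by
    rw [cohDefect_eq]
    refine (enorm_add_sq_le _ _).trans (le_of_eq ?_)
    congr 2
    rw [← hS]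
    split_ifs
    · rw [enorm_mul, ← ofReal_norm (fourier (-l) z.1), norm_fourier_apply, ENNReal.ofReal_one, one_mul,
        ← ofReal_norm, Complex.norm_real, ofReal_norm]
    · simp
  refine (mul_le_mul_right (ENNReal.tsum_le_tsum h1) _).trans (le_of_eq ?_)
  rw [ENNReal.tsum_add, ENNReal.tsum_mul_left, ENNReal.tsum_mul_left,
    tsum_eq_sum (s := S) (fun l hl => if_neg hl), Finset.sum_congr rfl (fun l hl => if_pos hl),
    Finset.sum_const, hS, cylWindow, Int.card_Ico, add_sub_cancel_left, Int.toNat_natCast,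
    nsmul_eq_mul, mul_add, ← mul_assoc, mul_comm _ (2 : ENNReal), mul_left_comm _ (2 : ENNReal),
    ← mul_assoc (L : ENNReal)⁻¹, ENNReal.inv_mul_cancel (by exact_mod_cast hL.ne')
      (ENNReal.natCast_ne_top L), one_mul]

theorem measurable_cylDefect (hF : IsCylFamily R B F) (ha : Measurable a) (l : ℤ) :
    Measurable fun z : UnitAddCircle × ℝ × Ω =>
      cylDefect (F z.2.2) (fun q => (a (q, z.2.1, z.2.2) : ℂ)) ħ L z.2.1 l z.1 := by
  refine measurable_of_floor (2 * Real.pi * ħ) (f := fun r (z : UnitAddCircle × ℝ × Ω) =>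
    (∑ k ∈ Finset.Ico r (r + L), fourier (-k) z.1 * cylCoef (F z.2.2) (l - k) (Real.pi * ħ * (l + k))) -
    if l ∈ Finset.Ico r (r + L) then fourier (-l) z.1 * (a (z.1, z.2.1, z.2.2) : ℂ) else 0)
    (fun r => ?_) (by fun_prop)
  have hf : ∀ k, Measurable fun z : UnitAddCircle × ℝ × Ω => fourier k z.1 := fun k =>
    (measurable_fourier k).comp measurable_fst
  refine Measurable.sub (Finset.measurable_sum _ fun _ _ => (hf _).mul ?_) ?_
  · exact (hF.continuous_cylCoef_left _ _).measurable.comp (by fun_prop)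
  · split_ifs
    · exact (hf _).mul (Complex.measurable_ofReal.comp ha)
    · exact measurable_const

theorem measurable_cohDefect_right (hF : IsCylFamily R B F) (z : UnitAddCircle × ℝ × Ω) (l : ℤ) :
    Measurable (cohDefect F a ħ L z l) :=
  Measurable.sub (Finset.measurable_sum _ fun _ _ =>
    (hF.continuous_cylCoef_left _ _).measurable.const_mul _) measurable_const

/-- The pointwise bound of the defect of a coherent wave packet. -/
theorem enorm_sq_defect_le (hF : IsCylFamily R B F) (hχ : IsCoherent ρ χ) (hħ : 0 < ħ) (hL : 0 < L)
    (z : UnitAddCircle × ℝ × Ω) :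
    ‖cylOp ρ χ F ħ (cylState (circleFrame D) χ (2 * Real.pi * ħ) L z) -
      (a z : ℂ) • cylState (circleFrame D) χ (2 * Real.pi * ħ) L z‖ₑ ^ 2 ≤
    ∫⁻ n', ‖inner ℂ (χ n') (χ z.2.2)‖ₑ ^ 2 * (2 * (L : ENNReal)⁻¹ * ∑' l,
        ‖cylDefect (F n') (fun q => (a (q, z.2.1, n') : ℂ)) ħ L z.2.1 l z.1‖ₑ ^ 2 +
      2 * ‖a (z.1, z.2.1, n') - a z‖ₑ ^ 2) ∂ρ := by
  rw [← isFrame_circleFrame.tsum_enorm_sq]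
  simp_rw [adjoint_defect_eq hF hχ hħ z]
  have h1 : ∀ l, ‖∫ n', ((((Real.sqrt L)⁻¹ : ℝ) : ℂ) *
      (inner ℂ (χ n') (χ z.2.2) * cohDefect F a ħ L z l n')) • χ n' ∂ρ‖ₑ ^ 2 ≤
      ∫⁻ n', ‖inner ℂ (χ n') (χ z.2.2)‖ₑ ^ 2 *
        ((L : ENNReal)⁻¹ * ‖cohDefect F a ħ L z l n'‖ₑ ^ 2) ∂ρ := fun l => by
    refine (hχ.enorm_sq_integral_smul_le ?_).trans_eq (lintegral_congr fun n' => ?_)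
    · refine Integrable.const_mul ?_ _
      exact (integrable_cohDefect hF z l).bdd_mul (c := 1)
        (hχ.measurable_inner _).aestronglyMeasurable
        (Eventually.of_forall fun n' => hχ.norm_inner_le _ _)
    · rw [enorm_mul, enorm_mul, mul_pow, mul_pow, enorm_sq_inv_sqrt hL]
      ring
  refine (ENNReal.tsum_le_tsum h1).trans ?_
  have hm : ∀ l, AEMeasurable (fun n' => ‖inner ℂ (χ n') (χ z.2.2)‖ₑ ^ 2 *
        ((L : ENNReal)⁻¹ * ‖cohDefect F a ħ L z l n'‖ₑ ^ 2)) ρ := fun l =>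
    (((hχ.measurable_inner _).enorm.pow_const 2).mul
      (((measurable_cohDefect_right hF z l).enorm.pow_const 2).const_mul _)).aemeasurable
  rw [← lintegral_tsum hm]
  refine lintegral_mono fun n' => ?_
  rw [ENNReal.tsum_mul_left, ENNReal.tsum_mul_left]
  exact mul_le_mul_right (tsum_enorm_sq_cohDefect_le hL z n') _

end Defect

/-! ### The defect integrated over the whole phase space. -/

section Total

variable {Ω D : Type*} [TopologicalSpace Ω] [MeasurableSpace Ω] [BorelSpace Ω]
  [SecondCountableTopology Ω]
  [NormedAddCommGroup D] [InnerProductSpace ℂ D] [CompleteSpace D] [FiniteDimensional ℂ D]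
  {ρ : Measure Ω} [IsFiniteMeasure ρ] {χ : Ω → D} {R B ħ : ℝ} {F : Ω → ℝ × ℝ → ℝ} {L : ℕ}
  {a : UnitAddCircle × ℝ × Ω → ℝ}

theorem lintegral_prod_prod_symm {f : UnitAddCircle × ℝ × Ω → ENNReal} (hf : Measurable f) :
    ∫⁻ z, f z ∂((volume : Measure UnitAddCircle).prod ((volume : Measure ℝ).prod ρ)) =
      ∫⁻ n, (∫⁻ p : ℝ, ∫⁻ q : UnitAddCircle, f (q, p, n)) ∂ρ := by
  rw [lintegral_prod_symm _ hf.aemeasurable, lintegral_prod_symm]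
  exact (hf.lintegral_prod_left').aemeasurable

theorem measure_ne_zero_eq_lintegral (hF : IsCylFamily R B F) (ha : Measurable a)
    (haF : ∀ (x ξ : ℝ) n, a ((x : UnitAddCircle), ξ, n) = F n (x, ξ)) :
    ((volume : Measure UnitAddCircle).prod ((volume : Measure ℝ).prod ρ)) {z | a z ≠ 0} =
      ∫⁻ n, cylMeasure {z | F n z ≠ 0} ∂ρ := by
  have hs : MeasurableSet {z | a z ≠ 0} := (measurableSet_eq_fun ha measurable_const).compl
  rw [← lintegral_indicator_one hs, lintegral_prod_prod_symm (measurable_one.indicator hs)]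
  refine lintegral_congr fun n => ?_
  have hs2 : MeasurableSet {z | F n z ≠ 0} :=
    (measurableSet_eq_fun (hF.cyl n).continuous.measurable measurable_const).compl
  rw [← lintegral_indicator_one hs2, cylMeasure,
    lintegral_prod_symm _ (measurable_one.indicator hs2).aemeasurable]
  refine lintegral_congr fun p => ?_
  rw [← UnitAddCircle.lintegral_preimage 0, zero_add]
  refine lintegral_congr fun x => ?_
  simp only [Set.indicator_apply, Set.mem_ofPred_eq, haF]
  rfl

/-- Averaging over the second variable of a kernel. -/
theorem lintegral_kernel_swap {K : Ω → Ω → ENNReal} (hKm : Measurable fun w : Ω × Ω => K w.1 w.2)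
    {k : ENNReal} (hK : ∀ n', ∫⁻ n, K n' n ∂ρ = k) {G : UnitAddCircle × ℝ × Ω → ENNReal}
    (hGm : Measurable G) :
    ∫⁻ z, ∫⁻ n', K n' z.2.2 * G (z.1, z.2.1, n') ∂ρ
      ∂((volume : Measure UnitAddCircle).prod ((volume : Measure ℝ).prod ρ)) =
    k * ∫⁻ z, G z ∂((volume : Measure UnitAddCircle).prod ((volume : Measure ℝ).prod ρ)) := by
  have hKm2 : ∀ n', Measurable fun n => K n' n := fun n' => hKm.comp measurable_prodMk_left
  have hm3 : Measurable fun w : (UnitAddCircle × ℝ × Ω) × Ω =>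
      K w.2 w.1.2.2 * G (w.1.1, w.1.2.1, w.2) :=
    (hKm.comp (by fun_prop : Measurable fun w : (UnitAddCircle × ℝ × Ω) × Ω => (w.2, w.1.2.2))).mul
      (hGm.comp (by fun_prop : Measurable fun w : (UnitAddCircle × ℝ × Ω) × Ω =>
        (w.1.1, w.1.2.1, w.2)))
  have hm2 : Measurable fun z : UnitAddCircle × ℝ × Ω =>
      ∫⁻ n', K n' z.2.2 * G (z.1, z.2.1, n') ∂ρ := hm3.lintegral_prod_right'
  have h4 : ∀ (q : UnitAddCircle) (p : ℝ), ∫⁻ n, ∫⁻ n', K n' n * G (q, p, n') ∂ρ ∂ρ =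
      ∫⁻ n', k * G (q, p, n') ∂ρ := fun q p => by
    rw [lintegral_lintegral_swap]
    · refine lintegral_congr fun n' => ?_
      rw [lintegral_mul_const _ (hKm2 n'), hK]
    · exact ((hKm.comp measurable_swap).mul (hGm.comp (by fun_prop : Measurable fun w : Ω × Ω =>
          (q, p, w.2)))).aemeasurable
  have hGk : Measurable fun z => k * G z := hGm.const_mul k
  rw [← lintegral_const_mul _ hGm, lintegral_prod _ hm2.aemeasurable, lintegral_prod _ hGk.aemeasurable]
  refine lintegral_congr fun q => ?_
  have m1 : Measurable fun y : ℝ × Ω => ∫⁻ n', K n' y.2 * G (q, y.1, n') ∂ρ :=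
    hm2.comp measurable_prodMk_left
  have m2 : Measurable fun y : ℝ × Ω => k * G (q, y) := hGk.comp measurable_prodMk_left
  refine (lintegral_prod _ m1.aemeasurable).trans ?_
  rw [lintegral_prod _ m2.aemeasurable]
  exact lintegral_congr fun p => h4 q p

/-- Averaging a function of the first variable of a symmetric probability kernel. -/
theorem lintegral_kernel_eq {K : Ω → Ω → ENNReal} (hKm : Measurable fun w : Ω × Ω => K w.1 w.2)
    (hK1 : ∀ n', ∫⁻ n, K n' n ∂ρ = 1) {G : UnitAddCircle × ℝ × Ω → ENNReal} (hGm : Measurable G)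
    (ha : Measurable a) (c : ENNReal) :
    ∫⁻ z, ∫⁻ n', K n' z.2.2 * (c * G (z.1, z.2.1, n') + 2 * ‖a (z.1, z.2.1, n') - a z‖ₑ ^ 2) ∂ρ
      ∂((volume : Measure UnitAddCircle).prod ((volume : Measure ℝ).prod ρ)) =
    c * (∫⁻ z, G z ∂((volume : Measure UnitAddCircle).prod ((volume : Measure ℝ).prod ρ))) +
    ∫⁻ z, 2 * ∫⁻ n', K n' z.2.2 * ‖a (z.1, z.2.1, n') - a z‖ₑ ^ 2 ∂ρ
      ∂((volume : Measure UnitAddCircle).prod ((volume : Measure ℝ).prod ρ)) := by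
  have hKm1 : ∀ n, Measurable fun n' => K n' n := fun n => hKm.comp measurable_prodMk_right
  have hzm : ∀ z : UnitAddCircle × ℝ × Ω, Measurable fun n' : Ω => (z.1, z.2.1, n') := fun z => by fun_prop
  have e1 : ∀ z : UnitAddCircle × ℝ × Ω, ∫⁻ n', K n' z.2.2 * (c *
      G (z.1, z.2.1, n') + 2 * ‖a (z.1, z.2.1, n') - a z‖ₑ ^ 2) ∂ρ =
      c * (∫⁻ n', K n' z.2.2 * G (z.1, z.2.1, n') ∂ρ) +
      2 * ∫⁻ n', K n' z.2.2 * ‖a (z.1, z.2.1, n') - a z‖ₑ ^ 2 ∂ρ := fun z => by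
    have m1 : Measurable fun n' => K n' z.2.2 * G (z.1, z.2.1, n') := (hKm1 _).mul (hGm.comp (hzm z))
    have m2 : Measurable fun n' => K n' z.2.2 * ‖a (z.1, z.2.1, n') - a z‖ₑ ^ 2 :=
      (hKm1 _).mul (((ha.comp (hzm z)).sub_const _).enorm.pow_const 2)
    rw [← lintegral_const_mul _ m1, ← lintegral_const_mul _ m2, ← lintegral_add_left (m1.const_mul _)]
    refine lintegral_congr fun n' => ?_
    ring
  rw [lintegral_congr e1]
  have hm3 : Measurable fun w : (UnitAddCircle × ℝ × Ω) × Ω =>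
      K w.2 w.1.2.2 * G (w.1.1, w.1.2.1, w.2) :=
    (hKm.comp (by fun_prop : Measurable fun w : (UnitAddCircle × ℝ × Ω) × Ω => (w.2, w.1.2.2))).mul
      (hGm.comp (by fun_prop : Measurable fun w : (UnitAddCircle × ℝ × Ω) × Ω =>
        (w.1.1, w.1.2.1, w.2)))
  have hm2 : Measurable fun z : UnitAddCircle × ℝ × Ω =>
      ∫⁻ n', K n' z.2.2 * G (z.1, z.2.1, n') ∂ρ := hm3.lintegral_prod_right'
  rw [lintegral_add_left (hm2.const_mul _), lintegral_const_mul _ hm2]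
  rw [lintegral_kernel_swap hKm hK1 hGm, one_mul]

/-- The weight `|⟨χ n', χ n⟩|²` has total mass one in `n`. Integrating it out leaves the
single-symbol defect of `F n'` integrated over `n'`, which is bounded slice by slice; the variation
of `a` between `n` and `n'` enters through `κ`. -/
theorem lintegral_enorm_sq_defect_le (hF : IsCylFamily R B F) (hχ : IsCoherent ρ χ) (hħ : 0 < ħ)
    (hL : 0 < L) (ha : Measurable a)
    (haF : ∀ (x ξ : ℝ) n, a ((x : UnitAddCircle), ξ, n) = F n (x, ξ)) {C τ κ : ℝ} (hτ : 0 < τ)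
    (hκ0 : 0 ≤ κ)
    (hC : ∀ n z, |F n z| ≤ C) (hx : ∀ n z, |dX (dX (F n)) z| ≤ C * τ ^ 2)
    (hξ : ∀ n z, |dXi (dXi (F n)) z| ≤ C * τ ^ 2)
    (hxξ : ∀ n z, |dX (dX (dXi (dXi (F n)))) z| ≤ C * τ ^ 4)
    (hκ : ∫⁻ z, ∫⁻ n', ‖inner ℂ (χ n') (χ z.2.2)‖ₑ ^ 2 * ‖a (z.1, z.2.1, n') - a z‖ₑ ^ 2 ∂ρ
      ∂((volume : Measure UnitAddCircle).prod ((volume : Measure ℝ).prod ρ)) ≤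
      ENNReal.ofReal κ *
        ((volume : Measure UnitAddCircle).prod ((volume : Measure ℝ).prod ρ)) {z | a z ≠ 0}) :
    ∫⁻ z, ‖cylOp ρ χ F ħ (cylState (circleFrame D) χ (2 * Real.pi * ħ) L z) -
      (a z : ℂ) • cylState (circleFrame D) χ (2 * Real.pi * ħ) L z‖ₑ ^ 2
        ∂(cylPhaseMeasure (2 * Real.pi * ħ) ρ) ≤
      ENNReal.ofReal (C ^ 2 * (16 * (2 * Real.pi * ħ) ^ 2 * (L ^ 2 * τ ^ 2 + τ ^ 4) + 8 * τ / L) +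
        2 * κ) * cylPhaseMeasure (2 * Real.pi * ħ) ρ {z | a z ≠ 0} := by
  set m := (volume : Measure UnitAddCircle).prod ((volume : Measure ℝ).prod ρ) with hm
  have hLp : (0 : ℝ) < L := by exact_mod_cast hL
  rw [cylPhaseMeasure, lintegral_smul_measure, Measure.smul_apply, smul_eq_mul, smul_eq_mul,
    mul_left_comm, ← hm]
  refine mul_le_mul_right ?_ _
  refine (lintegral_mono fun z => enorm_sq_defect_le hF hχ hħ hL z).trans ?_
  set K : Ω → Ω → ENNReal := fun n' n => ‖inner ℂ (χ n') (χ n)‖ₑ ^ 2 with hK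
  set G : UnitAddCircle × ℝ × Ω → ENNReal := fun z => ∑' l,
        ‖cylDefect (F z.2.2) (fun q => (a (q, z.2.1, z.2.2) : ℂ)) ħ L z.2.1 l z.1‖ₑ ^ 2 with hG
  have hGm : Measurable G := Measurable.tsum fun l =>
    (measurable_cylDefect hF ha l).enorm.pow_const 2
  have hKm : Measurable fun w : Ω × Ω => K w.1 w.2 := by
    have : StronglyMeasurable fun w : Ω × Ω => inner ℂ (χ w.1) (χ w.2) :=
      (hχ.meas.comp_measurable measurable_fst).inner (hχ.meas.comp_measurable measurable_snd)
    exact this.measurable.enorm.pow_const 2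
  have hK1 : ∀ n', ∫⁻ n, K n' n ∂ρ = 1 := fun n' => by
    have h1 := hχ.lintegral_eq (χ n')
    rw [← ofReal_norm, hχ.norm_eq, ENNReal.ofReal_one, one_pow] at h1
    rw [← h1]
    refine lintegral_congr fun n => ?_
    simp only [hK]
    rw [← ofReal_norm, norm_inner_symm, ofReal_norm]
  have e3 : ∫⁻ z, G z ∂m ≤ ENNReal.ofReal (C ^ 2 *
      (8 * L * (2 * Real.pi * ħ) ^ 2 * (L ^ 2 * τ ^ 2 + τ ^ 4) + 4 * τ)) * m {z | a z ≠ 0} := by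
    rw [hm, lintegral_prod_prod_symm hGm, measure_ne_zero_eq_lintegral hF ha haF,
      ← lintegral_const_mul' _ _ ENNReal.ofReal_ne_top]
    refine lintegral_mono fun n => ?_
    refine le_trans (lintegral_mono fun p => le_of_eq ?_)
      ((hF.cyl n).lintegral_tsum_cylBracket_le hħ L hτ (hC n) (hx n) (hξ n) (hxξ n))
    have hg : (fun q => (a (q, p, n) : ℂ)) = (hF.cyl n).onCircle p := by
      ext q
      obtain ⟨x, rfl⟩ := QuotientAddGroup.mk_surjective q
      rw [(hF.cyl n).onCircle_coe]
      exact congrArg _ (haF x p n)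
    simp only [hG]
    rw [lintegral_tsum]
    · refine tsum_congr fun l => ?_
      rw [hg, (hF.cyl n).lintegral_enorm_sq_cylDefect]
    · intro l
      exact (((measurable_cylDefect hF ha l).comp
        (by fun_prop : Measurable fun q : UnitAddCircle => (q, p, n))).enorm.pow_const 2).aemeasurable
  rw [lintegral_kernel_eq hKm hK1 hGm ha]
  have h2L : (2 * (L : ENNReal)⁻¹) = ENNReal.ofReal (2 / L) := by
    rw [div_eq_mul_inv, ENNReal.ofReal_mul zero_le_two, ENNReal.ofReal_inv_of_pos hLp,
      ENNReal.ofReal_natCast, ENNReal.ofReal_ofNat]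
  have hC0 : 0 ≤ C ^ 2 := sq_nonneg C
  have hfin : 2 * (L : ENNReal)⁻¹ * (∫⁻ z, G z ∂m) + 2 * (ENNReal.ofReal κ * m {z | a z ≠ 0}) ≤
      ENNReal.ofReal (C ^ 2 * (16 * (2 * Real.pi * ħ) ^ 2 * (L ^ 2 * τ ^ 2 + τ ^ 4) + 8 * τ / L) +
        2 * κ) * m {z | a z ≠ 0} := by
    refine (add_le_add_left (mul_le_mul_right e3 _) _).trans_eq ?_
    rw [h2L, ← ENNReal.ofReal_ofNat 2, ← mul_assoc, ← mul_assoc, ← add_mul,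
      ← ENNReal.ofReal_mul (by positivity), ← ENNReal.ofReal_mul (by positivity),
      ← ENNReal.ofReal_add (by positivity) (by positivity)]
    congr 2
    field_simp
    ring
  refine le_trans (add_le_add_right ?_ _) hfin
  rw [lintegral_const_mul' _ _ (by simp)]
  exact mul_le_mul_right hκ _

end Total

/-! ### Counting eigenvalues of the quantized family. -/

section Counting

variable {Ω D : Type} [TopologicalSpace Ω] [MeasurableSpace Ω] [BorelSpace Ω]
  [SecondCountableTopology Ω]
  [NormedAddCommGroup D] [InnerProductSpace ℂ D] [CompleteSpace D] [FiniteDimensional ℂ D]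
  {ρ : Measure Ω} [IsFiniteMeasure ρ] {χ : Ω → D} {R B ħ : ℝ} {F : Ω → ℝ × ℝ → ℝ}
  {a : UnitAddCircle × ℝ × Ω → ℝ}

theorem cylOp_traceClass (hF : IsCylFamily R B F) (hχ : IsCoherent ρ χ) (hħ : 0 < ħ) :
    IsSelfAdjoint (cylOp ρ χ F ħ) ∧ IsTraceClass (cylOp ρ χ F ħ) ∧
      ∀ ε : ℝ, 0 < ε → FinitelyManyOuter (cylOp ρ χ F ħ) ε := by
  obtain ⟨h1, h2, h3⟩ := cylOp_properties hF hχ hħ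
  have h4 := traceClass_and_counting _ h1 h2 _ h3
  exact ⟨h2, h4.1, fun ε hε => (h4.2 ε hε).1⟩

/-- The two-sided counting estimate for the quantization with coherent states. -/
theorem cylOp_counting (hF : IsCylFamily R B F) (hχ : IsCoherent ρ χ) (hħ : 0 < ħ) {L : ℕ}
    (hL : 0 < L) (ha : Measurable a)
    (haF : ∀ (x ξ : ℝ) n, a ((x : UnitAddCircle), ξ, n) = F n (x, ξ)) {C τ κ : ℝ} (hτ : 0 < τ)
    (hκ0 : 0 ≤ κ)
    (hC : ∀ n z, |F n z| ≤ C) (hx : ∀ n z, |dX (dX (F n)) z| ≤ C * τ ^ 2)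
    (hξ : ∀ n z, |dXi (dXi (F n)) z| ≤ C * τ ^ 2)
    (hxξ : ∀ n z, |dX (dX (dXi (dXi (F n)))) z| ≤ C * τ ^ 4)
    (hκ : ∫⁻ z, ∫⁻ n', ‖inner ℂ (χ n') (χ z.2.2)‖ₑ ^ 2 * ‖a (z.1, z.2.1, n') - a z‖ₑ ^ 2 ∂ρ
      ∂((volume : Measure UnitAddCircle).prod ((volume : Measure ℝ).prod ρ)) ≤
      ENNReal.ofReal κ *
        ((volume : Measure UnitAddCircle).prod ((volume : Measure ℝ).prod ρ)) {z | a z ≠ 0})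
    {ε δ : ℝ} (hε : 0 < ε) (hδ : 0 < δ) :
    (outerCount (cylOp ρ χ F ħ) ε : ENNReal) ≤
      cylPhaseMeasure (2 * Real.pi * ħ) ρ {z | ε - δ < |a z|} +
      ENNReal.ofReal (C ^ 2 * (16 * (2 * Real.pi * ħ) ^ 2 * (L ^ 2 * τ ^ 2 + τ ^ 4) + 8 * τ / L) +
        2 * κ) * cylPhaseMeasure (2 * Real.pi * ħ) ρ {z | a z ≠ 0} / ENNReal.ofReal (δ ^ 2) ∧
    cylPhaseMeasure (2 * Real.pi * ħ) ρ {z | ε + δ < |a z|} ≤ outerCount (cylOp ρ χ F ħ) ε +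
      ENNReal.ofReal (C ^ 2 * (16 * (2 * Real.pi * ħ) ^ 2 * (L ^ 2 * τ ^ 2 + τ ^ 4) + 8 * τ / L) +
        2 * κ) * cylPhaseMeasure (2 * Real.pi * ħ) ρ {z | a z ≠ 0} / ENNReal.ofReal (δ ^ 2) := by
  obtain ⟨h1, h2, h3⟩ := cylOp_properties hF hχ hħ
  have h4 := traceClass_and_counting _ h1 h2 _ h3
  exact (h4.2 ε hε).2 (cylPhaseMeasure (2 * Real.pi * ħ) ρ)
    (cylState (circleFrame D) χ (2 * Real.pi * ħ) L)
    (norm_cylState isFrame_circleFrame hχ hL) (measurable_inner_cylState hχ)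
    (lintegral_inner_cylState isFrame_circleFrame hχ (by positivity) hL) a ha _
    (lintegral_enorm_sq_defect_le hF hχ hħ hL ha haF hτ hκ0 hC hx hξ hxξ hκ) δ hδ

end Counting

/-! ### The choice of packet length and the resulting rate. -/

section Rate

/-- The number of frequencies in a wave packet. -/
noncomputable def packetLength (ħ : ℝ) : ℕ := ⌈ħ ^ (-(1 / 2) : ℝ)⌉₊

/-- The relative mean square defect of the wave packets. -/
noncomputable def packetRate (μ C ħ : ℝ) : ℝ :=
  C ^ 2 * (16 * (2 * Real.pi * ħ) ^ 2 * ((packetLength ħ : ℝ) ^ 2 * (ħ ^ (-μ)) ^ 2 + (ħ ^ (-μ)) ^ 4) +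
    8 * ħ ^ (-μ) / packetLength ħ)

theorem packetLength_pos {ħ : ℝ} (hħ : 0 < ħ) : 0 < packetLength ħ :=
  Nat.ceil_pos.2 (Real.rpow_pos_of_pos hħ _)

theorem packetRate_nonneg (μ C : ℝ) {ħ : ℝ} (hħ : 0 < ħ) : 0 ≤ packetRate μ C ħ := by
  unfold packetRate
  have := Real.rpow_pos_of_pos hħ (-μ)
  positivity

/-- With `L` between `ħ^(-1/2)` and `2 ħ^(-1/2)`, the packet has momentum width of order `ħ L ≈
ħ^(1/2)` and position scale `1 / L ≈ ħ^(1/2)`, both small against the scale `ħ^μ` of the symbol. The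
three terms are of order `ħ^(1 - 2μ)`, `ħ^(2 - 4μ)` and `ħ^(1/2 - μ)`. -/
theorem tendsto_packetRate {μ : ℝ} (hμ : μ < 1 / 2) (C : ℝ) :
    Tendsto (packetRate μ C) (𝓝[>] 0) (𝓝 0) := by
  have hp : ∀ s : ℝ, 0 < s → Tendsto (fun ħ : ℝ => ħ ^ s) (𝓝[>] 0) (𝓝 0) := fun s hs => by
    have := (Real.continuousAt_rpow_const 0 s (Or.inr hs.le)).tendsto
    rw [Real.zero_rpow hs.ne'] at this
    exact this.mono_left nhdsWithin_le_nhds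
  have hlim : Tendsto (fun ħ : ℝ => C ^ 2 * (16 * (2 * Real.pi) ^ 2 *
      (4 * ħ ^ (1 - 2 * μ) + ħ ^ (2 - 4 * μ)) + 8 * ħ ^ (1 / 2 - μ))) (𝓝[>] 0) (𝓝 0) := by
    have := ((((hp (1 - 2 * μ) (by linarith)).const_mul 4).add (hp (2 - 4 * μ) (by linarith))).const_mul
      (16 * (2 * Real.pi) ^ 2)).add ((hp (1 / 2 - μ) (by linarith)).const_mul 8) |>.const_mul (C ^ 2)
    simpa using this
  have hev : ∀ᶠ ħ : ℝ in 𝓝[>] 0, 0 < ħ ∧ ħ ≤ 1 := by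
    filter_upwards [self_mem_nhdsWithin, nhdsWithin_le_nhds (Iic_mem_nhds one_pos)] with ħ h1 h2
    exact ⟨h1, h2⟩
  refine tendsto_of_tendsto_of_tendsto_of_le_of_le' tendsto_const_nhds hlim
    (hev.mono fun ħ h => packetRate_nonneg μ C h.1) ?_
  filter_upwards [hev] with ħ ⟨h0, h1⟩
  unfold packetRate
  set s := ħ ^ (-(1 / 2) : ℝ) with hs
  have hs1 : 1 ≤ s := Real.one_le_rpow_of_pos_of_le_one_of_nonpos h0 h1 (by norm_num)
  have hL1 : s ≤ packetLength ħ := Nat.le_ceil _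
  have hL2 : (packetLength ħ : ℝ) ≤ 2 * s := by
    have := (Nat.ceil_lt_add_one (zero_le_one.trans hs1)).le
    unfold packetLength
    linarith
  have hs0 : 0 < s := by linarith
  have ht : 0 < ħ ^ (-μ) := Real.rpow_pos_of_pos h0 _
  have e1 : 4 * ħ ^ (1 - 2 * μ) = ħ ^ 2 * ((2 * s) ^ 2 * (ħ ^ (-μ)) ^ 2) := by
    rw [mul_pow, hs]
    simp only [← Real.rpow_natCast, ← Real.rpow_mul h0.le]
    rw [show (1 : ℝ) - 2 * μ = ((2 : ℕ) : ℝ) + (-(1 / 2) * ((2 : ℕ) : ℝ) + -μ * ((2 : ℕ) : ℝ)) by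
      push_cast; ring, Real.rpow_add h0, Real.rpow_add h0]
    norm_num
    ring
  have e2 : ħ ^ (2 - 4 * μ) = ħ ^ 2 * (ħ ^ (-μ)) ^ 4 := by
    simp only [← Real.rpow_natCast, ← Real.rpow_mul h0.le]
    rw [← Real.rpow_add h0]
    congr 1
    push_cast
    ring
  have e3 : ħ ^ (1 / 2 - μ) = ħ ^ (-μ) / s := by
    rw [hs, ← Real.rpow_sub h0]
    congr 1
    ring
  have b1 : (2 * Real.pi * ħ) ^ 2 * ((packetLength ħ : ℝ) ^ 2 * (ħ ^ (-μ)) ^ 2 + (ħ ^ (-μ)) ^ 4) ≤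
      (2 * Real.pi) ^ 2 * (4 * ħ ^ (1 - 2 * μ) + ħ ^ (2 - 4 * μ)) := by
    rw [e1, e2, mul_pow _ ħ, mul_assoc _ (ħ ^ 2), ← mul_add]
    gcongr
  have b2 : 8 * ħ ^ (-μ) / packetLength ħ ≤ 8 * ħ ^ (1 / 2 - μ) := by
    rw [e3, ← mul_div_assoc]
    gcongr
  refine mul_le_mul_of_nonneg_left ?_ (sq_nonneg C)
  nlinarith

end Rate

theorem continuous_of_continuous_coe_prod {X Y : Type*} [TopologicalSpace X] [TopologicalSpace Y]
    {f : UnitAddCircle × X → Y} (h : Continuous fun p : ℝ × X => f ((p.1 : UnitAddCircle), p.2)) :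
    Continuous f := by
  have h1 : IsOpenQuotientMap (Prod.map (QuotientAddGroup.mk : ℝ → UnitAddCircle) (id : X → X)) :=
    (QuotientAddGroup.isOpenQuotientMap_mk (N := AddSubgroup.zmultiples (1 : ℝ))).prodMap
      IsOpenQuotientMap.id
  exact h1.isQuotientMap.continuous_iff.2 h

/-! ### Iterated directional derivatives and the bounds they inherit from the symbol class. -/

section Derivatives

variable {E : Type*} [NormedAddCommGroup E] [NormedSpace ℝ E]

/-- Iterated directional derivatives. -/
noncomputable def iterDir (f : E → ℝ) : (n : ℕ) → (Fin n → E) → E → ℝ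
  | 0, _ => f
  | n + 1, m => fun z => fderiv ℝ (iterDir f n (Fin.tail m)) z (m 0)

theorem contDiffOn_iterDir {U : Set E} (hU : IsOpen U) {f : E → ℝ} (hf : ContDiffOn ℝ ∞ f U) (n : ℕ)
    (m : Fin n → E) : ContDiffOn ℝ ∞ (iterDir f n m) U := by
  induction n with
  | zero => exact hf
  | succ n ih => exact ((ih (Fin.tail m)).fderiv_of_isOpen hU (by simp)).clm_apply contDiffOn_const

theorem iteratedFDeriv_eq_iterDir {U : Set E} (hU : IsOpen U) {f : E → ℝ} (hf : ContDiffOn ℝ ∞ f U)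
    (n : ℕ) {z : E} (hz : z ∈ U) (m : Fin n → E) : iteratedFDeriv ℝ n f z m = iterDir f n m z := by
  induction n generalizing z with
  | zero => exact iteratedFDeriv_zero_apply m
  | succ n ih =>
    have hd : DifferentiableAt ℝ (iteratedFDeriv ℝ n f) z :=
      (hf.contDiffAt (hU.mem_nhds hz)).differentiableAt_iteratedFDeriv
        (by exact_mod_cast ENat.natCast_lt_top n)
    rw [iteratedFDeriv_succ_apply_left]
    have h := ((ContinuousMultilinearMap.apply ℝ (fun _ : Fin n => E) ℝ
      (Fin.tail m)).hasFDerivAt.comp z hd.hasFDerivAt).fderiv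
    have he : (fun z => iteratedFDeriv ℝ n f z (Fin.tail m)) =ᶠ[𝓝 z] iterDir f n (Fin.tail m) := by
      filter_upwards [hU.mem_nhds hz] with z' hz' using ih hz' _
    simp only [Function.comp_def, ContinuousMultilinearMap.apply_apply] at h
    rw [he.fderiv_eq] at h
    exact (congrArg (fun T : E →L[ℝ] ℝ => T (m 0)) h).symm

theorem dX_dX_eq {F : ℝ × ℝ → ℝ} (hF : ContDiff ℝ ∞ F) (z : ℝ × ℝ) :
    dX (dX F) z = iteratedFDeriv ℝ 2 F z ![(1, 0), (1, 0)] :=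
  (iteratedFDeriv_eq_iterDir isOpen_univ hF.contDiffOn 2 (Set.mem_univ z)
    ![(1, 0), (1, 0)]).symm

theorem dXi_dXi_eq {F : ℝ × ℝ → ℝ} (hF : ContDiff ℝ ∞ F) (z : ℝ × ℝ) :
    dXi (dXi F) z = iteratedFDeriv ℝ 2 F z ![(0, 1), (0, 1)] :=
  (iteratedFDeriv_eq_iterDir isOpen_univ hF.contDiffOn 2 (Set.mem_univ z)
    ![(0, 1), (0, 1)]).symm

theorem dX_dX_dXi_dXi_eq {F : ℝ × ℝ → ℝ} (hF : ContDiff ℝ ∞ F) (z : ℝ × ℝ) :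
    dX (dX (dXi (dXi F))) z = iteratedFDeriv ℝ 4 F z ![(1, 0), (1, 0), (0, 1), (0, 1)] :=
  (iteratedFDeriv_eq_iterDir isOpen_univ hF.contDiffOn 4 (Set.mem_univ z)
    ![(1, 0), (1, 0), (0, 1), (0, 1)]).symm

/-- The class of order `m = 0` serves for no `ξ` derivative and that of order `m = 2` for two, so
the weight in `ξ` is `1` every time. -/
theorem IsSymbol.exists_bounds {μ : ℝ} {F : ℝ → ℝ × ℝ → ℝ} (hF : ∀ m : ℝ, IsSymbol μ m F) :
    ∃ C, 0 ≤ C ∧ ∀ ħ, 0 < ħ → ħ ≤ 1 → ∀ z, |F ħ z| ≤ C ∧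
      |dX (dX (F ħ)) z| ≤ C * (ħ ^ (-μ)) ^ 2 ∧ |dXi (dXi (F ħ)) z| ≤ C * (ħ ^ (-μ)) ^ 2 ∧
      |dX (dX (dXi (dXi (F ħ)))) z| ≤ C * (ħ ^ (-μ)) ^ 4 := by
  obtain ⟨C0, h0⟩ := (hF 0).2 0 0
  obtain ⟨C1, h1⟩ := (hF 0).2 2 0
  obtain ⟨C2, h2⟩ := (hF 2).2 0 2
  obtain ⟨C3, h3⟩ := (hF 2).2 2 2
  refine ⟨|C0| + |C1| + |C2| + |C3|, by positivity, fun ħ hħ hħ1 z => ?_⟩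
  have hs := (hF 0).1 ħ hħ
  have hp2 : ħ ^ (-(μ * 2)) = (ħ ^ (-μ)) ^ 2 := by
    rw [← neg_mul, Real.rpow_mul hħ.le, Real.rpow_two]
  have hp4 : ħ ^ (-μ * 4) = (ħ ^ (-μ)) ^ 4 := by
    rw [Real.rpow_mul hħ.le]; exact_mod_cast Real.rpow_natCast _ 4
  have ht : 0 < ħ ^ (-μ) := Real.rpow_pos_of_pos hħ _
  have hC : ∀ {c T : ℝ}, 0 ≤ T → |c| ≤ |C0| + |C1| + |C2| + |C3| →
      c * T ≤ (|C0| + |C1| + |C2| + |C3|) * T := fun hT hc =>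
    mul_le_mul_of_nonneg_right ((le_abs_self _).trans hc) hT
  have a0 := abs_nonneg C0
  have a1 := abs_nonneg C1
  have a2 := abs_nonneg C2
  have a3 := abs_nonneg C3
  refine ⟨?_, ?_, ?_, ?_⟩
  · have h := h0 ħ hħ hħ1 z.1 z.2 ![] ![]
    simp at h
    linarith [le_abs_self C0]
  · have h := h1 ħ hħ hħ1 z.1 z.2 ![1, 1] ![]
    rw [dX_dX_eq hs]
    have e : (Fin.append (fun i => ((![1, 1] : Fin 2 → ℝ) i, (0 : ℝ))) fun i => ((0 : ℝ), (![] : Fin 0 → ℝ) i)) =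
        ![(1, 0), (1, 0)] := by
      ext i <;> fin_cases i <;> rfl
    rw [e] at h
    refine (h.trans (le_of_eq ?_)).trans (hC (c := C1) (by positivity) (by linarith))
    simp [hp2]
  · have h := h2 ħ hħ hħ1 z.1 z.2 ![] ![1, 1]
    rw [dXi_dXi_eq hs]
    have e : (Fin.append (fun i => ((![] : Fin 0 → ℝ) i, (0 : ℝ))) fun i => ((0 : ℝ), (![1, 1] : Fin 2 → ℝ) i)) =
        ![(0, 1), (0, 1)] := by
      ext i <;> fin_cases i <;> rfl
    rw [e] at h
    refine (h.trans (le_of_eq ?_)).trans (hC (c := C2) (by positivity) (by linarith))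
    simp [hp2]
  · have h := h3 ħ hħ hħ1 z.1 z.2 ![1, 1] ![1, 1]
    rw [dX_dX_dXi_dXi_eq hs]
    have e : (Fin.append (fun i => ((![1, 1] : Fin 2 → ℝ) i, (0 : ℝ))) fun i => ((0 : ℝ), (![1, 1] : Fin 2 → ℝ) i)) =
        ![(1, 0), (1, 0), (0, 1), (0, 1)] := by
      ext i <;> fin_cases i <;> rfl
    rw [e] at h
    refine (h.trans (le_of_eq ?_)).trans (hC (c := C3) (by positivity) (by linarith))
    have : (-μ * ((2 : ℕ) + (2 : ℕ) : ℝ)) = -μ * 4 := by push_cast; ring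
    rw [this, hp4]
    simp

end Derivatives

/-! ### The Weyl law on `T*S¹`. -/

section Circle

/-- The scalar case of the quantization with coherent states: one point and the unit vector of `ℂ`.
-/
theorem isCoherent_one : IsCoherent (Measure.dirac ()) (fun _ : Unit => (1 : ℂ)) where
  meas := stronglyMeasurable_const
  norm_eq _ := norm_one
  lintegral_eq v := by simp

theorem exists_isCyl_cylinderLift {f : UnitAddCircle × ℝ → ℝ} (hs : ContDiff ℝ ∞ (cylinderLift f))
    (hc : HasCompactSupport f) : ∃ R, IsCyl R (cylinderLift f) := by
  obtain ⟨R, hR⟩ := (hc.isCompact.image continuous_snd).isBounded.exists_norm_le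
  refine ⟨R, hs, fun x ξ => ?_, fun x ξ h => ?_⟩
  · simp only [cylinderLift]
    congr 2
    simp
  · by_contra h0
    have := hR ξ ⟨((x : UnitAddCircle), ξ), subset_tsupport _ h0, rfl⟩
    rw [Real.norm_eq_abs] at this
    linarith

theorem continuous_of_cylinderLift {f : UnitAddCircle × ℝ → ℝ} (hs : ContDiff ℝ ∞ (cylinderLift f)) :
    Continuous f :=
  continuous_of_continuous_coe_prod hs.continuous

theorem IsCyl.exists_isCylFamily {R : ℝ} {F : ℝ × ℝ → ℝ} (hF : IsCyl R F) :
    ∃ B, IsCylFamily R B fun _ : Unit => F := by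
  obtain ⟨B, -, hB⟩ := hF.exists_norm_cylCoef_le
  exact ⟨B, fun _ => hF, hF.continuous.comp _root_.continuous_snd, fun _ => hB⟩

/-- The Weyl quantization on the circle. -/
noncomputable def circleOp (ħ : ℝ) (f : UnitAddCircle × ℝ → ℝ) :
    Lp ℂ 2 (volume : Measure UnitAddCircle) →L[ℂ] Lp ℂ 2 (volume : Measure UnitAddCircle) :=
  cylOp (Measure.dirac ()) (fun _ : Unit => (1 : ℂ)) (fun _ => cylinderLift f) ħ

theorem isCircleWeylQuantization_circleOp {R ħ : ℝ} (hħ : 0 < ħ) {f : UnitAddCircle × ℝ → ℝ}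
    (hF : IsCyl R (cylinderLift f)) : IsCircleWeylQuantization ħ f (circleOp ħ f) := by
  obtain ⟨B, hB⟩ := hF.exists_isCylFamily
  intro φ hφ u hu
  filter_upwards [cylOp_apply_ae hB isCoherent_one hħ hφ hu] with x hx
  rw [circleOp, hx, integral_dirac]
  simp

theorem cylPhaseMeasure_dirac {h : ℝ} {P : UnitAddCircle × ℝ → Prop} (hP : MeasurableSet {z | P z}) :
    cylPhaseMeasure h (Measure.dirac ()) {z : UnitAddCircle × ℝ × Unit | P (z.1, z.2.1)} =
      ENNReal.ofReal h⁻¹ * volume {z | P z} := by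
  rw [cylPhaseMeasure, Measure.smul_apply, smul_eq_mul]
  congr 1
  have h1 : MeasurePreserving (Prod.map id Prod.fst : UnitAddCircle × ℝ × Unit → UnitAddCircle × ℝ)
      ((volume : Measure UnitAddCircle).prod ((volume : Measure ℝ).prod (Measure.dirac ())))
      ((volume : Measure UnitAddCircle).prod volume) :=
    (MeasurePreserving.id _).prod measurePreserving_fst
  exact h1.measure_preimage hP.nullMeasurableSet

/-- The Weyl law on `T*S¹`. -/
theorem weylLaw_circle (μ : ℝ) (hμ : μ < 1 / 2) (a : ℝ → UnitAddCircle × ℝ → ℝ)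
    (ha : ∀ m : ℝ, IsSymbol μ m (fun ħ => cylinderLift (a ħ)))
    (hac : ∀ ħ : ℝ, 0 < ħ → HasCompactSupport (a ħ)) :
    ∃ A : ℝ → (Lp ℂ 2 (volume : Measure UnitAddCircle) →L[ℂ]
        Lp ℂ 2 (volume : Measure UnitAddCircle)),
      (∀ ħ : ℝ, 0 < ħ → IsCircleWeylQuantization ħ (a ħ) (A ħ) ∧
        IsSelfAdjoint (A ħ) ∧ IsTraceClass (A ħ)) ∧
      ∀ ε : ℝ, 0 < ε →
        (∀ ħ : ℝ, 0 < ħ → FinitelyManyOuter (A ħ) ε) ∧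
        WeylBounds (𝓝[>] (0 : ℝ)) volume (fun ħ => 1 / (2 * Real.pi * ħ)) a
          (fun ħ => outerCount (A ħ) ε) ε ∧
        (NoConcentration (𝓝[>] (0 : ℝ)) volume a ε →
          WeylLaw (𝓝[>] (0 : ℝ)) volume (fun ħ => 1 / (2 * Real.pi * ħ)) a
            (fun ħ => outerCount (A ħ) ε) ε) := by
  have hs : ∀ ħ, 0 < ħ → ContDiff ℝ ∞ (cylinderLift (a ħ)) := (ha 0).1
  have hcyl : ∀ ħ, 0 < ħ → ∃ R, IsCyl R (cylinderLift (a ħ)) := fun ħ h =>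
    exists_isCyl_cylinderLift (hs ħ h) (hac ħ h)
  have htr : ∀ ħ, 0 < ħ → IsSelfAdjoint (circleOp ħ (a ħ)) ∧ IsTraceClass (circleOp ħ (a ħ)) ∧
      ∀ ε : ℝ, 0 < ε → FinitelyManyOuter (circleOp ħ (a ħ)) ε := fun ħ h => by
    obtain ⟨R, hR⟩ := hcyl ħ h
    obtain ⟨B, hB⟩ := hR.exists_isCylFamily
    exact cylOp_traceClass hB isCoherent_one h
  have hmeas : ∀ ħ, 0 < ħ → Measurable (a ħ) := fun ħ h =>
    (continuous_of_cylinderLift (hs ħ h)).measurable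
  obtain ⟨C, hC0, hC⟩ := IsSymbol.exists_bounds ha
  have hev : ∀ᶠ ħ : ℝ in 𝓝[>] 0, 0 < ħ ∧ ħ ≤ 1 := by
    filter_upwards [self_mem_nhdsWithin, nhdsWithin_le_nhds (Iic_mem_nhds one_pos)] with ħ h1 h2
    exact ⟨h1, h2⟩
  refine ⟨fun ħ => circleOp ħ (a ħ), fun ħ h => ⟨?_, (htr ħ h).1, (htr ħ h).2.1⟩, fun ε hε =>
    ⟨fun ħ h => (htr ħ h).2.2 ε hε, ?_⟩⟩
  · obtain ⟨R, hR⟩ := hcyl ħ h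
    exact isCircleWeylQuantization_circleOp h hR
  refine weylBounds_and_weylLaw_of_ennreal _ _ _ _ _ hε (packetRate μ C) (tendsto_packetRate hμ C)
    (hev.mono fun ħ h => packetRate_nonneg μ C h.1) ?_ ?_ ?_
  · filter_upwards [hev] with ħ hħ
    have := hħ.1
    positivity
  · filter_upwards [hev] with ħ hħ using (hac ħ hħ.1).measure_abs_pos_ne_top
  · filter_upwards [hev] with ħ hħ δ hδ
    have hħ0 := hħ.1
    obtain ⟨R, hR⟩ := hcyl ħ hħ.1
    obtain ⟨B, hB⟩ := hR.exists_isCylFamily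
    have hm := hmeas ħ hħ0
    -- Nothing varies over a one-point parameter space, so `κ = 0`.
    have key := cylOp_counting (a := fun z : UnitAddCircle × ℝ × Unit => a ħ (z.1, z.2.1)) (κ := 0)
      hB isCoherent_one hħ0 (packetLength_pos hħ0) (hm.comp (by fun_prop))
      (fun x ξ n => rfl) (Real.rpow_pos_of_pos hħ0 (-μ)) le_rfl
      (fun _ z => (hC ħ hħ0 hħ.2 z).1) (fun _ z => (hC ħ hħ0 hħ.2 z).2.1)
      (fun _ z => (hC ħ hħ0 hħ.2 z).2.2.1) (fun _ z => (hC ħ hħ0 hħ.2 z).2.2.2) (by simp) hε hδ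
    have m1 : ∀ t, MeasurableSet {z | t < |a ħ z|} := fun t =>
      measurableSet_lt measurable_const hm.abs
    have m2 : MeasurableSet {z | a ħ z ≠ 0} := (measurableSet_eq_fun hm measurable_const).compl
    have e0 : {z | a ħ z ≠ 0} = {z | 0 < |a ħ z|} := by ext z; simp
    rw [cylPhaseMeasure_dirac (m1 _), cylPhaseMeasure_dirac (m1 _), cylPhaseMeasure_dirac m2, e0] at key
    have e1 : ENNReal.ofReal (1 / (2 * Real.pi * ħ) * packetRate μ C ħ) * volume {z | 0 < |a ħ z|} =
        ENNReal.ofReal (packetRate μ C ħ) *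
          (ENNReal.ofReal (2 * Real.pi * ħ)⁻¹ * volume {z | 0 < |a ħ z|}) := by
      rw [ENNReal.ofReal_mul (by positivity), one_div]
      ring
    rw [e1, one_div, Measure.smul_apply, Measure.smul_apply, smul_eq_mul, smul_eq_mul]
    rw [mul_zero, add_zero] at key
    exact key

end Circle

/-! ### Moments of a height function on the sphere. -/

section Sphere

theorem finrank_E3 : Module.finrank ℝ E3 = 3 := by simp

instance : IsFiniteMeasure sphereArea := by unfold sphereArea; infer_instance

theorem integral_inner_pow_mul_exp (u : E3) (k : ℕ) :
    ∫ x : E3, inner ℝ u x ^ k * Real.exp (-‖x‖ ^ 2) =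
      (∫ n : S2, inner ℝ u (n : E3) ^ k ∂sphereArea) *
        ∫ r in Set.Ioi (0 : ℝ), r ^ (k + 2) * Real.exp (-r ^ 2) := by
  calc
    _ = ∫ x : ({(0 : E3)}ᶜ : Set E3), inner ℝ u (x : E3) ^ k * Real.exp (-‖(x : E3)‖ ^ 2)
        ∂((volume : Measure E3).comap (↑)) := by
      rw [integral_subtype_comap (measurableSet_singleton _).compl
        fun x => inner ℝ u x ^ k * Real.exp (-‖x‖ ^ 2), restrict_compl_singleton]
    _ = ∫ p : S2 × Set.Ioi (0 : ℝ), inner ℝ u (p.1 : E3) ^ k *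
        ((p.2 : ℝ) ^ k * Real.exp (-(p.2 : ℝ) ^ 2))
        ∂(sphereArea.prod (Measure.volumeIoiPow (Module.finrank ℝ E3 - 1))) := by
      rw [sphereArea, ← (volume : Measure E3).measurePreserving_homeomorphUnitSphereProd.integral_comp
        (Homeomorph.measurableEmbedding _)]
      refine integral_congr_ae (ae_of_all _ fun x => ?_)
      have hx : ‖(x : E3)‖ ≠ 0 := norm_ne_zero_iff.2 x.2
      simp only [homeomorphUnitSphereProd_apply_snd_coe, homeomorphUnitSphereProd_apply_fst_coe,
        inner_smul_right, mul_pow, inv_pow]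
      field_simp
    _ = (∫ n : S2, inner ℝ u (n : E3) ^ k ∂sphereArea) *
        ∫ r : Set.Ioi (0 : ℝ), (r : ℝ) ^ k * Real.exp (-(r : ℝ) ^ 2)
          ∂(Measure.volumeIoiPow (Module.finrank ℝ E3 - 1)) :=
      integral_prod_mul (fun n : S2 => inner ℝ u (n : E3) ^ k)
        (fun r : Set.Ioi (0 : ℝ) => (r : ℝ) ^ k * Real.exp (-(r : ℝ) ^ 2))
    _ = _ := by
      congr 1
      simp only [Measure.volumeIoiPow, ENNReal.ofReal]
      rw [integral_withDensity_eq_integral_smul (by fun_prop),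
        integral_subtype_comap measurableSet_Ioi fun a : ℝ =>
          Real.toNNReal (a ^ (Module.finrank ℝ E3 - 1)) • (a ^ k * Real.exp (-a ^ 2))]
      refine setIntegral_congr_fun measurableSet_Ioi fun x hx => ?_
      simp only [finrank_E3]
      rw [NNReal.smul_def, Real.coe_toNNReal _ (pow_nonneg (le_of_lt hx) _), smul_eq_mul]
      ring

theorem integral_inner_pow_mul_exp_eq_prod (u : S2) (k : ℕ) :
    ∫ x : E3, inner ℝ (u : E3) x ^ k * Real.exp (-‖x‖ ^ 2) =
      (∫ t : ℝ, t ^ k * Real.exp (-t ^ 2)) * Real.pi := by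
  have hu : ‖(u : E3)‖ = 1 := mem_sphere_zero_iff_norm.1 u.2
  obtain ⟨b, hb⟩ := Orthonormal.exists_orthonormalBasis_extension_of_card_eq (ι := Fin 3)
    (𝕜 := ℝ) (E := E3) (by simp) (v := fun _ => (u : E3)) (s := {0})
    ⟨fun _ => hu, fun i j hij => absurd (Subsingleton.elim i j) hij⟩
  have hb0 : b 0 = (u : E3) := hb 0 rfl
  rw [← b.measurePreserving_repr_symm.integral_comp
    b.repr.symm.toHomeomorph.measurableEmbedding,
    ← (EuclideanSpace.volume_preserving_symm_measurableEquiv_toLp (Fin 3)).symm.integral_comp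
      (MeasurableEquiv.measurableEmbedding _)]
  have h1 : ∀ y : Fin 3 → ℝ,
      inner ℝ (u : E3) (b.repr.symm (WithLp.toLp 2 y)) ^ k *
        Real.exp (-‖b.repr.symm (WithLp.toLp 2 y)‖ ^ 2) =
      ∏ i, (fun (i : Fin 3) (t : ℝ) => if i = 0 then t ^ k * Real.exp (-t ^ 2)
        else Real.exp (-t ^ 2)) i (y i) := by
    intro y
    rw [← hb0, ← b.repr_apply_apply, LinearIsometryEquiv.apply_symm_apply,
      LinearIsometryEquiv.norm_map, EuclideanSpace.norm_sq_eq, Fin.prod_univ_three,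
      Fin.sum_univ_three]
    simp only [Real.norm_eq_abs, sq_abs, neg_add, Real.exp_add]
    simp
    ring
  have hg : ∫ t : ℝ, Real.exp (-t ^ 2) = Real.sqrt Real.pi := by
    have := integral_gaussian 1
    simpa using this
  calc
    _ = ∫ y : Fin 3 → ℝ, ∏ i, (fun (i : Fin 3) (t : ℝ) => if i = 0 then t ^ k * Real.exp (-t ^ 2)
        else Real.exp (-t ^ 2)) i (y i) := integral_congr_ae (ae_of_all _ h1)
    _ = _ := by
      rw [integral_fintype_prod_volume_eq_prod (ι := Fin 3) (E := fun _ => ℝ)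
        (f := fun (i : Fin 3) (t : ℝ) => if i = 0 then t ^ k * Real.exp (-t ^ 2)
          else Real.exp (-t ^ 2)), Fin.prod_univ_three]
      simp only [if_true, Fin.isValue, one_ne_zero, if_false, Fin.reduceEq, hg]
      rw [mul_assoc, Real.mul_self_sqrt Real.pi_pos.le]

theorem integral_Ioi_pow_mul_exp (k : ℕ) :
    ∫ r in Set.Ioi (0 : ℝ), r ^ k * Real.exp (-r ^ 2) = Real.Gamma ((k + 1) / 2) / 2 := by
  have h := integral_rpow_mul_exp_neg_rpow (p := 2) (q := k) two_pos
    (by linarith [(Nat.cast_nonneg k : (0 : ℝ) ≤ k)])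
  rw [one_div, inv_mul_eq_div] at h
  rw [← h]
  refine setIntegral_congr_fun measurableSet_Ioi fun x _ => ?_
  simp [Real.rpow_natCast]

theorem integral_pow_mul_exp (k : ℕ) :
    ∫ t : ℝ, t ^ k * Real.exp (-t ^ 2) = if Even k then Real.Gamma ((k + 1) / 2) else 0 := by
  split_ifs with hk
  · have := integral_comp_abs (f := fun t : ℝ => t ^ k * Real.exp (-t ^ 2))
    simp only [hk.pow_abs, sq_abs] at this
    rw [this, integral_Ioi_pow_mul_exp]
    ring
  · have h := integral_neg_eq_self (fun t : ℝ => t ^ k * Real.exp (-t ^ 2)) volume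
    simp only [(Nat.not_even_iff_odd.1 hk).neg_pow, neg_sq, neg_mul, integral_neg] at h
    linarith

/-- The Gaussian moment `∫ ⟨u, x⟩^k exp(-‖x‖²)` is computed in polar coordinates and in Cartesian
coordinates with first axis `u`. Comparing the two gives the spherical moment; the Gamma factors
cancel by `Γ(s + 1) = s Γ(s)`. -/
theorem integral_inner_pow_sphere (u : S2) (k : ℕ) :
    ∫ n : S2, inner ℝ (u : E3) (n : E3) ^ k ∂sphereArea =
      2 * Real.pi * ∫ t in (-1 : ℝ)..1, t ^ k := by
  have h1 := integral_inner_pow_mul_exp (u : E3) k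
  rw [integral_inner_pow_mul_exp_eq_prod, integral_Ioi_pow_mul_exp, integral_pow_mul_exp] at h1
  have hk0 : (0 : ℝ) < ((k : ℝ) + 1) / 2 := by positivity
  have h2 : Real.Gamma (((k + 2 : ℕ) + 1) / 2) = ((k : ℝ) + 1) / 2 * Real.Gamma ((k + 1) / 2) := by
    rw [← Real.Gamma_add_one hk0.ne']
    congr 1
    push_cast
    ring
  have hG := Real.Gamma_pos_of_pos hk0
  rw [h2] at h1
  rw [integral_pow]
  split_ifs at h1 with hk
  · rw [one_pow, hk.add_one.neg_one_pow]
    have : ∫ n : S2, inner ℝ (u : E3) (n : E3) ^ k ∂sphereArea =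
        (Real.Gamma ((k + 1) / 2) * Real.pi) / ((((k : ℝ) + 1) / 2 * Real.Gamma ((k + 1) / 2)) / 2) := by
      rw [eq_div_iff (by positivity), h1]
    rw [this]
    field_simp
    ring
  · rw [one_pow, (Nat.not_even_iff_odd.1 hk).add_one.neg_one_pow]
    have : (((k : ℝ) + 1) / 2 * Real.Gamma ((k + 1) / 2)) / 2 ≠ 0 := by positivity
    rw [zero_mul] at h1
    rw [(mul_eq_zero.1 h1.symm).resolve_right this]
    simp

/-- Archimedes' theorem for the averages of polynomials in a height function. -/
theorem integral_eval_inner_sphere (u : S2) (P : Polynomial ℝ) :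
    ∫ n : S2, P.eval (inner ℝ (u : E3) (n : E3)) ∂sphereArea =
      2 * Real.pi * ∫ t in (-1 : ℝ)..1, P.eval t := by
  simp only [Polynomial.eval_eq_sum_range]
  rw [integral_finsetSum, intervalIntegral.integral_finsetSum, Finset.mul_sum]
  · refine Finset.sum_congr rfl fun i _ => ?_
    rw [integral_const_mul, integral_inner_pow_sphere, intervalIntegral.integral_const_mul]
    ring
  · exact fun i _ => (by fun_prop : Continuous fun t : ℝ => P.coeff i * t ^ i).intervalIntegrable _ _
  · exact fun i _ => (by fun_prop : Continuous fun n : S2 =>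
      P.coeff i * inner ℝ (u : E3) (n : E3) ^ i).integrable_of_hasCompactSupport
        (HasCompactSupport.of_compactSpace _)

/-- The transition probability `(1 + u · n) / 2` between two spin one half coherent states. -/
noncomputable def overlap (u n : S2) : ℝ := (1 + inner ℝ (u : E3) (n : E3)) / 2

theorem norm_S2 (n : S2) : ‖(n : E3)‖ = 1 := mem_sphere_zero_iff_norm.1 n.2

theorem overlap_nonneg (u n : S2) : 0 ≤ overlap u n := by
  have := (abs_le.1 (abs_real_inner_le_norm (u : E3) (n : E3))).1
  rw [norm_S2, norm_S2] at this
  rw [overlap]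
  linarith

theorem norm_sub_sq_eq_overlap (u n : S2) : ‖(u : E3) - n‖ ^ 2 = 4 * (1 - overlap u n) := by
  rw [norm_sub_sq_real, norm_S2, norm_S2, overlap]
  ring

theorem continuous_overlap (u : S2) : Continuous (overlap u) := by
  unfold overlap
  fun_prop

theorem integral_overlap_pow (u : S2) (N : ℕ) :
    ∫ n : S2, overlap u n ^ N ∂sphereArea = 4 * Real.pi / (N + 1) := by
  have h := integral_eval_inner_sphere u
    ((Polynomial.C (1 / 2 : ℝ) * (1 + Polynomial.X)) ^ N)
  simp only [Polynomial.eval_pow, Polynomial.eval_mul, Polynomial.eval_C, Polynomial.eval_add,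
    Polynomial.eval_one, Polynomial.eval_X] at h
  have e : ∀ n : S2, overlap u n ^ N = (1 / 2 * (1 + inner ℝ (u : E3) (n : E3))) ^ N := fun n => by
    rw [overlap]
    ring
  simp only [e, h]
  have h2 : ∫ t in (-1 : ℝ)..1, (1 / 2 * (1 + t)) ^ N = 2 * (1 / ((N : ℝ) + 1)) := by
    have := intervalIntegral.smul_integral_comp_mul_add (a := -1) (b := 1) (fun x : ℝ => x ^ N)
      (1 / 2) (1 / 2)
    rw [integral_pow] at this
    norm_num at this
    have e2 : ∀ t : ℝ, (1 / 2 * (1 + t)) ^ N = (1 / 2 * t + 1 / 2) ^ N := fun t => by ring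
    simp only [e2]
    rw [one_div ((N : ℝ) + 1), ← this]
    ring
  rw [h2]
  ring

end Sphere

/-! ### Measurable spin coherent states and their overlaps. -/

section Spinors

/-- A measurable choice of spinors: a unit vector in the range of `(1 + n · σ) / 2`. -/
noncomputable def spinor (n : S2) : Fin 2 → ℂ :=
  ![(Real.sqrt ((1 + (n : E3) 2) / 2) : ℂ),
    if (n : E3) 2 = -1 then 1 else
      ((n : E3) 0 + Complex.I * (n : E3) 1) / (2 * Real.sqrt ((1 + (n : E3) 2) / 2) : ℝ)]

theorem sum_sq_S2 (n : S2) : (n : E3) 0 ^ 2 + (n : E3) 1 ^ 2 + (n : E3) 2 ^ 2 = 1 := by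
  have h := norm_S2 n
  rw [EuclideanSpace.norm_eq, Real.sqrt_eq_one] at h
  simpa [Fin.sum_univ_three] using h

theorem spinor_mul_conj (n : S2) (s t : Fin 2) :
    spinor n s * (starRingEnd ℂ) (spinor n t) = ((1 / 2 : ℂ) • (1 + pauliDot n)) s t := by
  have h := sum_sq_S2 n
  by_cases hs : (n : E3) 2 = -1
  · have h0 : (n : E3) 0 = 0 := by nlinarith [sq_nonneg ((n : E3) 0), sq_nonneg ((n : E3) 1)]
    have h1 : (n : E3) 1 = 0 := by nlinarith [sq_nonneg ((n : E3) 0), sq_nonneg ((n : E3) 1)]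
    fin_cases s <;> fin_cases t <;> simp [spinor, pauliDot, hs, h0, h1]
    norm_num
  · have hpos : 0 < (1 + (n : E3) 2) / 2 := by
      have h1 : -1 ≤ (n : E3) 2 := by
        nlinarith [sq_nonneg ((n : E3) 0), sq_nonneg ((n : E3) 1)]
      have : -1 < (n : E3) 2 := lt_of_le_of_ne h1 (Ne.symm hs)
      linarith
    have hr2 := Real.mul_self_sqrt hpos.le
    have hr0 := Real.sqrt_pos.2 hpos
    simp only [spinor, hs, if_false]
    set r := Real.sqrt ((1 + (n : E3) 2) / 2)
    have hr2' : (r : ℂ) * r = (1 + (n : E3) 2) / 2 := by exact_mod_cast hr2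
    have hr' : (r : ℂ) ≠ 0 := by exact_mod_cast hr0.ne'
    have h' : ((n : E3) 0 : ℂ) ^ 2 + ((n : E3) 1 : ℂ) ^ 2 + ((n : E3) 2 : ℂ) ^ 2 = 1 := by
      simpa using congrArg (fun x : ℝ => (x : ℂ)) h
    fin_cases s <;> fin_cases t
    · simp [pauliDot, hr2']
      ring
    · simp [pauliDot, map_ofNat]
      field_simp
      ring
    · simp [pauliDot]
      field_simp
    · simp only [pauliDot, Fin.mk_one, Fin.isValue, Matrix.cons_val_one,
        map_div₀, map_add, map_mul, Complex.conj_I, Complex.conj_ofReal, Matrix.smul_apply,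
        Matrix.add_apply, Matrix.one_apply_eq, Matrix.of_apply, smul_eq_mul, Matrix.cons_val_fin_one]
      push_cast
      rw [div_mul_div_comm, div_eq_iff (by simp [hr'])]
      have e : (2 * (r : ℂ)) * (2 * r) = 2 * (1 + (n : E3) 2) := by
        linear_combination 4 * hr2'
      rw [e]
      linear_combination (-(((n : E3) 1 : ℂ) ^ 2)) * Complex.I_sq + h'

theorem measurable_spinor (k : Fin 2) : Measurable fun n => spinor n k := by
  have hc : ∀ i : Fin 3, Continuous fun n : S2 => (n : E3) i := fun i => by fun_prop
  fin_cases k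
  · have : Continuous fun n : S2 => (Real.sqrt ((1 + (n : E3) 2) / 2) : ℂ) := by fun_prop
    exact this.measurable
  · have h0 := (hc 0).measurable
    have h1 := (hc 1).measurable
    have h2 := (hc 2).measurable
    change Measurable fun n : S2 => if (n : E3) 2 = -1 then (1 : ℂ) else
      ((n : E3) 0 + Complex.I * (n : E3) 1) / (2 * Real.sqrt ((1 + (n : E3) 2) / 2) : ℝ)
    refine Measurable.ite (h2 (measurableSet_singleton _)) measurable_const ?_
    fun_prop

/-- A measurable choice of coherent states. -/
noncomputable def coherentVec (N : ℕ) (n : S2) : SpinSpace N :=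
  ⟨WithLp.toLp 2 fun s => ∏ i, spinor n (s i), fun σ s =>
    Equiv.prod_comp σ fun i => spinor n (s i)⟩

theorem inner_spinSpace {N : ℕ} (v w : SpinSpace N) :
    inner ℂ v w = ∑ s, (starRingEnd ℂ) (v.1 s) * w.1 s := by
  change inner ℂ v.1 w.1 = _
  rw [PiLp.inner_apply]
  refine Finset.sum_congr rfl fun s _ => ?_
  rw [RCLike.inner_apply, mul_comm]

/-- The vectors `coherentState` come from an arbitrary choice of rotations, with no measurability in
`n`. Only their projectors enter `Op_j`, and these agree with those of the measurable vectors since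
both are tensor powers of `(1 + n · σ)/2`. -/
theorem coherentProj_eq (N : ℕ) (n : S2) :
    coherentProj N n = (innerSL ℂ (coherentVec N n)).smulRight (coherentVec N n) := by
  ext1 w
  refine (rankOne_eq_tensorPow N n _ (exists_rotates n).choose_spec w).trans ?_
  apply Subtype.ext
  ext s
  change ∑ t : Fin N → Fin 2, (∏ i, ((1 / 2 : ℂ) • (1 + pauliDot n)) (s i) (t i)) * w.1 t =
    inner ℂ (coherentVec N n) w * ∏ i, spinor n (s i)
  rw [inner_spinSpace, Finset.sum_mul]
  refine Finset.sum_congr rfl fun t _ => ?_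
  simp_rw [← spinor_mul_conj, Finset.prod_mul_distrib]
  change _ = (starRingEnd ℂ) (∏ i, spinor n (t i)) * w.1 t * _
  rw [map_prod]
  ring

theorem inner_coherentVec (N : ℕ) (n n' : S2) :
    inner ℂ (coherentVec N n) (coherentVec N n') =
      (∑ k, (starRingEnd ℂ) (spinor n k) * spinor n' k) ^ N := by
  rw [inner_spinSpace]
  change ∑ s : Fin N → Fin 2, (starRingEnd ℂ) (∏ i, spinor n (s i)) * ∏ i, spinor n' (s i) = _
  simp_rw [map_prod, ← Finset.prod_mul_distrib]
  rw [← Fintype.prod_sum fun (_ : Fin N) k => (starRingEnd ℂ) (spinor n k) * spinor n' k]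
  simp

/-- For one spinor this is the trace of the product of the two projectors `(1 + n · σ)/2` and `(1 +
n' · σ)/2`; tensor powers raise it to the power `N`. -/
theorem norm_sq_inner_coherentVec (N : ℕ) (n n' : S2) :
    ‖inner ℂ (coherentVec N n) (coherentVec N n')‖ ^ 2 = overlap n n' ^ N := by
  rw [inner_coherentVec, norm_pow, ← pow_mul, mul_comm N 2, pow_mul]
  congr 1
  have h1 : ((‖∑ k, (starRingEnd ℂ) (spinor n k) * spinor n' k‖ ^ 2 : ℝ) : ℂ) =
      ∑ k, ∑ l, (spinor n' k * (starRingEnd ℂ) (spinor n' l)) *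
        (spinor n l * (starRingEnd ℂ) (spinor n k)) := by
    push_cast
    rw [← Complex.mul_conj', map_sum, Finset.sum_mul_sum]
    refine Finset.sum_congr rfl fun k _ => Finset.sum_congr rfl fun l _ => ?_
    rw [map_mul, Complex.conj_conj]
    ring
  have h2 : ((overlap n n' : ℝ) : ℂ) = ∑ k, ∑ l, (spinor n' k * (starRingEnd ℂ) (spinor n' l)) *
        (spinor n l * (starRingEnd ℂ) (spinor n k)) := by
    simp only [spinor_mul_conj, Fin.sum_univ_two, overlap, PiLp.inner_apply, Fin.sum_univ_three]
    simp [pauliDot]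
    linear_combination (((n : E3) 1 : ℂ) * ((n' : E3) 1 : ℂ) / 2) * Complex.I_sq
  exact_mod_cast h1.trans h2.symm

theorem overlap_self (n : S2) : overlap n n = 1 := by
  rw [overlap, real_inner_self_eq_norm_sq, norm_S2]
  norm_num

theorem norm_coherentVec (N : ℕ) (n : S2) : ‖coherentVec N n‖ = 1 := by
  have h := norm_sq_inner_coherentVec N n n
  rw [overlap_self, one_pow, inner_self_eq_norm_sq_to_K, norm_pow, RCLike.norm_ofReal,
    abs_norm, ← pow_mul] at h
  exact (pow_eq_one_iff_of_nonneg (norm_nonneg _) (by norm_num)).1 h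

theorem stronglyMeasurable_coherentVec (N : ℕ) : StronglyMeasurable (coherentVec N) := by
  have h1 : Measurable fun n : S2 => (WithLp.toLp 2 fun s : Fin N → Fin 2 => ∏ i, spinor n (s i) :
      EuclideanSpace ℂ (Fin N → Fin 2)) := by
    refine (PiLp.continuous_toLp 2 _).measurable.comp (measurable_pi_lambda _ fun s => ?_)
    exact Finset.measurable_fun_prod _ fun i _ => measurable_spinor (s i)
  let f : S2 → spinSpace N := coherentVec N
  have h2 : StronglyMeasurable f :=
    (Embedding.comp_stronglyMeasurable_iff (f := f) Topology.IsEmbedding.subtypeVal).1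
      h1.stronglyMeasurable
  exact h2

end Spinors

/-! ### Upper bound for the dimension of the symmetric tensors. -/

section Dimension

theorem exists_perm_comp_eq {N : ℕ} (s t : Fin N → Fin 2)
    (h : Fintype.card {i // s i = 1} = Fintype.card {i // t i = 1}) :
    ∃ σ : Equiv.Perm (Fin N), t ∘ σ = s := by
  let e := Fintype.equivOfCardEq h
  refine ⟨e.extendSubtype, funext fun i => ?_⟩
  by_cases hi : s i = 1
  · exact (e.extendSubtype_mem i hi).trans hi.symm
  · have := e.extendSubtype_not_mem i hi
    have h2 : ∀ k : Fin 2, ¬ k = 1 → k = 0 := by decide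
    exact (h2 _ this).trans (h2 _ hi).symm

/-- A symmetric tensor is determined by its coordinates on the `N + 1` strings consisting of `k`
ones followed by zeros, as any string is a permutation of one of these. The opposite inequality
comes later, from positivity of a trace. -/
theorem finrank_spinSpace_le (N : ℕ) : Module.finrank ℂ (SpinSpace N) ≤ N + 1 := by
  let L : SpinSpace N →ₗ[ℂ] (Fin (N + 1) → ℂ) :=
    { toFun := fun v k => v.1 fun i => if (i : ℕ) < k then 1 else 0
      map_add' := fun v w => rfl
      map_smul' := fun c v => rfl }
  have hL : Function.Injective L := by
    rw [injective_iff_map_eq_zero]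
    intro v hv
    apply Subtype.ext
    ext s
    have hk : Fintype.card {i // s i = 1} < N + 1 := by
      refine Nat.lt_succ_of_le ?_
      simpa using Fintype.card_subtype_le fun i => s i = 1
    obtain ⟨σ, hσ⟩ := exists_perm_comp_eq s
      (fun i => if (i : ℕ) < Fintype.card {i // s i = 1} then 1 else 0) (by
        have h2 : ∀ i : Fin N, (if (i : ℕ) < Fintype.card {i // s i = 1} then (1 : Fin 2) else 0) = 1 ↔
            (i : ℕ) < Fintype.card {i // s i = 1} := fun i => by split_ifs with h <;> simp [h]
        rw [Fintype.card_congr (Equiv.subtypeEquivRight h2), Fintype.card_subtype (fun i : Fin N =>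
          (i : ℕ) < Fintype.card {i // s i = 1}), Fin.card_filter_val_lt]
        omega)
    rw [← hσ, v.2 σ]
    exact congrFun hv ⟨_, hk⟩
  simpa using LinearMap.finrank_le_finrank_of_injective hL

end Dimension

/-! ### Trace identities for the frame operator. -/

section FrameOperator

variable {Ω D : Type*} [MeasurableSpace Ω] [NormedAddCommGroup D] [InnerProductSpace ℂ D]
  [FiniteDimensional ℂ D] [CompleteSpace D] {ρ : Measure Ω} [IsFiniteMeasure ρ] {χ : Ω → D}

/-- The frame operator `∫ |χ⟩⟨χ| dρ`, as a function. -/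
noncomputable def frameMap (ρ : Measure Ω) (χ : Ω → D) (v : D) : D :=
  ∫ n, inner ℂ (χ n) v • χ n ∂ρ

theorem inner_frameMap (hχ : StronglyMeasurable χ) (h1 : ∀ n, ‖χ n‖ = 1) (v w : D) :
    inner ℂ v (frameMap ρ χ w) = ∫ n, inner ℂ v (χ n) * inner ℂ (χ n) w ∂ρ := by
  rw [frameMap, ← integral_inner]
  · refine integral_congr_ae (ae_of_all _ fun n => ?_)
    simp only [inner_smul_right]
    ring
  · refine Integrable.of_bound ((hχ.inner stronglyMeasurable_const).smul hχ).aestronglyMeasurable ‖w‖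
      (ae_of_all _ fun n => ?_)
    rw [norm_smul, h1, mul_one]
    simpa [h1] using norm_inner_le_norm (𝕜 := ℂ) (χ n) w

theorem inner_frameMap_left (hχ : StronglyMeasurable χ) (h1 : ∀ n, ‖χ n‖ = 1) (v w : D) :
    inner ℂ (frameMap ρ χ v) w = inner ℂ v (frameMap ρ χ w) := by
  rw [← inner_conj_symm, inner_frameMap hχ h1, inner_frameMap hχ h1, ← integral_conj]
  refine integral_congr_ae (ae_of_all _ fun n => ?_)
  simp only [map_mul, inner_conj_symm]
  ring

theorem integrable_inner_mul_inner (hχ : StronglyMeasurable χ) (h1 : ∀ n, ‖χ n‖ = 1) {w : Ω → D}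
    {v : D} (hw : StronglyMeasurable w) {B : ℝ} (hB : ∀ n, ‖w n‖ ≤ B) :
    Integrable (fun n => inner ℂ (χ n) v * inner ℂ v (w n)) ρ := by
  refine Integrable.of_bound ((hχ.inner stronglyMeasurable_const).mul
    (stronglyMeasurable_const.inner hw)).aestronglyMeasurable (‖v‖ * (‖v‖ * B)) (ae_of_all _ fun n => ?_)
  rw [norm_mul]
  have h2 := norm_inner_le_norm (𝕜 := ℂ) (χ n) v
  rw [h1, one_mul] at h2
  have h3 := norm_inner_le_norm (𝕜 := ℂ) v (w n)
  have h4 := hB n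
  gcongr
  exact h3.trans (by gcongr)

/-- Trace identities for the frame operator. -/
theorem sum_norm_frameMap_sub (hχ : StronglyMeasurable χ) (h1 : ∀ n, ‖χ n‖ = 1) {k : ℝ}
    (hk : ∀ n, ∫ n', ‖inner ℂ (χ n) (χ n')‖ ^ 2 ∂ρ = k) {ι : Type*} [Fintype ι]
    (b : OrthonormalBasis ι ℂ D) :
    ∑ i, ‖frameMap ρ χ (b i) - b i‖ ^ 2 =
      ρ.real Set.univ * k - 2 * ρ.real Set.univ + Fintype.card ι := by
  have hχQ : ∀ n, inner ℂ (χ n) (frameMap ρ χ (χ n)) = (k : ℂ) := fun n => by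
    rw [inner_frameMap hχ h1, ← hk n, ← integral_complex_ofReal]
    refine integral_congr_ae (ae_of_all _ fun n' => ?_)
    simp only
    rw [← inner_conj_symm (χ n') (χ n), Complex.mul_conj']
    push_cast
    rfl
  have hQm : StronglyMeasurable fun n => frameMap ρ χ (χ n) := by
    have : StronglyMeasurable (Function.uncurry fun n n' : Ω => inner ℂ (χ n') (χ n) • χ n') :=
      ((hχ.comp_measurable measurable_snd).inner (hχ.comp_measurable measurable_fst)).smul
        (hχ.comp_measurable measurable_snd)
    exact this.integral_prod_right
  have hQB : ∀ n, ‖frameMap ρ χ (χ n)‖ ≤ 1 * ρ.real Set.univ := fun n => by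
    refine norm_integral_le_of_norm_le_const (ae_of_all _ fun n' => ?_)
    rw [norm_smul, h1, mul_one]
    simpa [h1] using norm_inner_le_norm (𝕜 := ℂ) (χ n') (χ n)
  -- With `Q` the frame operator: `tr Q` is the total mass, and in the next claim `tr Q²` is the
  -- integral of `⟨χ n, Q χ n⟩`, which by `hk` is constantly `k`.
  have e1 : ∑ i, inner ℂ (b i) (frameMap ρ χ (b i)) = (ρ.real Set.univ : ℂ) := by
    simp only [inner_frameMap hχ h1]
    rw [← integral_finsetSum]
    · have : ∀ n, ∑ i, inner ℂ (b i) (χ n) * inner ℂ (χ n) (b i) = 1 := fun n => by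
        simp_rw [mul_comm]
        rw [b.sum_inner_mul_inner, inner_self_eq_norm_sq_to_K, h1]
        simp
      simp [this]
    · intro i _
      simp_rw [mul_comm]
      exact integrable_inner_mul_inner hχ h1 hχ fun n => (h1 n).le
  have e2 : ∑ i, inner ℂ (frameMap ρ χ (b i)) (frameMap ρ χ (b i)) = (ρ.real Set.univ * k : ℂ) := by
    have : ∀ i, inner ℂ (frameMap ρ χ (b i)) (frameMap ρ χ (b i)) =
        ∫ n, inner ℂ (χ n) (b i) * inner ℂ (b i) (frameMap ρ χ (χ n)) ∂ρ := fun i => by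
      rw [inner_frameMap hχ h1]
      refine integral_congr_ae (ae_of_all _ fun n => ?_)
      simp only
      rw [inner_frameMap_left hχ h1]
      ring
    simp only [this]
    rw [← integral_finsetSum]
    · simp [b.sum_inner_mul_inner, hχQ]
    · exact fun i _ => integrable_inner_mul_inner hχ h1 hQm hQB
  have e3 : ∀ i, ‖frameMap ρ χ (b i) - b i‖ ^ 2 =
      (inner ℂ (frameMap ρ χ (b i)) (frameMap ρ χ (b i))).re -
        2 * (inner ℂ (b i) (frameMap ρ χ (b i))).re + 1 := fun i => by
    have h2 := norm_sub_sq (𝕜 := ℂ) (b i) (frameMap ρ χ (b i))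
    rw [norm_sub_rev, h2, b.norm_eq_one, inner_self_eq_norm_sq_to_K]
    norm_cast
    simp only [RCLike.re_to_complex, Complex.coe_algebraMap]
    norm_cast
    ring
  simp_rw [e3]
  rw [Finset.sum_add_distrib, Finset.sum_sub_distrib, ← Finset.mul_sum, ← Complex.re_sum,
    ← Complex.re_sum, e1, e2]
  norm_cast
  simp

end FrameOperator

/-! ### Coherent states resolve the identity. -/

section Resolution

theorem sphereArea_real_univ : sphereArea.real Set.univ = 4 * Real.pi := by
  have h := integral_overlap_pow southPole 0
  simpa using h

/-- The normalised measure on the sphere making the coherent states a resolution of identity. -/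
noncomputable def spinMeasure (N : ℕ) : Measure S2 :=
  ENNReal.ofReal (Module.finrank ℂ (SpinSpace N) / (4 * Real.pi)) • sphereArea

instance (N : ℕ) : IsFiniteMeasure (spinMeasure N) :=
  sphereArea.smul_finite ENNReal.ofReal_ne_top

theorem integral_spinMeasure {G : Type*} [NormedAddCommGroup G] [NormedSpace ℝ G] (N : ℕ)
    (f : S2 → G) : ∫ n, f n ∂spinMeasure N =
      (Module.finrank ℂ (SpinSpace N) / (4 * Real.pi)) • ∫ n, f n ∂sphereArea := by
  rw [spinMeasure, integral_smul_measure, ENNReal.toReal_ofReal (by positivity)]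

theorem spinMeasure_real_univ (N : ℕ) :
    (spinMeasure N).real Set.univ = Module.finrank ℂ (SpinSpace N) := by
  have h := integral_spinMeasure N fun _ => (1 : ℝ)
  simp only [integral_const, smul_eq_mul, mul_one, sphereArea_real_univ] at h
  rw [h]
  field_simp

theorem integral_overlap_pow_spinMeasure (N k : ℕ) (u : S2) :
    ∫ n, overlap u n ^ k ∂spinMeasure N = Module.finrank ℂ (SpinSpace N) / (k + 1) := by
  rw [integral_spinMeasure, integral_overlap_pow, smul_eq_mul]
  field_simp

/-- Write `d` for the dimension and `Q` for the frame operator of the measure of total mass `d`. The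
trace identity gives `‖Q - 1‖² = d²/(N + 1) - d` in Hilbert-Schmidt norm. Nonnegativity means `d ≥ N
+ 1`, the converse bound is known, and then `‖Q - 1‖ = 0`. Irreducibility and Schur's lemma are not
needed. -/
theorem finrank_spinSpace_and_frameMap (N : ℕ) : Module.finrank ℂ (SpinSpace N) = N + 1 ∧
    ∀ v, frameMap (spinMeasure N) (coherentVec N) v = v := by
  let b := stdOrthonormalBasis ℂ (SpinSpace N)
  have key := sum_norm_frameMap_sub (ρ := spinMeasure N) (stronglyMeasurable_coherentVec N)
    (norm_coherentVec N) (k := Module.finrank ℂ (SpinSpace N) / (N + 1)) (fun n => by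
      simp_rw [norm_sq_inner_coherentVec]
      exact integral_overlap_pow_spinMeasure N N n) b
  rw [spinMeasure_real_univ, Fintype.card_fin] at key
  have hd : 0 < Module.finrank ℂ (SpinSpace N) := by
    have : Nontrivial (SpinSpace N) := ⟨coherentVec N southPole, 0, fun h => by
      simpa [h] using norm_coherentVec N southPole⟩
    exact Module.finrank_pos
  have hle := finrank_spinSpace_le N
  have h0 : 0 ≤ ∑ i, ‖frameMap (spinMeasure N) (coherentVec N) (b i) - b i‖ ^ 2 :=
    Finset.sum_nonneg fun i _ => by positivity
  have hdR : (0 : ℝ) < Module.finrank ℂ (SpinSpace N) := by exact_mod_cast hd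
  have hN : (0 : ℝ) < (N : ℝ) + 1 := by positivity
  have hdim : Module.finrank ℂ (SpinSpace N) = N + 1 := by
    refine le_antisymm hle ?_
    rw [key] at h0
    have h2 : (Module.finrank ℂ (SpinSpace N) : ℝ) ≤
        Module.finrank ℂ (SpinSpace N) * (Module.finrank ℂ (SpinSpace N) / (N + 1)) := by linarith
    rw [le_mul_iff_one_le_right hdR, one_le_div hN] at h2
    exact_mod_cast h2
  refine ⟨hdim, ?_⟩
  have hz : ∑ i, ‖frameMap (spinMeasure N) (coherentVec N) (b i) - b i‖ ^ 2 = 0 := by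
    rw [key, hdim]
    push_cast
    field_simp
    ring
  have hb : ∀ i, frameMap (spinMeasure N) (coherentVec N) (b i) = b i := fun i => by
    have := (Finset.sum_eq_zero_iff_of_nonneg fun i _ => by positivity).1 hz i (Finset.mem_univ _)
    exact sub_eq_zero.1 (norm_eq_zero.1 (pow_eq_zero_iff two_ne_zero |>.1 this))
  intro v
  refine InnerProductSpace.ext_inner_left_basis b.toBasis fun i => ?_
  rw [b.coe_toBasis, ← inner_frameMap_left (stronglyMeasurable_coherentVec N) (norm_coherentVec N),
    hb]

theorem isCoherent_coherentVec (N : ℕ) : IsCoherent (spinMeasure N) (coherentVec N) where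
  meas := stronglyMeasurable_coherentVec N
  norm_eq := norm_coherentVec N
  lintegral_eq v := by
    have hm := stronglyMeasurable_coherentVec N
    have h : ∫ n, ‖inner ℂ (coherentVec N n) v‖ ^ 2 ∂spinMeasure N = ‖v‖ ^ 2 := by
      have h1 := inner_frameMap (ρ := spinMeasure N) hm (norm_coherentVec N) v v
      rw [(finrank_spinSpace_and_frameMap N).2, inner_self_eq_norm_sq_to_K] at h1
      have h2 : ∀ n, inner ℂ v (coherentVec N n) * inner ℂ (coherentVec N n) v =
          ((‖inner ℂ (coherentVec N n) v‖ ^ 2 : ℝ) : ℂ) := fun n => by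
        rw [← inner_conj_symm v, Complex.conj_mul']
        push_cast
        rfl
      simp_rw [h2] at h1
      rw [integral_complex_ofReal] at h1
      refine Complex.ofReal_injective (h1.symm.trans ?_)
      push_cast
      rfl
    have h3 : ∀ n, ‖inner ℂ (coherentVec N n) v‖ₑ ^ 2 =
        ENNReal.ofReal (‖inner ℂ (coherentVec N n) v‖ ^ 2) := fun n => by
      rw [ENNReal.ofReal_pow (norm_nonneg _), ofReal_norm]
    simp_rw [h3]
    rw [← ofReal_integral_eq_lintegral_ofReal, h, ENNReal.ofReal_pow (norm_nonneg _), ofReal_norm]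
    · refine Integrable.of_bound ((hm.inner stronglyMeasurable_const).norm.pow 2).aestronglyMeasurable
        (‖v‖ ^ 2) (ae_of_all _ fun n => ?_)
      have := norm_inner_le_norm (𝕜 := ℂ) (coherentVec N n) v
      rw [norm_coherentVec, one_mul] at this
      rw [norm_pow, norm_norm]
      gcongr
    · exact ae_of_all _ fun n => by positivity

end Resolution

/-! ### Homogeneous lifts of symbols, their slices and their derivatives. -/

section SpinLift

theorem isOpen_ne_zero_snd_snd : IsOpen {z : ℝ × ℝ × E3 | z.2.2 ≠ 0} :=
  isOpen_ne_fun (by fun_prop) continuous_const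

theorem coe_S2_ne_zero (n : S2) : (n : E3) ≠ 0 := norm_ne_zero_iff.1 (by rw [norm_S2]; simp)

theorem radialProj_coe (n : S2) : radialProj n = n := by
  rw [radialProj, dif_neg (coe_S2_ne_zero n)]
  apply Subtype.ext
  simp

theorem radialProj_smul {c : ℝ} (hc : 0 < c) (v : E3) : radialProj (c • v) = radialProj v := by
  by_cases hv : v = 0
  · simp [hv]
  · rw [radialProj, radialProj, dif_neg hv, dif_neg (smul_ne_zero hc.ne' hv)]
    apply Subtype.ext
    simp only [norm_smul, Real.norm_of_nonneg hc.le, smul_smul]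
    congr 1
    field_simp

/-- The slice of a function on `ℝ × ℝ × ℝ³` at a point of `ℝ³`. -/
def sliceAt (g : ℝ × ℝ × E3 → ℝ) (v : E3) (z : ℝ × ℝ) : ℝ := g (z.1, z.2, v)

theorem sliceAt_spinLift (f : SpinPhase → ℝ) (n : S2) :
    sliceAt (spinLift f) n = cylinderLift fun z => f (z.1, z.2, n) := by
  funext z
  simp only [sliceAt, spinLift, cylinderLift, radialProj_coe]

theorem fderiv_sliceAt {g : ℝ × ℝ × E3 → ℝ} {v : E3} {z : ℝ × ℝ}
    (hg : DifferentiableAt ℝ g (z.1, z.2, v)) (w : ℝ × ℝ) :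
    fderiv ℝ (sliceAt g v) z w = fderiv ℝ g (z.1, z.2, v) (w.1, w.2, 0) := by
  have h1 : HasFDerivAt (fun z : ℝ × ℝ => (z.1, z.2, v))
      ((ContinuousLinearMap.fst ℝ ℝ ℝ).prod ((ContinuousLinearMap.snd ℝ ℝ ℝ).prod 0)) z :=
    hasFDerivAt_fst.prodMk (hasFDerivAt_snd.prodMk (hasFDerivAt_const v z))
  have h2 := (hg.hasFDerivAt.comp z h1).fderiv
  exact congrArg (fun T : ℝ × ℝ →L[ℝ] ℝ => T w) h2

variable {g : ℝ × ℝ × E3 → ℝ}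

theorem contDiff_sliceAt (hg : ContDiffOn ℝ ∞ g {z | z.2.2 ≠ 0}) {v : E3} (hv : v ≠ 0) :
    ContDiff ℝ ∞ (sliceAt g v) := by
  rw [← contDiffOn_univ]
  exact hg.comp (by fun_prop : ContDiff ℝ ∞ fun z : ℝ × ℝ => (z.1, z.2, v)).contDiffOn fun z _ => hv

theorem dX_sliceAt (hg : ContDiffOn ℝ ∞ g {z | z.2.2 ≠ 0}) {v : E3} (hv : v ≠ 0) :
    dX (sliceAt g v) = sliceAt (iterDir g 1 ![(1, 0, 0)]) v :=
  funext fun _ => fderiv_sliceAt (((hg.contDiffAt (isOpen_ne_zero_snd_snd.mem_nhds hv))).differentiableAt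
    (by simp)) (1, 0)

theorem dXi_sliceAt (hg : ContDiffOn ℝ ∞ g {z | z.2.2 ≠ 0}) {v : E3} (hv : v ≠ 0) :
    dXi (sliceAt g v) = sliceAt (iterDir g 1 ![(0, 1, 0)]) v :=
  funext fun _ => fderiv_sliceAt (((hg.contDiffAt (isOpen_ne_zero_snd_snd.mem_nhds hv))).differentiableAt
    (by simp)) (0, 1)

theorem dX_dX_sliceAt (hg : ContDiffOn ℝ ∞ g {z | z.2.2 ≠ 0}) {v : E3} (hv : v ≠ 0) :
    dX (dX (sliceAt g v)) = sliceAt (iterDir g 2 ![(1, 0, 0), (1, 0, 0)]) v := by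
  rw [dX_sliceAt hg hv, dX_sliceAt (contDiffOn_iterDir isOpen_ne_zero_snd_snd hg _ _) hv]
  rfl

theorem dXi_dXi_sliceAt (hg : ContDiffOn ℝ ∞ g {z | z.2.2 ≠ 0}) {v : E3} (hv : v ≠ 0) :
    dXi (dXi (sliceAt g v)) = sliceAt (iterDir g 2 ![(0, 1, 0), (0, 1, 0)]) v := by
  rw [dXi_sliceAt hg hv, dXi_sliceAt (contDiffOn_iterDir isOpen_ne_zero_snd_snd hg _ _) hv]
  rfl

theorem dX_dX_dXi_dXi_sliceAt (hg : ContDiffOn ℝ ∞ g {z | z.2.2 ≠ 0}) {v : E3} (hv : v ≠ 0) :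
    dX (dX (dXi (dXi (sliceAt g v)))) =
      sliceAt (iterDir g 4 ![(1, 0, 0), (1, 0, 0), (0, 1, 0), (0, 1, 0)]) v := by
  rw [dXi_dXi_sliceAt hg hv, dX_dX_sliceAt (contDiffOn_iterDir isOpen_ne_zero_snd_snd hg _ _) hv]
  rfl

theorem IsSpinSymbol.exists_bounds {μ : ℝ} {a : ℝ → SpinPhase → ℝ} (ha : ∀ m : ℝ, IsSpinSymbol μ m a) :
    ∃ C, 0 ≤ C ∧ ∀ ħ, 0 < ħ → ħ ≤ 1 → ∀ (x ξ : ℝ) (n : S2), |spinLift (a ħ) (x, ξ, n)| ≤ C ∧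
      |iterDir (spinLift (a ħ)) 2 ![(1, 0, 0), (1, 0, 0)] (x, ξ, n)| ≤ C * (ħ ^ (-μ)) ^ 2 ∧
      |iterDir (spinLift (a ħ)) 2 ![(0, 1, 0), (0, 1, 0)] (x, ξ, n)| ≤ C * (ħ ^ (-μ)) ^ 2 ∧
      |iterDir (spinLift (a ħ)) 4 ![(1, 0, 0), (1, 0, 0), (0, 1, 0), (0, 1, 0)] (x, ξ, n)| ≤
        C * (ħ ^ (-μ)) ^ 4 ∧
      ∀ w : E3, |fderiv ℝ (spinLift (a ħ)) (x, ξ, n) (0, 0, w)| ≤ C * ħ ^ (-μ) * ‖w‖ := by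
  obtain ⟨C0, h0⟩ := (ha 0).2 0 0 0
  obtain ⟨C1, h1⟩ := (ha 0).2 2 0 0
  obtain ⟨C2, h2⟩ := (ha 2).2 0 2 0
  obtain ⟨C3, h3⟩ := (ha 2).2 2 2 0
  obtain ⟨C4, h4⟩ := (ha 0).2 0 0 1
  refine ⟨|C0| + |C1| + |C2| + |C3| + |C4|, by positivity, fun ħ hħ hħ1 x ξ n => ?_⟩
  have hs := (ha 0).1 ħ hħ
  have hz : (x, ξ, (n : E3)) ∈ {z : ℝ × ℝ × E3 | z.2.2 ≠ 0} := coe_S2_ne_zero n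
  have hp2 : ħ ^ (-(μ * 2)) = (ħ ^ (-μ)) ^ 2 := by
    rw [← neg_mul, Real.rpow_mul hħ.le, Real.rpow_two]
  have hp4 : ħ ^ (-μ * 4) = (ħ ^ (-μ)) ^ 4 := by
    rw [Real.rpow_mul hħ.le]; exact_mod_cast Real.rpow_natCast _ 4
  have ht : 0 < ħ ^ (-μ) := Real.rpow_pos_of_pos hħ _
  have hC : ∀ {c T : ℝ}, 0 ≤ T → |c| ≤ |C0| + |C1| + |C2| + |C3| + |C4| →
      c * T ≤ (|C0| + |C1| + |C2| + |C3| + |C4|) * T := fun hT hc =>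
    mul_le_mul_of_nonneg_right ((le_abs_self _).trans hc) hT
  have a0 := abs_nonneg C0
  have a1 := abs_nonneg C1
  have a2 := abs_nonneg C2
  have a3 := abs_nonneg C3
  have a4 := abs_nonneg C4
  have hiter := iteratedFDeriv_eq_iterDir isOpen_ne_zero_snd_snd hs
  refine ⟨?_, ?_, ?_, ?_, fun w => ?_⟩
  · have h := h0 ħ hħ hħ1 x ξ n ![]
    simp at h
    linarith [le_abs_self C0]
  · have h := h1 ħ hħ hħ1 x ξ n ![]
    rw [hiter _ hz] at h
    refine (h.trans (le_of_eq ?_)).trans (hC (c := C1) (by positivity) (by linarith))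
    simp [hp2]
  · have h := h2 ħ hħ hħ1 x ξ n ![]
    rw [hiter _ hz] at h
    refine (h.trans (le_of_eq ?_)).trans (hC (c := C2) (by positivity) (by linarith))
    simp [hp2]
  · have h := h3 ħ hħ hħ1 x ξ n ![]
    rw [hiter _ hz] at h
    refine (h.trans (le_of_eq ?_)).trans (hC (c := C3) (by positivity) (by linarith))
    have : (-μ * ((2 : ℕ) + (2 : ℕ) + (0 : ℕ) : ℝ)) = -μ * 4 := by push_cast; ring
    rw [this, hp4]
    simp
  · have h := h4 ħ hħ hħ1 x ξ n ![w]
    rw [hiter _ hz] at h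
    rw [mul_assoc]
    refine (h.trans (le_of_eq ?_)).trans (hC (c := C4) (by positivity) (by linarith))
    simp
    ring

end SpinLift

/-! ### Lipschitz bound along the sphere. -/

section Lipschitz

/-- At distance at least `1/2` the sup bound suffices, because `C ≤ T`. Closer points are joined by
a segment in the ball of radius `1/2` about `n`, where `‖v‖ ≥ 1/2`; homogeneity of degree zero makes
the gradient at `v` at most `T / ‖v‖ ≤ 2 T`. -/
theorem abs_sub_le_norm_sub {f : SpinPhase → ℝ} (hs : ContDiffOn ℝ ∞ (spinLift f) {z | z.2.2 ≠ 0})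
    {C T x ξ : ℝ} (hCT : C ≤ T) (hT : 0 ≤ T) (hb : ∀ n : S2, |spinLift f (x, ξ, n)| ≤ C)
    (hd : ∀ (n : S2) (w : E3), |fderiv ℝ (spinLift f) (x, ξ, n) (0, 0, w)| ≤ T * ‖w‖) (n n' : S2) :
    |spinLift f (x, ξ, n') - spinLift f (x, ξ, n)| ≤ 4 * T * ‖(n' : E3) - n‖ := by
  rcases le_or_gt (1 / 2) ‖(n' : E3) - n‖ with h | h
  · have h1 := abs_sub (spinLift f (x, ξ, n')) (spinLift f (x, ξ, n))
    have h2 := hb n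
    have h3 := hb n'
    nlinarith
  let G : E3 → ℝ := fun v => spinLift f (x, ξ, v)
  have hGs : ∀ {c : ℝ}, 0 < c → ∀ v, G (c • v) = G v := fun hc v => by
    simp only [G, spinLift, radialProj_smul hc]
  have hGd : ∀ n : S2, HasFDerivAt G ((fderiv ℝ (spinLift f) (x, ξ, n)).comp
      ((0 : E3 →L[ℝ] ℝ).prod ((0 : E3 →L[ℝ] ℝ).prod (ContinuousLinearMap.id ℝ E3)))) (n : E3) := fun n => by
    have h1 : HasFDerivAt (fun v : E3 => (x, ξ, v))
        ((0 : E3 →L[ℝ] ℝ).prod ((0 : E3 →L[ℝ] ℝ).prod (ContinuousLinearMap.id ℝ E3))) (n : E3) :=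
      (hasFDerivAt_const x _).prodMk ((hasFDerivAt_const ξ _).prodMk (hasFDerivAt_id _))
    have h2 : DifferentiableAt ℝ (spinLift f) (x, ξ, (n : E3)) :=
      (hs.contDiffAt (isOpen_ne_zero_snd_snd.mem_nhds (coe_S2_ne_zero n))).differentiableAt (by simp)
    exact h2.hasFDerivAt.comp (n : E3) h1
  have hball : ∀ v ∈ Metric.ball (n : E3) (1 / 2), 1 / 2 ≤ ‖v‖ := fun v hv => by
    rw [mem_ball_iff_norm'] at hv
    have := norm_sub_norm_le (n : E3) v
    rw [norm_S2] at this
    linarith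
  have hder : ∀ v ∈ Metric.ball (n : E3) (1 / 2), ∃ A : E3 →L[ℝ] ℝ, HasFDerivAt G A v ∧ ‖A‖ ≤ 2 * T := by
    intro v hv
    have hv1 := hball v hv
    have hv0 : 0 < ‖v‖ := by linarith
    have hvne : v ≠ 0 := norm_pos_iff.1 hv0
    have hn : ((radialProj v : S2) : E3) = ‖v‖⁻¹ • v := by rw [radialProj, dif_neg hvne]
    have h1 := hGd (radialProj v)
    have h2 : HasFDerivAt (fun w : E3 => ‖v‖⁻¹ • w) (‖v‖⁻¹ • ContinuousLinearMap.id ℝ E3) v :=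
      (hasFDerivAt_id v).const_smul ‖v‖⁻¹
    have h3 := HasFDerivAt.comp v (g := G) (f := fun w : E3 => ‖v‖⁻¹ • w) (by rw [← hn]; exact h1) h2
    have h4 : (G ∘ fun w : E3 => ‖v‖⁻¹ • w) = G := funext fun w => hGs (inv_pos.2 hv0) w
    rw [h4] at h3
    refine ⟨_, h3, ContinuousLinearMap.opNorm_le_bound _ (by positivity) fun w => ?_⟩
    have h5 := hd (radialProj v) (‖v‖⁻¹ • w)
    rw [norm_smul, norm_inv, norm_norm] at h5
    refine (le_of_eq ?_).trans (h5.trans ?_)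
    · rfl
    · have h6 : ‖v‖⁻¹ ≤ 2 := by
        rw [inv_le_comm₀ hv0 two_pos]
        linarith
      have := mul_le_mul_of_nonneg_right h6 (norm_nonneg w)
      nlinarith
  have h0 : (0 : ℝ) < 1 / 2 := by norm_num
  have key := (convex_ball (n : E3) (1 / 2)).norm_image_sub_le_of_norm_fderiv_le (𝕜 := ℝ) (f := G)
    (C := 2 * T) (fun v hv => (hder v hv).choose_spec.1.differentiableAt) (fun v hv => by
      rw [(hder v hv).choose_spec.1.fderiv]
      exact (hder v hv).choose_spec.2) (Metric.mem_ball_self h0)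
      (mem_ball_iff_norm.2 h)
  refine key.trans ?_
  have := mul_nonneg hT (norm_nonneg ((n' : E3) - n))
  linarith

end Lipschitz

/-! ### Concentration of the spin kernel near the diagonal. -/

section Kernel

/-- Since `‖n' - n‖² = 4 (1 - overlap)`, the integral is four times the difference of two
consecutive moments of the overlap, that is `4 (1 - (N + 1)/(N + 2))`. -/
theorem lintegral_spin_kernel (N : ℕ) (n' : S2) :
    ∫⁻ n, ‖inner ℂ (coherentVec N n') (coherentVec N n)‖ₑ ^ 2 *
      ENNReal.ofReal (‖(n' : E3) - n‖ ^ 2) ∂spinMeasure N = ENNReal.ofReal (4 / (N + 2)) := by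
  have h : ∀ n, ‖inner ℂ (coherentVec N n') (coherentVec N n)‖ₑ ^ 2 *
      ENNReal.ofReal (‖(n' : E3) - n‖ ^ 2) =
      ENNReal.ofReal (4 * (overlap n' n ^ N - overlap n' n ^ (N + 1))) := fun n => by
    rw [← ofReal_norm, ← ENNReal.ofReal_pow (norm_nonneg _), norm_sq_inner_coherentVec,
      ← ENNReal.ofReal_mul (pow_nonneg (overlap_nonneg _ _) _), norm_sub_sq_eq_overlap]
    congr 1
    ring
  have hi : ∀ k, Integrable (fun n => overlap n' n ^ k) (spinMeasure N) := fun k =>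
    ((continuous_overlap n').pow k).integrable_of_hasCompactSupport (HasCompactSupport.of_compactSpace _)
  have hle : ∀ n, overlap n' n ≤ 1 := fun n => by
    have := norm_sub_sq_eq_overlap n' n
    nlinarith [sq_nonneg ‖(n' : E3) - n‖]
  have hi2 : Integrable (fun n => 4 * (overlap n' n ^ N - overlap n' n ^ (N + 1))) (spinMeasure N) :=
    ((hi N).sub (hi (N + 1))).const_mul 4
  simp_rw [h]
  rw [← ofReal_integral_eq_lintegral_ofReal hi2 (ae_of_all _ fun n => ?_), integral_const_mul, integral_sub (hi N) (hi (N + 1)),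
    integral_overlap_pow_spinMeasure, integral_overlap_pow_spinMeasure,
    (finrank_spinSpace_and_frameMap N).1]
  · congr 1
    push_cast
    field_simp
    ring
  · have := pow_le_pow_of_le_one (overlap_nonneg n' n) (hle n) (Nat.le_add_right N 1)
    simp only [Pi.zero_apply]
    linarith

/-- The integrand vanishes unless the point at `n` or the point at `n'` lies in `S`, and the kernel
has mass `k` in either variable; the two cases give the factor `2`. -/
theorem lintegral_le_of_le_kernel {Ω : Type*} [TopologicalSpace Ω] [MeasurableSpace Ω] [BorelSpace Ω]
    [SecondCountableTopology Ω] {ρ : Measure Ω} [IsFiniteMeasure ρ]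
    {K : Ω → Ω → ENNReal} (hKm : Measurable fun w : Ω × Ω => K w.1 w.2) {k : ENNReal}
    (hK : ∀ n', ∫⁻ n, K n' n ∂ρ = k) (hK' : ∀ n, ∫⁻ n', K n' n ∂ρ = k)
    {S : Set (UnitAddCircle × ℝ × Ω)} (hS : MeasurableSet S) {H : UnitAddCircle × ℝ × Ω → Ω → ENNReal}
    (h1 : ∀ z n', H z n' ≤ K n' z.2.2) (h2 : ∀ z n', z ∉ S → (z.1, z.2.1, n') ∉ S → H z n' = 0) :
    ∫⁻ z, ∫⁻ n', H z n' ∂ρ ∂((volume : Measure UnitAddCircle).prod ((volume : Measure ℝ).prod ρ)) ≤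
      2 * k * ((volume : Measure UnitAddCircle).prod ((volume : Measure ℝ).prod ρ)) S := by
  have hGm : Measurable (S.indicator (1 : UnitAddCircle × ℝ × Ω → ENNReal)) :=
    measurable_one.indicator hS
  have hKm1 : ∀ n, Measurable fun n' => K n' n := fun n => hKm.comp measurable_prodMk_right
  have hpt : ∀ z n', H z n' ≤ K n' z.2.2 * S.indicator 1 z +
      K n' z.2.2 * S.indicator 1 (z.1, z.2.1, n') := by
    intro z n'
    by_cases hz : z ∈ S
    · refine (h1 z n').trans (le_trans (le_of_eq ?_) le_self_add)
      rw [Set.indicator_of_mem hz, Pi.one_apply, mul_one]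
    · by_cases hz' : (z.1, z.2.1, n') ∈ S
      · refine (h1 z n').trans (le_trans (le_of_eq ?_) le_add_self)
        rw [Set.indicator_of_mem hz', Pi.one_apply, mul_one]
      · rw [h2 z n' hz hz']
        exact zero_le
  calc
    _ ≤ ∫⁻ z : UnitAddCircle × ℝ × Ω, (k * S.indicator 1 z +
        ∫⁻ n', K n' z.2.2 * S.indicator 1 (z.1, z.2.1, n') ∂ρ)
        ∂((volume : Measure UnitAddCircle).prod ((volume : Measure ℝ).prod ρ)) := by
      refine lintegral_mono fun z => (lintegral_mono (hpt z)).trans_eq ?_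
      rw [lintegral_add_left ((hKm1 _).mul_const _), lintegral_mul_const _ (hKm1 _), hK']
    _ = _ := by
      rw [lintegral_add_left (hGm.const_mul _), lintegral_const_mul _ hGm,
        lintegral_kernel_swap hKm hK hGm, lintegral_indicator_one hS]
      ring

theorem lintegral_spin_kernel_mul_le (N : ℕ) {a : SpinPhase → ℝ} (ha : Measurable a) {Λ : ℝ}
    (hΛ : ∀ (x : UnitAddCircle) (ξ : ℝ) (n n' : S2),
      |a (x, ξ, n') - a (x, ξ, n)| ≤ Λ * ‖(n' : E3) - n‖) :
    ∫⁻ z, ∫⁻ n', ‖inner ℂ (coherentVec N n') (coherentVec N z.2.2)‖ₑ ^ 2 *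
        ‖a (z.1, z.2.1, n') - a z‖ₑ ^ 2 ∂spinMeasure N
        ∂((volume : Measure UnitAddCircle).prod ((volume : Measure ℝ).prod (spinMeasure N))) ≤
      ENNReal.ofReal (8 * Λ ^ 2 / (N + 2)) *
        ((volume : Measure UnitAddCircle).prod ((volume : Measure ℝ).prod (spinMeasure N)))
          {z | a z ≠ 0} := by
  have hχ := stronglyMeasurable_coherentVec N
  have hm1 : Measurable fun w : S2 × S2 => ‖inner ℂ (coherentVec N w.1) (coherentVec N w.2)‖ₑ ^ 2 :=
    (((hχ.comp_measurable measurable_fst).inner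
      (hχ.comp_measurable measurable_snd)).measurable.enorm).pow_const 2
  have hc2 : Continuous fun w : S2 × S2 => ‖(w.1 : E3) - w.2‖ ^ 2 := by fun_prop
  have hKm : Measurable fun w : S2 × S2 => ENNReal.ofReal (Λ ^ 2) *
      (‖inner ℂ (coherentVec N w.1) (coherentVec N w.2)‖ₑ ^ 2 *
        ENNReal.ofReal (‖(w.1 : E3) - w.2‖ ^ 2)) :=
    (hm1.mul hc2.measurable.ennreal_ofReal).const_mul _
  have hK : ∀ n', ∫⁻ n, ENNReal.ofReal (Λ ^ 2) *
      (‖inner ℂ (coherentVec N n') (coherentVec N n)‖ₑ ^ 2 *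
        ENNReal.ofReal (‖(n' : E3) - n‖ ^ 2)) ∂spinMeasure N =
      ENNReal.ofReal (Λ ^ 2) * ENNReal.ofReal (4 / (N + 2)) := fun n' => by
    rw [lintegral_const_mul', lintegral_spin_kernel N n']
    exact ENNReal.ofReal_ne_top
  have hsymm : ∀ n n' : S2, ENNReal.ofReal (Λ ^ 2) *
      (‖inner ℂ (coherentVec N n') (coherentVec N n)‖ₑ ^ 2 *
        ENNReal.ofReal (‖(n' : E3) - n‖ ^ 2)) = ENNReal.ofReal (Λ ^ 2) *
      (‖inner ℂ (coherentVec N n) (coherentVec N n')‖ₑ ^ 2 *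
        ENNReal.ofReal (‖(n : E3) - n'‖ ^ 2)) := fun n n' => by
    rw [norm_sub_rev, ← ofReal_norm, ← ofReal_norm, norm_inner_symm]
  have hA : MeasurableSet {z | a z ≠ 0} := (measurableSet_eq_fun ha measurable_const).compl
  have key := lintegral_le_of_le_kernel (ρ := spinMeasure N)
    (K := fun n' n => ENNReal.ofReal (Λ ^ 2) * (‖inner ℂ (coherentVec N n') (coherentVec N n)‖ₑ ^ 2 *
      ENNReal.ofReal (‖(n' : E3) - n‖ ^ 2))) hKm hK
    (fun n => (lintegral_congr fun n' => hsymm n n').trans (hK n)) hA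
    (H := fun z n' => ‖inner ℂ (coherentVec N n') (coherentVec N z.2.2)‖ₑ ^ 2 *
        ‖a (z.1, z.2.1, n') - a z‖ₑ ^ 2)
    (fun z n' => by
      rw [mul_left_comm]
      refine mul_le_mul_right ?_ _
      rw [← ENNReal.ofReal_mul (sq_nonneg Λ), ← ofReal_norm, ← ENNReal.ofReal_pow (norm_nonneg _),
        ← mul_pow, Real.norm_eq_abs]
      exact ENNReal.ofReal_le_ofReal
        (pow_le_pow_left₀ (abs_nonneg _) (hΛ z.1 z.2.1 z.2.2 n') 2))
    (fun z n' hz hz' => by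
      have h0 : a z = 0 := not_not.1 hz
      have h0' : a (z.1, z.2.1, n') = 0 := not_not.1 hz'
      rw [h0, h0', sub_zero, enorm_zero]
      simp)
  refine key.trans_eq ?_
  congr 1
  rw [← ENNReal.ofReal_mul (sq_nonneg Λ), ← ENNReal.ofReal_ofNat 2, ← ENNReal.ofReal_mul two_pos.le]
  congr 1
  ring

end Kernel

/-! ### Slices of a symbol over the sphere form a family with uniform bounds. -/

section Family

theorem exists_abs_le_of_isCyl {Ω : Type*} [TopologicalSpace Ω] [CompactSpace Ω] {R : ℝ}
    {F : Ω → ℝ × ℝ → ℝ} (hF : ∀ n, IsCyl R (F n))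
    (hc : Continuous fun p : Ω × (ℝ × ℝ) => F p.1 p.2) : ∃ B, ∀ n z, |F n z| ≤ B := by
  obtain ⟨B, hB⟩ := (isCompact_univ.prod (isCompact_Icc.prod isCompact_Icc) : IsCompact
    ((Set.univ : Set Ω) ×ˢ (Set.Icc (0 : ℝ) 1 ×ˢ Set.Icc (-R) R))).exists_bound_of_continuousOn
    hc.continuousOn
  refine ⟨max B 0, fun n z => ?_⟩
  by_cases h : R < |z.2|
  · rw [show F n z = 0 from (hF n).supp z.1 z.2 h]; simp
  · obtain ⟨y, hy, hy2⟩ := ((hF n).periodic_fst z.2).exists_mem_Ico₀ one_pos z.1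
    have : F n z = F n (y, z.2) := hy2
    rw [this]
    exact (hB (n, y, z.2) ⟨trivial, ⟨hy.1, hy.2.le⟩, abs_le.1 (not_lt.1 h)⟩).trans (le_max_left _ _)

theorem continuous_sliceAt {g : ℝ × ℝ × E3 → ℝ} (hg : ContDiffOn ℝ ∞ g {z | z.2.2 ≠ 0}) :
    Continuous fun p : S2 × (ℝ × ℝ) => sliceAt g p.1 p.2 :=
  hg.continuousOn.comp_continuous
    (by fun_prop : Continuous fun p : S2 × (ℝ × ℝ) => (p.2.1, p.2.2, (p.1 : E3)))
    fun p => coe_S2_ne_zero p.1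

theorem exists_isCyl_sliceAt {f : SpinPhase → ℝ} (hs : ContDiffOn ℝ ∞ (spinLift f) {z | z.2.2 ≠ 0})
    (hc : HasCompactSupport f) : ∃ R, ∀ n : S2, IsCyl R (sliceAt (spinLift f) n) := by
  obtain ⟨R, hR⟩ := (hc.isCompact.image (continuous_fst.comp continuous_snd)).isBounded.exists_norm_le
  refine ⟨R, fun n => ⟨contDiff_sliceAt hs (coe_S2_ne_zero n), fun x ξ => ?_, fun x ξ h => ?_⟩⟩
  · simp only [sliceAt, spinLift]
    congr 2
    simp
  · rw [sliceAt_spinLift]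
    by_contra h0
    have := hR ξ ⟨((x : UnitAddCircle), ξ, n), subset_tsupport _ h0, rfl⟩
    rw [Real.norm_eq_abs] at this
    linarith

theorem exists_isCylFamily_sliceAt {f : SpinPhase → ℝ}
    (hs : ContDiffOn ℝ ∞ (spinLift f) {z | z.2.2 ≠ 0}) (hc : HasCompactSupport f) :
    ∃ R B, IsCylFamily R B fun n : S2 => sliceAt (spinLift f) n := by
  obtain ⟨R, hR⟩ := exists_isCyl_sliceAt hs hc
  obtain ⟨B, hB⟩ := exists_abs_le_of_isCyl hR (continuous_sliceAt hs)
  obtain ⟨B', hB'⟩ := exists_abs_le_of_isCyl (fun n => (hR n).deriv_fst.deriv_fst) (by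
    simp_rw [dX_dX_sliceAt hs (coe_S2_ne_zero _)]
    exact continuous_sliceAt (contDiffOn_iterDir isOpen_ne_zero_snd_snd hs _ _))
  refine ⟨R, 2 * max B B', hR, continuous_sliceAt hs, fun n m ξ => ?_⟩
  rw [← div_eq_mul_inv, le_div_iff₀ (by positivity), mul_comm]
  exact (hR n).one_add_sq_mul_norm_cylCoef_le (fun z => (hB n z).trans (le_max_left _ _))
    (fun z => (hB' n z).trans (le_max_right _ _)) m ξ

theorem continuous_of_spinLift {f : SpinPhase → ℝ}
    (hs : ContDiffOn ℝ ∞ (spinLift f) {z | z.2.2 ≠ 0}) : Continuous f := by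
  refine continuous_of_continuous_coe_prod ?_
  have h := hs.continuousOn.comp_continuous
    (by fun_prop : Continuous fun p : ℝ × ℝ × S2 => (p.1, p.2.1, (p.2.2 : E3)))
    fun p => coe_S2_ne_zero p.2.2
  simpa only [Function.comp_def, spinLift, radialProj_coe] using h

end Family

/-! ### The Weyl law on `T*S¹ × S²`. -/

section SpinLaw

/-- The quantization on `T*S¹ × S²`. -/
noncomputable def spinOp (N : ℕ) (f : SpinPhase → ℝ) :
    Lp (SpinSpace N) 2 (volume : Measure UnitAddCircle) →L[ℂ]
      Lp (SpinSpace N) 2 (volume : Measure UnitAddCircle) :=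
  cylOp (spinMeasure N) (coherentVec N) (fun n : S2 => sliceAt (spinLift f) n) (N / 2 : ℝ)⁻¹

theorem isSpinQuantization_spinOp {N : ℕ} (hN : 0 < N) {f : SpinPhase → ℝ}
    (hs : ContDiffOn ℝ ∞ (spinLift f) {z | z.2.2 ≠ 0}) (hc : HasCompactSupport f) :
    IsSpinQuantization N f (spinOp N f) := by
  obtain ⟨R, B, hB⟩ := exists_isCylFamily_sliceAt hs hc
  have hħ : (0 : ℝ) < (N / 2 : ℝ)⁻¹ := by positivity
  intro φ hφ u hu
  filter_upwards [cylOp_apply_ae hB (isCoherent_coherentVec N) hħ hφ hu] with x hx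
  rw [spinOp, hx, integral_spinMeasure]
  simp_rw [coherentProj_eq, sliceAt_spinLift]

/-- The constant of the theorem is the product of `1/(2πħ) = j/(2π)` on the cylinder with `dim/(4π)`
on the sphere. -/
theorem cylPhaseMeasure_spinMeasure {N : ℕ} (hN : 0 < N) :
    cylPhaseMeasure (2 * Real.pi * (N / 2 : ℝ)⁻¹) (spinMeasure N) =
      ENNReal.ofReal (Module.finrank ℂ (SpinSpace N) * (N / 2 : ℝ) / (8 * Real.pi ^ 2)) •
        spinPhaseVolume := by
  have hN' : (0 : ℝ) < N := by exact_mod_cast hN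
  rw [cylPhaseMeasure, spinMeasure, Measure.prod_smul_right, Measure.prod_smul_right, smul_smul,
    ← ENNReal.ofReal_mul (by positivity)]
  congr 2
  field_simp
  ring

instance : IsFiniteMeasureOnCompacts spinPhaseVolume := by
  unfold spinPhaseVolume
  infer_instance

/-- The relative error in the Weyl law on `T*S¹ × S²`. -/
noncomputable def spinRate (μ C ħ : ℝ) : ℝ :=
  packetRate μ C ħ + 2 * (64 * C ^ 2 * ħ ^ (1 - 2 * μ))

theorem spinRate_nonneg (μ C : ℝ) {ħ : ℝ} (hħ : 0 < ħ) : 0 ≤ spinRate μ C ħ :=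
  add_nonneg (packetRate_nonneg μ C hħ) (by positivity)

theorem tendsto_spinRate {μ : ℝ} (hμ : μ < 1 / 2) (C : ℝ) :
    Tendsto (spinRate μ C) (𝓝[>] 0) (𝓝 0) := by
  have h : Tendsto (fun ħ : ℝ => ħ ^ (1 - 2 * μ)) (𝓝[>] 0) (𝓝 0) := by
    have := (Real.continuousAt_rpow_const (0 : ℝ) (1 - 2 * μ) (Or.inr (by linarith))).tendsto
    rw [Real.zero_rpow (by linarith)] at this
    exact this.mono_left nhdsWithin_le_nhds
  have h2 := (tendsto_packetRate hμ C).add ((h.const_mul (64 * C ^ 2)).const_mul 2)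
  rw [mul_zero, mul_zero, add_zero] at h2
  exact h2

theorem tendsto_inv_half_nhdsGT : Tendsto (fun N : ℕ => (N / 2 : ℝ)⁻¹) atTop (𝓝[>] 0) := by
  refine tendsto_inv_atTop_nhdsGT_zero.comp ?_
  exact tendsto_natCast_atTop_atTop.atTop_div_const two_pos

/-- The Weyl law on `T*S¹ × S²`. -/
theorem weylLaw_spin (μ : ℝ) (hμ0 : 0 ≤ μ) (hμ : μ < 1 / 2) (a : ℝ → SpinPhase → ℝ)
    (ha : ∀ m : ℝ, IsSpinSymbol μ m a) (hac : ∀ ħ : ℝ, 0 < ħ → HasCompactSupport (a ħ)) :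
    ∃ A : (N : ℕ) → (Lp (SpinSpace N) 2 (volume : Measure UnitAddCircle) →L[ℂ]
        Lp (SpinSpace N) 2 (volume : Measure UnitAddCircle)),
      (∀ N : ℕ, 0 < N → IsSpinQuantization N (a (N / 2 : ℝ)⁻¹) (A N) ∧
        IsSelfAdjoint (A N) ∧ IsTraceClass (A N)) ∧
      ∀ ε : ℝ, 0 < ε →
        (∀ N : ℕ, 0 < N → FinitelyManyOuter (A N) ε) ∧
        WeylBounds atTop spinPhaseVolume
          (fun N : ℕ => Module.finrank ℂ (SpinSpace N) * (N / 2 : ℝ) / (8 * Real.pi ^ 2))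
          (fun N : ℕ => a (N / 2 : ℝ)⁻¹) (fun N => outerCount (A N) ε) ε ∧
        (NoConcentration atTop spinPhaseVolume (fun N : ℕ => a (N / 2 : ℝ)⁻¹) ε →
          WeylLaw atTop spinPhaseVolume
            (fun N : ℕ => Module.finrank ℂ (SpinSpace N) * (N / 2 : ℝ) / (8 * Real.pi ^ 2))
            (fun N : ℕ => a (N / 2 : ℝ)⁻¹) (fun N => outerCount (A N) ε) ε) := by
  have hs : ∀ ħ, 0 < ħ → ContDiffOn ℝ ∞ (spinLift (a ħ)) {z | z.2.2 ≠ 0} := (ha 0).1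
  have hpos : ∀ N : ℕ, 0 < N → (0 : ℝ) < (N / 2 : ℝ)⁻¹ := fun N hN => by positivity
  have htr : ∀ N : ℕ, 0 < N → IsSelfAdjoint (spinOp N (a (N / 2 : ℝ)⁻¹)) ∧
      IsTraceClass (spinOp N (a (N / 2 : ℝ)⁻¹)) ∧
      ∀ ε : ℝ, 0 < ε → FinitelyManyOuter (spinOp N (a (N / 2 : ℝ)⁻¹)) ε := fun N hN => by
    obtain ⟨R, B, hB⟩ := exists_isCylFamily_sliceAt (hs _ (hpos N hN)) (hac _ (hpos N hN))
    exact cylOp_traceClass hB (isCoherent_coherentVec N) (hpos N hN)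
  obtain ⟨C, hC0, hC⟩ := IsSpinSymbol.exists_bounds ha
  -- The symbol estimates are available only for `ħ ≤ 1`, that is for `N ≥ 2`.
  have hev : ∀ᶠ N : ℕ in atTop, 0 < N ∧ (N / 2 : ℝ)⁻¹ ≤ 1 := by
    filter_upwards [eventually_ge_atTop 2] with N hN
    have hN' : (2 : ℝ) ≤ N := by exact_mod_cast hN
    exact ⟨by omega, inv_le_one_of_one_le₀ (by linarith)⟩
  refine ⟨fun N => spinOp N (a (N / 2 : ℝ)⁻¹), fun N hN => ⟨isSpinQuantization_spinOp hN
    (hs _ (hpos N hN)) (hac _ (hpos N hN)), (htr N hN).1, (htr N hN).2.1⟩, fun ε hε =>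
    ⟨fun N hN => (htr N hN).2.2 ε hε, ?_⟩⟩
  refine weylBounds_and_weylLaw_of_ennreal _ _ _ _ _ hε (fun N : ℕ => spinRate μ C (N / 2 : ℝ)⁻¹)
    ((tendsto_spinRate hμ C).comp tendsto_inv_half_nhdsGT)
    (hev.mono fun N h => spinRate_nonneg μ C (hpos N h.1)) ?_ ?_ ?_
  · filter_upwards [hev] with N hN
    have := hN.1
    rw [(finrank_spinSpace_and_frameMap N).1]
    positivity
  · filter_upwards [hev] with N hN using (hac _ (hpos N hN.1)).measure_abs_pos_ne_top
  · filter_upwards [hev] with N hN δ hδ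
    have hħ0 := hpos N hN.1
    have hN0 : (0 : ℝ) < N := by exact_mod_cast hN.1
    obtain ⟨R, B, hB⟩ := exists_isCylFamily_sliceAt (hs _ hħ0) (hac _ hħ0)
    have hm := (continuous_of_spinLift (hs _ hħ0)).measurable
    have hbd := hC _ hħ0 hN.2
    -- Here `μ ≥ 0` enters: the sup bound `C` must not exceed the derivative bound `C ħ^(-μ)` in the
    -- Lipschitz estimate for distant points.
    have hτ : 1 ≤ ((N / 2 : ℝ)⁻¹) ^ (-μ) :=
      Real.one_le_rpow_of_pos_of_le_one_of_nonpos hħ0 hN.2 (by linarith)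
    have hτ2 : (((N / 2 : ℝ)⁻¹) ^ (-μ)) ^ 2 * (N / 2 : ℝ)⁻¹ = ((N / 2 : ℝ)⁻¹) ^ (1 - 2 * μ) := by
      rw [← Real.rpow_natCast, ← Real.rpow_mul hħ0.le, ← Real.rpow_add_one hħ0.ne']
      congr 1
      push_cast
      ring
    have hκ := lintegral_spin_kernel_mul_le N (a := a (N / 2 : ℝ)⁻¹) hm
      (Λ := 4 * (C * ((N / 2 : ℝ)⁻¹) ^ (-μ))) (fun x ξ n n' => by
        induction x using QuotientAddGroup.induction_on with
        | H x =>
          have := abs_sub_le_norm_sub (hs _ hħ0) (le_mul_of_one_le_right hC0 hτ)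
            (mul_nonneg hC0 (by positivity)) (fun n => (hbd x ξ n).1)
            (fun n => (hbd x ξ n).2.2.2.2) n n'
          simpa only [spinLift, radialProj_coe] using this)
    -- As `8 · 4² = 128` and `128 / N = 64 ħ`, the spin error is `64 C² ħ^(1 - 2μ)`, the term
    -- doubled in `spinRate`.
    have hκ' : 8 * (4 * (C * ((N / 2 : ℝ)⁻¹) ^ (-μ))) ^ 2 / ((N : ℝ) + 2) ≤
        64 * C ^ 2 * ((N / 2 : ℝ)⁻¹) ^ (1 - 2 * μ) := by
      rw [← hτ2]
      calc
        _ ≤ 8 * (4 * (C * ((N / 2 : ℝ)⁻¹) ^ (-μ))) ^ 2 / (N : ℝ) := by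
          gcongr
          linarith
        _ = _ := by
          field_simp
          ring
    have key := cylOp_counting (a := a (N / 2 : ℝ)⁻¹) hB (isCoherent_coherentVec N) hħ0
      (packetLength_pos hħ0) hm (fun x ξ n => by rw [sliceAt_spinLift]; rfl)
      (Real.rpow_pos_of_pos hħ0 (-μ)) (by positivity) (fun n z => (hbd z.1 z.2 n).1)
      (fun n z => by rw [dX_dX_sliceAt (hs _ hħ0) (coe_S2_ne_zero n)]; exact (hbd z.1 z.2 n).2.1)
      (fun n z => by rw [dXi_dXi_sliceAt (hs _ hħ0) (coe_S2_ne_zero n)]; exact (hbd z.1 z.2 n).2.2.1)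
      (fun n z => by
        rw [dX_dX_dXi_dXi_sliceAt (hs _ hħ0) (coe_S2_ne_zero n)]
        exact (hbd z.1 z.2 n).2.2.2.1)
      (hκ.trans (mul_le_mul_left (ENNReal.ofReal_le_ofReal hκ') _)) hε hδ
    have e0 : {z | a (N / 2 : ℝ)⁻¹ z ≠ 0} = {z | 0 < |a (N / 2 : ℝ)⁻¹ z|} := by ext z; simp
    rw [cylPhaseMeasure_spinMeasure hN.1, e0] at key
    have e1 : ENNReal.ofReal (Module.finrank ℂ (SpinSpace N) * (N / 2 : ℝ) / (8 * Real.pi ^ 2) *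
        spinRate μ C (N / 2 : ℝ)⁻¹) * spinPhaseVolume {z | 0 < |a (N / 2 : ℝ)⁻¹ z|} =
        ENNReal.ofReal (spinRate μ C (N / 2 : ℝ)⁻¹) *
          (ENNReal.ofReal (Module.finrank ℂ (SpinSpace N) * (N / 2 : ℝ) / (8 * Real.pi ^ 2)) •
            spinPhaseVolume) {z | 0 < |a (N / 2 : ℝ)⁻¹ z|} := by
      rw [ENNReal.ofReal_mul (by positivity), Measure.smul_apply, smul_eq_mul]
      ring
    rw [e1]
    exact key

end SpinLaw

/-- Weyl law for real compactly supported symbols: on `ℝ^{2d}`, on the cylinder `T*S¹`, and on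
`T*S¹ × S²` (with `j = N/2`, `ħ = 1/j`). -/
theorem mainTheorem6 (μ : ℝ) (hμ0 : 0 ≤ μ) (hμ : μ < 1 / 2) :
    -- Weyl quantization on `ℝ^d`
    (∀ (d : ℕ) (a : ℝ → EuclideanSpace ℝ (Fin d) × EuclideanSpace ℝ (Fin d) → ℝ),
      (∀ m : ℝ, IsSymbol μ m a) → (∀ ħ : ℝ, 0 < ħ → HasCompactSupport (a ħ)) →
      ∃ A : ℝ → (Lp ℂ 2 (volume : Measure (EuclideanSpace ℝ (Fin d))) →L[ℂ]
          Lp ℂ 2 (volume : Measure (EuclideanSpace ℝ (Fin d)))),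
        (∀ ħ : ℝ, 0 < ħ → IsWeylQuantization ħ (a ħ) (A ħ) ∧
          IsSelfAdjoint (A ħ) ∧ IsTraceClass (A ħ)) ∧
        ∀ ε : ℝ, 0 < ε →
          (∀ ħ : ℝ, 0 < ħ → FinitelyManyOuter (A ħ) ε) ∧
          WeylBounds (𝓝[>] (0 : ℝ)) volume (fun ħ => 1 / (2 * Real.pi * ħ) ^ d) a
            (fun ħ => outerCount (A ħ) ε) ε ∧
          (NoConcentration (𝓝[>] (0 : ℝ)) volume a ε →
            WeylLaw (𝓝[>] (0 : ℝ)) volume (fun ħ => 1 / (2 * Real.pi * ħ) ^ d) a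
              (fun ħ => outerCount (A ħ) ε) ε)) ∧
    -- Weyl quantization on the circle
    (∀ a : ℝ → UnitAddCircle × ℝ → ℝ,
      (∀ m : ℝ, IsSymbol μ m (fun ħ => cylinderLift (a ħ))) →
      (∀ ħ : ℝ, 0 < ħ → HasCompactSupport (a ħ)) →
      ∃ A : ℝ → (Lp ℂ 2 (volume : Measure UnitAddCircle) →L[ℂ]
          Lp ℂ 2 (volume : Measure UnitAddCircle)),
        (∀ ħ : ℝ, 0 < ħ → IsCircleWeylQuantization ħ (a ħ) (A ħ) ∧
          IsSelfAdjoint (A ħ) ∧ IsTraceClass (A ħ)) ∧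
        ∀ ε : ℝ, 0 < ε →
          (∀ ħ : ℝ, 0 < ħ → FinitelyManyOuter (A ħ) ε) ∧
          WeylBounds (𝓝[>] (0 : ℝ)) volume (fun ħ => 1 / (2 * Real.pi * ħ)) a
            (fun ħ => outerCount (A ħ) ε) ε ∧
          (NoConcentration (𝓝[>] (0 : ℝ)) volume a ε →
            WeylLaw (𝓝[>] (0 : ℝ)) volume (fun ħ => 1 / (2 * Real.pi * ħ)) a
              (fun ħ => outerCount (A ħ) ε) ε)) ∧
    -- combined quantization `Op_j` on `T*S¹ × S²`
    (∀ a : ℝ → SpinPhase → ℝ,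
      (∀ m : ℝ, IsSpinSymbol μ m a) → (∀ ħ : ℝ, 0 < ħ → HasCompactSupport (a ħ)) →
      ∃ A : (N : ℕ) → (Lp (SpinSpace N) 2 (volume : Measure UnitAddCircle) →L[ℂ]
          Lp (SpinSpace N) 2 (volume : Measure UnitAddCircle)),
        (∀ N : ℕ, 0 < N → IsSpinQuantization N (a (N / 2 : ℝ)⁻¹) (A N) ∧
          IsSelfAdjoint (A N) ∧ IsTraceClass (A N)) ∧
        ∀ ε : ℝ, 0 < ε →
          (∀ N : ℕ, 0 < N → FinitelyManyOuter (A N) ε) ∧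
          WeylBounds atTop spinPhaseVolume
            (fun N : ℕ => Module.finrank ℂ (SpinSpace N) * (N / 2 : ℝ) / (8 * Real.pi ^ 2))
            (fun N : ℕ => a (N / 2 : ℝ)⁻¹) (fun N => outerCount (A N) ε) ε ∧
          (NoConcentration atTop spinPhaseVolume (fun N : ℕ => a (N / 2 : ℝ)⁻¹) ε →
            WeylLaw atTop spinPhaseVolume
              (fun N : ℕ => Module.finrank ℂ (SpinSpace N) * (N / 2 : ℝ) / (8 * Real.pi ^ 2))
              (fun N : ℕ => a (N / 2 : ℝ)⁻¹) (fun N => outerCount (A N) ε) ε)) := by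
  exact ⟨fun d a ha hac => weylLaw_euclidean μ hμ d a ha hac,
    fun a ha hac => weylLaw_circle μ hμ a ha hac, fun a ha hac => weylLaw_spin μ hμ0 hμ a ha hac⟩
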